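/- Let $N,K\ge 2$ and consider a two-parameter family of continuous piecewise-linear maps on $\mathbb R^N$, $f(x;\xi)=A_L(\xi)x+B(\xi)$ if $s\le 0$ and $f(x;\xi)=A_R(\xi)x+B(\xi)$ if $s\ge 0$, where $s=e_1^{\sf T}x$, $\xi\in\mathbb R^2$, and $A_L,A_R,B$ are $C^K$ in $\xi$ with $A_R=A_L+Ce_1^{\sf T}$ for some $C=C(\xi)\in\mathbb R^N$. Write $f^L,f^R$ for the two affine pieces. For an $n$-periodic $\mathcal S\in\{L,R\}^{\mathbb Z}$ put $f^{\mathcal S}=f^{\mathcal S_{n-1}}\circ\cdots\circ f^{\mathcal S_0}$ and $M_{\mathcal S}=A_{\mathcal S_{n-1}}\cdots A_{\mathcal S_0}$; let $\mathcal S^{(i)}$ be the $i$-th left shift of $\mathcal S$ and $\mathcal S^{\overline i}$ the sequence $\mathcal S$ with the symbols at the indices $i+n\mathbb Z$ flipped. An $\mathcal S$-cycle consists of points $x^{\mathcal S}_i$ with $f^{\mathcal S_i}(x^{\mathcal S}_i)=x^{\mathcal S}_{i+1}$, $x^{\mathcal S}_{i+n}=x^{\mathcal S}_i$; $s^{\mathcal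 S}_i$ is the first coordinate of $x^{\mathcal S}_i$; the cycle is admissible if $s_i^{\mathcal S}\le0$ when $\mathcal S_i=L$ and $s_i^{\mathcal S}\ge0$ when $\mathcal S_i=R$. Let $\mathcal F[\ell,m,n]_i=L$ if $im \bmod n<\ell$, and $R$ otherwise. **Shrinking point.** Let $\mathcal S=\mathcal F[\ell,m,n]$ with $0<m<n$, $\gcd(m,n)=1$, $2\le\ell\le n-2$, and let $d$ be the inverse of $m$ modulo $n$ (indices of points of $n$-periodic cycles are taken modulo $n$). Let $\xi^*$ be an $\mathcal S$-shrinking point: at $\xi^*$, $e_1^{\sf T}\mathrm{adj}(I-A_L)B\ne0$, $a:=\det(I-M_{\mathcal S^{\overline 0}})\ne0$, $\det(I-M_{\mathcal S^{\overline{\ell d}}})\neq0$, and the unique $\mathcal S^{\overline 0}$-cycle is admissible with $s_i^{\mathcal S^{\overline 0}}=0$ if and only if $i\equiv 0$ or $i\equiv\ell d \pmod n$. Put $t_i=s_i^{\mathcal S^{\overline 0}}(\xi^*)$. Let $\rho_1=1,\rho_2,\dots,\rho_N$ be the eigenvalues of $M_{\mathcal S}(\xi^*)$, with multiplicity, $\rho_{\max}=\max_{j\ge2}|\rho_j|$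 and $c=\prod_{j\ge2}(1-\rho_j)$. Near $\xi^*$ let $\eta=s_0^{\mathcal S^{\overline0}}(\xi)$, $\nu=s_{\ell d}^{\mathcal S^{\overline0}}(\xi)$, let $J=\partial(\eta,\nu)/\partial(\xi_1,\xi_2)$ at $\xi^*$, and define $(r,\theta)$ by $\eta=|ct_d/a|\,r\cos\theta$, $\nu=|ct_{(\ell-1)d}/a|\,r\sin\theta$. For $j\in\{0,(\ell-1)d,\ell d,-d\}$ let $u_j^{\sf T},v_j$ be the left and right eigenvectors of $M_{\mathcal S^{(j)}}(\xi^*)$ for the eigenvalue $1$ with $u_j^{\sf T}v_j=1$, $e_1^{\sf T}v_j=1$, and, with matrices evaluated at $\xi^*$, let $$\kappa^+_{j}=u_0^{\sf T}M_{\mathcal S^{\overline{\ell d}}}^{\,j}v_{-d}\ (j\ge0),\qquad \kappa^+_{j}=u_{\ell d}^{\sf T}M_{\mathcal S^{\overline0(\ell d)}}^{\,-j-1}v_{(\ell-1)d}\ (j\le-1).$$ **Centre manifold.** Let $\lambda(\xi)$ be the $C^K$ continuation near $\xi^*$ of the eigenvalue $1$ of $M_{\mathcal S^{(-d)}}$,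 and $\omega_{-d}^{\sf T},\zeta_{-d}$ the corresponding left and right eigenvectors with $e_1^{\sf T}\zeta_{-d}=1=\omega_{-d}^{\sf T}\zeta_{-d}$. Let $x^{\rm int}_{-d}$ be the $C^K$ extension to a neighbourhood of $\xi^*$ of $(I-\zeta_{-d}e_1^{\sf T})x^{\mathcal S}_{-d}$ (defined where $\lambda\ne1$), and put $u(x)=\omega_{-d}^{\sf T}(x-x^{\rm int}_{-d})$, $v(h)=x^{\rm int}_{-d}+h\zeta_{-d}$. **Sectors.** Let $m^- /n^-<m^+/n^+$ be the left and right Farey roots of $m/n$, $\ell_k^+=k\ell+\lceil\ell n^+/n\rceil$, $m_k^+=km+m^+$, $n_k^+=kn+n^+$, $d_k^+$ the inverse of $m_k^+$ modulo $n_k^+$, and $\mathcal G^+[k,j]=\mathcal F[\ell_k^++j,m_k^+,n_k^+]$. The $\mathcal G^+_k$-mode-locking region is the set of parameters at which $f$ has an admissible $\mathcal F[\ell',m_k^+,n_k^+]$-cycle, $0<\ell'<n_k^+$, all of whose stability multipliers have modulus less than $1$. Let $\Delta\ell\ge0$. The inner boundary $\gamma_k$ is a $C^K$ arc, a graph over an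 interval of values of $\theta$ inside $(3\pi/2,2\pi)$ if $a<0$ and inside $(\pi/2,\pi)$ if $a>0$, with endpoints $p_k,q_k$, such that: (i) along $\gamma_k$ there is an admissible $\mathcal G^+[k,\Delta\ell]$-cycle whose point of index $i$ lies on $s=0$, where either $i=0$ along the whole arc or $i=(\ell_k^++\Delta\ell-1)d_k^+$ along the whole arc; (ii) at interior points of $\gamma_k$, nearby parameters with the same $\theta$ lie in the $\mathcal G_k^+$-mode-locking region if their $r$ is larger, and outside it if their $r$ is smaller; (iii) $p_k$ is a $\mathcal G^+[k,\Delta\ell]$-shrinking point if $\kappa^+_{\Delta\ell}>0$, and at $p_k$ there is an admissible $\mathcal G^+[k,\Delta\ell]$-cycle with stability multiplier $-1$ if $\kappa^+_{\Delta\ell}<0$; the same holds for $q_k$ with $\Delta\ell-1$ in place of $\Delta\ell$. The sector $\Sigma^+_{k,\Delta\ell}$ is well-defined if $\gamma_k$ and $\gamma_{k+1}$ exist, and is then the region of the $(\eta,\nu)$-plane bounded by $\gamma_k$, $\gamma_{k+1}$, the line segment from $p_k$ to $p_{k+1}$ and the line segment from $q_k$ to $q_{k+1}$. **Lemma 5.1.**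 Suppose $\det J\ne0$, $\rho_{\max}<1$, $\Delta\ell\ge0$, $\kappa^+_{\Delta\ell}\ne0$, $\kappa^+_{\Delta\ell-1}\neq0$ and $(\kappa^+_{\Delta\ell}-\kappa^+_{\Delta\ell-1})\,a>0$. Then there are a neighbourhood $U$ of $\xi^*$, a constant $C$ and a $k_0$ such that for every $k\ge k_0$, every well-defined sector $\Sigma^+_{k,\Delta\ell}$ with $\gamma_k,\gamma_{k+1}\subset U$, and every parameter $\xi\in U$ in that sector, with polar angle $\theta$, the derivatives $$\frac{d}{dh}\,u\big(f^{\mathcal G^+[k,\Delta\ell]}(v(h))\big),\qquad \frac{d}{dh}\,u\big(f^{\mathcal G^+[k,\Delta\ell]^{\overline0}}(v(h))\big)$$ exist at every $h\in\mathbb R$, do not depend on $h$, and differ by at most $C/k$ from, respectively, $$\frac{t_{-d}\,\kappa^+_{\Delta\ell}\tan\theta}{t_d},\qquad \begin{cases}\dfrac{t_{(\ell-1)d}\,\kappa^+_{-1}\tan\theta}{t_{(\ell+1)d}},&\Delta\ell=0,\\[2mm]\dfrac{t_{-d}\,\kappa^+_{\Delta\ell-1}\tan\theta}{t_d},&\Delta\ell\ge1.\end{cases}$$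 -/

import Mathlib

open Filter Topology Matrix

noncomputable section

/-- The two symbols of an itinerary. -/
inductive Side
  | L
  | R

/-- Exchange of the two symbols. -/
def Side.flip : Side → Side
  | Side.L => Side.R
  | Side.R => Side.L

/-- A two-parameter family of continuous two-piece piecewise-linear maps on `ℝ^N`,
`x ↦ AL ξ x + B ξ` if `x 0 ≤ 0` and `x ↦ AR ξ x + B ξ` if `x 0 ≥ 0`, with coefficients of class
`C^K` in the parameter `ξ ∈ ℝ²`. Coordinate `0` of `x` is the quantity usually called `s` (the first
coordinate). Continuity on `x 0 = 0` says that `AL ξ` and `AR ξ` agree outside the first column. -/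
structure PWLFamily (N K : ℕ) [NeZero N] where
  AL : ℝ × ℝ → Matrix (Fin N) (Fin N) ℝ
  AR : ℝ × ℝ → Matrix (Fin N) (Fin N) ℝ
  B : ℝ × ℝ → Fin N → ℝ
  smooth_AL : ∀ i j, ContDiff ℝ K (fun ξ => AL ξ i j)
  smooth_AR : ∀ i j, ContDiff ℝ K (fun ξ => AR ξ i j)
  smooth_B : ∀ i, ContDiff ℝ K (fun ξ => B ξ i)
  continuous_switching : ∀ ξ i j, j ≠ 0 → AL ξ i j = AR ξ i j

/-! ### Symbol sequences -/

/-- The `i`-th left shift `S^{(i)}`. -/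
def shiftSeq (S : ℤ → Side) (i : ℤ) : ℤ → Side := fun j => S (i + j)

/-- `S` with the symbols at the indices `i + j n`, `j ∈ ℤ`, flipped. -/
def flipAt (n : ℕ) (S : ℤ → Side) (i : ℤ) : ℤ → Side :=
  open Classical in fun j => if (n : ℤ) ∣ j - i then (S j).flip else S j

/-- The rotational symbol sequence `F[l, m, n]`. -/
def rotSeq (l : ℤ) (m n : ℕ) : ℤ → Side :=
  fun i => if (i * m) % (n : ℤ) < l then Side.L else Side.R

/-- The multiplicative inverse of `m` modulo `n`. -/
def modInv (m n : ℕ) : ℤ := (((m : ZMod n)⁻¹).val : ℤ)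

/-- `mm/nm` and `mp/np` are the left and right Farey roots (Farey parents) of `m/n`:
`m/n` is their mediant and they are Farey neighbours, `mm/nm < mp/np`. -/
def IsFareyRoots (m n mm nm mp np : ℕ) : Prop :=
  mm + mp = m ∧ nm + np = n ∧ 0 < nm ∧ 0 < np ∧ mp * nm = mm * np + 1

/-- `l_k^+ = k l + ⌈l n^+ / n⌉`. -/
def ellK (l n np k : ℕ) : ℤ := k * l + ⌈((l * np : ℕ) : ℚ) / (n : ℚ)⌉

/-- `m_k^+ = k m + m^+`, and also `n_k^+ = k n + n^+`. -/
def levelK (m mp k : ℕ) : ℕ := k * m + mp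

/-- `G^+[k, j] = F[l_k^+ + j, m_k^+, n_k^+]`. -/
def seqG (l m n mp np k : ℕ) (j : ℤ) : ℤ → Side :=
  rotSeq (ellK l n np k + j) (levelK m mp k) (levelK n np k)

section Family

variable {N K : ℕ} [NeZero N] (f : PWLFamily N K)

/-! ### Compositions and cycles -/

/-- The matrix of the piece with the given symbol. -/
def sideMat (ξ : ℝ × ℝ) : Side → Matrix (Fin N) (Fin N) ℝ
  | Side.L => f.AL ξ
  | Side.R => f.AR ξ

/-- `f^L` and `f^R`. -/
def sideMap (ξ : ℝ × ℝ) (σ : Side) (x : Fin N → ℝ) : Fin N → ℝ :=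
  sideMat f ξ σ *ᵥ x + f.B ξ

/-- `f^S = f^{S_{n-1}} ∘ ⋯ ∘ f^{S_0}`. -/
def wordMap (S : ℤ → Side) (ξ : ℝ × ℝ) : ℕ → (Fin N → ℝ) → Fin N → ℝ
  | 0, x => x
  | n + 1, x => sideMap f ξ (S n) (wordMap S ξ n x)

/-- `M_S = A_{S_{n-1}} ⋯ A_{S_0}`. -/
def wordMat (S : ℤ → Side) (ξ : ℝ × ℝ) : ℕ → Matrix (Fin N) (Fin N) ℝ
  | 0 => 1
  | n + 1 => sideMat f ξ (S n) * wordMat S ξ n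

/-- `P_S = I + A_{S_{n-1}} + A_{S_{n-1}} A_{S_{n-2}} + ⋯ + A_{S_{n-1}} ⋯ A_{S_1}`. -/
def wordP (S : ℤ → Side) (ξ : ℝ × ℝ) : ℕ → Matrix (Fin N) (Fin N) ℝ
  | 0 => 0
  | n + 1 => sideMat f ξ (S n) * wordP S ξ n + 1

/-- An `S`-cycle, `S` of period `n`, written as an `n`-periodic sequence of points. -/
def IsCycle (S : ℤ → Side) (n : ℕ) (ξ : ℝ × ℝ) (x : ℤ → Fin N → ℝ) : Prop :=
  (∀ i, x (i + n) = x i) ∧ ∀ i, x (i + 1) = sideMap f ξ (S i) (x i)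

/-- Every point of `x` lies on the side of the switching manifold given by its symbol. -/
def IsAdmissible (S : ℤ → Side) (x : ℤ → Fin N → ℝ) : Prop :=
  ∀ i, match S i with
    | Side.L => x i 0 ≤ 0
    | Side.R => 0 ≤ x i 0

/-- The `i`-th point `(I - M_{S^{(i)}})⁻¹ P_{S^{(i)}} B` of the `S`-cycle; it is the unique one
if `det (I - M_S) ≠ 0`. -/
def cyclePt (S : ℤ → Side) (n : ℕ) (ξ : ℝ × ℝ) (i : ℤ) : Fin N → ℝ :=
  (1 - wordMat f (shiftSeq S i) ξ n)⁻¹ *ᵥ (wordP f (shiftSeq S i) ξ n *ᵥ f.B ξ)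

/-- The complex eigenvalues of a real matrix, with algebraic multiplicity. -/
def eigs (M : Matrix (Fin N) (Fin N) ℝ) : Multiset ℂ :=
  (M.map (algebraMap ℝ ℂ)).charpoly.roots

/-- The mode-locking region of rotation number `m / n`: the parameters at which the map has an
attracting (admissible, all stability multipliers of modulus less than one) rotational periodic
solution of that rotation number. -/
def modeLocking (m n : ℕ) : Set (ℝ × ℝ) :=
  {ξ | ∃ l : ℤ, 0 < l ∧ l < n ∧ ∃ x : ℤ → Fin N → ℝ,
    IsCycle f (rotSeq l m n) n ξ x ∧ IsAdmissible (rotSeq l m n) x ∧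
    ∀ z ∈ eigs (wordMat f (rotSeq l m n) ξ n), ‖z‖ < 1}

/-! ### Shrinking points -/

/-- `F[l, m, n]` with the symbol at index `0` flipped. -/
def seqS0 (l : ℤ) (m n : ℕ) : ℤ → Side := flipAt n (rotSeq l m n) 0

/-- `F[l, m, n]` with the symbol at index `l d` flipped. -/
def seqSld (l : ℤ) (m n : ℕ) : ℤ → Side := flipAt n (rotSeq l m n) (l * modInv m n)

/-- The parameter point `ξ` is an `F[l, m, n]`-shrinking point. -/
def IsShrinkingPoint (l : ℤ) (m n : ℕ) (ξ : ℝ × ℝ) : Prop :=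
  2 ≤ l ∧ l ≤ (n : ℤ) - 2 ∧ 0 < m ∧ m < n ∧ Nat.Coprime m n ∧
  ((1 - f.AL ξ).adjugate *ᵥ f.B ξ) 0 ≠ 0 ∧
  (1 - wordMat f (seqS0 l m n) ξ n).det ≠ 0 ∧
  (1 - wordMat f (seqSld l m n) ξ n).det ≠ 0 ∧
  IsAdmissible (seqS0 l m n) (cyclePt f (seqS0 l m n) n ξ) ∧
  ∀ i : ℤ, cyclePt f (seqS0 l m n) n ξ i 0 = 0 ↔
    (i ≡ 0 [ZMOD n] ∨ i ≡ l * modInv m n [ZMOD n])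

variable (l m n : ℕ) (ξ₀ : ℝ × ℝ)

/-- `a = det (I - M)` for `F[l, m, n]` with index `0` flipped, at the shrinking point `ξ₀`. -/
def aConst : ℝ := (1 - wordMat f (seqS0 l m n) ξ₀ n).det

/-- `t_{j d}`, the first coordinate of the point of index `j d` of the unique cycle (index `0`
flipped) at the shrinking point `ξ₀`. -/
def tConst (j : ℤ) : ℝ := cyclePt f (seqS0 l m n) n ξ₀ (j * modInv m n) 0

/-- The eigenvalues `ρ_2, …, ρ_N` of `M_S` at the shrinking point: one copy of `ρ_1 = 1` is
removed from the list of all eigenvalues. -/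
def restEigs : Multiset ℂ :=
  open Classical in (eigs (wordMat f (rotSeq l m n) ξ₀ n)).erase 1

/-- `ρ_max`, the largest modulus among `ρ_2, …, ρ_N`. -/
def rhoMax : ℝ := (((restEigs f l m n ξ₀).map (fun z => ‖z‖₊)).sup : NNReal)

/-- `c = ∏_{j ≥ 2} (1 - ρ_j)`, a real number because `M_S` is real. -/
def cConst : ℝ := (((restEigs f l m n ξ₀).map (fun z => 1 - z)).prod).re

/-- The local coordinates `(η, ν)` of the parameter `ξ`. -/
def coordEN (ξ : ℝ × ℝ) : ℝ × ℝ :=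
  (cyclePt f (seqS0 l m n) n ξ 0 0, cyclePt f (seqS0 l m n) n ξ (l * modInv m n) 0)

/-- The determinant of `J = ∂(η, ν) / ∂(ξ₁, ξ₂)` at the shrinking point. -/
def detJ : ℝ :=
  fderiv ℝ (fun ξ => (coordEN f l m n ξ).1) ξ₀ (1, 0) *
      fderiv ℝ (fun ξ => (coordEN f l m n ξ).2) ξ₀ (0, 1) -
    fderiv ℝ (fun ξ => (coordEN f l m n ξ).1) ξ₀ (0, 1) *
      fderiv ℝ (fun ξ => (coordEN f l m n ξ).2) ξ₀ (1, 0)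

/-- The point of the `(η, ν)`-plane with (scaled) polar coordinates `(r, θ)`. -/
def polarEN (r θ : ℝ) : ℝ × ℝ :=
  (|cConst f l m n ξ₀ * tConst f l m n ξ₀ 1 / aConst f l m n ξ₀| * r * Real.cos θ,
    |cConst f l m n ξ₀ * tConst f l m n ξ₀ (l - 1) / aConst f l m n ξ₀| * r * Real.sin θ)

/-! ### Normalised eigenvectors, `κ`, and the centre manifold -/

/-- The right eigenvector of `M` for the eigenvalue `lam` whose first coordinate is one. -/
def rightEig (M : Matrix (Fin N) (Fin N) ℝ) (lam : ℝ) : Fin N → ℝ :=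
  Classical.epsilon fun v => M *ᵥ v = lam • v ∧ v 0 = 1

/-- The left eigenvector of `M` for `lam` whose product with `rightEig M lam` is one. -/
def leftEig (M : Matrix (Fin N) (Fin N) ℝ) (lam : ℝ) : Fin N → ℝ :=
  Classical.epsilon fun w => w ᵥ* M = lam • w ∧ w ⬝ᵥ rightEig M lam = 1

/-- `v_{j d}`: right eigenvector of `M_{S^{(j d)}}` for the eigenvalue `1` at `ξ₀`. -/
def vVec (j : ℤ) : Fin N → ℝ :=
  rightEig (wordMat f (shiftSeq (rotSeq l m n) (j * modInv m n)) ξ₀ n) 1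

/-- `u_{j d}`: left eigenvector of `M_{S^{(j d)}}` for the eigenvalue `1` at `ξ₀`. -/
def uVec (j : ℤ) : Fin N → ℝ :=
  leftEig (wordMat f (shiftSeq (rotSeq l m n) (j * modInv m n)) ξ₀ n) 1

/-- `κ^+_j`. -/
def kappaPlus (j : ℤ) : ℝ :=
  if j ≤ -1 then
    uVec f l m n ξ₀ l ⬝ᵥ
      (wordMat f (shiftSeq (seqS0 l m n) (l * modInv m n)) ξ₀ n ^ (-j - 1).toNat *ᵥ
        vVec f l m n ξ₀ (l - 1))
  else
    uVec f l m n ξ₀ 0 ⬝ᵥ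
      (wordMat f (seqSld l m n) ξ₀ n ^ j.toNat *ᵥ vVec f l m n ξ₀ (-1))

/-- `M_{S^{(-d)}}` at the parameter `ξ`. -/
def matMd (ξ : ℝ × ℝ) : Matrix (Fin N) (Fin N) ℝ :=
  wordMat f (shiftSeq (rotSeq l m n) (-modInv m n)) ξ n

/-- The `C^K` continuation `lam` near `ξ₀` of the eigenvalue `1` of `M_{S^{(-d)}}`. -/
def critEig : ℝ × ℝ → ℝ :=
  Classical.epsilon fun lam => lam ξ₀ = 1 ∧ ContDiffAt ℝ K lam ξ₀ ∧
    ∀ᶠ ξ in 𝓝 ξ₀, ∃ v : Fin N → ℝ, v ≠ 0 ∧ matMd f l m n ξ *ᵥ v = lam ξ • v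

/-- `ζ_{-d}`. -/
def zetaVec (ξ : ℝ × ℝ) : Fin N → ℝ := rightEig (matMd f l m n ξ) (critEig f l m n ξ₀ ξ)

/-- `ω_{-d}`. -/
def omegaVec (ξ : ℝ × ℝ) : Fin N → ℝ := leftEig (matMd f l m n ξ) (critEig f l m n ξ₀ ξ)

/-- `x^int_{-d}`: the `C^K` extension, to a neighbourhood of `ξ₀`, of
`(I - ζ_{-d} e_1^T) x^S_{-d}`, which is defined where `lam ≠ 1`. -/
def xInt : ℝ × ℝ → Fin N → ℝ :=
  Classical.epsilon fun X => ContDiffAt ℝ K X ξ₀ ∧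
    ∀ᶠ ξ in 𝓝 ξ₀, critEig f l m n ξ₀ ξ ≠ 1 →
      X ξ = cyclePt f (rotSeq l m n) n ξ (-modInv m n) -
        cyclePt f (rotSeq l m n) n ξ (-modInv m n) 0 • zetaVec f l m n ξ₀ ξ

/-- `u(x) = ω_{-d}^T (x - x^int_{-d})`. -/
def uFun (ξ : ℝ × ℝ) (x : Fin N → ℝ) : ℝ :=
  omegaVec f l m n ξ₀ ξ ⬝ᵥ (x - xInt f l m n ξ₀ ξ)

/-- `v(h) = x^int_{-d} + h ζ_{-d}`. -/
def vFun (ξ : ℝ × ℝ) (h : ℝ) : Fin N → ℝ :=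
  xInt f l m n ξ₀ ξ + h • zetaVec f l m n ξ₀ ξ

/-! ### The sectors -/

/-- The condition on the endpoint of an inner boundary with label `j`: if `κ^+_j > 0` it is a
`G^+[k, j]`-shrinking point; if `κ^+_j < 0` there is a `G^+[k, j]`-cycle with stability
multiplier `-1`. -/
def IsArcEnd (mp np k : ℕ) (j : ℤ) (ξ : ℝ × ℝ) : Prop :=
  (0 < kappaPlus f l m n ξ₀ j →
    IsShrinkingPoint f (ellK l n np k + j) (levelK m mp k) (levelK n np k) ξ) ∧
  (kappaPlus f l m n ξ₀ j < 0 →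
    (∃ x : ℤ → Fin N → ℝ, IsCycle f (seqG l m n mp np k j) (levelK n np k) ξ x ∧
      IsAdmissible (seqG l m n mp np k j) x) ∧
    (-1 - wordMat f (seqG l m n mp np k j) ξ (levelK n np k)).det = 0)

/-- At `ξ` there is an admissible `G^+[k, j]`-cycle whose point of index `i` lies on the switching
manifold. -/
def IsBorderCollision (mp np k : ℕ) (j i : ℤ) (ξ : ℝ × ℝ) : Prop :=
  ∃ x : ℤ → Fin N → ℝ, IsCycle f (seqG l m n mp np k j) (levelK n np k) ξ x ∧
    IsAdmissible (seqG l m n mp np k j) x ∧ x i 0 = 0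

/-- The inner boundary `γ_k` of the `G^+_k`-mode-locking region between its endpoints `p_k` and
`q_k`, which carry the labels `j` and `j - 1`, parametrised by the polar angle `θ`.
* It is a `C^K` arc `r = rad θ` over the angles between `θp` and `θq`, inside the open quadrant of
  the `(η, ν)`-plane that contains the `G^+_k`-mode-locking regions (fourth if `a < 0`, second if
  `a > 0`).
* The two curves that bound this part of the mode-locking region are those where the point of index
  `0`, respectively `(l_k^+ + j - 1) d_k^+`, of the `G^+[k, j]`-cycle lies on the switching
  manifold; the arc is one of these.
* It is the inner one: close to a point of the arc, parameters with the same `θ` and smaller `r`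
  are outside the mode-locking region, those with larger `r` are inside. -/
structure InnerArc (mp np k : ℕ) (j : ℤ) where
  θp : ℝ
  θq : ℝ
  curve : ℝ → ℝ × ℝ
  rad : ℝ → ℝ
  quadrant_neg : aConst f l m n ξ₀ < 0 →
    Set.uIcc θp θq ⊆ Set.Ioo (3 * Real.pi / 2) (2 * Real.pi)
  quadrant_pos : 0 < aConst f l m n ξ₀ → Set.uIcc θp θq ⊆ Set.Ioo (Real.pi / 2) Real.pi
  rad_pos : ∀ θ ∈ Set.uIcc θp θq, 0 < rad θ
  polar : ∀ θ ∈ Set.uIcc θp θq, coordEN f l m n (curve θ) = polarEN f l m n ξ₀ (rad θ) θ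
  smooth : ContDiffOn ℝ K curve (Set.uIcc θp θq)
  border :
    (∀ θ ∈ Set.uIcc θp θq, IsBorderCollision f l m n mp np k j 0 (curve θ)) ∨
    (∀ θ ∈ Set.uIcc θp θq, IsBorderCollision f l m n mp np k j
      ((ellK l n np k + j - 1) * modInv (levelK m mp k) (levelK n np k)) (curve θ))
  inner : ∀ θ ∈ Set.Ioo (min θp θq) (max θp θq), ∀ᶠ ξ in 𝓝 (curve θ), ∀ r : ℝ,
    coordEN f l m n ξ = polarEN f l m n ξ₀ r θ →
      (r < rad θ → ξ ∉ modeLocking f (levelK m mp k) (levelK n np k)) ∧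
      (rad θ < r → ξ ∈ modeLocking f (levelK m mp k) (levelK n np k))
  end_p : IsArcEnd f l m n ξ₀ mp np k j (curve θp)
  end_q : IsArcEnd f l m n ξ₀ mp np k (j - 1) (curve θq)

variable {f l m n ξ₀}

/-- The points of the arc, in the parameter plane. -/
def InnerArc.points {mp np k : ℕ} {j : ℤ} (γ : InnerArc f l m n ξ₀ mp np k j) : Set (ℝ × ℝ) :=
  γ.curve '' Set.uIcc γ.θp γ.θq

/-- The closed curve made of `γ_k`, `γ_{k+1}`, the line segment from `p_k` to `p_{k+1}` and the
line segment from `q_k` to `q_{k+1}`, in the `(η, ν)`-plane. -/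
def sectorBoundary {mp np k : ℕ} {j : ℤ} (γ : InnerArc f l m n ξ₀ mp np k j)
    (γ' : InnerArc f l m n ξ₀ mp np (k + 1) j) : Set (ℝ × ℝ) :=
  coordEN f l m n '' γ.points ∪ coordEN f l m n '' γ'.points ∪
    segment ℝ (coordEN f l m n (γ.curve γ.θp)) (coordEN f l m n (γ'.curve γ'.θp)) ∪
    segment ℝ (coordEN f l m n (γ.curve γ.θq)) (coordEN f l m n (γ'.curve γ'.θq))

/-- The region bounded by a closed curve: the curve and the bounded components of its
complement. -/
def enclosedRegion (C : Set (ℝ × ℝ)) : Set (ℝ × ℝ) :=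
  C ∪ {x | x ∉ C ∧ Bornology.IsBounded (connectedComponentIn Cᶜ x)}

/-- The sector `Σ^+_{k, j}` (as a subset of the `(η, ν)`-plane) determined by `γ_k` and
`γ_{k+1}`. -/
def sector {mp np k : ℕ} {j : ℤ} (γ : InnerArc f l m n ξ₀ mp np k j)
    (γ' : InnerArc f l m n ξ₀ mp np (k + 1) j) : Set (ℝ × ℝ) :=
  enclosedRegion (sectorBoundary γ γ')

end Family

end

open Filter Topology Matrix Asymptotics

noncomputable section

/-! ### Affine words: composition, single-letter flips, cycles. -/

section Words

variable {N K : ℕ} [NeZero N] (f : PWLFamily N K)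

/-! At the shrinking point the points `x_i` of the cycle form a polygon, and the letters at the
indices `0` and `ℓd`, whose points lie on `s = 0`, may be changed freely. The polygon is therefore a
cycle of `S`, of `S` flipped at `0`, of `S` flipped at `ℓd`, and of `S^{(-d)}`. So it and its shift
by `d` are two `S`-cycles, `1` is an eigenvalue of `M_S`, and the edges `x_{i+d} - x_i` are the
eigenvectors that matter.

Over one period the word `G^+[k,j]` consists of `j` turns of `S` flipped at `ℓd`, a link of `n^+`
letters of `S`, and `k - j` turns of `S^{(-d)}` (`IsFareyRoots.seqG_window`, `wordMat_seqG`).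
Flipping its letter `0` only changes the first turn. The maps are affine, so both derivatives equal
`λ^(k-i) ω·(Yζ)` with a matrix `Y` not depending on `k`. At `ξ*` the factor `ω·(Yζ)` is an explicit
multiple of some `κ` (`IsShrinkingPoint.slope_nat`, `IsShrinkingPoint.slope_neg_one`). It remains to
see that `λ^k = -tan θ + O(1/k)` in the sector.

Put `P = aη/(c t_d)` and `P' = -aν/(c t_{(ℓ-1)d})`, so that `P'/P = -tan θ`. Single-letter flips
perturb matrices by rank one, which expresses `a` through eigenvectors. It follows that `λ - 1 = P'
- P + O(r²)` and that one turn moves the centre coordinate of `x_0` by `-t_{-d}P' + O(r²)`. On an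
inner boundary a cycle point enters the turns near `x_{-d}` and leaves them near `x_0`. With `Σ = 1
+ λ + ⋯ + λ^{k-1}` this reads `P'Σ ≈ λ^k` and `PΣ ≈ 1` (`CentreExpansion.balance`). Where `λ^k` is
bounded above and below, `P` is of order `1/k`, `P'/P = λ^k + O(1/k)`, and `k(P' - P) = log(P'/P) +
O(1/k)`. At the ends of the arcs a multiplier `±1` pins `λ^k` near a constant, and monotonicity of
`tan` then bounds `P'/P` along the whole arc.

The passage from the boundary to the interior rests on the shape of the set `logRegion` cut out by
the logarithmic relation. On a line through the origin `P'/P` is constant, so the relation is a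
system of linear inequalities and holds on an interval. A set with this property that misses one
such line contains everything enclosed by its subsets. It contains both arcs and both segments,
hence the sector (`IsShrinkingPoint.sector_subset`). Exponentiating the relation gives `λ^k = P'/P +
O(1/k)` inside. -/

theorem shiftSeq_shiftSeq (S : ℤ → Side) (i j : ℤ) :
    shiftSeq (shiftSeq S i) j = shiftSeq S (i + j) := by
  funext a; simp [shiftSeq, add_assoc]

theorem shiftSeq_zero (S : ℤ → Side) : shiftSeq S 0 = S := by
  funext a; simp [shiftSeq]

theorem wordMap_add (S : ℤ → Side) (ξ : ℝ × ℝ) (a b : ℕ) (x : Fin N → ℝ) :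
    wordMap f S ξ (a + b) x = wordMap f (shiftSeq S a) ξ b (wordMap f S ξ a x) := by
  induction b with
  | zero => rfl
  | succ b ih => rw [← add_assoc]; simp only [wordMap, ih, shiftSeq]; push_cast; rfl

theorem wordMat_add (S : ℤ → Side) (ξ : ℝ × ℝ) (a b : ℕ) :
    wordMat f S ξ (a + b) = wordMat f (shiftSeq S a) ξ b * wordMat f S ξ a := by
  induction b with
  | zero => simp [wordMat]
  | succ b ih =>
    rw [← add_assoc]; simp only [wordMat, ih, shiftSeq, Matrix.mul_assoc]; push_cast; rfl

theorem wordMap_congr {S T : ℤ → Side} (ξ : ℝ × ℝ) {n : ℕ} (h : ∀ i < n, S i = T i) :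
    wordMap f S ξ n = wordMap f T ξ n := by
  induction n with
  | zero => rfl
  | succ n ih =>
    funext x
    simp only [wordMap, ih fun i hi => h i (hi.trans n.lt_succ_self), h n n.lt_succ_self]

theorem wordMat_congr {S T : ℤ → Side} (ξ : ℝ × ℝ) {n : ℕ} (h : ∀ i < n, S i = T i) :
    wordMat f S ξ n = wordMat f T ξ n := by
  induction n with
  | zero => rfl
  | succ n ih =>
    simp only [wordMat, ih fun i hi => h i (hi.trans n.lt_succ_self), h n n.lt_succ_self]

theorem wordMap_sub (S : ℤ → Side) (ξ : ℝ × ℝ) (n : ℕ) (x y : Fin N → ℝ) :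
    wordMap f S ξ n x - wordMap f S ξ n y = wordMat f S ξ n *ᵥ (x - y) := by
  induction n with
  | zero => simp [wordMap, wordMat]
  | succ n ih =>
    simp only [wordMap, wordMat, sideMap, ← Matrix.mulVec_mulVec, add_sub_add_right_eq_sub]
    rw [← ih, Matrix.mulVec_sub]

theorem wordMap_eq (S : ℤ → Side) (ξ : ℝ × ℝ) (n : ℕ) (x : Fin N → ℝ) :
    wordMap f S ξ n x = wordMat f S ξ n *ᵥ x + wordP f S ξ n *ᵥ f.B ξ := by
  induction n with
  | zero => simp [wordMap, wordMat, wordP]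
  | succ n ih =>
    simp only [wordMap, wordMat, wordP, sideMap, ih, Matrix.mulVec_add, Matrix.add_mulVec,
      Matrix.one_mulVec, ← Matrix.mulVec_mulVec]
    abel

theorem wordMap_mul {S : ℤ → Side} {n : ℕ} (hS : ∀ i, S (i + n) = S i) (ξ : ℝ × ℝ) (k : ℕ) :
    wordMap f S ξ (k * n) = (wordMap f S ξ n)^[k] := by
  induction k with
  | zero => funext x; simp [wordMap]
  | succ k ih =>
    funext x
    rw [add_mul, one_mul, add_comm, wordMap_add, Function.iterate_succ_apply, ← ih]
    congr 2
    funext i; rw [shiftSeq, add_comm, hS]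

theorem wordMat_mul {S : ℤ → Side} {n : ℕ} (hS : ∀ i, S (i + n) = S i) (ξ : ℝ × ℝ) (k : ℕ) :
    wordMat f S ξ (k * n) = wordMat f S ξ n ^ k := by
  induction k with
  | zero => simp [wordMat]
  | succ k ih =>
    rw [add_mul, one_mul, add_comm, wordMat_add, pow_succ, ← ih]
    congr 2
    funext i; rw [shiftSeq, add_comm, hS]

/-- The first column of `AR - AL`, the only one that may be nonzero. -/
def jumpVec (ξ : ℝ × ℝ) : Fin N → ℝ := fun i => f.AR ξ i 0 - f.AL ξ i 0

theorem AR_eq (ξ : ℝ × ℝ) :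
    f.AR ξ = f.AL ξ + vecMulVec (jumpVec f ξ) (Pi.single 0 1) := by
  ext i j
  by_cases hj : j = 0
  · subst hj; simp [jumpVec, vecMulVec_apply]
  · simp [vecMulVec_apply, hj, f.continuous_switching ξ i j hj]

theorem sideMap_L (ξ : ℝ × ℝ) (x : Fin N → ℝ) :
    sideMap f ξ Side.L x = sideMap f ξ Side.R x - x 0 • jumpVec f ξ := by
  simp only [sideMap, sideMat, AR_eq, Matrix.add_mulVec, vecMulVec_mulVec]
  ext i; simp; ring

theorem sideMap_of_zero (ξ : ℝ × ℝ) {x : Fin N → ℝ} (hx : x 0 = 0) (σ τ : Side) :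
    sideMap f ξ σ x = sideMap f ξ τ x := by
  cases σ <;> cases τ <;> simp [sideMap_L, hx]

/-- The orbits agree up to index `i`, the two pieces then differ by `s` times the jump vector, and
the remaining letters carry this difference linearly. Thus `η` and `ν`, being values of `s` at
flipped letters, appear as exact displacements. -/
theorem wordMap_flip {S T : ℤ → Side} (ξ : ℝ × ℝ) {i b : ℕ} (hlt : ∀ j < i, S j = T j)
    (hL : S i = Side.L) (hR : T i = Side.R)
    (hgt : ∀ j : ℕ, i < j → j < i + 1 + b → S j = T j) (x : Fin N → ℝ) :
    wordMap f S ξ (i + 1 + b) x = wordMap f T ξ (i + 1 + b) x -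
      (wordMap f T ξ i x) 0 • (wordMat f (shiftSeq S (i + 1)) ξ b *ᵥ jumpVec f ξ) := by
  have hc : ∀ y, wordMap f (shiftSeq S (i + 1 : ℕ)) ξ b y =
      wordMap f (shiftSeq T (i + 1 : ℕ)) ξ b y := by
    intro y
    rw [wordMap_congr]
    intro j hj
    have := hgt (i + 1 + j) (by omega) (by omega)
    simpa [shiftSeq] using this
  have h1 := wordMap_sub f (shiftSeq S (i + 1 : ℕ)) ξ b (wordMap f T ξ (i + 1) x)
    (wordMap f S ξ (i + 1) x)
  have h2 : wordMap f T ξ (i + 1) x - wordMap f S ξ (i + 1) x =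
      (wordMap f T ξ i x) 0 • jumpVec f ξ := by
    simp only [wordMap, hL, hR, sideMap_L, wordMap_congr f ξ hlt]
    abel
  rw [h2, mulVec_smul] at h1
  rw [wordMap_add, wordMap_add f T, ← hc]
  push_cast at h1 ⊢
  rw [← h1]; abel

/-- The linear counterpart of `wordMap_flip`: a flip is a rank-one perturbation, which
`det_one_sub_rankOne` can evaluate. -/
theorem wordMat_flip {S T : ℤ → Side} (ξ : ℝ × ℝ) {i b : ℕ} (hlt : ∀ j < i, S j = T j)
    (hL : S i = Side.L) (hR : T i = Side.R)
    (hgt : ∀ j : ℕ, i < j → j < i + 1 + b → S j = T j) :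
    wordMat f T ξ (i + 1 + b) = wordMat f S ξ (i + 1 + b) +
      vecMulVec (wordMat f (shiftSeq S (i + 1)) ξ b *ᵥ jumpVec f ξ)
        (Pi.single 0 1 ᵥ* wordMat f S ξ i) := by
  have hc : wordMat f (shiftSeq S (i + 1 : ℕ)) ξ b = wordMat f (shiftSeq T (i + 1 : ℕ)) ξ b := by
    apply wordMat_congr
    intro j hj
    have := hgt (i + 1 + j) (by omega) (by omega)
    simpa [shiftSeq] using this
  rw [wordMat_add, wordMat_add f S, ← hc]
  simp only [wordMat, hL, hR, sideMat, AR_eq, wordMat_congr f ξ hlt]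
  push_cast
  rw [Matrix.add_mul, Matrix.mul_add, vecMulVec_mul, mul_vecMulVec]

theorem wordMap_eq_of_collision {S T : ℤ → Side} (ξ : ℝ × ℝ) {i n : ℕ}
    (h : ∀ j < n, j ≠ i → S j = T j) {x : Fin N → ℝ} (hx : wordMap f S ξ i x 0 = 0) :
    wordMap f S ξ n x = wordMap f T ξ n x := by
  induction n with
  | zero => rfl
  | succ n ih =>
    have ih' := ih fun j hj hji => h j (by omega) hji
    simp only [wordMap]
    by_cases hn : n = i
    · subst hn
      rw [← ih']
      exact sideMap_of_zero f ξ hx _ _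
    · rw [ih', h n (by omega) hn]

theorem IsCycle.wordMap_eq {S : ℤ → Side} {n : ℕ} {ξ : ℝ × ℝ} {x : ℤ → Fin N → ℝ}
    (h : IsCycle f S n ξ x) (i : ℤ) (a : ℕ) :
    wordMap f (shiftSeq S i) ξ a (x i) = x (i + a) := by
  induction a with
  | zero => simp [wordMap]
  | succ a ih =>
    simp only [wordMap, ih, shiftSeq]
    push_cast
    rw [← add_assoc, h.2]

theorem IsCycle.shift {S : ℤ → Side} {n : ℕ} {ξ : ℝ × ℝ} {x : ℤ → Fin N → ℝ}
    (h : IsCycle f S n ξ x) (i : ℤ) :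
    IsCycle f (shiftSeq S i) n ξ (fun j => x (i + j)) := by
  refine ⟨fun j => ?_, fun j => ?_⟩
  · simp only [← add_assoc, h.1]
  · simp only [← add_assoc, h.2]; rfl

/-- The two pieces agree on `s = 0`, so the letter of a point lying there is immaterial. This makes
one polygon a cycle of several words. -/
theorem IsCycle.congr {S T : ℤ → Side} {n : ℕ} {ξ : ℝ × ℝ} {x : ℤ → Fin N → ℝ}
    (h : IsCycle f S n ξ x) (hT : ∀ i, S i = T i ∨ x i 0 = 0) : IsCycle f T n ξ x := by
  refine ⟨h.1, fun i => ?_⟩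
  rw [h.2]
  rcases hT i with hi | hi
  · rw [hi]
  · exact sideMap_of_zero f ξ hi _ _

theorem shiftSeq_add_period {S : ℤ → Side} {n : ℕ} (hS : ∀ i, S (i + n) = S i) (i : ℤ) :
    shiftSeq S (i + n) = shiftSeq S i := by
  funext j
  simp only [shiftSeq]
  rw [show i + n + j = i + j + n by ring, hS]

/-- By periodicity both sides apply the same `n + 1` letters. Hence a piece carries fixed points of
one shift of the word to fixed points of the next. -/
theorem wordMap_shift_succ {S : ℤ → Side} {n : ℕ} (hS : ∀ i, S (i + n) = S i) (ξ : ℝ × ℝ) (i : ℤ)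
    (x : Fin N → ℝ) :
    wordMap f (shiftSeq S (i + 1)) ξ n (sideMap f ξ (S i) x) =
      sideMap f ξ (S i) (wordMap f (shiftSeq S i) ξ n x) := by
  have h1 := wordMap_add f (shiftSeq S i) ξ n 1 x
  have h2 := wordMap_add f (shiftSeq S i) ξ 1 n x
  rw [shiftSeq_shiftSeq, shiftSeq_add_period hS] at h1
  rw [shiftSeq_shiftSeq, add_comm 1 n, h1] at h2
  simpa [wordMap, shiftSeq] using h2.symm

/-- Shifting a periodic word does not change the characteristic polynomial of its matrix. -/
theorem charpoly_wordMat_shift {S : ℤ → Side} {n : ℕ} (hn : 0 < n) (hS : ∀ i, S (i + n) = S i)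
    (ξ : ℝ × ℝ) (i : ℤ) :
    (wordMat f (shiftSeq S i) ξ n).charpoly = (wordMat f S ξ n).charpoly := by
  -- Cutting the period after `a` letters writes the two matrices as `QR` and `RQ`.
  have hnat : ∀ a : ℕ, ∀ T : ℤ → Side, (∀ i, T (i + n) = T i) → a ≤ n →
      (wordMat f (shiftSeq T a) ξ n).charpoly = (wordMat f T ξ n).charpoly := by
    intro a T hT ha
    obtain ⟨b, rfl⟩ := Nat.exists_eq_add_of_le ha
    have h1 := wordMat_add f T ξ a b
    have h2 := wordMat_add f (shiftSeq T a) ξ b a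
    rw [shiftSeq_shiftSeq, show (a : ℤ) + b = 0 + (a + b : ℕ) by push_cast; ring,
      shiftSeq_add_period hT, shiftSeq_zero, add_comm b a] at h2
    rw [h1, h2, Matrix.charpoly_mul_comm]
  have hmod : shiftSeq S i = shiftSeq S ((i % n).toNat : ℤ) := by
    have hper : ∀ (q : ℤ) (j : ℤ), S (j + q * n) = S j := by
      intro q
      induction q using Int.induction_on with
      | zero => simp
      | succ q ih => intro j; rw [add_mul, one_mul, ← add_assoc, hS, ih]
      | pred q ih => intro j; rw [← hS, ← ih j]; congr 1; ring
    funext j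
    simp only [shiftSeq]
    rw [Int.toNat_of_nonneg (Int.emod_nonneg _ (by omega)), ← hper (i / n) (i % n + j)]
    congr 1
    have := Int.emod_add_mul_ediv i n
    linarith
  rw [hmod]
  refine hnat _ S hS ?_
  have := Int.emod_lt_of_pos i (show (0 : ℤ) < n by omega)
  omega

theorem det_one_sub_eq_of_charpoly {N : ℕ} {A B : Matrix (Fin N) (Fin N) ℝ}
    (h : A.charpoly = B.charpoly) : (1 - A).det = (1 - B).det := by
  have := congrArg (Polynomial.eval 1) h
  simpa [Matrix.eval_charpoly] using this

theorem cyclePt_isFixed {S : ℤ → Side} {n : ℕ} {ξ : ℝ × ℝ} {i : ℤ}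
    (h : (1 - wordMat f (shiftSeq S i) ξ n).det ≠ 0) :
    wordMap f (shiftSeq S i) ξ n (cyclePt f S n ξ i) = cyclePt f S n ξ i := by
  have : (1 - wordMat f (shiftSeq S i) ξ n) *ᵥ cyclePt f S n ξ i =
      wordP f (shiftSeq S i) ξ n *ᵥ f.B ξ := by
    rw [cyclePt, mulVec_mulVec, mul_nonsing_inv _ (isUnit_iff_ne_zero.2 h), one_mulVec]
  rw [wordMap_eq, ← this, sub_mulVec, one_mulVec]; abel

theorem eq_of_wordMap_fixed {S : ℤ → Side} {n : ℕ} {ξ : ℝ × ℝ}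
    (h : (1 - wordMat f S ξ n).det ≠ 0) {x y : Fin N → ℝ}
    (hx : wordMap f S ξ n x = x) (hy : wordMap f S ξ n y = y) : x = y := by
  have h1 := wordMap_sub f S ξ n x y
  rw [hx, hy] at h1
  have h2 : (1 - wordMat f S ξ n) *ᵥ (x - y) = 0 := by
    rw [sub_mulVec, one_mulVec, ← h1, sub_self]
  exact sub_eq_zero.1 (eq_zero_of_mulVec_eq_zero h h2)

theorem isCycle_cyclePt {S : ℤ → Side} {n : ℕ} (hn : 0 < n) (hS : ∀ i, S (i + n) = S i)
    {ξ : ℝ × ℝ} (h : (1 - wordMat f S ξ n).det ≠ 0) :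
    IsCycle f S n ξ (cyclePt f S n ξ) := by
  have hi : ∀ i, (1 - wordMat f (shiftSeq S i) ξ n).det ≠ 0 := fun i => by
    rwa [det_one_sub_eq_of_charpoly (charpoly_wordMat_shift f hn hS ξ i)]
  refine ⟨fun i => by simp only [cyclePt, shiftSeq_add_period hS], fun i => ?_⟩
  refine eq_of_wordMap_fixed f (hi (i + 1)) (cyclePt_isFixed f (hi _)) ?_
  rw [wordMap_shift_succ f hS, cyclePt_isFixed f (hi i)]

theorem IsCycle.det_eq_zero {S : ℤ → Side} {n : ℕ} {ξ : ℝ × ℝ} {x y : ℤ → Fin N → ℝ}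
    (hx : IsCycle f S n ξ x) (hy : IsCycle f S n ξ y) (hne : x 0 ≠ y 0) :
    (1 - wordMat f S ξ n).det = 0 := by
  by_contra h
  refine hne (eq_of_wordMap_fixed f h ?_ ?_)
  · have := hx.wordMap_eq f 0 n
    rwa [shiftSeq_zero, hx.1] at this
  · have := hy.wordMap_eq f 0 n
    rwa [shiftSeq_zero, hy.1] at this

end Words

/-! ### Bordered matrices: normalised eigenvectors and rank-one perturbations. -/

section Bordered

variable {N : ℕ} [NeZero N]

/-- Additivity of the determinant in one column. The adjugate form needs no invertibility of `A`, so
it applies to `xI - M` at every `x`, eigenvalues included. -/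
theorem det_add_vecMulVec_single {R : Type*} [CommRing R] (A : Matrix (Fin N) (Fin N) R)
    (p : Fin N → R) :
    (A + vecMulVec p (Pi.single 0 1)).det = A.det + (A.adjugate *ᵥ p) 0 := by
  have : A + vecMulVec p (Pi.single 0 1) = A.updateCol 0 ((fun i => A i 0) + p) := by
    ext i j
    by_cases hj : j = 0
    · subst hj; simp [vecMulVec_apply]
    · simp [vecMulVec_apply, hj]
  rw [this, det_updateCol_add, updateCol_eq_self, ← cramer_eq_adjugate_mulVec, cramer_apply]

/-- Bordering by an eigenvector turns the eigenvalue `1` into `0`. -/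
theorem det_bordered {M : Matrix (Fin N) (Fin N) ℝ} {q : Polynomial ℝ}
    (hq : M.charpoly = (Polynomial.X - Polynomial.C 1) * q) {v : Fin N → ℝ}
    (hv : M *ᵥ v = v) (hv0 : v 0 = 1) :
    (1 - M + vecMulVec v (Pi.single 0 1)).det = q.eval 1 := by
  -- Since `v` is an eigenvector of `xI - M` for `x - 1`, the adjugate component times `x - 1` is
  -- the determinant. Keeping the factor `x - 1` makes this a polynomial identity, and the value at
  -- `x = 1` is read off only after cancelling.
  have key : ∀ x : ℝ, (x - 1) * (M - vecMulVec v (Pi.single 0 1)).charpoly.eval x =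
      x * M.charpoly.eval x := by
    intro x
    have h1 : (scalar (Fin N) x - M) *ᵥ v = (x - 1) • v := by
      rw [sub_mulVec, hv]; ext i; simp [scalar_apply]; ring
    have h2 : (x - 1) * ((scalar (Fin N) x - M).adjugate *ᵥ v) 0 = (scalar (Fin N) x - M).det := by
      have := congrFun (congrArg (fun w => (scalar (Fin N) x - M).adjugate *ᵥ w) h1) 0
      simp only [mulVec_smul, mulVec_mulVec, adjugate_mul, smul_mulVec, one_mulVec, Pi.smul_apply,
        smul_eq_mul, hv0, mul_one] at this
      exact this.symm
    rw [eval_charpoly, eval_charpoly, ← sub_add, det_add_vecMulVec_single, mul_add, h2]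
    ring
  have key' : (M - vecMulVec v (Pi.single 0 1)).charpoly = Polynomial.X * q := by
    have h3 : (Polynomial.X - Polynomial.C 1) * (M - vecMulVec v (Pi.single 0 1)).charpoly =
        (Polynomial.X - Polynomial.C 1) * (Polynomial.X * q) := by
      refine Polynomial.funext fun x => ?_
      have := key x
      rw [hq] at this
      simp only [Polynomial.eval_mul, Polynomial.eval_sub, Polynomial.eval_X, Polynomial.eval_C]
        at this ⊢
      rw [this]; ring
    exact mul_left_cancel₀ (Polynomial.X_sub_C_ne_zero 1) h3
  have := congrArg (Polynomial.eval 1) key'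
  rw [eval_charpoly] at this
  simpa [sub_add] using this

variable {M : Matrix (Fin N) (Fin N) ℝ} {lam : ℝ}

theorem bordered_mulVec (M : Matrix (Fin N) (Fin N) ℝ) (lam : ℝ) (p v : Fin N → ℝ) :
    (lam • (1 : Matrix (Fin N) (Fin N) ℝ) - M + vecMulVec p (Pi.single 0 1)) *ᵥ v =
      lam • v - M *ᵥ v + v 0 • p := by
  rw [add_mulVec, sub_mulVec, smul_mulVec, one_mulVec, vecMulVec_mulVec]
  ext i; simp

/-- For vectors with first coordinate `1` the eigenvalue equation becomes a nonsingular linear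
system. This gives uniqueness, and differentiability in the parameter once the bordered matrix is
differentiable. -/
theorem eq_bordered_inv {p : Fin N → ℝ}
    (hT : (lam • (1 : Matrix (Fin N) (Fin N) ℝ) - M + vecMulVec p (Pi.single 0 1)).det ≠ 0)
    {v : Fin N → ℝ} (hv : M *ᵥ v = lam • v) (hv0 : v 0 = 1) :
    v = (lam • (1 : Matrix (Fin N) (Fin N) ℝ) - M + vecMulVec p (Pi.single 0 1))⁻¹ *ᵥ p := by
  have h := bordered_mulVec M lam p v
  rw [hv, hv0, sub_self, zero_add, one_smul] at h
  rw [← congrArg (fun w => (lam • (1 : Matrix (Fin N) (Fin N) ℝ) - M +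
    vecMulVec p (Pi.single 0 1))⁻¹ *ᵥ w) h, mulVec_mulVec,
    nonsing_inv_mul _ (isUnit_iff_ne_zero.2 hT), one_mulVec]

/-- An eigenvector with vanishing first coordinate would lie in the kernel of the bordered matrix.
So every eigenvector can be normalised, and the choice defining `rightEig` is not vacuous. -/
theorem rightEig_spec {p : Fin N → ℝ}
    (hT : (lam • (1 : Matrix (Fin N) (Fin N) ℝ) - M + vecMulVec p (Pi.single 0 1)).det ≠ 0)
    (hex : ∃ v : Fin N → ℝ, v ≠ 0 ∧ M *ᵥ v = lam • v) :
    M *ᵥ rightEig M lam = lam • rightEig M lam ∧ rightEig M lam 0 = 1 := by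
  obtain ⟨v, hv, hMv⟩ := hex
  have h0 : v 0 ≠ 0 := by
    intro h0
    refine hv (eq_zero_of_mulVec_eq_zero hT ?_)
    rw [bordered_mulVec, hMv, h0]; simp
  exact Classical.epsilon_spec (p := fun v => M *ᵥ v = lam • v ∧ v 0 = 1)
    ⟨(v 0)⁻¹ • v, by rw [mulVec_smul, hMv, smul_comm], by simp [h0]⟩

theorem bordered_vecMul (M : Matrix (Fin N) (Fin N) ℝ) (lam : ℝ) (p w : Fin N → ℝ) :
    w ᵥ* (lam • (1 : Matrix (Fin N) (Fin N) ℝ) - M + vecMulVec p (Pi.single 0 1)) =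
      lam • w - w ᵥ* M + (w ⬝ᵥ p) • Pi.single 0 1 := by
  rw [vecMul_add, vecMul_sub, vecMul_smul, vecMul_one, vecMul_vecMulVec]

theorem leftEig_spec {p : Fin N → ℝ} (hp : p = rightEig M lam)
    (hT : (lam • (1 : Matrix (Fin N) (Fin N) ℝ) - M + vecMulVec p (Pi.single 0 1)).det ≠ 0)
    (hex : ∃ v : Fin N → ℝ, v ≠ 0 ∧ M *ᵥ v = lam • v) :
    leftEig M lam ᵥ* M = lam • leftEig M lam ∧ leftEig M lam ⬝ᵥ p = 1 := by
  obtain ⟨v, hv, hMv⟩ := hex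
  obtain ⟨w, hw, hMw⟩ : ∃ w : Fin N → ℝ, w ≠ 0 ∧
      w ᵥ* (lam • (1 : Matrix (Fin N) (Fin N) ℝ) - M) = 0 := by
    rw [exists_vecMul_eq_zero_iff, ← exists_mulVec_eq_zero_iff]
    exact ⟨v, hv, by rw [sub_mulVec, hMv, smul_mulVec, one_mulVec, sub_self]⟩
  have hMw' : w ᵥ* M = lam • w := by
    rw [vecMul_sub, vecMul_smul, vecMul_one, sub_eq_zero] at hMw
    exact hMw.symm
  have h0 : w ⬝ᵥ p ≠ 0 := by
    intro h0
    refine hw (eq_zero_of_vecMul_eq_zero hT ?_)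
    rw [bordered_vecMul, hMw', h0]; simp
  rw [hp] at h0 ⊢
  exact Classical.epsilon_spec (p := fun w => w ᵥ* M = lam • w ∧ w ⬝ᵥ rightEig M lam = 1)
    ⟨(w ⬝ᵥ rightEig M lam)⁻¹ • w, by rw [smul_vecMul, hMw', smul_comm], by simp [h0]⟩

theorem left_eq_smul {p : Fin N → ℝ}
    (hT : (lam • (1 : Matrix (Fin N) (Fin N) ℝ) - M + vecMulVec p (Pi.single 0 1)).det ≠ 0)
    {w : Fin N → ℝ} (hw : w ᵥ* M = lam • w) :
    w = (w ⬝ᵥ p) • (Pi.single 0 1 ᵥ*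
      (lam • (1 : Matrix (Fin N) (Fin N) ℝ) - M + vecMulVec p (Pi.single 0 1))⁻¹) := by
  have h := bordered_vecMul M lam p w
  rw [hw, sub_self, zero_add] at h
  rw [← smul_vecMul, ← h, vecMul_vecMul, mul_nonsing_inv _ (isUnit_iff_ne_zero.2 hT), vecMul_one]

/-- Left eigenvectors are multiples of `leftEig`. -/
theorem left_eq_smul_leftEig {p : Fin N → ℝ} (hp : p = rightEig M lam)
    (hT : (lam • (1 : Matrix (Fin N) (Fin N) ℝ) - M + vecMulVec p (Pi.single 0 1)).det ≠ 0)
    (hex : ∃ v : Fin N → ℝ, v ≠ 0 ∧ M *ᵥ v = lam • v)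
    {w : Fin N → ℝ} (hw : w ᵥ* M = lam • w) : w = (w ⬝ᵥ p) • leftEig M lam := by
  obtain ⟨h1, h2⟩ := leftEig_spec hp hT hex
  have h3 := left_eq_smul hT h1
  rw [h2, one_smul] at h3
  rw [h3]
  exact left_eq_smul hT hw

theorem leftEig_eq {p : Fin N → ℝ} (hp : p = rightEig M lam)
    (hT : (lam • (1 : Matrix (Fin N) (Fin N) ℝ) - M + vecMulVec p (Pi.single 0 1)).det ≠ 0)
    (hex : ∃ v : Fin N → ℝ, v ≠ 0 ∧ M *ᵥ v = lam • v) :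
    leftEig M lam = Pi.single 0 1 ᵥ*
      (lam • (1 : Matrix (Fin N) (Fin N) ℝ) - M + vecMulVec p (Pi.single 0 1))⁻¹ := by
  obtain ⟨h1, h2⟩ := leftEig_spec hp hT hex
  have h3 := left_eq_smul hT h1
  rwa [h2, one_smul] at h3

/-- A rank-one perturbation of a matrix with simple eigenvalue `1`. -/
theorem det_one_sub_rankOne {v u y z : Fin N → ℝ}
    (hv : M *ᵥ v = v) (hv0 : v 0 = 1) (hu : u ᵥ* M = u) (huv : u ⬝ᵥ v = 1) {c : ℝ} (hc : c ≠ 0)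
    (hT : (1 - M + vecMulVec v (Pi.single 0 1)).det = c) :
    (1 - (M + vecMulVec y z)).det = -(c * (z ⬝ᵥ v) * (u ⬝ᵥ y)) := by
  set T := 1 - M + vecMulVec v (Pi.single 0 1) with hTdef
  have hU : IsUnit T.det := isUnit_iff_ne_zero.2 (hT ▸ hc)
  have hTv : T *ᵥ v = v := by
    have := bordered_mulVec M 1 v v
    rwa [one_smul, hv, one_smul, sub_self, hv0, one_smul, zero_add] at this
  have huT : u ᵥ* T = Pi.single 0 1 := by
    have := bordered_vecMul M 1 v u
    rwa [one_smul, hu, one_smul, sub_self, huv, one_smul, zero_add] at this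
  have hTv' : T⁻¹ *ᵥ v = v := by
    conv_lhs => rw [← hTv]
    rw [mulVec_mulVec, nonsing_inv_mul _ hU, one_mulVec]
  have hw0 : (T⁻¹ *ᵥ y) 0 = u ⬝ᵥ y := by
    have : (Pi.single 0 1 : Fin N → ℝ) ⬝ᵥ (T⁻¹ *ᵥ y) = u ⬝ᵥ y := by
      rw [← huT, dotProduct_mulVec, vecMul_vecMul, mul_nonsing_inv _ hU, vecMul_one]
    simpa using this
  -- After factoring out `T` the correction has rank two, and `det (1 - AB) = det (1 - BA)` leaves a
  -- `2 × 2` determinant. Its corner vanishes because `v 0 = 1`, so the unknown entry `z·T⁻¹y` drops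
  -- out.
  let A : Matrix (Fin N) (Fin 2) ℝ := Matrix.of fun i j => ![v i, (T⁻¹ *ᵥ y) i] j
  let B : Matrix (Fin 2) (Fin N) ℝ := Matrix.of ![Pi.single 0 1, z]
  have hAB : 1 - (M + vecMulVec y z) = T * (1 - A * B) := by
    have h1 : A * B = vecMulVec v (Pi.single 0 1) + vecMulVec (T⁻¹ *ᵥ y) z := by
      ext i j
      simp [A, B, Matrix.mul_apply, Fin.sum_univ_two, vecMulVec_apply]
    rw [h1, mul_sub, mul_one, mul_add, mul_vecMulVec, mul_vecMulVec, mulVec_mulVec,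
      mul_nonsing_inv _ hU, one_mulVec, hTv, hTdef]
    abel
  have hBA : 1 - B * A = !![0, -(u ⬝ᵥ y); -(z ⬝ᵥ v), 1 - z ⬝ᵥ (T⁻¹ *ᵥ y)] := by
    ext i j
    fin_cases i <;> fin_cases j <;> simp [A, B, hv0, hw0, dotProduct]
    all_goals rfl
  rw [hAB, det_mul, hT, det_one_sub_mul_comm, hBA, det_fin_two_of]
  ring

end Bordered

/-! ### Eigenvalues other than `1` and decay of the deflated matrix. -/

section Spectrum

variable {N : ℕ}

open Polynomial in
theorem eigs_eq_cons {M : Matrix (Fin N) (Fin N) ℝ} {q : ℝ[X]}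
    (hq : M.charpoly = (X - C 1) * q) :
    eigs M = 1 ::ₘ (q.map (algebraMap ℝ ℂ)).roots := by
  have hq0 : q ≠ 0 := by
    rintro rfl
    exact (charpoly_monic M).ne_zero (by simp [hq])
  have h : (M.map (algebraMap ℝ ℂ)).charpoly = (X - C 1) * q.map (algebraMap ℝ ℂ) := by
    rw [charpoly_map, hq]; simp
  rw [eigs, h, roots_mul, roots_X_sub_C]
  · simp
  · exact mul_ne_zero (X_sub_C_ne_zero 1)
      ((Polynomial.map_ne_zero_iff (algebraMap ℝ ℂ).injective).2 hq0)

open Polynomial in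
theorem prod_one_sub_roots {M : Matrix (Fin N) (Fin N) ℝ} {q : ℝ[X]}
    (hq : M.charpoly = (X - C 1) * q) :
    (((q.map (algebraMap ℝ ℂ)).roots.map (fun z => 1 - z)).prod) = ((q.eval 1 : ℝ) : ℂ) := by
  have hm : q.Monic := (monic_X_sub_C (1 : ℝ)).of_mul_monic_left (hq ▸ charpoly_monic M)
  have hm' : (q.map (algebraMap ℝ ℂ)).Monic := hm.map _
  have hs := (IsAlgClosed.splits (q.map (algebraMap ℝ ℂ)))
  have := hs.eval_eq_prod_roots_of_monic hm' 1
  rw [← this]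
  have h2 := Polynomial.eval_map_algebraMap (B := ℂ) q 1
  rw [h2]
  simp [Polynomial.aeval_def, Polynomial.eval₂_at_one]

attribute [local instance] Matrix.linftyOpNormedAddCommGroup Matrix.linftyOpNormedSpace
  Matrix.linftyOpNormedRing Matrix.linftyOpNormedAlgebra

open Polynomial in
-- An eigenvector of `M - v uᵀ` for a nonzero eigenvalue is annihilated by `u`, hence is an
-- eigenvector of `M`. The eigenvalue `1` is excluded, so all eigenvalues lie in the open unit disc
-- and Gelfand's formula applies.
theorem deflated_pow_tendsto [NeZero N] {M : Matrix (Fin N) (Fin N) ℝ} {q : ℝ[X]}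
    (hq : M.charpoly = (X - C 1) * q) (hroots : ∀ z ∈ (q.map (algebraMap ℝ ℂ)).roots, ‖z‖ < 1)
    {v u : Fin N → ℝ} (hv : M *ᵥ v = v) (hv0 : v 0 = 1) (hu : u ᵥ* M = u) (huv : u ⬝ᵥ v = 1)
    (hT : (1 - M + vecMulVec v (Pi.single 0 1)).det ≠ 0) :
    Tendsto (fun p : ℕ => ‖(M - vecMulVec v u) ^ p‖) atTop (𝓝 0) := by
  set D := M - vecMulVec v u with hD
  set φ := algebraMap ℝ ℂ
  have hmv : ∀ (A : Matrix (Fin N) (Fin N) ℝ) (x : Fin N → ℝ),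
      A.map φ *ᵥ (φ ∘ x) = φ ∘ (A *ᵥ x) := fun A x => by
    ext i; exact (RingHom.map_mulVec φ A x i).symm
  have huD : u ᵥ* D = 0 := by rw [hD, vecMul_sub, hu, vecMul_vecMulVec, huv, one_smul, sub_self]
  have hspec : ∀ μ ∈ spectrum ℂ (D.map φ), ‖μ‖ < 1 := by
    intro μ hμ
    rw [spectrum.mem_iff, isUnit_iff_isUnit_det, isUnit_iff_ne_zero, not_not,
      ← exists_mulVec_eq_zero_iff] at hμ
    obtain ⟨w, hw, hDw⟩ := hμ
    have hDw' : D.map φ *ᵥ w = μ • w := by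
      rw [sub_mulVec, sub_eq_zero, Algebra.algebraMap_eq_smul_one, smul_mulVec, one_mulVec] at hDw
      exact hDw.symm
    by_cases hμ0 : μ = 0
    · simp [hμ0]
    have huw : (φ ∘ u) ⬝ᵥ w = 0 := by
      have h1 : (φ ∘ u) ⬝ᵥ (D.map φ *ᵥ w) = 0 := by
        rw [dotProduct_mulVec]
        have : (φ ∘ u) ᵥ* D.map φ = 0 := by
          ext i
          have := RingHom.map_vecMul φ D u i
          rw [huD] at this
          simpa using this.symm
        rw [this, zero_dotProduct]
      rw [hDw', dotProduct_smul, smul_eq_mul] at h1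
      exact (mul_eq_zero.1 h1).resolve_left hμ0
    have hDM : D.map φ *ᵥ w = M.map φ *ᵥ w := by
      have : M.map φ = D.map φ + vecMulVec (φ ∘ v) (φ ∘ u) := by
        ext i j; simp [hD, vecMulVec_apply]
      rw [this, add_mulVec, vecMulVec_mulVec, huw]; simp
    rw [hDM] at hDw'
    have hroot : (M.map φ).charpoly.IsRoot μ := by
      rw [IsRoot, eval_charpoly, ← exists_mulVec_eq_zero_iff]
      refine ⟨w, hw, ?_⟩
      rw [sub_mulVec, hDw']; ext i; simp [scalar_apply]
    have hmem : μ ∈ eigs M := by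
      rw [eigs, mem_roots (charpoly_monic _).ne_zero]; exact hroot
    rw [eigs_eq_cons hq, Multiset.mem_cons] at hmem
    rcases hmem with rfl | hmem
    -- For the eigenvalue `1`, nonsingularity of the bordered matrix makes `w` a multiple of `v`,
    -- and `u·w = 0` with `u·v = 1` then forces `w = 0`.
    · exfalso
      set T := 1 - M + vecMulVec v (Pi.single 0 1) with hTdef
      have hTw : T.map φ *ᵥ (w - w 0 • (φ ∘ v)) = 0 := by
        have e1 : T.map φ = 1 - M.map φ + vecMulVec (φ ∘ v) (Pi.single 0 1) := by
          ext i j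
          by_cases hj : j = 0 <;> by_cases hij : i = j <;>
            simp [hTdef, vecMulVec_apply, hj, Matrix.one_apply, hij]
        have e2 : M.map φ *ᵥ (φ ∘ v) = φ ∘ v := by rw [hmv, hv]
        rw [e1, add_mulVec, sub_mulVec, one_mulVec, vecMulVec_mulVec, mulVec_sub, hDw', mulVec_smul,
          e2]
        ext i; simp [hv0]
      have hdet : (T.map φ).det ≠ 0 := by
        rw [← RingHom.mapMatrix_apply, ← RingHom.map_det]
        exact (map_ne_zero φ).2 hT
      have hwv := sub_eq_zero.1 (eq_zero_of_mulVec_eq_zero hdet hTw)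
      have : w 0 = 0 := by
        have huv' : (φ ∘ u) ⬝ᵥ (φ ∘ v) = 1 := by
          rw [← RingHom.map_dotProduct, huv, map_one]
        rw [hwv, dotProduct_smul, huv', smul_eq_mul, mul_one] at huw
        exact huw
      rw [this, zero_smul] at hwv
      exact hw hwv
    · exact hroots μ hmem
  have : CompleteSpace (Matrix (Fin N) (Fin N) ℂ) := FiniteDimensional.complete ℂ _
  have : Nontrivial (Matrix (Fin N) (Fin N) ℂ) := by
    have : Nonempty (Fin N) := ⟨0⟩
    infer_instance
  have hrad : spectralRadius ℂ (D.map φ) < ((1 : NNReal) : ENNReal) :=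
    spectrum.spectralRadius_lt_of_forall_lt (D.map φ) fun k hk => hspec k hk
  obtain ⟨s, hs1, hs2⟩ := ENNReal.lt_iff_exists_nnreal_btwn.1 hrad
  have hev := (spectrum.pow_nnnorm_pow_one_div_tendsto_nhds_spectralRadius (D.map φ)).eventually
    (gt_mem_nhds hs1)
  -- The `ℓ^∞` operator norm depends only on the moduli of the entries, so passing to complex
  -- matrices does not change it.
  have hnorm : ∀ A : Matrix (Fin N) (Fin N) ℝ, ‖A‖₊ = ‖A.map φ‖₊ := by
    intro A
    simp [linfty_opNNNorm_def, φ]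
  have hs2' : (s : ℝ) < 1 := by exact_mod_cast hs2
  refine squeeze_zero' (.of_forall fun p => norm_nonneg _) ?_
    (tendsto_pow_atTop_nhds_zero_of_lt_one s.2 hs2')
  filter_upwards [hev, eventually_gt_atTop 0] with p hp hp0
  have hpow : (D ^ p).map φ = (D.map φ) ^ p := map_pow (RingHom.mapMatrix φ) D p
  rw [← hpow, ← hnorm, one_div, ENNReal.rpow_inv_lt_iff (by positivity), ENNReal.rpow_natCast] at hp
  exact_mod_cast hp.le

end Spectrum

/-! ### Letters of rotational words and of their flips. -/

section Rotational

theorem rotSeq_add_period (l : ℤ) (m n : ℕ) (i : ℤ) : rotSeq l m n (i + n) = rotSeq l m n i := by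
  simp only [rotSeq]
  rw [show (i + n) * (m : ℤ) = i * m + n * m by ring, Int.add_mul_emod_self_left]

theorem flipAt_add_period {S : ℤ → Side} {n : ℕ} (hS : ∀ i, S (i + n) = S i) (j i : ℤ) :
    flipAt n S j (i + n) = flipAt n S j i := by
  simp only [flipAt, hS]
  have : (n : ℤ) ∣ i + n - j ↔ (n : ℤ) ∣ i - j := by
    rw [show i + n - j = i - j + n by ring, dvd_add_self_right]
  simp only [this]

theorem shiftSeq_add_period_apply {S : ℤ → Side} {n : ℕ} (hS : ∀ i, S (i + n) = S i) (j i : ℤ) :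
    shiftSeq S j (i + n) = shiftSeq S j i := by
  simp only [shiftSeq, ← add_assoc, hS]

theorem seqS0_add_period (l : ℤ) (m n : ℕ) (i : ℤ) : seqS0 l m n (i + n) = seqS0 l m n i :=
  flipAt_add_period (rotSeq_add_period l m n) 0 i

theorem seqSld_add_period (l : ℤ) (m n : ℕ) (i : ℤ) : seqSld l m n (i + n) = seqSld l m n i :=
  flipAt_add_period (rotSeq_add_period l m n) _ i

theorem modInv_mul_modEq {m n : ℕ} (hn : 0 < n) (h : Nat.Coprime m n) :
    modInv m n * m ≡ 1 [ZMOD n] := by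
  have : NeZero n := ⟨hn.ne'⟩
  rw [← ZMod.intCast_eq_intCast_iff]
  push_cast
  rw [modInv]
  push_cast
  rw [ZMod.natCast_zmod_val, mul_comm, ZMod.coe_mul_inv_eq_one m h]

theorem mul_modInv_emod {m n : ℕ} (hn : 0 < n) (h : Nat.Coprime m n) (j : ℤ) :
    (j * modInv m n * m) % n = j % n := by
  have := (modInv_mul_modEq hn h).mul_left j
  rw [mul_one, ← mul_assoc] at this
  exact this

/-- The indices congruent to `j d` are those visited at step `j` of the rotation. -/
theorem modEq_mul_modInv_iff {m n : ℕ} (hn : 0 < n) (h : Nat.Coprime m n) (i j : ℤ) :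
    i ≡ j * modInv m n [ZMOD n] ↔ (i * m) % n = j % n := by
  constructor
  · intro hi
    rw [← mul_modInv_emod hn h j]
    exact hi.mul_right _
  · intro hi
    have h1 : i * m ≡ j [ZMOD n] := hi
    have h2 := h1.mul_right (modInv m n)
    have h3 := (modInv_mul_modEq hn h).mul_left i
    calc i ≡ i * (modInv m n * m) [ZMOD n] := by simpa using h3.symm
      _ = i * m * modInv m n := by ring
      _ ≡ _ [ZMOD n] := h2

theorem rotSeq_mul_modInv {m n : ℕ} (hn : 0 < n) (h : Nat.Coprime m n) (l j : ℤ) :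
    rotSeq l m n (j * modInv m n) = if j % n < l then Side.L else Side.R := by
  rw [rotSeq, mul_modInv_emod hn h]

theorem seqS0_of_not {l : ℤ} {m n : ℕ} {i : ℤ} (hi : ¬ i ≡ 0 [ZMOD n]) :
    seqS0 l m n i = rotSeq l m n i := by
  rw [seqS0, flipAt, if_neg]
  rwa [← Int.modEq_iff_dvd, Int.modEq_comm]

theorem seqS0_of_modEq {l : ℤ} {m n : ℕ} {i : ℤ} (hl : 0 < l) (hi : i ≡ 0 [ZMOD n]) :
    rotSeq l m n i = Side.L ∧ seqS0 l m n i = Side.R := by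
  have h1 : rotSeq l m n i = Side.L := by
    rw [rotSeq, if_pos]
    have : i * m % n = 0 := by simpa [Int.ModEq] using hi.mul_right (m : ℤ)
    omega
  refine ⟨h1, ?_⟩
  rw [seqS0, flipAt, if_pos, h1, Side.flip]
  rwa [← Int.modEq_iff_dvd, Int.modEq_comm]

theorem seqSld_of_not {l : ℤ} {m n : ℕ} {i : ℤ} (hi : ¬ i ≡ l * modInv m n [ZMOD n]) :
    seqSld l m n i = rotSeq l m n i := by
  rw [seqSld, flipAt, if_neg]
  rwa [← Int.modEq_iff_dvd, Int.modEq_comm]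

theorem seqSld_of_modEq {l : ℤ} {m n : ℕ} {i : ℤ} (hn : 0 < n) (h : Nat.Coprime m n) (hl : 0 < l)
    (hln : l < n) (hi : i ≡ l * modInv m n [ZMOD n]) :
    rotSeq l m n i = Side.R ∧ seqSld l m n i = Side.L := by
  have h1 : rotSeq l m n i = Side.R := by
    rw [rotSeq, if_neg]
    rw [(modEq_mul_modInv_iff hn h i l).1 hi, Int.emod_eq_of_lt hl.le hln]
    omega
  refine ⟨h1, ?_⟩
  rw [seqSld, flipAt, if_pos, h1, Side.flip]
  rwa [← Int.modEq_iff_dvd, Int.modEq_comm]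

theorem shift_rotSeq_apply {l : ℤ} {m n : ℕ} (hn : 0 < n) (h : Nat.Coprime m n) (i : ℤ) :
    shiftSeq (rotSeq l m n) (-modInv m n) i =
      if (i * m - 1) % n < l then Side.L else Side.R := by
  have : (-modInv m n + i) * m % n = (i * m - 1) % n := by
    have := (modInv_mul_modEq hn h).sub_left (i * m)
    rw [show (-modInv m n + i) * (m : ℤ) = i * m - modInv m n * m by ring]
    exact this
  rw [shiftSeq, rotSeq, this]

theorem sub_one_emod {n : ℕ} (hn : 0 < n) (a : ℤ) :
    (a - 1) % n = if a % n = 0 then (n : ℤ) - 1 else a % n - 1 := by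
  have h0 := Int.emod_nonneg a (show (n : ℤ) ≠ 0 by omega)
  have h1 := Int.emod_lt_of_pos a (show (0 : ℤ) < n by omega)
  rw [← Int.emod_sub_emod]
  split_ifs with h
  · rw [h, zero_sub, ← Int.add_emod_right, Int.emod_eq_of_lt] <;> omega
  · rw [Int.emod_eq_of_lt] <;> omega

/-- `S` and `S^{(-d)}` agree except at the indices `0` and `l d`. -/
theorem shift_rotSeq_of_not {l : ℤ} {m n : ℕ} (hn : 0 < n) (h : Nat.Coprime m n) (hl : 0 < l)
    (hln : l < n) {i : ℤ} (h0 : ¬ i ≡ 0 [ZMOD n]) (hld : ¬ i ≡ l * modInv m n [ZMOD n]) :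
    shiftSeq (rotSeq l m n) (-modInv m n) i = rotSeq l m n i := by
  have h0' : i * m % n ≠ 0 := by
    have := modEq_mul_modInv_iff hn h i 0
    rw [zero_mul] at this
    simpa using (not_congr this).1 h0
  have hl' : i * m % n ≠ l := by
    have := (not_congr (modEq_mul_modInv_iff hn h i l)).1 hld
    rwa [Int.emod_eq_of_lt hl.le hln] at this
  rw [shift_rotSeq_apply hn h, rotSeq, sub_one_emod hn, if_neg h0']
  congr 1
  apply propext
  omega

theorem shift_rotSeq_of_zero {l : ℤ} {m n : ℕ} (hn : 0 < n) (h : Nat.Coprime m n)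
    (hln : l < n) {i : ℤ} (h0 : i ≡ 0 [ZMOD n]) :
    shiftSeq (rotSeq l m n) (-modInv m n) i = Side.R := by
  have h0' : i * m % n = 0 := by simpa [Int.ModEq] using h0.mul_right (m : ℤ)
  rw [shift_rotSeq_apply hn h, sub_one_emod hn, if_pos h0', if_neg]
  omega

theorem shift_rotSeq_of_ld {l : ℤ} {m n : ℕ} (hn : 0 < n) (h : Nat.Coprime m n) (hl : 0 < l)
    (hln : l < n) {i : ℤ} (hld : i ≡ l * modInv m n [ZMOD n]) :
    shiftSeq (rotSeq l m n) (-modInv m n) i = Side.L := by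
  have hl' : i * m % n = l := by
    have := (modEq_mul_modInv_iff hn h i l).1 hld
    rwa [Int.emod_eq_of_lt hl.le hln] at this
  rw [shift_rotSeq_apply hn h, sub_one_emod hn, if_neg (show i * m % n ≠ 0 by omega), hl',
    if_pos (by omega)]

end Rotational

/-! ### Arithmetic of the Farey roots and the letters of `G^+[k,j]`. -/

section Farey

variable {l m n mm nm mp np : ℕ}

theorem IsFareyRoots.mul_eq (h : IsFareyRoots m n mm nm mp np) : mp * n = m * np + 1 := by
  obtain ⟨h1, h2, -, -, h3⟩ := h
  rw [← h1, ← h2]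
  nlinarith

theorem IsFareyRoots.level_mul (h : IsFareyRoots m n mm nm mp np) (k : ℕ) :
    levelK m mp k * n = m * levelK n np k + 1 := by
  have := h.mul_eq
  simp only [levelK]
  nlinarith

/-- The determinant relation gives `n^+ m ≡ -1` modulo `n`. So a link of `n^+` letters carries `S`
to `S^{(-d)}`. -/
theorem IsFareyRoots.np_modEq (h : IsFareyRoots m n mm nm mp np) (hc : Nat.Coprime m n) :
    (np : ℤ) ≡ -modInv m n [ZMOD n] := by
  have hn : 0 < n := by obtain ⟨-, h2, h3, -, -⟩ := h; omega
  have h2 := modEq_mul_modInv_iff hn hc np (-1)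
  rw [neg_one_mul] at h2
  rw [h2]
  have h3 : (mp : ℤ) * n = m * np + 1 := by exact_mod_cast h.mul_eq
  rw [show (np : ℤ) * m = -1 + n * mp by linarith, Int.add_mul_emod_self_left]

/-- The residue `l d mod n`. -/
def ldRes (l m n : ℕ) : ℕ := ((l * modInv m n) % n).toNat

theorem ldRes_cast (hn : 0 < n) : (ldRes l m n : ℤ) = (l * modInv m n) % n :=
  Int.toNat_of_nonneg (Int.emod_nonneg _ (by omega))

theorem ldRes_lt (hn : 0 < n) : ldRes l m n < n := by
  have := Int.emod_lt_of_pos (l * modInv m n) (show (0 : ℤ) < n by omega)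
  rw [← ldRes_cast hn] at this
  omega

theorem ldRes_modEq (hn : 0 < n) : (ldRes l m n : ℤ) ≡ l * modInv m n [ZMOD n] := by
  rw [ldRes_cast hn]; exact Int.mod_modEq _ _

theorem natCast_modEq_ld_iff (hn : 0 < n) {i : ℕ} (hi : i < n) :
    (i : ℤ) ≡ l * modInv m n [ZMOD n] ↔ i = ldRes l m n := by
  constructor
  · intro h
    have h2 : (i : ℤ) ≡ ldRes l m n [ZMOD n] := h.trans (ldRes_modEq hn).symm
    rw [Int.natCast_modEq_iff] at h2
    exact h2.eq_of_lt_of_lt hi (ldRes_lt hn)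
  · rintro rfl
    exact ldRes_modEq hn

theorem natCast_modEq_zero_iff {i : ℕ} (hi : i < n) : (i : ℤ) ≡ 0 [ZMOD n] ↔ i = 0 := by
  constructor
  · intro h
    rw [show (0 : ℤ) = (0 : ℕ) from rfl, Int.natCast_modEq_iff] at h
    exact h.eq_of_lt_of_lt hi (by omega)
  · rintro rfl; rfl

theorem ldRes_pos (hc : Nat.Coprime m n) (hl : 0 < l) (hln : l < n) : 0 < ldRes l m n := by
  have hn : 0 < n := by omega
  rw [Nat.pos_iff_ne_zero]
  intro h
  have h1 := (modEq_mul_modInv_iff hn hc (0 : ℤ) l).1 ((natCast_modEq_ld_iff (i := 0) hn hn).2 h.symm)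
  rw [zero_mul, Int.emod_eq_of_lt (b := (n : ℤ)) (a := (l : ℤ)) (by omega) (by omega)] at h1
  simp at h1; omega

/-- As `n^+ ≡ -d`, the number `ℓn^+ + (ℓd mod n)` is a multiple of `n`, and it exceeds `ℓn^+` by
less than `n`. So rounding `ℓn^+/n` up adds exactly the residue of `ℓd`. -/
theorem IsFareyRoots.mul_ellK (h : IsFareyRoots m n mm nm mp np) (hc : Nat.Coprime m n) (k : ℕ) :
    (n : ℤ) * ellK l n np k = l * levelK n np k + ldRes l m n := by
  have hn : 0 < n := by obtain ⟨-, h2, h3, -, -⟩ := h; omega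
  have h1 : (l : ℤ) * np + ldRes l m n ≡ 0 [ZMOD n] := by
    have e1 := (h.np_modEq hc).mul_left l
    have e2 := e1.add (ldRes_modEq (l := l) (m := m) hn)
    refine e2.trans ?_
    rw [show (l : ℤ) * -modInv m n + l * modInv m n = 0 by ring]
  obtain ⟨c, hc'⟩ := (Int.modEq_zero_iff_dvd).1 h1
  have hceil : ⌈((l * np : ℕ) : ℚ) / (n : ℚ)⌉ = c := by
    have hnq : (0 : ℚ) < n := by exact_mod_cast hn
    have hq : (l : ℚ) * np + ldRes l m n = n * c := by exact_mod_cast hc'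
    have hlt : (ldRes l m n : ℚ) < n := by exact_mod_cast ldRes_lt hn
    rw [Int.ceil_eq_iff]
    push_cast
    constructor
    · rw [lt_div_iff₀ hnq]; nlinarith
    · rw [div_le_iff₀ hnq]
      have : (0 : ℚ) ≤ ldRes l m n := by positivity
      nlinarith
  rw [ellK, hceil, levelK]
  push_cast
  linear_combination -hc'

/-- From `n m_k = m n_k + 1`. The assumption `1 ≤ k` gives `n < n_k`, so that `n` is its own
residue. -/
theorem IsFareyRoots.modInv_level (h : IsFareyRoots m n mm nm mp np) {k : ℕ} (hk : 1 ≤ k) :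
    modInv (levelK m mp k) (levelK n np k) = n := by
  obtain ⟨-, h2, h3, h4, -⟩ := id h
  have hlt : n < levelK n np k := by simp only [levelK]; nlinarith
  have h1 : (levelK m mp k : ZMod (levelK n np k)) * n = 1 := by
    have := congrArg (Nat.cast : ℕ → ZMod (levelK n np k)) (h.level_mul k)
    push_cast at this
    simpa using this
  have : NeZero (levelK n np k) := ⟨by omega⟩
  rw [modInv, ZMod.inv_eq_of_mul_eq_one _ _ _ h1, ZMod.val_natCast, Nat.mod_eq_of_lt hlt]

/-- Position of the index `i` under the rotation by `m_k / n_k`. -/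
theorem IsFareyRoots.level_emod (h : IsFareyRoots m n mm nm mp np) {k i : ℕ}
    (hi : i < levelK n np k) :
    (n : ℤ) * ((i * levelK m mp k : ℤ) % levelK n np k) =
      ((i * m : ℤ) % n) * levelK n np k + i := by
  have hn : 0 < n := by obtain ⟨-, h2, h3, -, -⟩ := h; omega
  have h1 : (levelK m mp k : ℤ) * n = m * levelK n np k + 1 := by exact_mod_cast h.level_mul k
  set q := (i * m : ℤ) / n
  set ρ := (i * m : ℤ) % n
  have hq : ρ + n * q = i * m := Int.emod_add_mul_ediv _ _
  have hρ0 : 0 ≤ ρ := Int.emod_nonneg _ (by omega)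
  have hρ1 : ρ < n := Int.emod_lt_of_pos _ (by omega)
  have key : (n : ℤ) * (i * levelK m mp k - levelK n np k * q) = ρ * levelK n np k + i := by
    linear_combination (i : ℤ) * h1 - levelK n np k * hq
  have hnpos : (0 : ℤ) < n := by omega
  have hNi : (i : ℤ) + 1 ≤ levelK n np k := by omega
  have e : (i * levelK m mp k : ℤ) % levelK n np k = i * levelK m mp k - levelK n np k * q := by
    rw [← Int.sub_mul_emod_self_left _ _ q, Int.emod_eq_of_lt]
    · by_contra hneg
      push Not at hneg
      have : (n : ℤ) * (i * levelK m mp k - levelK n np k * q) < 0 := by nlinarith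
      rw [key] at this
      have : 0 ≤ ρ * levelK n np k := by positivity
      omega
    · by_contra hge
      push Not at hge
      have h5 : (n : ℤ) * levelK n np k ≤ n * (i * levelK m mp k - levelK n np k * q) := by
        nlinarith
      rw [key] at h5
      nlinarith
  rw [e, key]

/-- Multiplying the defining inequality by `n` orders the indices lexicographically: first by `im
mod n`, then by `i` itself. -/
theorem IsFareyRoots.seqG_eq (h : IsFareyRoots m n mm nm mp np) (hc : Nat.Coprime m n) {k i : ℕ}
    (hi : i < levelK n np k) (j : ℤ) :
    seqG l m n mp np k j i =
      if ((i * m : ℤ) % n) * levelK n np k + i < l * levelK n np k + ldRes l m n + n * j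
      then Side.L else Side.R := by
  have hn : 0 < n := by obtain ⟨-, h2, h3, -, -⟩ := h; omega
  rw [seqG, rotSeq]
  congr 1
  apply propext
  rw [← h.level_emod hi, ← h.mul_ellK hc k, ← mul_add]
  exact (mul_lt_mul_iff_right₀ (by omega)).symm

/-- Let `ρ = im mod n`. Since `j < k`, the shift `(ℓd mod n) + nj` of the threshold stays below
`n_k`, so the classes `ρ < ℓ` and `ρ > ℓ` keep the letters of `S`. In the class `ρ = ℓ`, which
consists of the indices congruent to `ℓd`, exactly the indices in the first `j` blocks become `L`.
-/
theorem IsFareyRoots.seqG_window (h : IsFareyRoots m n mm nm mp np) (hc : Nat.Coprime m n)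
    (hl : 0 < l) (hln : l < n) {k i j : ℕ} (hj : j < k)
    (hi : i < levelK n np k) :
    seqG l m n mp np k j i = if i < j * n then seqSld l m n i else rotSeq l m n i := by
  have hn : 0 < n := by omega
  have he := ldRes_lt (l := l) (m := m) hn
  have hbig : ldRes l m n + n * j < levelK n np k := by
    simp only [levelK]
    have : (j + 1) * n ≤ k * n := Nat.mul_le_mul_right _ hj
    nlinarith
  rw [h.seqG_eq hc hi]
  have hρ := modEq_mul_modInv_iff hn hc i l
  rw [Int.emod_eq_of_lt (a := (l : ℤ)) (by omega) (by omega)] at hρ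
  set ρ := (i * m : ℤ) % n with hρdef
  have hρ0 : 0 ≤ ρ := Int.emod_nonneg _ (by omega)
  have hrot : rotSeq l m n i = if ρ < l then Side.L else Side.R := rfl
  have hbig' : (ldRes l m n : ℤ) + n * j < levelK n np k := by exact_mod_cast hbig
  have hiZ : (i : ℤ) < levelK n np k := by exact_mod_cast hi
  rcases lt_trichotomy ρ l with hlt | heq | hgt
  · have hn1 : ¬ (i : ℤ) ≡ l * modInv m n [ZMOD n] := by rw [hρ]; omega
    rw [seqSld_of_not hn1, hrot, if_pos hlt, if_pos, ite_self]
    have : (ρ + 1) * levelK n np k ≤ l * levelK n np k :=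
      mul_le_mul_of_nonneg_right (by omega) (by omega)
    have : (0 : ℤ) ≤ n * j := by positivity
    have : (0 : ℤ) ≤ ldRes l m n := by positivity
    linarith
  · have h1 := hρ.2 heq
    obtain ⟨hR, hL⟩ := seqSld_of_modEq hn hc (by omega) (by omega : (l : ℤ) < n) h1
    rw [hR, hL, heq]
    have hmod : i % n = ldRes l m n := by
      have h2 : (i : ℤ) ≡ ldRes l m n [ZMOD n] := h1.trans (ldRes_modEq hn).symm
      rw [Int.natCast_modEq_iff] at h2
      rw [← Nat.mod_eq_of_lt he]; exact h2
    have hdm := Nat.mod_add_div i n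
    have hiff : i < ldRes l m n + n * j ↔ i < j * n := by
      rw [hmod] at hdm
      constructor
      · intro hh
        have : n * (i / n) < n * j := by omega
        have := lt_of_mul_lt_mul_left this (Nat.zero_le _)
        have : (i / n + 1) * n ≤ j * n := Nat.mul_le_mul_right _ this
        nlinarith
      · intro hh; nlinarith
    congr 1
    apply propext
    rw [← hiff]
    constructor
    · intro hh; zify; linarith
    · intro hh; zify at hh; linarith
  · have hn1 : ¬ (i : ℤ) ≡ l * modInv m n [ZMOD n] := by rw [hρ]; omega
    rw [seqSld_of_not hn1, hrot, if_neg (show ¬ ρ < l by omega), if_neg, ite_self]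
    have : (l + 1) * levelK n np k ≤ ρ * levelK n np k :=
      mul_le_mul_of_nonneg_right (by omega) (by omega)
    have : (0 : ℤ) ≤ i := by positivity
    linarith

/-- Lowering the threshold by `n` reaches into the class of `(ℓ-1)d`, to which `n_k + (ℓd mod n)`
belongs. Stepping back by `n` from this number gives the only affected index of the window. -/
theorem IsFareyRoots.seqG_neg_one (h : IsFareyRoots m n mm nm mp np) (hc : Nat.Coprime m n)
    (hl : 0 < l) (hln : l < n) {k i : ℕ} (hk : 1 ≤ k) (hi : i < levelK n np k) :
    seqG l m n mp np k (-1) i =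
      if i + n = levelK n np k + ldRes l m n then Side.R else rotSeq l m n i := by
  have hn : 0 < n := by omega
  have he := ldRes_lt (l := l) (m := m) hn
  have he0 := ldRes_pos hc hl hln
  have hbig : n < levelK n np k := by
    obtain ⟨-, -, -, h4, -⟩ := h
    simp only [levelK]; nlinarith
  rw [h.seqG_eq hc hi]
  have hρ := modEq_mul_modInv_iff hn hc i (l - 1)
  rw [Int.emod_eq_of_lt (a := (l : ℤ) - 1) (by omega) (by omega)] at hρ
  set ρ := (i * m : ℤ) % n with hρdef
  have hρ0 : 0 ≤ ρ := Int.emod_nonneg _ (by omega)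
  have hrot : rotSeq l m n i = if ρ < l then Side.L else Side.R := rfl
  have hbig' : (n : ℤ) < levelK n np k := by exact_mod_cast hbig
  have hiZ : (i : ℤ) < levelK n np k := by exact_mod_cast hi
  have heZ : (ldRes l m n : ℤ) < n := by exact_mod_cast he
  have hlevel : (levelK n np k : ℤ) + ldRes l m n ≡ (l - 1) * modInv m n [ZMOD n] := by
    have e1 : (levelK n np k : ℤ) ≡ np [ZMOD n] := by
      simp only [levelK]; push_cast
      rw [add_comm, Int.ModEq, Int.add_mul_emod_self_right]
    have e2 := (e1.trans (h.np_modEq hc)).add (ldRes_modEq (l := l) (m := m) hn)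
    rwa [show -modInv m n + l * modInv m n = (l - 1) * modInv m n by ring] at e2
  by_cases hi2 : i + n = levelK n np k + ldRes l m n
  · rw [if_pos hi2, if_neg]
    have h1 : (i : ℤ) ≡ (l - 1) * modInv m n [ZMOD n] := by
      have : (i : ℤ) + n = levelK n np k + ldRes l m n := by exact_mod_cast hi2
      rw [← this] at hlevel
      refine Int.ModEq.trans ?_ hlevel
      rw [Int.ModEq, Int.add_emod_right]
    rw [hρ.1 h1]
    have : (i : ℤ) + n = levelK n np k + ldRes l m n := by exact_mod_cast hi2
    nlinarith
  · rw [if_neg hi2, hrot]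
    congr 1
    apply propext
    constructor
    · intro hh
      by_contra hge
      push Not at hge
      have : (l : ℤ) * levelK n np k ≤ ρ * levelK n np k :=
        mul_le_mul_of_nonneg_right hge (by omega)
      have : (0 : ℤ) ≤ i := by positivity
      linarith
    · intro hh
      rcases (show ρ ≤ l - 2 ∨ ρ = l - 1 by omega) with h2 | h2
      · have : (ρ + 2) * levelK n np k ≤ l * levelK n np k :=
          mul_le_mul_of_nonneg_right (by omega) (by omega)
        have : (0 : ℤ) ≤ ldRes l m n := by positivity
        linarith
      · have h3 := hρ.2 h2
        by_contra hge
        push Not at hge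
        rw [h2] at hge
        have h4 : (levelK n np k : ℤ) + ldRes l m n - n ≤ i := by linarith
        have h5 := (h3.trans hlevel.symm).symm.dvd
        obtain ⟨c, hc5⟩ := h5
        have hc0 : c = -1 := by
          have a1 : (n : ℤ) * (-2) < n * c := by omega
          have a2 : (n : ℤ) * c < n * 0 := by
            have : (0 : ℤ) < ldRes l m n := by exact_mod_cast he0
            omega
          have a3 := lt_of_mul_lt_mul_left a1 (by omega)
          have a4 := lt_of_mul_lt_mul_left a2 (by omega)
          omega
        subst hc0
        apply hi2
        zify
        linarith

end Farey

/-! ### The polygon at a shrinking point. -/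

section ShrinkingCycles

variable {N K : ℕ} [NeZero N] {f : PWLFamily N K} {l : ℤ} {m n : ℕ} {ξ : ℝ × ℝ}

theorem IsShrinkingPoint.n_pos (h : IsShrinkingPoint f l m n ξ) : 0 < n := by
  obtain ⟨h1, h2, h3, h4, -⟩ := h; omega

theorem IsShrinkingPoint.coprime (h : IsShrinkingPoint f l m n ξ) : Nat.Coprime m n :=
  h.2.2.2.2.1

theorem IsShrinkingPoint.zero_iff (h : IsShrinkingPoint f l m n ξ) (i : ℤ) :
    cyclePt f (seqS0 l m n) n ξ i 0 = 0 ↔ (i ≡ 0 [ZMOD n] ∨ i ≡ l * modInv m n [ZMOD n]) :=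
  h.2.2.2.2.2.2.2.2.2 i

theorem IsShrinkingPoint.isCycle_seqS0 (h : IsShrinkingPoint f l m n ξ) :
    IsCycle f (seqS0 l m n) n ξ (cyclePt f (seqS0 l m n) n ξ) :=
  isCycle_cyclePt f h.n_pos (seqS0_add_period l m n) h.2.2.2.2.2.2.1

theorem IsShrinkingPoint.isCycle_rotSeq (h : IsShrinkingPoint f l m n ξ) :
    IsCycle f (rotSeq l m n) n ξ (cyclePt f (seqS0 l m n) n ξ) := by
  refine h.isCycle_seqS0.congr f fun i => ?_
  by_cases hi : i ≡ 0 [ZMOD n]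
  · exact Or.inr ((h.zero_iff i).2 (Or.inl hi))
  · exact Or.inl (seqS0_of_not hi)

theorem IsShrinkingPoint.isCycle_seqSld (h : IsShrinkingPoint f l m n ξ) :
    IsCycle f (seqSld l m n) n ξ (cyclePt f (seqS0 l m n) n ξ) := by
  refine h.isCycle_rotSeq.congr f fun i => ?_
  by_cases hi : i ≡ l * modInv m n [ZMOD n]
  · exact Or.inr ((h.zero_iff i).2 (Or.inr hi))
  · exact Or.inl (seqSld_of_not hi).symm

/-- `S` and `S^{(-d)}` differ exactly at the indices `0` and `ℓd`, where the polygon lies on `s =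
0`. -/
theorem IsShrinkingPoint.isCycle_shift (h : IsShrinkingPoint f l m n ξ) :
    IsCycle f (shiftSeq (rotSeq l m n) (-modInv m n)) n ξ (cyclePt f (seqS0 l m n) n ξ) := by
  refine h.isCycle_rotSeq.congr f fun i => ?_
  by_cases h0 : i ≡ 0 [ZMOD n]
  · exact Or.inr ((h.zero_iff i).2 (Or.inl h0))
  by_cases hi : i ≡ l * modInv m n [ZMOD n]
  · exact Or.inr ((h.zero_iff i).2 (Or.inr hi))
  · have := h.1; have := h.2.1
    exact Or.inl (shift_rotSeq_of_not h.n_pos h.coprime (by omega) (by omega) h0 hi).symm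

theorem IsShrinkingPoint.tConst_eq_zero_iff {l : ℕ} (h : IsShrinkingPoint f l m n ξ) (j : ℤ) :
    tConst f l m n ξ j = 0 ↔ j % n = 0 ∨ j % n = l := by
  have h1 := h.1
  have h2 := h.2.1
  rw [tConst, h.zero_iff, modEq_mul_modInv_iff h.n_pos h.coprime _ (l : ℤ),
    mul_modInv_emod h.n_pos h.coprime, Int.emod_eq_of_lt (a := (l : ℤ)) (by omega) (by omega)]
  have := modEq_mul_modInv_iff h.n_pos h.coprime (j * modInv m n) 0
  rw [zero_mul, mul_modInv_emod h.n_pos h.coprime] at this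
  rw [this, Int.zero_emod]

theorem IsShrinkingPoint.tConst_ne_zero {l : ℕ} (h : IsShrinkingPoint f l m n ξ) {j i : ℤ}
    (hj : j % n = i) (h0 : i ≠ 0) (hl : i ≠ l) : tConst f l m n ξ j ≠ 0 := by
  rw [Ne, h.tConst_eq_zero_iff, hj]; tauto

theorem IsShrinkingPoint.tConst_neg {l : ℕ} (h : IsShrinkingPoint f l m n ξ) {j : ℤ}
    (hj0 : 0 < j) (hjl : j < l) : tConst f l m n ξ j < 0 := by
  have h1 := h.1
  have h2 := h.2.1
  have hmod : j % n = j := Int.emod_eq_of_lt hj0.le (by omega)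
  refine lt_of_le_of_ne ?_ (h.tConst_ne_zero hmod hj0.ne' hjl.ne)
  have hnot : ¬ j * modInv m n ≡ 0 [ZMOD n] := by
    have := modEq_mul_modInv_iff h.n_pos h.coprime (j * modInv m n) 0
    rw [zero_mul, mul_modInv_emod h.n_pos h.coprime, hmod, Int.zero_emod] at this
    rw [this]; exact hj0.ne'
  have hs : seqS0 l m n (j * modInv m n) = Side.L := by
    rw [seqS0_of_not hnot, rotSeq_mul_modInv h.n_pos h.coprime, hmod, if_pos hjl]
  have := h.2.2.2.2.2.2.2.2.1 (j * modInv m n)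
  rw [hs] at this
  exact this

/-- At a shrinking point `1` is an eigenvalue of `M_S`: there are two different `S`-cycles. -/
theorem IsShrinkingPoint.det_eq_zero (h : IsShrinkingPoint f l m n ξ) :
    (1 - wordMat f (rotSeq l m n) ξ n).det = 0 := by
  have h1 := h.1
  have h2 := h.2.1
  have hc := h.isCycle_shift.shift f (modInv m n)
  rw [shiftSeq_shiftSeq, neg_add_cancel, shiftSeq_zero] at hc
  -- The two cycles differ because `x_0` lies on `s = 0` while `x_d` does not, as `1 < ℓ`.
  refine h.isCycle_rotSeq.det_eq_zero f hc fun heq => ?_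
  have e1 : cyclePt f (seqS0 l m n) n ξ 0 0 = 0 := (h.zero_iff 0).2 (Or.inl rfl)
  rw [heq, add_zero, h.zero_iff] at e1
  have e0 := modEq_mul_modInv_iff h.n_pos h.coprime (1 * modInv m n) 0
  rw [zero_mul, mul_modInv_emod h.n_pos h.coprime, Int.emod_eq_of_lt (a := (1 : ℤ)) (by omega) (by omega),
    Int.zero_emod, one_mul] at e0
  have el := modEq_mul_modInv_iff h.n_pos h.coprime (1 * modInv m n) l
  rw [mul_modInv_emod h.n_pos h.coprime, Int.emod_eq_of_lt (a := (1 : ℤ)) (by omega) (by omega),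
    Int.emod_eq_of_lt (a := l) (by omega) (by omega), one_mul] at el
  rw [e0, el] at e1
  omega

end ShrinkingCycles

/-! ### Factorisation of the words `G^+[k,j]` and of their flips into turns and a link. -/

section Words

variable {N K : ℕ} [NeZero N] (f : PWLFamily N K) {l m n mm nm mp np : ℕ}

/-- The itinerary `S^{(-d)}`. -/
def cmSeq (l : ℤ) (m n : ℕ) : ℤ → Side := shiftSeq (rotSeq l m n) (-modInv m n)

theorem cmSeq_add_period (l : ℤ) (m n : ℕ) (i : ℤ) : cmSeq l m n (i + n) = cmSeq l m n i :=
  shiftSeq_add_period_apply (rotSeq_add_period l m n) _ i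

theorem shiftSeq_congr_modEq {S : ℤ → Side} {n : ℕ} (hS : ∀ i, S (i + n) = S i) {i j : ℤ}
    (h : i ≡ j [ZMOD n]) : shiftSeq S i = shiftSeq S j := by
  obtain ⟨c, hc⟩ := h.symm.dvd
  have hi : i = j + c * n := by linarith
  subst hi
  clear hc h
  induction c using Int.induction_on with
  | zero => simp
  | succ q ih => rw [add_mul, one_mul, ← add_assoc, shiftSeq_add_period hS, ih]
  | pred q ih =>
    rw [← shiftSeq_add_period hS, ← ih]
    congr 1; ring

theorem shift_rotSeq_np (h : IsFareyRoots m n mm nm mp np) (hc : Nat.Coprime m n) (l : ℤ) (a : ℕ) :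
    shiftSeq (rotSeq l m n) (np + a * n : ℕ) = cmSeq l m n := by
  rw [cmSeq]
  refine shiftSeq_congr_modEq (rotSeq_add_period l m n) ?_
  refine Int.ModEq.trans ?_ (h.np_modEq hc)
  push_cast
  rw [Int.ModEq, Int.add_mul_emod_self_right]

theorem rotSeq_block (n : ℕ) {S : ℤ → Side} (hS : ∀ i, S (i + n) = S i) (a : ℕ) :
    shiftSeq S (a * n : ℕ) = S := by
  rw [shiftSeq_congr_modEq hS (j := 0), shiftSeq_zero]
  push_cast
  rw [Int.ModEq, Int.mul_emod_left, Int.zero_emod]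

theorem wordMap_rotSeq_tail (h : IsFareyRoots m n mm nm mp np) (hc : Nat.Coprime m n) (l : ℤ)
    (ξ : ℝ × ℝ) (a : ℕ) (x : Fin N → ℝ) :
    wordMap f (rotSeq l m n) ξ (np + a * n) x =
      (wordMap f (cmSeq l m n) ξ n)^[a] (wordMap f (rotSeq l m n) ξ np x) := by
  have := shift_rotSeq_np h hc l 0
  rw [zero_mul, add_zero] at this
  rw [wordMap_add, this, wordMap_mul f (cmSeq_add_period l m n)]

theorem wordMat_rotSeq_tail (h : IsFareyRoots m n mm nm mp np) (hc : Nat.Coprime m n) (l : ℤ)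
    (ξ : ℝ × ℝ) (a : ℕ) :
    wordMat f (rotSeq l m n) ξ (np + a * n) =
      (wordMat f (cmSeq l m n) ξ n) ^ a * wordMat f (rotSeq l m n) ξ np := by
  have := shift_rotSeq_np h hc l 0
  rw [zero_mul, add_zero] at this
  rw [wordMat_add, this, wordMat_mul f (cmSeq_add_period l m n)]

/-- The link word and the two centre matrices intertwine. -/
theorem link_comm (h : IsFareyRoots m n mm nm mp np) (hc : Nat.Coprime m n) (l : ℤ)
    (ξ : ℝ × ℝ) :
    wordMat f (cmSeq l m n) ξ n * wordMat f (rotSeq l m n) ξ np =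
      wordMat f (rotSeq l m n) ξ np * wordMat f (rotSeq l m n) ξ n := by
  have h1 := wordMat_rotSeq_tail f h hc l ξ 1
  have h2 := wordMat_add f (rotSeq l m n) ξ n np
  have h3 := rotSeq_block n (rotSeq_add_period l m n) 1
  rw [one_mul] at h1 h3
  rw [h3, add_comm n np, h1, pow_one] at h2
  exact h2

theorem levelK_eq {j k : ℕ} (hj : j ≤ k) (n np : ℕ) :
    levelK n np k = j * n + (np + (k - j) * n) := by
  obtain ⟨c, rfl⟩ := Nat.exists_eq_add_of_le hj
  simp [levelK]; ring

theorem seqG_head (h : IsFareyRoots m n mm nm mp np) (hc : Nat.Coprime m n)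
    (hl : 0 < l) (hln : l < n) {k i j : ℕ} (hj : j < k) (hi : i < j * n) :
    seqG l m n mp np k j i = seqSld l m n i := by
  have := levelK_eq hj.le n np
  rw [h.seqG_window hc hl hln hj (by omega), if_pos hi]

theorem seqG_tail (h : IsFareyRoots m n mm nm mp np) (hc : Nat.Coprime m n)
    (hl : 0 < l) (hln : l < n) {k i j : ℕ} (hj : j < k) (hi : i < np + (k - j) * n) :
    shiftSeq (seqG l m n mp np k j) (j * n : ℕ) i = rotSeq l m n i := by
  have h1 := levelK_eq hj.le n np
  have h2 : ((j * n : ℕ) : ℤ) + i = ((j * n + i : ℕ) : ℤ) := by push_cast; ring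
  rw [shiftSeq, h2, h.seqG_window hc hl hln hj (by omega), if_neg (by omega), ← h2]
  exact congrFun (rotSeq_block n (rotSeq_add_period l m n) j) i

/-- Only the exponent of the turn map of `S^{(-d)}` grows with `k`; the other factors form one fixed
affine map for each parameter. -/
theorem wordMap_seqG (h : IsFareyRoots m n mm nm mp np) (hc : Nat.Coprime m n)
    (hl : 0 < l) (hln : l < n) {k j : ℕ} (hj : j < k) (ξ : ℝ × ℝ) (x : Fin N → ℝ) :
    wordMap f (seqG l m n mp np k j) ξ (levelK n np k) x =
      (wordMap f (cmSeq l m n) ξ n)^[k - j] (wordMap f (rotSeq l m n) ξ np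
        ((wordMap f (seqSld l m n) ξ n)^[j] x)) := by
  rw [levelK_eq hj.le n np, wordMap_add, wordMap_congr f ξ fun i hi => seqG_tail h hc hl hln hj hi,
    wordMap_rotSeq_tail f h hc, wordMap_congr f ξ fun i hi => seqG_head h hc hl hln hj hi,
    wordMap_mul f (seqSld_add_period l m n)]

theorem wordMat_seqG (h : IsFareyRoots m n mm nm mp np) (hc : Nat.Coprime m n)
    (hl : 0 < l) (hln : l < n) {k j : ℕ} (hj : j < k) (ξ : ℝ × ℝ) :
    wordMat f (seqG l m n mp np k j) ξ (levelK n np k) =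
      wordMat f (cmSeq l m n) ξ n ^ (k - j) *
        (wordMat f (rotSeq l m n) ξ np * wordMat f (seqSld l m n) ξ n ^ j) := by
  rw [levelK_eq hj.le n np, wordMat_add, wordMat_congr f ξ fun i hi => seqG_tail h hc hl hln hj hi,
    wordMat_rotSeq_tail f h hc, wordMat_congr f ξ fun i hi => seqG_head h hc hl hln hj hi,
    wordMat_mul f (seqSld_add_period l m n), Matrix.mul_assoc]

/-- With the symbol at index `0` flipped, `S^{(l d) flipped}` becomes `S^{(-d)}`. -/
theorem flip_seqSld_window (hc : Nat.Coprime m n) (hl : 0 < l) (hln : l < n) {i : ℕ} (hi : i < n) :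
    (if i = 0 then (seqSld l m n i).flip else seqSld l m n i) = cmSeq l m n i := by
  have hn : 0 < n := by omega
  have he0 := ldRes_pos hc hl hln
  by_cases h0 : i = 0
  · subst h0
    rw [if_pos rfl, cmSeq, shift_rotSeq_of_zero hn hc (by omega) (by rfl), seqSld_of_not,
      (seqS0_of_modEq (i := ((0 : ℕ) : ℤ)) (by omega : (0 : ℤ) < l) (by rfl)).1]
    · rfl
    · rw [natCast_modEq_ld_iff hn hn]; omega
  · rw [if_neg h0]
    by_cases h1 : (i : ℤ) ≡ l * modInv m n [ZMOD n]
    · rw [(seqSld_of_modEq hn hc (by omega) (by omega) h1).2, cmSeq,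
        shift_rotSeq_of_ld hn hc (by omega) (by omega) h1]
    · rw [seqSld_of_not h1, cmSeq, shift_rotSeq_of_not hn hc (by omega) (by omega) _ h1]
      rwa [natCast_modEq_zero_iff hi]

/-- `S^{(-d)}` and `S` with index `0` flipped agree except at the index `l d`. -/
theorem cmSeq_eq_seqS0 (hc : Nat.Coprime m n) (hl : 0 < l) (hln : l < n) {i : ℕ} (hi : i < n)
    (hie : i ≠ ldRes l m n) : cmSeq l m n i = seqS0 l m n i := by
  have hn : 0 < n := by omega
  by_cases h0 : i = 0
  · subst h0
    rw [cmSeq, shift_rotSeq_of_zero hn hc (by omega) (by rfl),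
      (seqS0_of_modEq (i := ((0 : ℕ) : ℤ)) (by omega : (0 : ℤ) < l) (by rfl)).2]
  · have h0' : ¬ (i : ℤ) ≡ 0 [ZMOD n] := by rwa [natCast_modEq_zero_iff hi]
    rw [cmSeq, shift_rotSeq_of_not hn hc (by omega) (by omega) h0'
      (by rwa [natCast_modEq_ld_iff hn hi]), seqS0_of_not h0']

theorem cmSeq_ldRes (hc : Nat.Coprime m n) (hl : 0 < l) (hln : l < n) :
    cmSeq l m n (ldRes l m n) = Side.L ∧ seqS0 l m n (ldRes l m n) = Side.R := by
  have hn : 0 < n := by omega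
  have h1 := ldRes_modEq (l := l) (m := m) hn
  refine ⟨shift_rotSeq_of_ld hn hc (by omega) (by omega) h1, ?_⟩
  rw [seqS0_of_not, (seqSld_of_modEq hn hc (by omega) (by omega) h1).1]
  rw [natCast_modEq_zero_iff (ldRes_lt hn)]
  exact (ldRes_pos hc hl hln).ne'

theorem flipAt_level_window {S : ℤ → Side} {ν i : ℕ} (hi : i < ν) :
    flipAt ν S 0 i = if i = 0 then (S i).flip else S i := by
  have : (ν : ℤ) ∣ (i : ℤ) - 0 ↔ i = 0 := by
    rw [sub_zero, Int.natCast_dvd_natCast]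
    exact ⟨fun h => Nat.eq_zero_of_dvd_of_lt h hi, fun h => h ▸ dvd_zero _⟩
  simp only [flipAt, this]

/-- Flipping letter `0` turns the first of the `j + 1` flipped turns into a turn of `S^{(-d)}`. At
`ξ*` this turn fixes `v_{-d}`, which is why the flipped word labelled `j + 1` has a slope governed
by `κ_j`. -/
theorem wordMat_flip_seqG (h : IsFareyRoots m n mm nm mp np) (hc : Nat.Coprime m n)
    (hl : 0 < l) (hln : l < n) {k j : ℕ} (hj : j + 1 < k) (ξ : ℝ × ℝ) :
    wordMat f (flipAt (levelK n np k) (seqG l m n mp np k (j + 1 : ℕ)) 0) ξ (levelK n np k) =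
      wordMat f (cmSeq l m n) ξ n ^ (k - (j + 1)) * (wordMat f (rotSeq l m n) ξ np *
        (wordMat f (seqSld l m n) ξ n ^ j * wordMat f (cmSeq l m n) ξ n)) := by
  have hn : 0 < n := by omega
  have hlev : levelK n np k = n + (j * n + (np + (k - (j + 1)) * n)) := by
    rw [levelK_eq hj.le n np]; ring
  have hGcm : ∀ i < n, flipAt (levelK n np k) (seqG l m n mp np k (j + 1 : ℕ)) 0 (i : ℕ) =
      cmSeq l m n i := by
    intro i hi
    rw [flipAt_level_window (by omega), seqG_head h hc hl hln hj (by nlinarith),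
      flip_seqSld_window hc hl hln hi]
  have hGt : ∀ i < j * n + (np + (k - (j + 1)) * n),
      shiftSeq (flipAt (levelK n np k) (seqG l m n mp np k (j + 1 : ℕ)) 0) n (i : ℕ) =
        shiftSeq (seqG l m n mp np k (j + 1 : ℕ)) n (i : ℕ) := by
    intro i hi
    rw [shiftSeq, shiftSeq, ← Nat.cast_add, flipAt_level_window (by omega), if_neg (by omega)]
  have hG := wordMat_seqG f h hc hl hln hj ξ
  have hsplit := wordMat_add f (seqG l m n mp np k (j + 1 : ℕ)) ξ n
    (j * n + (np + (k - (j + 1)) * n))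
  rw [hlev, wordMat_add, ← hlev, wordMat_congr f ξ hGt, wordMat_congr f ξ hGcm]
  have hhead : ∀ i < j * n, shiftSeq (seqG l m n mp np k (j + 1 : ℕ)) n (i : ℕ) =
      seqSld l m n i := by
    intro i hi
    rw [shiftSeq, ← Nat.cast_add, seqG_head h hc hl hln hj (by linarith)]
    push_cast; rw [add_comm, seqSld_add_period]
  have htail : ∀ i < np + (k - (j + 1)) * n,
      shiftSeq (shiftSeq (seqG l m n mp np k (j + 1 : ℕ)) n) (j * n : ℕ) (i : ℕ) =
        rotSeq l m n i := by
    intro i hi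
    rw [shiftSeq_shiftSeq, ← seqG_tail h hc hl hln hj hi]
    congr 2; push_cast; ring
  rw [wordMat_add, wordMat_congr f ξ hhead, wordMat_congr f ξ htail,
    wordMat_mul f (seqSld_add_period l m n), wordMat_rotSeq_tail f h hc]
  simp only [Matrix.mul_assoc]

/-- With label `0` the first turn follows `S`, and the flip makes it a turn of `S` flipped at `0`.
This is the origin of `κ_{-1}`. -/
theorem wordMat_flip_seqG_zero (h : IsFareyRoots m n mm nm mp np) (hc : Nat.Coprime m n)
    (hl : 0 < l) (hln : l < n) {k : ℕ} (hk : 1 < k) (ξ : ℝ × ℝ) :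
    wordMat f (flipAt (levelK n np k) (seqG l m n mp np k (0 : ℕ)) 0) ξ (levelK n np k) =
      wordMat f (cmSeq l m n) ξ n ^ (k - 1) * (wordMat f (rotSeq l m n) ξ np *
        wordMat f (seqS0 l m n) ξ n) := by
  have hn : 0 < n := by omega
  have hlev : levelK n np k = n + (np + (k - 1) * n) := by
    rw [levelK_eq hk.le n np]; ring
  have hG : ∀ i < levelK n np k, seqG l m n mp np k (0 : ℕ) (i : ℕ) = rotSeq l m n i := by
    intro i hi
    rw [h.seqG_window hc hl hln (by omega) hi, zero_mul, if_neg (by omega)]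
  have h1 : ∀ i < n, flipAt (levelK n np k) (seqG l m n mp np k (0 : ℕ)) 0 (i : ℕ) =
      seqS0 l m n i := by
    intro i hi
    rw [flipAt_level_window (by omega), hG i (by omega)]
    by_cases h0 : i = 0
    · subst h0
      obtain ⟨e1, e2⟩ := seqS0_of_modEq (l := l) (m := m) (n := n) (i := ((0 : ℕ) : ℤ)) (by omega)
        (by rfl)
      rw [if_pos rfl, e1, e2, Side.flip]
    · rw [if_neg h0, seqS0_of_not (by rwa [natCast_modEq_zero_iff hi])]
  have h2 : ∀ i < np + (k - 1) * n,
      shiftSeq (flipAt (levelK n np k) (seqG l m n mp np k (0 : ℕ)) 0) n (i : ℕ) =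
        rotSeq l m n i := by
    intro i hi
    rw [shiftSeq, ← Nat.cast_add, flipAt_level_window (by omega), if_neg (by omega),
      hG _ (by omega)]
    push_cast; rw [add_comm, rotSeq_add_period]
  rw [hlev, wordMat_add, ← hlev, wordMat_congr f ξ h1, wordMat_congr f ξ h2,
    wordMat_rotSeq_tail f h hc, Matrix.mul_assoc]

/-- The exceptional letter lies in the last turn, so the new block stands on the left of the power.
A cyclic permutation of the factors is needed later to bring it next to the link. -/
theorem wordMat_seqG_neg_one (h : IsFareyRoots m n mm nm mp np) (hc : Nat.Coprime m n)
    (hl : 0 < l) (hln : l < n) {k : ℕ} (hk : 1 ≤ k) (ξ : ℝ × ℝ) :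
    wordMat f (seqG l m n mp np k (-1)) ξ (levelK n np k) =
      wordMat f (seqS0 l m n) ξ n * (wordMat f (cmSeq l m n) ξ n ^ (k - 1) *
        wordMat f (rotSeq l m n) ξ np) := by
  have hn : 0 < n := by omega
  have hlev : levelK n np k = np + (k - 1) * n + n := by
    obtain ⟨c, rfl⟩ := Nat.exists_eq_add_of_le hk
    simp [levelK]; ring
  have he := ldRes_lt (l := l) (m := m) hn
  have h1 : ∀ i < np + (k - 1) * n, seqG l m n mp np k (-1) (i : ℕ) = rotSeq l m n i := by
    intro i hi
    rw [h.seqG_neg_one hc hl hln hk (by omega), if_neg (by omega)]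
  have h2 : ∀ i < n, shiftSeq (seqG l m n mp np k (-1)) (np + (k - 1) * n : ℕ) (i : ℕ) =
      seqS0 l m n i := by
    intro i hi
    rw [shiftSeq, ← Nat.cast_add, h.seqG_neg_one hc hl hln hk (by omega)]
    by_cases hie : i = ldRes l m n
    · rw [if_pos (by omega), hie, (cmSeq_ldRes hc hl hln).2]
    · rw [if_neg (by omega), ← cmSeq_eq_seqS0 hc hl hln hi hie, ← shift_rotSeq_np h hc l (k - 1)]
      rw [Nat.cast_add]; rfl
  rw [hlev, wordMat_add, wordMat_congr f ξ h1, wordMat_congr f ξ h2, wordMat_rotSeq_tail f h hc]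

end Words

/-! ### Border collisions as equations for a returning point. -/

section Collisions

variable {N K : ℕ} [NeZero N] {f : PWLFamily N K} {l m n mm nm mp np : ℕ}

theorem IsCycle.wordMap_zero {S : ℤ → Side} {n : ℕ} {ξ : ℝ × ℝ} {x : ℤ → Fin N → ℝ}
    (h : IsCycle f S n ξ x) (a : ℕ) : wordMap f S ξ a (x 0) = x a := by
  have := h.wordMap_eq f 0 a
  rwa [shiftSeq_zero, zero_add] at this

theorem IsCycle.eq_of_modEq {S : ℤ → Side} {n : ℕ} {ξ : ℝ × ℝ} {x : ℤ → Fin N → ℝ}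
    (h : IsCycle f S n ξ x) {i j : ℤ} (hij : i ≡ j [ZMOD n]) : x i = x j := by
  obtain ⟨c, hc⟩ := hij.symm.dvd
  have hi : i = j + c * n := by linarith
  subst hi
  clear hc hij
  induction c using Int.induction_on with
  | zero => simp
  | succ q ih => rw [add_mul, one_mul, ← add_assoc, h.1, ih]
  | pred q ih => rw [← h.1, ← ih]; congr 1; ring

theorem collision_start (h : IsFareyRoots m n mm nm mp np) (hc : Nat.Coprime m n)
    (hl : 0 < l) (hln : l < n) {k j : ℕ} (hj : j < k) {ξ : ℝ × ℝ}
    (hb : IsBorderCollision f l m n mp np k j 0 ξ) :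
    ∃ z : Fin N → ℝ, z 0 = 0 ∧ z = (wordMap f (cmSeq l m n) ξ n)^[k - j]
      (wordMap f (rotSeq l m n) ξ np ((wordMap f (seqSld l m n) ξ n)^[j] z)) := by
  obtain ⟨x, hx, -, h0⟩ := hb
  refine ⟨x 0, h0, ?_⟩
  rw [← wordMap_seqG f h hc hl hln hj, hx.wordMap_zero]
  have := hx.1 0
  rw [zero_add] at this
  exact this.symm

/-- Since `d_k = n`, the second collision index sits at position `ℓd` of a turn: the last flipped
turn if `j ≥ 1`, and the last turn of the whole period if `j = 0`. -/
theorem IsFareyRoots.collision_index (h : IsFareyRoots m n mm nm mp np) (hc : Nat.Coprime m n)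
    {k : ℕ} (hk : 1 ≤ k) (j : ℤ) :
    (ellK l n np k + j - 1) * modInv (levelK m mp k) (levelK n np k) ≡
      ldRes l m n + (j - 1) * n [ZMOD levelK n np k] := by
  rw [h.modInv_level hk]
  have h1 := h.mul_ellK (l := l) hc k
  have h2 : (ellK l n np k + j - 1) * (n : ℤ) = ldRes l m n + (j - 1) * n + levelK n np k * l := by
    linear_combination h1
  rw [h2, Int.ModEq, Int.add_mul_emod_self_left]

/-- The collision is recorded as agreement of two words on the last flipped turn, since they differ
only at the colliding letter. In this form its transversality will be measured by a difference of
two `κ`. -/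
theorem collision_end_succ (h : IsFareyRoots m n mm nm mp np) (hc : Nat.Coprime m n)
    (hl : 0 < l) (hln : l < n) {k j : ℕ} (hj : j + 1 < k) {ξ : ℝ × ℝ}
    (hb : IsBorderCollision f l m n mp np k (j + 1 : ℕ)
      ((ellK l n np k + (j + 1 : ℕ) - 1) * modInv (levelK m mp k) (levelK n np k)) ξ) :
    ∃ z : Fin N → ℝ, wordMap f (seqSld l m n) ξ n ((wordMap f (seqSld l m n) ξ n)^[j] z) =
        wordMap f (rotSeq l m n) ξ n ((wordMap f (seqSld l m n) ξ n)^[j] z) ∧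
      z = (wordMap f (cmSeq l m n) ξ n)^[k - (j + 1)]
      (wordMap f (rotSeq l m n) ξ np ((wordMap f (seqSld l m n) ξ n)^[j + 1] z)) := by
  have hn : 0 < n := by omega
  have he := ldRes_lt (l := l) (m := m) hn
  obtain ⟨x, hx, -, h0⟩ := hb
  rw [hx.eq_of_modEq (h.collision_index hc (by omega) _)] at h0
  refine ⟨x 0, ?_, ?_⟩
  · have hidx : (ldRes l m n : ℤ) + ((j + 1 : ℕ) - 1) * n = (j * n + ldRes l m n : ℕ) := by
      push_cast; ring
    have hhead : ∀ i < j * n, seqG l m n mp np k (j + 1 : ℕ) (i : ℕ) = seqSld l m n i :=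
      fun i hi => seqG_head h hc hl hln hj (by nlinarith)
    have hnext : ∀ i < ldRes l m n,
        shiftSeq (seqG l m n mp np k (j + 1 : ℕ)) (j * n : ℕ) (i : ℕ) = seqSld l m n i := by
      intro i hi
      rw [shiftSeq, ← Nat.cast_add, seqG_head h hc hl hln hj (by nlinarith), Nat.cast_add]
      exact congrFun (rotSeq_block n (seqSld_add_period l m n) j) i
    rw [hidx, ← hx.wordMap_zero, wordMap_add, wordMap_congr f ξ hnext, wordMap_congr f ξ hhead,
      wordMap_mul f (seqSld_add_period l m n)] at h0
    refine wordMap_eq_of_collision f ξ (fun i hi hie => ?_) h0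
    exact seqSld_of_not (by rwa [natCast_modEq_ld_iff hn hi])
  · rw [← wordMap_seqG f h hc hl hln hj, hx.wordMap_zero]
    have := hx.1 0
    rw [zero_add] at this
    exact this.symm

/-- The base point is moved to the start of the last turn, so that the collision occurs `ℓd mod n`
letters later inside a turn of `S^{(-d)}`. -/
theorem collision_end_zero (h : IsFareyRoots m n mm nm mp np) (hc : Nat.Coprime m n)
    (hl : 0 < l) (hln : l < n) {k : ℕ} (hk : 1 ≤ k) {ξ : ℝ × ℝ}
    (hb : IsBorderCollision f l m n mp np k (0 : ℕ)
      ((ellK l n np k + (0 : ℕ) - 1) * modInv (levelK m mp k) (levelK n np k)) ξ) :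
    ∃ z : Fin N → ℝ, wordMap f (cmSeq l m n) ξ (ldRes l m n) z 0 = 0 ∧
      z = (wordMap f (cmSeq l m n) ξ n)^[k - 1]
      (wordMap f (rotSeq l m n) ξ np (wordMap f (cmSeq l m n) ξ n z)) := by
  have hn : 0 < n := by omega
  have he := ldRes_lt (l := l) (m := m) hn
  obtain ⟨x, hx, -, h0⟩ := hb
  rw [hx.eq_of_modEq (h.collision_index hc hk _)] at h0
  have hlev : levelK n np k = np + (k - 1) * n + n := by
    obtain ⟨c, rfl⟩ := Nat.exists_eq_add_of_le hk
    simp [levelK]; ring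
  have hG : ∀ i < levelK n np k, seqG l m n mp np k (0 : ℕ) (i : ℕ) = rotSeq l m n i := by
    intro i hi
    rw [h.seqG_window hc hl hln (by omega) hi, zero_mul, if_neg (by omega)]
  have hz : x (np + (k - 1) * n : ℕ) = (wordMap f (cmSeq l m n) ξ n)^[k - 1]
      (wordMap f (rotSeq l m n) ξ np (x 0)) := by
    rw [← hx.wordMap_zero, wordMap_congr f ξ fun i hi => hG i (by omega),
      wordMap_rotSeq_tail f h hc]
  have hcm : ∀ i < n, shiftSeq (seqG l m n mp np k (0 : ℕ)) (np + (k - 1) * n : ℕ) (i : ℕ) =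
      cmSeq l m n i := by
    intro i hi
    rw [shiftSeq, ← Nat.cast_add, hG _ (by omega), ← shift_rotSeq_np h hc l (k - 1), Nat.cast_add]
    rfl
  have hstep : ∀ a ≤ n, wordMap f (cmSeq l m n) ξ a (x (np + (k - 1) * n : ℕ)) =
      x (np + (k - 1) * n + a : ℕ) := by
    intro a ha
    have := hx.wordMap_eq f (np + (k - 1) * n : ℕ) a
    rw [wordMap_congr f ξ fun i hi => hcm i (by omega)] at this
    rw [this]; push_cast; rfl
  refine ⟨x (np + (k - 1) * n : ℕ), ?_, ?_⟩
  · rw [hstep _ he.le]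
    have : (ldRes l m n : ℤ) + ((0 : ℕ) - 1) * n + levelK n np k =
        (np + (k - 1) * n + ldRes l m n : ℕ) := by
      rw [hlev]; push_cast; ring
    rw [← this, hx.1, h0]
  · have hx0 : x (levelK n np k) = x 0 := by
      have := hx.1 0
      rwa [zero_add] at this
    rw [hstep n le_rfl, ← hlev, hx0, hz]

end Collisions

/-! ### Eigenvectors from polygon edges, slopes in terms of `κ`, and the constant `a`. -/

section ShrinkingAlgebra

variable {N K : ℕ} [NeZero N] {f : PWLFamily N K} {l m n : ℕ} {ξ : ℝ × ℝ}

open Polynomial in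
/-- The characteristic polynomial of `M_S` at a shrinking point with `ρ_max < 1`. -/
theorem IsShrinkingPoint.exists_factor (h : IsShrinkingPoint f l m n ξ)
    (hρ : rhoMax f l m n ξ < 1) :
    ∃ q : ℝ[X], (wordMat f (rotSeq l m n) ξ n).charpoly = (X - C 1) * q ∧
      (∀ z ∈ (q.map (algebraMap ℝ ℂ)).roots, ‖z‖ < 1) ∧ q.eval 1 = cConst f l m n ξ ∧
      cConst f l m n ξ ≠ 0 := by
  have hroot : (wordMat f (rotSeq l m n) ξ n).charpoly.IsRoot 1 := by
    rw [IsRoot, eval_charpoly]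
    simpa using h.det_eq_zero
  obtain ⟨q, hq⟩ := dvd_iff_isRoot.2 hroot
  have hrest : restEigs f l m n ξ = (q.map (algebraMap ℝ ℂ)).roots := by
    rw [restEigs, eigs_eq_cons hq, Multiset.erase_cons_head]
  have hlt : ∀ z ∈ (q.map (algebraMap ℝ ℂ)).roots, ‖z‖ < 1 := by
    intro z hz
    rw [rhoMax, hrest] at hρ
    refine lt_of_le_of_lt ?_ hρ
    have := Multiset.le_sup (Multiset.mem_map_of_mem (fun z : ℂ => ‖z‖₊) hz)
    exact_mod_cast this
  have hc : q.eval 1 = cConst f l m n ξ := by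
    rw [cConst, hrest, prod_one_sub_roots hq, Complex.ofReal_re]
  refine ⟨q, hq, hlt, hc, ?_⟩
  rw [← hc]
  intro h0
  have hq0 : q.map (algebraMap ℝ ℂ) ≠ 0 := by
    refine (Polynomial.map_ne_zero_iff (algebraMap ℝ ℂ).injective).2 ?_
    rintro rfl
    exact (charpoly_monic (wordMat f (rotSeq l m n) ξ n)).ne_zero (by rw [hq, mul_zero])
  have h1 : (1 : ℂ) ∈ (q.map (algebraMap ℝ ℂ)).roots := by
    rw [mem_roots hq0, IsRoot, ← map_one (algebraMap ℝ ℂ), eval_map_apply, h0, map_zero]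
  simpa using hlt 1 h1

/-- The differences of consecutive vertices of the polygon of `S`-cycles are mapped to each
other. -/
theorem IsShrinkingPoint.wordMat_edge (h : IsShrinkingPoint f l m n ξ) (i : ℤ) (a : ℕ) :
    wordMat f (shiftSeq (rotSeq l m n) i) ξ a *ᵥ (cyclePt f (seqS0 l m n) n ξ (i + modInv m n) -
      cyclePt f (seqS0 l m n) n ξ i) = cyclePt f (seqS0 l m n) n ξ (i + modInv m n + a) -
      cyclePt f (seqS0 l m n) n ξ (i + a) := by
  have h1 := h.isCycle_shift.wordMap_eq f (i + modInv m n) a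
  rw [shiftSeq_shiftSeq, show -modInv m n + (i + modInv m n) = i by ring] at h1
  rw [← wordMap_sub, h1, h.isCycle_rotSeq.wordMap_eq]

theorem IsShrinkingPoint.tConst_of_zero (h : IsShrinkingPoint f l m n ξ) :
    tConst f l m n ξ 0 = 0 := by
  rw [h.tConst_eq_zero_iff]; simp

theorem IsShrinkingPoint.tConst_of_l (h : IsShrinkingPoint f l m n ξ) :
    tConst f l m n ξ l = 0 := by
  have h1 := h.1
  have h2 := h.2.1
  rw [h.tConst_eq_zero_iff, Int.emod_eq_of_lt (a := (l : ℤ)) (by omega) (by omega)]; simp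

theorem IsShrinkingPoint.tConst_neg_one_ne (h : IsShrinkingPoint f l m n ξ) :
    tConst f l m n ξ (-1) ≠ 0 := by
  have h1 := h.1
  have h2 := h.2.1
  refine h.tConst_ne_zero (i := n - 1) ?_ (by omega) (by omega)
  rw [← Int.add_emod_right, Int.emod_eq_of_lt] <;> omega

theorem IsShrinkingPoint.tConst_one_neg (h : IsShrinkingPoint f l m n ξ) :
    tConst f l m n ξ 1 < 0 := by
  have h1 := h.1
  exact h.tConst_neg (by omega) (by omega)

theorem IsShrinkingPoint.tConst_l_sub_one_neg (h : IsShrinkingPoint f l m n ξ) :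
    tConst f l m n ξ (l - 1) < 0 := by
  have h1 := h.1
  exact h.tConst_neg (by omega) (by omega)

theorem IsShrinkingPoint.tConst_l_add_one_ne (h : IsShrinkingPoint f l m n ξ) :
    tConst f l m n ξ (l + 1) ≠ 0 := by
  have h1 := h.1
  have h2 := h.2.1
  refine h.tConst_ne_zero (i := l + 1) ?_ (by omega) (by omega)
  rw [Int.emod_eq_of_lt] <;> omega

/-- A full period maps the edge `x_{(j+1)d} - x_{jd}` to itself, so the edge normalises to `v_{jd}`
when its first coordinate is nonzero. The characteristic polynomial is the same for all shifts,
hence so is the bordered determinant `c`; as `c ≠ 0`, both eigenvectors are unique up to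
normalisation. -/
theorem IsShrinkingPoint.eigenvectors (h : IsShrinkingPoint f l m n ξ)
    (hρ : rhoMax f l m n ξ < 1) (j : ℤ) (hj : tConst f l m n ξ (j + 1) ≠ tConst f l m n ξ j) :
    (1 - wordMat f (shiftSeq (rotSeq l m n) (j * modInv m n)) ξ n +
        vecMulVec (vVec f l m n ξ j) (Pi.single 0 1)).det = cConst f l m n ξ ∧
      wordMat f (shiftSeq (rotSeq l m n) (j * modInv m n)) ξ n *ᵥ vVec f l m n ξ j =
        vVec f l m n ξ j ∧ vVec f l m n ξ j 0 = 1 ∧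
      uVec f l m n ξ j ᵥ* wordMat f (shiftSeq (rotSeq l m n) (j * modInv m n)) ξ n =
        uVec f l m n ξ j ∧ uVec f l m n ξ j ⬝ᵥ vVec f l m n ξ j = 1 ∧
      (∀ w : Fin N → ℝ, w ᵥ* wordMat f (shiftSeq (rotSeq l m n) (j * modInv m n)) ξ n = w →
        w = (w ⬝ᵥ vVec f l m n ξ j) • uVec f l m n ξ j) ∧
      (tConst f l m n ξ (j + 1) - tConst f l m n ξ j) • vVec f l m n ξ j =
        cyclePt f (seqS0 l m n) n ξ ((j + 1) * modInv m n) -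
          cyclePt f (seqS0 l m n) n ξ (j * modInv m n) := by
  obtain ⟨q, hq, hroots, hqc, hc0⟩ := h.exists_factor hρ
  set M := wordMat f (shiftSeq (rotSeq l m n) (j * modInv m n)) ξ n with hM
  have hqM : M.charpoly = (Polynomial.X - Polynomial.C 1) * q := by
    rw [hM, charpoly_wordMat_shift f h.n_pos (rotSeq_add_period _ _ _), hq]
  set p := cyclePt f (seqS0 l m n) n ξ ((j + 1) * modInv m n) -
          cyclePt f (seqS0 l m n) n ξ (j * modInv m n) with hp
  have hMp : M *ᵥ p = p := by
    have := h.wordMat_edge (j * modInv m n) n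
    rw [h.isCycle_seqS0.1, h.isCycle_seqS0.1] at this
    rwa [show j * modInv m n + modInv m n = (j + 1) * modInv m n by ring] at this
  have hp0 : p 0 = tConst f l m n ξ (j + 1) - tConst f l m n ξ j := rfl
  have hne : p 0 ≠ 0 := by rw [hp0]; exact sub_ne_zero.2 hj
  have hv' : M *ᵥ ((p 0)⁻¹ • p) = (p 0)⁻¹ • p := by rw [mulVec_smul, hMp]
  have hv0' : ((p 0)⁻¹ • p) 0 = 1 := by simp [hne]
  have hdet' := det_bordered hqM hv' hv0'
  have hT' : ((1 : ℝ) • (1 : Matrix (Fin N) (Fin N) ℝ) - M +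
      vecMulVec ((p 0)⁻¹ • p) (Pi.single 0 1)).det ≠ 0 := by
    rw [one_smul, hdet', hqc]; exact hc0
  have hex : ∃ v : Fin N → ℝ, v ≠ 0 ∧ M *ᵥ v = (1 : ℝ) • v :=
    ⟨p, fun h0 => hne (by rw [h0]; rfl), by rw [one_smul, hMp]⟩
  obtain ⟨hr1, hr0⟩ := rightEig_spec hT' hex
  have hvv : vVec f l m n ξ j = (p 0)⁻¹ • p := by
    rw [eq_bordered_inv hT' (v := (p 0)⁻¹ • p) (by rw [hv', one_smul]) hv0']
    exact eq_bordered_inv hT' hr1 hr0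
  have hpr : (p 0)⁻¹ • p = rightEig M 1 := hvv.symm
  obtain ⟨hl1, hl0⟩ := leftEig_spec hpr hT' hex
  rw [hvv]
  refine ⟨by rw [hdet', hqc], hv', hv0', ?_, hl0, ?_, ?_⟩
  · rw [one_smul] at hl1; exact hl1
  · intro w hw
    exact left_eq_smul_leftEig hpr hT' hex (by rw [hw, one_smul])
  · rw [← hp0, smul_smul, mul_inv_cancel₀ hne, one_smul]


/-- The normalised eigenvectors of the centre matrix `M_{S^{(-d)}}`. -/
theorem IsShrinkingPoint.centre_eigenvectors (h : IsShrinkingPoint f l m n ξ)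
    (hρ : rhoMax f l m n ξ < 1) :
    (1 - wordMat f (cmSeq l m n) ξ n +
        vecMulVec (vVec f l m n ξ (-1)) (Pi.single 0 1)).det = cConst f l m n ξ ∧
      wordMat f (cmSeq l m n) ξ n *ᵥ vVec f l m n ξ (-1) = vVec f l m n ξ (-1) ∧
      vVec f l m n ξ (-1) 0 = 1 ∧
      uVec f l m n ξ (-1) ᵥ* wordMat f (cmSeq l m n) ξ n = uVec f l m n ξ (-1) ∧
      uVec f l m n ξ (-1) ⬝ᵥ vVec f l m n ξ (-1) = 1 ∧
      -tConst f l m n ξ (-1) • vVec f l m n ξ (-1) =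
        cyclePt f (seqS0 l m n) n ξ 0 - cyclePt f (seqS0 l m n) n ξ (-modInv m n) := by
  have h1 := h.eigenvectors hρ (-1) (by
    rw [neg_add_cancel, h.tConst_of_zero]; exact h.tConst_neg_one_ne.symm)
  rw [neg_add_cancel, h.tConst_of_zero, zero_sub, zero_mul, neg_one_mul] at h1
  exact ⟨h1.1, h1.2.1, h1.2.2.1, h1.2.2.2.1, h1.2.2.2.2.1, h1.2.2.2.2.2.2⟩

theorem IsShrinkingPoint.start_eigenvectors (h : IsShrinkingPoint f l m n ξ)
    (hρ : rhoMax f l m n ξ < 1) :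
    uVec f l m n ξ 0 ᵥ* wordMat f (rotSeq l m n) ξ n = uVec f l m n ξ 0 ∧
      uVec f l m n ξ 0 ⬝ᵥ vVec f l m n ξ 0 = 1 ∧
      (∀ w : Fin N → ℝ, w ᵥ* wordMat f (rotSeq l m n) ξ n = w →
        w = (w ⬝ᵥ vVec f l m n ξ 0) • uVec f l m n ξ 0) ∧
      tConst f l m n ξ 1 • vVec f l m n ξ 0 =
        cyclePt f (seqS0 l m n) n ξ (modInv m n) - cyclePt f (seqS0 l m n) n ξ 0 := by
  have h1 := h.eigenvectors hρ 0 (by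
    rw [zero_add, h.tConst_of_zero]; exact h.tConst_one_neg.ne)
  rw [zero_add, h.tConst_of_zero, sub_zero, zero_mul, one_mul, shiftSeq_zero] at h1
  exact ⟨h1.2.2.2.1, h1.2.2.2.2.1, h1.2.2.2.2.2.1, h1.2.2.2.2.2.2⟩

variable {mm nm mp np : ℕ}

theorem IsShrinkingPoint.cyclePt_np (h : IsShrinkingPoint f l m n ξ)
    (hF : IsFareyRoots m n mm nm mp np) (i : ℤ) :
    cyclePt f (seqS0 l m n) n ξ (i + np) = cyclePt f (seqS0 l m n) n ξ (i - modInv m n) :=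
  h.isCycle_seqS0.eq_of_modEq ((hF.np_modEq h.coprime).add_left i)

/-- The link intertwines `M_S` with `M_{S^{(-d)}}`, so it pulls `u_{-d}` back to a multiple of
`u_0`. The factor is read off from the edge at `x_0`, which the link carries to the negative of the
edge from `x_{-d}` to `x_0`, rescaled by first coordinates as `t_d v_0 ↦ -t_{-d} v_{-d}`. -/
theorem IsShrinkingPoint.left_link (h : IsShrinkingPoint f l m n ξ)
    (hρ : rhoMax f l m n ξ < 1) (hF : IsFareyRoots m n mm nm mp np) :
    uVec f l m n ξ (-1) ᵥ* wordMat f (rotSeq l m n) ξ np =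
      (-(tConst f l m n ξ (-1) / tConst f l m n ξ 1)) • uVec f l m n ξ 0 := by
  obtain ⟨-, hv, hv0, hu, huv, hedge⟩ := h.centre_eigenvectors hρ
  obtain ⟨-, -, huniq, hedge0⟩ := h.start_eigenvectors hρ
  have ht1 := h.tConst_one_neg.ne
  have hX : tConst f l m n ξ 1 • (wordMat f (rotSeq l m n) ξ np *ᵥ vVec f l m n ξ 0) =
      -tConst f l m n ξ (-1) • vVec f l m n ξ (-1) := by
    have := h.wordMat_edge 0 np
    rw [shiftSeq_zero, zero_add, h.cyclePt_np hF, h.cyclePt_np hF, sub_self, zero_sub,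
      ← hedge0, ← hedge, mulVec_smul] at this
    exact this
  rw [huniq (uVec f l m n ξ (-1) ᵥ* wordMat f (rotSeq l m n) ξ np) ?_]
  · congr 1
    rw [← dotProduct_mulVec]
    have := congrArg (fun w => uVec f l m n ξ (-1) ⬝ᵥ w) hX
    simp only [dotProduct_smul, huv, smul_eq_mul, mul_one] at this
    field_simp
    linarith
  · rw [vecMul_vecMul, ← link_comm f hF h.coprime, ← vecMul_vecMul, hu]

theorem IsShrinkingPoint.slope_nat (h : IsShrinkingPoint f l m n ξ)
    (hρ : rhoMax f l m n ξ < 1) (hF : IsFareyRoots m n mm nm mp np) (j : ℕ) :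
    uVec f l m n ξ (-1) ⬝ᵥ ((wordMat f (rotSeq l m n) ξ np * wordMat f (seqSld l m n) ξ n ^ j) *ᵥ
      vVec f l m n ξ (-1)) =
      -(tConst f l m n ξ (-1) / tConst f l m n ξ 1) * kappaPlus f l m n ξ j := by
  rw [← mulVec_mulVec, dotProduct_mulVec, h.left_link hρ hF, smul_dotProduct, smul_eq_mul,
    kappaPlus, if_neg (by omega), Int.toNat_natCast]

/-- The turn of `S` flipped at `0` is cut at position `ℓd`. Before the cut it follows `S^{(-d)}` and
carries `v_{-d}` to a multiple of `v_{(ℓ-1)d}`. After the cut it follows `S^{(ℓd)}` and pulls `u_0`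
back to a multiple of `u_{ℓd}`. What remains is `u_{ℓd}·v_{(ℓ-1)d} = κ_{-1}`. -/
theorem IsShrinkingPoint.slope_neg_one (h : IsShrinkingPoint f l m n ξ)
    (hρ : rhoMax f l m n ξ < 1) (hF : IsFareyRoots m n mm nm mp np) :
    uVec f l m n ξ (-1) ⬝ᵥ ((wordMat f (rotSeq l m n) ξ np * wordMat f (seqS0 l m n) ξ n) *ᵥ
      vVec f l m n ξ (-1)) =
      -(tConst f l m n ξ (l - 1) / tConst f l m n ξ (l + 1)) * kappaPlus f l m n ξ (-1) := by
  have h1 := h.1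
  have h2 := h.2.1
  have hn := h.n_pos
  obtain ⟨-, hv, hv0, hu, huv, hedge⟩ := h.centre_eigenvectors hρ
  obtain ⟨hu0, huv0, huniq, hedge0⟩ := h.start_eigenvectors hρ
  have ht1 := h.tConst_one_neg.ne
  have htn := h.tConst_neg_one_ne
  have htl := h.tConst_l_add_one_ne
  have htl' := h.tConst_l_sub_one_neg.ne
  obtain ⟨-, -, -, hul, hulv, huniql, hedgel⟩ := h.eigenvectors hρ l (by rwa [h.tConst_of_l])
  obtain ⟨-, -, -, -, -, -, hedgel'⟩ := h.eigenvectors hρ (l - 1) (by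
    rw [sub_add_cancel, h.tConst_of_l]; exact htl'.symm)
  rw [sub_add_cancel, h.tConst_of_l, zero_sub] at hedgel'
  rw [h.tConst_of_l, sub_zero] at hedgel
  set e := ldRes l m n with he
  have hen : e < n := ldRes_lt hn
  have hemod := ldRes_modEq (l := l) (m := m) hn
  rw [← he] at hemod
  obtain ⟨b, hb⟩ := Nat.exists_eq_add_of_lt hen
  have hsplit : n = e + (b + 1) := by omega
  have hxe : ∀ i : ℤ, cyclePt f (seqS0 l m n) n ξ (i + e) =
      cyclePt f (seqS0 l m n) n ξ (i + l * modInv m n) := fun i =>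
    h.isCycle_seqS0.eq_of_modEq (hemod.add_left i)
  have hY : wordMat f (seqS0 l m n) ξ e = wordMat f (cmSeq l m n) ξ e :=
    wordMat_congr f ξ fun i hi => (cmSeq_eq_seqS0 h.coprime (by omega) (by omega) (by omega)
      (by omega)).symm
  have hZ : wordMat f (shiftSeq (seqS0 l m n) e) ξ (b + 1) =
      wordMat f (shiftSeq (rotSeq l m n) (l * modInv m n)) ξ (b + 1) := by
    rw [← shiftSeq_congr_modEq (rotSeq_add_period l m n) hemod]
    refine wordMat_congr f ξ fun i hi => ?_
    rw [shiftSeq, shiftSeq, ← Nat.cast_add, seqS0_of_not]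
    rw [natCast_modEq_zero_iff (by omega)]
    have := ldRes_pos h.coprime (show 0 < l by omega) (show l < n by omega)
    omega
  have hYv : tConst f l m n ξ (-1) • (wordMat f (cmSeq l m n) ξ e *ᵥ vVec f l m n ξ (-1)) =
      tConst f l m n ξ (l - 1) • vVec f l m n ξ (l - 1) := by
    have := h.wordMat_edge (-modInv m n) e
    rw [neg_add_cancel, ← hedge, mulVec_smul, hxe, hxe, zero_add,
      show -modInv m n + l * modInv m n = (l - 1) * modInv m n by ring, ← hedgel'] at this
    rw [neg_smul, neg_smul, neg_inj] at this
    exact this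
  have hZv : tConst f l m n ξ (l + 1) •
      (wordMat f (shiftSeq (rotSeq l m n) (l * modInv m n)) ξ (b + 1) *ᵥ vVec f l m n ξ l) =
      tConst f l m n ξ 1 • vVec f l m n ξ 0 := by
    have := h.wordMat_edge (l * modInv m n) (b + 1)
    rw [show (l : ℤ) * modInv m n + modInv m n = (l + 1) * modInv m n by ring, ← hedgel,
      mulVec_smul] at this
    rw [this, hedge0]
    have hm : (l : ℤ) * modInv m n + (b + 1 : ℕ) ≡ 0 [ZMOD n] := by
      have := hemod.symm.add_right (b + 1 : ℕ)
      rw [← Nat.cast_add, ← hsplit] at this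
      exact this.trans (by simp [Int.ModEq])
    have hm2 : ((l : ℤ) + 1) * modInv m n + (b + 1 : ℕ) ≡ modInv m n [ZMOD n] := by
      have := hm.add_left (modInv m n)
      rw [add_zero] at this
      rwa [show ((l : ℤ) + 1) * modInv m n + (b + 1 : ℕ) =
        modInv m n + (l * modInv m n + (b + 1 : ℕ)) by ring]
    rw [h.isCycle_seqS0.eq_of_modEq hm, h.isCycle_seqS0.eq_of_modEq hm2]
  have hcomm : wordMat f (rotSeq l m n) ξ n *
      wordMat f (shiftSeq (rotSeq l m n) (l * modInv m n)) ξ (b + 1) =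
      wordMat f (shiftSeq (rotSeq l m n) (l * modInv m n)) ξ (b + 1) *
      wordMat f (shiftSeq (rotSeq l m n) (l * modInv m n)) ξ n := by
    rw [← shiftSeq_congr_modEq (rotSeq_add_period l m n) hemod]
    have e1 := wordMat_add f (shiftSeq (rotSeq l m n) e) ξ (b + 1) n
    have e2 := wordMat_add f (shiftSeq (rotSeq l m n) e) ξ n (b + 1)
    have h3 : shiftSeq (rotSeq l m n) (n : ℤ) = rotSeq l m n := by
      have := rotSeq_block n (rotSeq_add_period l m n) 1
      rwa [one_mul] at this
    rw [shiftSeq_shiftSeq, ← Nat.cast_add, ← hsplit, h3] at e1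
    have h4 : shiftSeq (shiftSeq (rotSeq l m n) e) n = shiftSeq (rotSeq l m n) e := by
      rw [shiftSeq_shiftSeq, shiftSeq_add_period (rotSeq_add_period l m n)]
    rw [h4, add_comm n, e1] at e2
    exact e2
  have huZ : uVec f l m n ξ 0 ᵥ*
      wordMat f (shiftSeq (rotSeq l m n) (l * modInv m n)) ξ (b + 1) =
      (tConst f l m n ξ 1 / tConst f l m n ξ (l + 1)) • uVec f l m n ξ l := by
    rw [huniql (uVec f l m n ξ 0 ᵥ*
      wordMat f (shiftSeq (rotSeq l m n) (l * modInv m n)) ξ (b + 1)) ?_]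
    · congr 1
      rw [← dotProduct_mulVec]
      have := congrArg (fun w => uVec f l m n ξ 0 ⬝ᵥ w) hZv
      simp only [dotProduct_smul, huv0, smul_eq_mul, mul_one] at this
      field_simp
      linarith
    · rw [vecMul_vecMul, ← hcomm, ← vecMul_vecMul, hu0]
  have hYv' : wordMat f (cmSeq l m n) ξ e *ᵥ vVec f l m n ξ (-1) =
      (tConst f l m n ξ (l - 1) / tConst f l m n ξ (-1)) • vVec f l m n ξ (l - 1) := by
    rw [div_eq_inv_mul, ← smul_smul, ← hYv, smul_smul, inv_mul_cancel₀ htn, one_smul]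
  have hM : wordMat f (seqS0 l m n) ξ n =
      wordMat f (shiftSeq (rotSeq l m n) (l * modInv m n)) ξ (b + 1) *
        wordMat f (cmSeq l m n) ξ e := by
    have := wordMat_add f (seqS0 l m n) ξ e (b + 1)
    rw [← hsplit] at this
    rw [this, hZ, hY]
  rw [← mulVec_mulVec, dotProduct_mulVec, h.left_link hρ hF, hM, smul_dotProduct,
    ← mulVec_mulVec, dotProduct_mulVec, huZ, hYv', smul_dotProduct, dotProduct_smul, kappaPlus,
    if_pos (by omega)]
  simp only [smul_eq_mul, neg_neg, sub_self, Int.toNat_zero, pow_zero, one_mulVec]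
  field_simp


/-- The image of the jump vector under the letters of `S` with indices `i + 1, …, i + b`. -/
def flipVec (f : PWLFamily N K) (S : ℤ → Side) (ξ : ℝ × ℝ) (i b : ℕ) : Fin N → ℝ :=
  wordMat f (shiftSeq S (i + 1)) ξ b *ᵥ jumpVec f ξ

/-- The representative in `[0, n)` of `d`. -/
def invRes (m n : ℕ) : ℕ := ((m : ZMod n)⁻¹).val

theorem invRes_cast (m n : ℕ) : (invRes m n : ℤ) = modInv m n := rfl

theorem invRes_lt (hn : 0 < n) : invRes m n < n := by
  have : NeZero n := ⟨hn.ne'⟩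
  exact ZMod.val_lt _

theorem cmSeq_invRes (hn : 0 < n) (hl : 0 < l) :
    (∀ i : ℕ, i < n → i ≠ invRes m n → cmSeq l m n i = shiftSeq (seqS0 l m n) (-modInv m n) i) ∧
    cmSeq l m n (invRes m n) = Side.L ∧
      shiftSeq (seqS0 l m n) (-modInv m n) (invRes m n) = Side.R := by
  have h0 := seqS0_of_modEq (l := l) (m := m) (n := n) (i := 0) (by omega) (by rfl)
  refine ⟨fun i hi hne => ?_, ?_, ?_⟩
  · rw [shiftSeq, seqS0_of_not]; · rfl
    intro hc
    apply hne
    have h1 : (i : ℤ) ≡ invRes m n [ZMOD n] := by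
      have := hc.add_left (modInv m n)
      rwa [add_zero, add_neg_cancel_left] at this
    rw [Int.natCast_modEq_iff] at h1
    exact h1.eq_of_lt_of_lt hi (invRes_lt hn)
  · rw [cmSeq, shiftSeq, invRes_cast, neg_add_cancel]; exact h0.1
  · rw [shiftSeq, invRes_cast, neg_add_cancel]; exact h0.2

/-- `S^{(-d)}` differs from `S` flipped at `0` only at the letter `ℓd`. The orbit of `x_0` has first
coordinate `ν` there, so the displacement of this moving point is known exactly. -/
theorem wordMap_cmSeq_start (hc : Nat.Coprime m n) (hl : 0 < l) (hln : l < n)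
    (hdet : (1 - wordMat f (seqS0 l m n) ξ n).det ≠ 0) :
    wordMap f (cmSeq l m n) ξ n (cyclePt f (seqS0 l m n) n ξ 0) = cyclePt f (seqS0 l m n) n ξ 0 -
      (coordEN f l m n ξ).2 •
        flipVec f (cmSeq l m n) ξ (ldRes l m n) (n - ldRes l m n - 1) := by
  have hn : 0 < n := by omega
  have he := ldRes_lt (l := l) (m := m) hn
  obtain ⟨hL, hR⟩ := cmSeq_ldRes hc hl hln
  have hX := isCycle_cyclePt f hn (seqS0_add_period l m n) hdet
  have := wordMap_flip f ξ (S := cmSeq l m n) (T := seqS0 l m n) (i := ldRes l m n)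
    (b := n - ldRes l m n - 1)
    (fun j hj => cmSeq_eq_seqS0 hc hl hln (by omega) (by omega)) hL hR
    (fun j hj hj' => cmSeq_eq_seqS0 hc hl hln (by omega) (by omega))
    (cyclePt f (seqS0 l m n) n ξ 0)
  rw [show ldRes l m n + 1 + (n - ldRes l m n - 1) = n by omega, hX.wordMap_zero, hX.wordMap_zero,
    hX.eq_of_modEq (ldRes_modEq hn),
    hX.eq_of_modEq (show (n : ℤ) ≡ 0 [ZMOD n] by simp [Int.ModEq])] at this
  exact this

/-- The same comparison started at `x_{-d}`: the only different letter is at step `d`, where the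
orbit is at `x_0` and `s = η`. -/
theorem wordMap_cmSeq_neg (hl : 0 < l) (hln : l < n)
    (hdet : (1 - wordMat f (seqS0 l m n) ξ n).det ≠ 0) :
    wordMap f (cmSeq l m n) ξ n (cyclePt f (seqS0 l m n) n ξ (-modInv m n)) =
      cyclePt f (seqS0 l m n) n ξ (-modInv m n) - (coordEN f l m n ξ).1 •
        flipVec f (cmSeq l m n) ξ (invRes m n) (n - invRes m n - 1) := by
  have hn : 0 < n := by omega
  have he := invRes_lt (m := m) hn
  obtain ⟨heq, hL, hR⟩ := cmSeq_invRes (m := m) hn hl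
  have hX := isCycle_cyclePt f hn (seqS0_add_period l m n) hdet
  have := wordMap_flip f ξ (S := cmSeq l m n) (T := shiftSeq (seqS0 l m n) (-modInv m n))
    (i := invRes m n) (b := n - invRes m n - 1)
    (fun j hj => heq j (by omega) (by omega)) hL hR
    (fun j hj hj' => heq j (by omega) (by omega))
    (cyclePt f (seqS0 l m n) n ξ (-modInv m n))
  rw [show invRes m n + 1 + (n - invRes m n - 1) = n by omega, hX.wordMap_eq, hX.wordMap_eq,
    invRes_cast, neg_add_cancel, hX.1] at this
  exact this

/-- The flip at `ℓd` is a rank-one perturbation of the centre matrix. Its determinant formula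
expresses `u_{-d}·flipVec`, the coefficient of `ν` in the displacement, through `a`, `c` and the
`t`'s. -/
theorem IsShrinkingPoint.aConst_eq_start (h : IsShrinkingPoint f l m n ξ)
    (hρ : rhoMax f l m n ξ < 1) :
    aConst f l m n ξ = -(cConst f l m n ξ *
      (tConst f l m n ξ (l - 1) / tConst f l m n ξ (-1)) *
      (uVec f l m n ξ (-1) ⬝ᵥ
        flipVec f (cmSeq l m n) ξ (ldRes l m n) (n - ldRes l m n - 1))) := by
  have h1 := h.1
  have h2 := h.2.1
  have hn := h.n_pos
  have he := ldRes_lt (l := l) (m := m) hn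
  obtain ⟨hT, hv, hv0, hu, huv, hedge⟩ := h.centre_eigenvectors hρ
  obtain ⟨q, -, -, -, hc0⟩ := h.exists_factor hρ
  obtain ⟨hL, hR⟩ := cmSeq_ldRes h.coprime (show 0 < l by omega) (show l < n by omega)
  have hM := wordMat_flip f ξ (S := cmSeq l m n) (T := seqS0 l m n) (i := ldRes l m n)
    (b := n - ldRes l m n - 1)
    (fun j hj => cmSeq_eq_seqS0 h.coprime (by omega) (by omega) (by omega) (by omega)) hL hR
    (fun j hj hj' => cmSeq_eq_seqS0 h.coprime (by omega) (by omega) (by omega) (by omega))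
  rw [show ldRes l m n + 1 + (n - ldRes l m n - 1) = n by omega] at hM
  have hz : (Pi.single 0 1 ᵥ* wordMat f (cmSeq l m n) ξ (ldRes l m n)) ⬝ᵥ vVec f l m n ξ (-1) =
      tConst f l m n ξ (l - 1) / tConst f l m n ξ (-1) := by
    have := h.wordMat_edge (-modInv m n) (ldRes l m n)
    rw [neg_add_cancel, ← hedge, mulVec_smul, zero_add, h.isCycle_seqS0.eq_of_modEq (ldRes_modEq hn),
      h.isCycle_seqS0.eq_of_modEq ((ldRes_modEq hn).add_left (-modInv m n)),
      show -modInv m n + l * modInv m n = (l - 1) * modInv m n by ring] at this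
    have h3 := congrFun this 0
    have h4 : cyclePt f (seqS0 l m n) n ξ (l * modInv m n) 0 = 0 := h.tConst_of_l
    have h5 : cyclePt f (seqS0 l m n) n ξ ((l - 1) * modInv m n) 0 = tConst f l m n ξ (l - 1) := rfl
    rw [Pi.sub_apply, h4, h5, Pi.smul_apply, smul_eq_mul] at h3
    rw [← dotProduct_mulVec, single_dotProduct, one_mul, eq_div_iff h.tConst_neg_one_ne]
    change (wordMat f (cmSeq l m n) ξ (ldRes l m n) *ᵥ vVec f l m n ξ (-1)) 0 * _ = _
    have h6 : (wordMat f (cmSeq l m n) ξ (ldRes l m n) *ᵥ vVec f l m n ξ (-1)) 0 =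
      (wordMat f (shiftSeq (rotSeq l m n) (-modInv m n)) ξ (ldRes l m n) *ᵥ
        vVec f l m n ξ (-1)) 0 := rfl
    rw [h6]; linarith
  rw [aConst, hM, det_one_sub_rankOne hv hv0 hu huv hc0 hT, hz]
  rfl

/-- The same determinant is computed from the shifted word, which differs from `S^{(-d)}` at step
`d`. This evaluates the coefficient of `η`. -/
theorem IsShrinkingPoint.aConst_eq_neg (h : IsShrinkingPoint f l m n ξ)
    (hρ : rhoMax f l m n ξ < 1) :
    aConst f l m n ξ = cConst f l m n ξ *
      (tConst f l m n ξ 1 / tConst f l m n ξ (-1)) *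
      (uVec f l m n ξ (-1) ⬝ᵥ
        flipVec f (cmSeq l m n) ξ (invRes m n) (n - invRes m n - 1)) := by
  have h1 := h.1
  have h2 := h.2.1
  have hn := h.n_pos
  have he := invRes_lt (m := m) hn
  obtain ⟨hT, hv, hv0, hu, huv, hedge⟩ := h.centre_eigenvectors hρ
  obtain ⟨q, -, -, -, hc0⟩ := h.exists_factor hρ
  obtain ⟨heq, hL, hR⟩ := cmSeq_invRes (m := m) hn (show 0 < l by omega)
  have hM := wordMat_flip f ξ (S := cmSeq l m n) (T := shiftSeq (seqS0 l m n) (-modInv m n))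
    (i := invRes m n) (b := n - invRes m n - 1)
    (fun j hj => heq j (by omega) (by omega)) hL hR
    (fun j hj hj' => heq j (by omega) (by omega))
  rw [show invRes m n + 1 + (n - invRes m n - 1) = n by omega] at hM
  have hz : (Pi.single 0 1 ᵥ* wordMat f (cmSeq l m n) ξ (invRes m n)) ⬝ᵥ vVec f l m n ξ (-1) =
      -(tConst f l m n ξ 1 / tConst f l m n ξ (-1)) := by
    have := h.wordMat_edge (-modInv m n) (invRes m n)
    rw [neg_add_cancel, ← hedge, mulVec_smul, zero_add, invRes_cast, neg_add_cancel] at this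
    have h3 := congrFun this 0
    have h4 : cyclePt f (seqS0 l m n) n ξ 0 0 = 0 := by
      have := h.tConst_of_zero
      rwa [tConst, zero_mul] at this
    have h5 : cyclePt f (seqS0 l m n) n ξ (modInv m n) 0 = tConst f l m n ξ 1 := by
      rw [tConst, one_mul]
    rw [Pi.sub_apply, h4, h5, Pi.smul_apply, smul_eq_mul] at h3
    rw [← dotProduct_mulVec, single_dotProduct, one_mul, ← neg_div,
      eq_div_iff h.tConst_neg_one_ne]
    have h6 : (wordMat f (cmSeq l m n) ξ (invRes m n) *ᵥ vVec f l m n ξ (-1)) 0 =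
      (wordMat f (shiftSeq (rotSeq l m n) (-modInv m n)) ξ (invRes m n) *ᵥ
        vVec f l m n ξ (-1)) 0 := rfl
    rw [h6]; linarith
  rw [aConst, ← det_one_sub_eq_of_charpoly
    (charpoly_wordMat_shift f hn (seqS0_add_period l m n) ξ (-modInv m n)), hM,
    det_one_sub_rankOne hv hv0 hu huv hc0 hT, hz]
  rw [mul_neg, neg_mul, neg_neg]
  rfl

end ShrinkingAlgebra

/-! ### Differentiability of matrix and vector functions at a point. -/

section Regularity

variable {N : ℕ} {E : Type*} [NormedAddCommGroup E] [NormedSpace ℝ E] {ξ₀ : E}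

/-- Entrywise differentiability at a point of a matrix-valued function. -/
def MatDiffAt (A : E → Matrix (Fin N) (Fin N) ℝ) (ξ₀ : E) : Prop :=
  ∀ i j, DifferentiableAt ℝ (fun ξ => A ξ i j) ξ₀

theorem differentiableAt_entry {v : E → Fin N → ℝ} (hv : DifferentiableAt ℝ v ξ₀) (i : Fin N) :
    DifferentiableAt ℝ (fun ξ => v ξ i) ξ₀ :=
  differentiableAt_pi.1 hv i

theorem differentiableAt_dotProduct {v w : E → Fin N → ℝ} (hv : DifferentiableAt ℝ v ξ₀)
    (hw : DifferentiableAt ℝ w ξ₀) : DifferentiableAt ℝ (fun ξ => v ξ ⬝ᵥ w ξ) ξ₀ := by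
  simp only [dotProduct]
  exact DifferentiableAt.fun_sum fun i _ =>
    (differentiableAt_entry hv i).mul (differentiableAt_entry hw i)

variable {A B : E → Matrix (Fin N) (Fin N) ℝ}

theorem matDiffAt_const (M : Matrix (Fin N) (Fin N) ℝ) : MatDiffAt (fun _ : E => M) ξ₀ :=
  fun _ _ => differentiableAt_const _

theorem MatDiffAt.add (hA : MatDiffAt A ξ₀) (hB : MatDiffAt B ξ₀) :
    MatDiffAt (fun ξ => A ξ + B ξ) ξ₀ := fun i j => (hA i j).add (hB i j)

theorem MatDiffAt.sub (hA : MatDiffAt A ξ₀) (hB : MatDiffAt B ξ₀) :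
    MatDiffAt (fun ξ => A ξ - B ξ) ξ₀ := fun i j => (hA i j).sub (hB i j)

theorem MatDiffAt.smul {c : E → ℝ} (hc : DifferentiableAt ℝ c ξ₀) (hA : MatDiffAt A ξ₀) :
    MatDiffAt (fun ξ => c ξ • A ξ) ξ₀ := fun i j => hc.mul (hA i j)

theorem MatDiffAt.mul (hA : MatDiffAt A ξ₀) (hB : MatDiffAt B ξ₀) :
    MatDiffAt (fun ξ => A ξ * B ξ) ξ₀ := by
  intro i j
  simp only [Matrix.mul_apply]
  exact DifferentiableAt.fun_sum fun k _ => (hA i k).mul (hB k j)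

theorem MatDiffAt.pow (hA : MatDiffAt A ξ₀) (k : ℕ) : MatDiffAt (fun ξ => A ξ ^ k) ξ₀ := by
  induction k with
  | zero => simpa using matDiffAt_const 1
  | succ k ih => simpa only [pow_succ] using ih.mul hA

theorem MatDiffAt.mulVec (hA : MatDiffAt A ξ₀) {v : E → Fin N → ℝ}
    (hv : DifferentiableAt ℝ v ξ₀) : DifferentiableAt ℝ (fun ξ => A ξ *ᵥ v ξ) ξ₀ := by
  refine differentiableAt_pi.2 fun i => ?_
  exact differentiableAt_dotProduct (v := fun ξ => A ξ i) (differentiableAt_pi.2 (hA i)) hv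

theorem MatDiffAt.vecMul (hA : MatDiffAt A ξ₀) {v : E → Fin N → ℝ}
    (hv : DifferentiableAt ℝ v ξ₀) : DifferentiableAt ℝ (fun ξ => v ξ ᵥ* A ξ) ξ₀ := by
  refine differentiableAt_pi.2 fun i => ?_
  exact differentiableAt_dotProduct hv (w := fun ξ j => A ξ j i)
    (differentiableAt_pi.2 fun j => hA j i)

theorem matDiffAt_vecMulVec {v w : E → Fin N → ℝ} (hv : DifferentiableAt ℝ v ξ₀)
    (hw : DifferentiableAt ℝ w ξ₀) : MatDiffAt (fun ξ => vecMulVec (v ξ) (w ξ)) ξ₀ := by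
  intro i j
  simp only [vecMulVec_apply]
  exact (differentiableAt_entry hv i).mul (differentiableAt_entry hw j)

theorem MatDiffAt.det (hA : MatDiffAt A ξ₀) : DifferentiableAt ℝ (fun ξ => (A ξ).det) ξ₀ := by
  simp only [Matrix.det_apply]
  refine DifferentiableAt.fun_sum fun σ _ => ?_
  refine DifferentiableAt.const_smul ?_ _
  classical
  refine Finset.induction_on (motive := fun s : Finset (Fin N) =>
    DifferentiableAt ℝ (fun ξ => ∏ i ∈ s, A ξ (σ i) i) ξ₀) Finset.univ
    (by simp) fun a s has ih => ?_
  simp only [Finset.prod_insert has]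
  exact (hA _ _).mul ih

theorem MatDiffAt.inv (hA : MatDiffAt A ξ₀) (h0 : (A ξ₀).det ≠ 0) :
    MatDiffAt (fun ξ => (A ξ)⁻¹) ξ₀ := by
  have hadj : MatDiffAt (fun ξ => (A ξ).adjugate) ξ₀ := by
    intro i j
    simp only [adjugate_apply]
    refine MatDiffAt.det (A := fun ξ => (A ξ).updateRow j (Pi.single i 1)) fun a b => ?_
    simp only [updateRow_apply]
    split_ifs
    · exact differentiableAt_const _
    · exact hA a b
  intro i j
  simp only [Matrix.inv_def, Ring.inverse_eq_inv']
  exact (hA.det.inv h0).mul (hadj i j)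

theorem MatDiffAt.tendsto (hA : MatDiffAt A ξ₀) (i j : Fin N) :
    Tendsto (fun ξ => A ξ i j) (𝓝 ξ₀) (𝓝 (A ξ₀ i j)) := (hA i j).continuousAt

end Regularity

/-! ### Differentiability of words, cycle points and jump images in the parameter. -/

section FamilyRegularity

variable {N K : ℕ} [NeZero N] (f : PWLFamily N K)

theorem contDiff_sideMat (σ : Side) (i j : Fin N) : ContDiff ℝ K (fun ξ => sideMat f ξ σ i j) := by
  cases σ
  · exact f.smooth_AL i j
  · exact f.smooth_AR i j

theorem contDiff_wordMat (S : ℤ → Side) (n : ℕ) (i j : Fin N) :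
    ContDiff ℝ K (fun ξ => wordMat f S ξ n i j) := by
  induction n generalizing i j with
  | zero => simp only [wordMat]; exact contDiff_const
  | succ n ih =>
    simp only [wordMat, Matrix.mul_apply]
    exact ContDiff.sum fun k _ => (contDiff_sideMat f _ i k).mul (ih k j)

variable (hK : 1 ≤ K)
include hK

theorem one_le_cast : (K : WithTop ℕ∞) ≠ 0 := by
  simp; omega

theorem matDiffAt_wordMat (S : ℤ → Side) (n : ℕ) (ξ₀ : ℝ × ℝ) :
    MatDiffAt (fun ξ => wordMat f S ξ n) ξ₀ :=
  fun i j => ((contDiff_wordMat f S n i j).differentiable (one_le_cast hK)) ξ₀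

theorem differentiableAt_B (ξ₀ : ℝ × ℝ) : DifferentiableAt ℝ f.B ξ₀ :=
  differentiableAt_pi.2 fun i => ((f.smooth_B i).differentiable (one_le_cast hK)) ξ₀

theorem matDiffAt_wordP (S : ℤ → Side) (n : ℕ) (ξ₀ : ℝ × ℝ) :
    MatDiffAt (fun ξ => wordP f S ξ n) ξ₀ := by
  induction n with
  | zero => exact matDiffAt_const 0
  | succ n ih =>
    simp only [wordP]
    refine MatDiffAt.add (MatDiffAt.mul (fun i j => ?_) ih) (matDiffAt_const 1)
    exact ((contDiff_sideMat f _ i j).differentiable (one_le_cast hK)) ξ₀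

theorem differentiableAt_wordMap (S : ℤ → Side) (n : ℕ) (ξ₀ : ℝ × ℝ) {x : ℝ × ℝ → Fin N → ℝ}
    (hx : DifferentiableAt ℝ x ξ₀) : DifferentiableAt ℝ (fun ξ => wordMap f S ξ n (x ξ)) ξ₀ := by
  simp only [wordMap_eq]
  exact ((matDiffAt_wordMat f hK S n ξ₀).mulVec hx).add
    ((matDiffAt_wordP f hK S n ξ₀).mulVec (differentiableAt_B f hK ξ₀))

theorem differentiableAt_cyclePt (S : ℤ → Side) (n : ℕ) (ξ₀ : ℝ × ℝ) (i : ℤ)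
    (h : (1 - wordMat f (shiftSeq S i) ξ₀ n).det ≠ 0) :
    DifferentiableAt ℝ (fun ξ => cyclePt f S n ξ i) ξ₀ := by
  simp only [cyclePt]
  refine MatDiffAt.mulVec (MatDiffAt.inv ((matDiffAt_const 1).sub
    (matDiffAt_wordMat f hK _ n ξ₀)) h) ?_
  exact (matDiffAt_wordP f hK _ n ξ₀).mulVec (differentiableAt_B f hK ξ₀)

theorem differentiableAt_flipVec (S : ℤ → Side) (ξ₀ : ℝ × ℝ) (i b : ℕ) :
    DifferentiableAt ℝ (fun ξ => flipVec f S ξ i b) ξ₀ := by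
  simp only [flipVec]
  refine (matDiffAt_wordMat f hK _ b ξ₀).mulVec (differentiableAt_pi.2 fun j => ?_)
  exact (((f.smooth_AR j 0).differentiable (one_le_cast hK)) ξ₀).sub
    (((f.smooth_AL j 0).differentiable (one_le_cast hK)) ξ₀)

end FamilyRegularity

/-! ### Continuation of the critical eigenvalue and its eigenvectors. -/

section CriticalEigenvalue

variable {N K : ℕ} [NeZero N] {f : PWLFamily N K} {l m n : ℕ} {ξ₀ : ℝ × ℝ}

theorem contDiff_det {N : ℕ} {E : Type*} [NormedAddCommGroup E] [NormedSpace ℝ E] {K : WithTop ℕ∞}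
    {A : E → Matrix (Fin N) (Fin N) ℝ} (hA : ∀ i j, ContDiff ℝ K fun ξ => A ξ i j) :
    ContDiff ℝ K fun ξ => (A ξ).det := by
  simp only [Matrix.det_apply]
  refine ContDiff.sum fun σ _ => ContDiff.const_smul _ ?_
  exact contDiff_prod fun i _ => hA _ _

/-- The implicit function theorem for `det (xI - M(ξ))` at `(ξ*, 1)` supplies a function with the
required properties. Whichever function the choice in `critEig` selects then has them too. -/
theorem IsShrinkingPoint.critEig_spec (h : IsShrinkingPoint f l m n ξ₀)
    (hρ : rhoMax f l m n ξ₀ < 1) (hK : 1 ≤ K) :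
    critEig f l m n ξ₀ ξ₀ = 1 ∧ ContDiffAt ℝ K (critEig f l m n ξ₀) ξ₀ ∧
    ∀ᶠ ξ in 𝓝 ξ₀, ∃ v : Fin N → ℝ, v ≠ 0 ∧
      wordMat f (cmSeq l m n) ξ n *ᵥ v = critEig f l m n ξ₀ ξ • v := by
  obtain ⟨q, hq, -, hqc, hc0⟩ := h.exists_factor hρ
  let G : (ℝ × ℝ) × ℝ → ℝ := fun p =>
    (p.2 • (1 : Matrix (Fin N) (Fin N) ℝ) - wordMat f (cmSeq l m n) p.1 n).det
  have hG : ContDiff ℝ K G := by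
    refine contDiff_det fun i j => ?_
    simp only [Matrix.sub_apply, Matrix.smul_apply, smul_eq_mul]
    exact (contDiff_snd.mul contDiff_const).sub
      ((contDiff_wordMat f _ n i j).comp contDiff_fst)
  have hGat : ContDiffAt ℝ K G (ξ₀, 1) := hG.contDiffAt
  have hchar : ∀ x : ℝ, G (ξ₀, x) = (x - 1) * q.eval x := by
    intro x
    have h1 : (wordMat f (cmSeq l m n) ξ₀ n).charpoly = (Polynomial.X - Polynomial.C 1) * q := by
      rw [cmSeq, charpoly_wordMat_shift f h.n_pos (rotSeq_add_period _ _ _), hq]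
    have h2 := congrArg (Polynomial.eval x) h1
    rw [eval_charpoly] at h2
    simp only [Polynomial.eval_mul, Polynomial.eval_sub, Polynomial.eval_X,
      Polynomial.eval_C] at h2
    rw [← h2]
    simp only [G, scalar_apply, smul_one_eq_diagonal]
  -- At `ξ*` the determinant is `(x - 1) q(x)`, whose derivative at `1` is `q(1) = c ≠ 0`.
  have hderiv : HasDerivAt (fun x => G (ξ₀, x)) (cConst f l m n ξ₀) 1 := by
    have h1 : HasDerivAt (fun x : ℝ => (x - 1) * q.eval x) _ 1 :=
      ((hasDerivAt_id (1 : ℝ)).sub_const 1).mul (q.hasDerivAt 1)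
    rw [funext hchar]
    convert! h1 using 1
    simp [hqc]
  have hpartial : ∀ x : ℝ, (fderiv ℝ G (ξ₀, 1) ∘L .inr ℝ (ℝ × ℝ) ℝ) x =
      x * cConst f l m n ξ₀ := by
    have h1 := (hGat.differentiableAt (one_le_cast hK)).hasFDerivAt
    have h2 : HasFDerivAt (fun x : ℝ => (ξ₀, x)) (ContinuousLinearMap.inr ℝ (ℝ × ℝ) ℝ) 1 :=
      hasFDerivAt_prodMk_right ξ₀ 1
    have h3 := (h1.comp (1 : ℝ) h2).hasDerivAt.unique hderiv
    intro x
    have := (fderiv ℝ G (ξ₀, 1) ∘L .inr ℝ (ℝ × ℝ) ℝ).map_smul x 1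
    rw [smul_eq_mul, mul_one] at this
    rw [this, h3, smul_eq_mul]
  have hinv : (fderiv ℝ G (ξ₀, 1) ∘L .inr ℝ (ℝ × ℝ) ℝ).IsInvertible := by
    refine ⟨ContinuousLinearEquiv.unitsEquivAut ℝ (Units.mk0 _ hc0), ?_⟩
    ext
    rw [hpartial]
    simp
  have hKc := one_le_cast hK
  refine Classical.epsilon_spec (p := fun lam : ℝ × ℝ → ℝ => lam ξ₀ = 1 ∧ ContDiffAt ℝ K lam ξ₀ ∧
    ∀ᶠ ξ in 𝓝 ξ₀, ∃ v : Fin N → ℝ, v ≠ 0 ∧ matMd f l m n ξ *ᵥ v = lam ξ • v)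
    ⟨hGat.implicitFunction hKc hinv, ?_, ?_, ?_⟩
  · exact hGat.implicitFunction_apply_self hKc hinv
  · exact hGat.contDiffAt_implicitFunction hKc hinv
  · filter_upwards [hGat.eventually_apply_implicitFunction hKc hinv] with ξ hξ
    rw [hchar, sub_self, zero_mul] at hξ
    obtain ⟨v, hv, hv0⟩ := exists_mulVec_eq_zero_iff.2 hξ
    refine ⟨v, hv, ?_⟩
    rw [sub_mulVec, sub_eq_zero, smul_mulVec, one_mulVec] at hv0
    exact hv0.symm

theorem IsShrinkingPoint.zetaVec_self (h : IsShrinkingPoint f l m n ξ₀)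
    (hρ : rhoMax f l m n ξ₀ < 1) (hK : 1 ≤ K) :
    zetaVec f l m n ξ₀ ξ₀ = vVec f l m n ξ₀ (-1) := by
  rw [zetaVec, (h.critEig_spec hρ hK).1, vVec, neg_one_mul]; rfl

theorem IsShrinkingPoint.omegaVec_self (h : IsShrinkingPoint f l m n ξ₀)
    (hρ : rhoMax f l m n ξ₀ < 1) (hK : 1 ≤ K) :
    omegaVec f l m n ξ₀ ξ₀ = uVec f l m n ξ₀ (-1) := by
  rw [omegaVec, (h.critEig_spec hρ hK).1, uVec, neg_one_mul]; rfl

theorem IsShrinkingPoint.differentiableAt_critEig (h : IsShrinkingPoint f l m n ξ₀)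
    (hρ : rhoMax f l m n ξ₀ < 1) (hK : 1 ≤ K) :
    DifferentiableAt ℝ (critEig f l m n ξ₀) ξ₀ :=
  (h.critEig_spec hρ hK).2.1.differentiableAt (one_le_cast hK)

theorem IsShrinkingPoint.zetaVec_spec (h : IsShrinkingPoint f l m n ξ₀)
    (hρ : rhoMax f l m n ξ₀ < 1) (hK : 1 ≤ K) :
    (∀ᶠ ξ in 𝓝 ξ₀, wordMat f (cmSeq l m n) ξ n *ᵥ zetaVec f l m n ξ₀ ξ =
        critEig f l m n ξ₀ ξ • zetaVec f l m n ξ₀ ξ ∧ zetaVec f l m n ξ₀ ξ 0 = 1) ∧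
      DifferentiableAt ℝ (zetaVec f l m n ξ₀) ξ₀ := by
  obtain ⟨h1, -, hex⟩ := h.critEig_spec hρ hK
  obtain ⟨hdet, -⟩ := h.centre_eigenvectors hρ
  obtain ⟨q, -, -, -, hc0⟩ := h.exists_factor hρ
  set T : ℝ × ℝ → Matrix (Fin N) (Fin N) ℝ := fun ξ => critEig f l m n ξ₀ ξ • 1 -
    wordMat f (cmSeq l m n) ξ n + vecMulVec (vVec f l m n ξ₀ (-1)) (Pi.single 0 1) with hTdef
  have hT : MatDiffAt T ξ₀ :=
    ((MatDiffAt.smul (h.differentiableAt_critEig hρ hK) (matDiffAt_const 1)).sub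
      (matDiffAt_wordMat f hK _ n ξ₀)).add (matDiffAt_const _)
  have hT0 : (T ξ₀).det ≠ 0 := by
    simp only [hTdef, h1, one_smul, hdet]; exact hc0
  have hTev : ∀ᶠ ξ in 𝓝 ξ₀, (T ξ).det ≠ 0 :=
    hT.det.continuousAt.eventually_ne hT0
  have hspec : ∀ᶠ ξ in 𝓝 ξ₀, wordMat f (cmSeq l m n) ξ n *ᵥ zetaVec f l m n ξ₀ ξ =
      critEig f l m n ξ₀ ξ • zetaVec f l m n ξ₀ ξ ∧ zetaVec f l m n ξ₀ ξ 0 = 1 := by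
    filter_upwards [hTev, hex] with ξ hξ1 hξ2
    exact rightEig_spec hξ1 hξ2
  refine ⟨hspec, ?_⟩
  have heq : zetaVec f l m n ξ₀ =ᶠ[𝓝 ξ₀] fun ξ => (T ξ)⁻¹ *ᵥ vVec f l m n ξ₀ (-1) := by
    filter_upwards [hTev, hspec] with ξ hξ1 hξ2
    exact eq_bordered_inv hξ1 hξ2.1 hξ2.2
  exact ((hT.inv hT0).mulVec (differentiableAt_const _)).congr_of_eventuallyEq heq

/-- Here the border is the moving vector `ζ_{-d}(ξ)`, because `leftEig` is normalised against it. -/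
theorem IsShrinkingPoint.omegaVec_spec (h : IsShrinkingPoint f l m n ξ₀)
    (hρ : rhoMax f l m n ξ₀ < 1) (hK : 1 ≤ K) :
    (∀ᶠ ξ in 𝓝 ξ₀, omegaVec f l m n ξ₀ ξ ᵥ* wordMat f (cmSeq l m n) ξ n =
        critEig f l m n ξ₀ ξ • omegaVec f l m n ξ₀ ξ ∧
        omegaVec f l m n ξ₀ ξ ⬝ᵥ zetaVec f l m n ξ₀ ξ = 1) ∧
      DifferentiableAt ℝ (omegaVec f l m n ξ₀) ξ₀ := by
  obtain ⟨h1, -, hex⟩ := h.critEig_spec hρ hK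
  obtain ⟨hdet, -⟩ := h.centre_eigenvectors hρ
  obtain ⟨q, -, -, -, hc0⟩ := h.exists_factor hρ
  obtain ⟨hz, hzd⟩ := h.zetaVec_spec hρ hK
  set T : ℝ × ℝ → Matrix (Fin N) (Fin N) ℝ := fun ξ => critEig f l m n ξ₀ ξ • 1 -
    wordMat f (cmSeq l m n) ξ n + vecMulVec (zetaVec f l m n ξ₀ ξ) (Pi.single 0 1) with hTdef
  have hT : MatDiffAt T ξ₀ :=
    ((MatDiffAt.smul (h.differentiableAt_critEig hρ hK) (matDiffAt_const 1)).sub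
      (matDiffAt_wordMat f hK _ n ξ₀)).add (matDiffAt_vecMulVec hzd (differentiableAt_const _))
  have hT0 : (T ξ₀).det ≠ 0 := by
    simp only [hTdef, h1, one_smul, h.zetaVec_self hρ hK, hdet]; exact hc0
  have hTev : ∀ᶠ ξ in 𝓝 ξ₀, (T ξ).det ≠ 0 :=
    hT.det.continuousAt.eventually_ne hT0
  have hspec : ∀ᶠ ξ in 𝓝 ξ₀, omegaVec f l m n ξ₀ ξ ᵥ* wordMat f (cmSeq l m n) ξ n =
        critEig f l m n ξ₀ ξ • omegaVec f l m n ξ₀ ξ ∧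
        omegaVec f l m n ξ₀ ξ ⬝ᵥ zetaVec f l m n ξ₀ ξ = 1 := by
    filter_upwards [hTev, hex] with ξ hξ1 hξ2
    exact leftEig_spec rfl hξ1 hξ2
  refine ⟨hspec, ?_⟩
  have heq : omegaVec f l m n ξ₀ =ᶠ[𝓝 ξ₀] fun ξ => Pi.single 0 1 ᵥ* (T ξ)⁻¹ := by
    filter_upwards [hTev, hex] with ξ hξ1 hξ2
    exact leftEig_eq rfl hξ1 hξ2
  exact ((hT.inv hT0).vecMul (differentiableAt_const _)).congr_of_eventuallyEq heq

end CriticalEigenvalue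

/-! ### Uniform geometric decay of matrix powers near `ξ₀`. -/

section PowerBound

attribute [local instance] Matrix.linftyOpNormedAddCommGroup Matrix.linftyOpNormedSpace
  Matrix.linftyOpNormedRing Matrix.linftyOpNormedAlgebra

variable {N : ℕ} {E : Type*} [NormedAddCommGroup E] [NormedSpace ℝ E] {ξ₀ : E}

theorem linfty_norm_le_sum (A : Matrix (Fin N) (Fin N) ℝ) : ‖A‖ ≤ ∑ i, ∑ j, ‖A i j‖ := by
  have h : ‖A‖₊ ≤ ∑ i, ∑ j, ‖A i j‖₊ := by
    rw [linfty_opNNNorm_def]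
    exact Finset.sup_le fun i hi =>
      Finset.single_le_sum (f := fun i => ∑ j, ‖A i j‖₊) (fun _ _ => zero_le) hi
  have := NNReal.coe_le_coe.2 h
  push_cast at this
  exact this

theorem MatDiffAt.eventually_norm_lt {A : E → Matrix (Fin N) (Fin N) ℝ} (hA : MatDiffAt A ξ₀)
    {c : ℝ} (hc : ‖A ξ₀‖ < c) : ∀ᶠ ξ in 𝓝 ξ₀, ‖A ξ‖ < c := by
  have h1 : Tendsto (fun ξ => ∑ i, ∑ j, ‖(A ξ - A ξ₀) i j‖) (𝓝 ξ₀) (𝓝 0) := by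
    have : (0 : ℝ) = ∑ i : Fin N, ∑ j : Fin N, ‖(A ξ₀ - A ξ₀) i j‖ := by simp
    rw [this]
    refine tendsto_finsetSum _ fun i _ => tendsto_finsetSum _ fun j _ => ?_
    exact ((hA.tendsto i j).sub_const _).norm
  filter_upwards [h1.eventually (gt_mem_nhds (sub_pos.2 hc))] with ξ hξ
  have h2 := linfty_norm_le_sum (A ξ - A ξ₀)
  have h3 : ‖A ξ‖ ≤ ‖A ξ - A ξ₀‖ + ‖A ξ₀‖ := by
    simpa using norm_add_le (A ξ - A ξ₀) (A ξ₀)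
  linarith

theorem norm_pow_mulVec_le (D : Matrix (Fin N) (Fin N) ℝ) {R : ℝ} (hR : ‖D‖ ≤ R) (k : ℕ)
    (x : Fin N → ℝ) : ‖D ^ k *ᵥ x‖ ≤ R ^ k * ‖x‖ := by
  have hR0 : 0 ≤ R := (norm_nonneg D).trans hR
  induction k with
  | zero => simp
  | succ k ih =>
    rw [pow_succ', ← mulVec_mulVec]
    calc ‖D *ᵥ (D ^ k *ᵥ x)‖ ≤ ‖D‖ * ‖D ^ k *ᵥ x‖ := linfty_opNorm_mulVec _ _
      _ ≤ R * (R ^ k * ‖x‖) := by gcongr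
      _ = R ^ (k + 1) * ‖x‖ := by ring

/-- If some power of `D ξ₀` is a contraction, the powers of `D ξ` decay geometrically, uniformly
near `ξ₀`. -/
theorem MatDiffAt.exists_pow_bound {D : E → Matrix (Fin N) (Fin N) ℝ} (hD : MatDiffAt D ξ₀)
    (hlim : Tendsto (fun p : ℕ => ‖D ξ₀ ^ p‖) atTop (𝓝 0)) :
    ∃ C σ : ℝ, 0 < C ∧ 0 < σ ∧ σ < 1 ∧
      ∀ᶠ ξ in 𝓝 ξ₀, ∀ (k : ℕ) (x : Fin N → ℝ), ‖D ξ ^ k *ᵥ x‖ ≤ C * σ ^ k * ‖x‖ := by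
  obtain ⟨p, hp, hp0⟩ := ((hlim.eventually (gt_mem_nhds (show (0 : ℝ) < 1 / 2 by norm_num))).and
    (eventually_gt_atTop 0)).exists
  have hpR : (p : ℝ) ≠ 0 := by positivity
  set R := ‖D ξ₀‖ + 1
  have hR1 : 1 ≤ R := by simp [R]
  -- The `p`-th power of `D` at least halves norms near `ξ₀`, so `σ^p = 1/2` is a valid rate. The
  -- fewer than `p` remaining steps cost at most the factor `2 R^p`.
  set σ : ℝ := (1 / 2 : ℝ) ^ (1 / p : ℝ)
  have hσ0 : 0 < σ := by positivity
  have hσ1 : σ < 1 := Real.rpow_lt_one (by norm_num) (by norm_num) (by positivity)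
  have hσp : σ ^ p = 1 / 2 := by
    rw [← Real.rpow_natCast, ← Real.rpow_mul (by norm_num), one_div_mul_cancel hpR, Real.rpow_one]
  refine ⟨2 * R ^ p, σ, by positivity, hσ0, hσ1, ?_⟩
  filter_upwards [(hD.pow p).eventually_norm_lt hp,
    hD.eventually_norm_lt (show ‖D ξ₀‖ < R by simp [R])] with ξ h1 h2 k x
  have hk := Nat.div_add_mod k p
  set q := k / p
  set s := k % p
  have hs : s < p := Nat.mod_lt _ hp0
  have hb : (1 / 2 : ℝ) ^ q ≤ 2 * σ ^ k := by
    rw [← hk, pow_add, pow_mul, hσp]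
    have h3 : 1 / 2 ≤ σ ^ s := by
      rw [← hσp]; exact pow_le_pow_of_le_one hσ0.le hσ1.le hs.le
    have h4 : (0 : ℝ) < (1 / 2) ^ q := by positivity
    nlinarith
  have hRs : R ^ s ≤ R ^ p := pow_le_pow_right₀ hR1 hs.le
  calc ‖D ξ ^ k *ᵥ x‖ = ‖(D ξ ^ p) ^ q *ᵥ (D ξ ^ s *ᵥ x)‖ := by
        rw [mulVec_mulVec, ← pow_mul, ← pow_add, hk]
    _ ≤ (1 / 2) ^ q * ‖D ξ ^ s *ᵥ x‖ := norm_pow_mulVec_le _ h1.le _ _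
    _ ≤ (2 * σ ^ k) * (R ^ s * ‖x‖) := by
        gcongr
        exact norm_pow_mulVec_le _ h2.le _ _
    _ ≤ (2 * σ ^ k) * (R ^ p * ‖x‖) := by gcongr
    _ = _ := by ring

end PowerBound

/-! ### First-order expansions of the critical eigenvalue and of the drift. -/

section Expansions

variable {N K : ℕ} [NeZero N] {f : PWLFamily N K} {l m n : ℕ} {ξ₀ : ℝ × ℝ}

/-- The centre matrix with its critical eigenvalue removed. -/
def stableMat (f : PWLFamily N K) (l m n : ℕ) (ξ₀ ξ : ℝ × ℝ) : Matrix (Fin N) (Fin N) ℝ :=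
  wordMat f (cmSeq l m n) ξ n -
    critEig f l m n ξ₀ ξ • vecMulVec (zetaVec f l m n ξ₀ ξ) (omegaVec f l m n ξ₀ ξ)

theorem IsShrinkingPoint.stableMat_bound (h : IsShrinkingPoint f l m n ξ₀)
    (hρ : rhoMax f l m n ξ₀ < 1) (hK : 1 ≤ K) :
    ∃ C σ : ℝ, 0 < C ∧ 0 < σ ∧ σ < 1 ∧ ∀ᶠ ξ in 𝓝 ξ₀, ∀ (k : ℕ) (x : Fin N → ℝ),
      ‖stableMat f l m n ξ₀ ξ ^ k *ᵥ x‖ ≤ C * σ ^ k * ‖x‖ := by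
  obtain ⟨q, hq, hroots, hqc, hc0⟩ := h.exists_factor hρ
  obtain ⟨hdet, hv, hv0, hu, huv, -⟩ := h.centre_eigenvectors hρ
  have hq' : (wordMat f (cmSeq l m n) ξ₀ n).charpoly = (Polynomial.X - Polynomial.C 1) * q := by
    rw [cmSeq, charpoly_wordMat_shift f h.n_pos (rotSeq_add_period _ _ _), hq]
  refine MatDiffAt.exists_pow_bound ?_ ?_
  · exact (matDiffAt_wordMat f hK _ n ξ₀).sub (MatDiffAt.smul (h.differentiableAt_critEig hρ hK)
      (matDiffAt_vecMulVec (h.zetaVec_spec hρ hK).2 (h.omegaVec_spec hρ hK).2))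
  · have := deflated_pow_tendsto hq' hroots hv hv0 hu huv (by rw [hdet]; exact hc0)
    simpa only [stableMat, (h.critEig_spec hρ hK).1, one_smul, h.zetaVec_self hρ hK,
      h.omegaVec_self hρ hK] using this

/-- `P = (a / (c t_d)) η`. -/
def pCoord (f : PWLFamily N K) (l m n : ℕ) (ξ₀ : ℝ × ℝ) (w : ℝ × ℝ) : ℝ :=
  aConst f l m n ξ₀ / (cConst f l m n ξ₀ * tConst f l m n ξ₀ 1) * w.1

/-- `P' = -(a / (c t_{(l-1)d})) ν`. -/
def pCoord' (f : PWLFamily N K) (l m n : ℕ) (ξ₀ : ℝ × ℝ) (w : ℝ × ℝ) : ℝ :=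
  -(aConst f l m n ξ₀ / (cConst f l m n ξ₀ * tConst f l m n ξ₀ (l - 1))) * w.2

theorem IsShrinkingPoint.det_seqS0_ne (h : IsShrinkingPoint f l m n ξ₀) :
    (1 - wordMat f (seqS0 l m n) ξ₀ n).det ≠ 0 := h.2.2.2.2.2.2.1

theorem IsShrinkingPoint.aConst_ne (h : IsShrinkingPoint f l m n ξ₀) :
    aConst f l m n ξ₀ ≠ 0 := h.det_seqS0_ne

theorem IsShrinkingPoint.differentiableAt_cyclePt (h : IsShrinkingPoint f l m n ξ₀) (hK : 1 ≤ K)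
    (i : ℤ) : DifferentiableAt ℝ (fun ξ => cyclePt f (seqS0 l m n) n ξ i) ξ₀ := by
  refine _root_.differentiableAt_cyclePt f hK _ n ξ₀ i ?_
  rw [det_one_sub_eq_of_charpoly
    (charpoly_wordMat_shift f h.n_pos (seqS0_add_period l m n) ξ₀ i)]
  exact h.det_seqS0_ne

theorem IsShrinkingPoint.differentiableAt_coordEN (h : IsShrinkingPoint f l m n ξ₀) (hK : 1 ≤ K) :
    DifferentiableAt ℝ (coordEN f l m n) ξ₀ := by
  change DifferentiableAt ℝ (fun ξ => (cyclePt f (seqS0 l m n) n ξ 0 0,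
    cyclePt f (seqS0 l m n) n ξ (l * modInv m n) 0)) ξ₀
  exact (differentiableAt_entry (h.differentiableAt_cyclePt hK 0) 0).prodMk
    (differentiableAt_entry (h.differentiableAt_cyclePt hK _) 0)

theorem IsShrinkingPoint.coordEN_self (h : IsShrinkingPoint f l m n ξ₀) :
    coordEN f l m n ξ₀ = 0 := by
  have h1 := h.tConst_of_zero
  have h2 := h.tConst_of_l
  rw [tConst, zero_mul] at h1
  exact Prod.ext h1 h2

theorem IsShrinkingPoint.coordEN_isBigO (h : IsShrinkingPoint f l m n ξ₀) (hK : 1 ≤ K) :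
    coordEN f l m n =O[𝓝 ξ₀] fun ξ => ‖ξ - ξ₀‖ := by
  have := (h.differentiableAt_coordEN hK).isBigO_sub
  simpa [h.coordEN_self] using this.norm_right

/-- Since `det J ≠ 0`, the derivative of `(η, ν)` at `ξ*` is injective, so the distance to `ξ*` is
controlled by `(η, ν)`. -/
theorem IsShrinkingPoint.isBigO_coordEN (h : IsShrinkingPoint f l m n ξ₀) (hK : 1 ≤ K)
    (hJ : detJ f l m n ξ₀ ≠ 0) :
    (fun ξ => ‖ξ - ξ₀‖) =O[𝓝 ξ₀] coordEN f l m n := by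
  have hd := h.differentiableAt_coordEN hK
  set L := fderiv ℝ (coordEN f l m n) ξ₀ with hL
  have h1 : fderiv ℝ (fun ξ => (coordEN f l m n ξ).1) ξ₀ = (ContinuousLinearMap.fst ℝ ℝ ℝ).comp L :=
    fderiv.fst hd
  have h2 : fderiv ℝ (fun ξ => (coordEN f l m n ξ).2) ξ₀ = (ContinuousLinearMap.snd ℝ ℝ ℝ).comp L :=
    fderiv.snd hd
  rw [detJ, h1, h2] at hJ
  simp only [ContinuousLinearMap.comp_apply, ContinuousLinearMap.coe_fst',
    ContinuousLinearMap.coe_snd'] at hJ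
  have hker : L.ker = ⊥ := by
    rw [LinearMap.ker_eq_bot']
    rintro ⟨x, y⟩ hxy
    have hdec : ((x, y) : ℝ × ℝ) = x • (1, 0) + y • (0, 1) := by simp
    have h0 : L (x, y) = x • L (1, 0) + y • L (0, 1) := by
      rw [hdec, map_add, map_smul, map_smul]
    have h0' : x • L (1, 0) + y • L (0, 1) = 0 := h0.symm.trans hxy
    have e1 := congrArg Prod.fst h0'
    have e2 := congrArg Prod.snd h0'
    simp only [Prod.fst_add, Prod.smul_fst, smul_eq_mul, Prod.fst_zero, Prod.snd_add,
      Prod.smul_snd, Prod.snd_zero] at e1 e2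
    have hx : x * ((L (1, 0)).1 * (L (0, 1)).2 - (L (0, 1)).1 * (L (1, 0)).2) = 0 := by
      linear_combination (L (0, 1)).2 * e1 - (L (0, 1)).1 * e2
    have hy : y * ((L (1, 0)).1 * (L (0, 1)).2 - (L (0, 1)).1 * (L (1, 0)).2) = 0 := by
      linear_combination (L (1, 0)).1 * e2 - (L (1, 0)).2 * e1
    have hx' := (mul_eq_zero.1 hx).resolve_right hJ
    have hy' := (mul_eq_zero.1 hy).resolve_right hJ
    rw [hx', hy']; rfl
  have hind : IsInducing L := (LinearEquiv.ofInjectiveEndo L.toLinearMap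
    (LinearMap.ker_eq_bot.1 hker)).toContinuousLinearEquiv.toHomeomorph.isInducing
  have := (hd.hasFDerivAt.isTheta_sub hind).2
  simpa [h.coordEN_self] using this.norm_left

theorem IsShrinkingPoint.pCoord_isBigO (h : IsShrinkingPoint f l m n ξ₀) (hK : 1 ≤ K) :
    (fun ξ => pCoord f l m n ξ₀ (coordEN f l m n ξ)) =O[𝓝 ξ₀] (fun ξ => ‖ξ - ξ₀‖) ∧
    (fun ξ => pCoord' f l m n ξ₀ (coordEN f l m n ξ)) =O[𝓝 ξ₀] (fun ξ => ‖ξ - ξ₀‖) := by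
  have h1 := h.coordEN_isBigO hK
  constructor
  · exact ((isBigO_fst_prod' (f' := coordEN f l m n)).trans h1).const_mul_left _
  · exact ((isBigO_snd_prod' (f' := coordEN f l m n)).trans h1).const_mul_left _

theorem IsShrinkingPoint.isBigO_pCoord (h : IsShrinkingPoint f l m n ξ₀) (hK : 1 ≤ K)
    (hρ : rhoMax f l m n ξ₀ < 1) (hJ : detJ f l m n ξ₀ ≠ 0) :
    (fun ξ => ‖ξ - ξ₀‖) =O[𝓝 ξ₀] fun ξ => |pCoord f l m n ξ₀ (coordEN f l m n ξ)| +
      |pCoord' f l m n ξ₀ (coordEN f l m n ξ)| := by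
  obtain ⟨q, -, -, -, hc0⟩ := h.exists_factor hρ
  refine (h.isBigO_coordEN hK hJ).trans ?_
  have hne1 : aConst f l m n ξ₀ / (cConst f l m n ξ₀ * tConst f l m n ξ₀ 1) ≠ 0 :=
    div_ne_zero h.aConst_ne (mul_ne_zero hc0 h.tConst_one_neg.ne)
  have hne2 : -(aConst f l m n ξ₀ / (cConst f l m n ξ₀ * tConst f l m n ξ₀ (l - 1))) ≠ 0 :=
    neg_ne_zero.2 (div_ne_zero h.aConst_ne (mul_ne_zero hc0 h.tConst_l_sub_one_neg.ne))
  have hb : ∀ x y : ℝ, |x| ≤ ‖|x| + |y|‖ ∧ |y| ≤ ‖|x| + |y|‖ := by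
    intro x y
    rw [Real.norm_of_nonneg (by positivity)]
    constructor
    · linarith [abs_nonneg y]
    · linarith [abs_nonneg x]
  refine IsBigO.prod_left ?_ ?_
  · refine (isBigO_self_const_mul hne1 (fun ξ => (coordEN f l m n ξ).1) (𝓝 ξ₀)).trans ?_
    exact IsBigO.of_bound 1 (.of_forall fun ξ => by rw [one_mul]; exact (hb _ _).1)
  · refine (isBigO_self_const_mul hne2 (fun ξ => (coordEN f l m n ξ).2) (𝓝 ξ₀)).trans ?_
    exact IsBigO.of_bound 1 (.of_forall fun ξ => by rw [one_mul]; exact (hb _ _).2)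

/-- The drift of the centre coordinate under one application of `f^{S^{(-d)}}`. -/
def drift (f : PWLFamily N K) (l m n : ℕ) (ξ₀ ξ : ℝ × ℝ) : ℝ :=
  omegaVec f l m n ξ₀ ξ ⬝ᵥ (wordMap f (cmSeq l m n) ξ n (cyclePt f (seqS0 l m n) n ξ₀ 0) -
    cyclePt f (seqS0 l m n) n ξ₀ 0)

theorem IsShrinkingPoint.critEig_isBigO (h : IsShrinkingPoint f l m n ξ₀)
    (hρ : rhoMax f l m n ξ₀ < 1) (hK : 1 ≤ K) :
    (fun ξ => critEig f l m n ξ₀ ξ - 1) =O[𝓝 ξ₀] fun ξ => ‖ξ - ξ₀‖ := by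
  have := (h.differentiableAt_critEig hρ hK).isBigO_sub
  rw [(h.critEig_spec hρ hK).1] at this
  exact this.norm_right

/-- The source of the quadratic errors: each is a product of two quantities that are `O(‖ξ - ξ₀‖)`.
Differentiability at `ξ₀` alone suffices for these expansions. -/
theorem isBigO_mul_sq {g₁ g₂ : ℝ × ℝ → ℝ} (h1 : g₁ =O[𝓝 ξ₀] fun ξ => ‖ξ - ξ₀‖)
    (h2 : g₂ =O[𝓝 ξ₀] fun ξ => ‖ξ - ξ₀‖) :
    (fun ξ => g₁ ξ * g₂ ξ) =O[𝓝 ξ₀] fun ξ => ‖ξ - ξ₀‖ ^ 2 := by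
  simpa only [sq] using h1.mul h2

theorem DifferentiableAt.isBigO_sub_norm {F : Type*} [NormedAddCommGroup F] [NormedSpace ℝ F]
    {g : ℝ × ℝ → F} (hg : DifferentiableAt ℝ g ξ₀) :
    (fun ξ => g ξ - g ξ₀) =O[𝓝 ξ₀] fun ξ => ‖ξ - ξ₀‖ := hg.isBigO_sub.norm_right

/-- Comparison of the centre displacement at a moving point with the drift. -/
theorem IsShrinkingPoint.centre_displacement (h : IsShrinkingPoint f l m n ξ₀)
    (hρ : rhoMax f l m n ξ₀ < 1) (hK : 1 ≤ K) {X : ℝ × ℝ → Fin N → ℝ}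
    (hX : DifferentiableAt ℝ X ξ₀) :
    (fun ξ => omegaVec f l m n ξ₀ ξ ⬝ᵥ (wordMap f (cmSeq l m n) ξ n (X ξ) - X ξ) -
      (drift f l m n ξ₀ ξ + (critEig f l m n ξ₀ ξ - 1) *
        (uVec f l m n ξ₀ (-1) ⬝ᵥ (X ξ₀ - cyclePt f (seqS0 l m n) n ξ₀ 0))))
      =O[𝓝 ξ₀] fun ξ => ‖ξ - ξ₀‖ ^ 2 := by
  obtain ⟨hω, hωd⟩ := h.omegaVec_spec hρ hK
  set y := cyclePt f (seqS0 l m n) n ξ₀ 0 with hy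
  have hd : DifferentiableAt ℝ (fun ξ => omegaVec f l m n ξ₀ ξ ⬝ᵥ (X ξ - y)) ξ₀ :=
    differentiableAt_dotProduct hωd (hX.sub_const y)
  have h1 := isBigO_mul_sq (h.critEig_isBigO hρ hK) hd.isBigO_sub_norm
  refine h1.congr' ?_ EventuallyEq.rfl
  filter_upwards [hω] with ξ hξ
  rw [h.omegaVec_self hρ hK]
  have e1 := wordMap_sub f (cmSeq l m n) ξ n (X ξ) y
  have e2 : wordMap f (cmSeq l m n) ξ n (X ξ) - X ξ =
      (wordMat f (cmSeq l m n) ξ n *ᵥ (X ξ - y) - (X ξ - y)) +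
        (wordMap f (cmSeq l m n) ξ n y - y) := by
    rw [← e1]; abel
  have e3 : omegaVec f l m n ξ₀ ξ ⬝ᵥ (wordMat f (cmSeq l m n) ξ n *ᵥ (X ξ - y)) =
      critEig f l m n ξ₀ ξ * (omegaVec f l m n ξ₀ ξ ⬝ᵥ (X ξ - y)) := by
    rw [dotProduct_mulVec, hξ.1, smul_dotProduct, smul_eq_mul]
  rw [e2, dotProduct_add, dotProduct_sub _ (wordMat f (cmSeq l m n) ξ n *ᵥ (X ξ - y)) (X ξ - y),
    e3, drift]
  ring

theorem IsShrinkingPoint.eventually_det_ne (h : IsShrinkingPoint f l m n ξ₀) (hK : 1 ≤ K) :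
    ∀ᶠ ξ in 𝓝 ξ₀, (1 - wordMat f (seqS0 l m n) ξ n).det ≠ 0 :=
  ((matDiffAt_const 1).sub (matDiffAt_wordMat f hK _ n ξ₀)).det.continuousAt.eventually_ne
    h.det_seqS0_ne

/-- The displacement at the moving point `x_0(ξ)` is an exact multiple of `ν`. Replacing this point
by the fixed one costs `O(r²)`, and `aConst_eq_start` identifies the coefficient. -/
theorem IsShrinkingPoint.drift_isBigO (h : IsShrinkingPoint f l m n ξ₀)
    (hρ : rhoMax f l m n ξ₀ < 1) (hK : 1 ≤ K) :
    (fun ξ => drift f l m n ξ₀ ξ + tConst f l m n ξ₀ (-1) *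
      pCoord' f l m n ξ₀ (coordEN f l m n ξ)) =O[𝓝 ξ₀] fun ξ => ‖ξ - ξ₀‖ ^ 2 := by
  have hl1 := h.1
  have hl2 := h.2.1
  obtain ⟨q, -, -, -, hc0⟩ := h.exists_factor hρ
  have h1 := h.centre_displacement hρ hK (h.differentiableAt_cyclePt hK 0)
  simp only [sub_self, dotProduct_zero, mul_zero, add_zero] at h1
  have hω := (h.omegaVec_spec hρ hK).2
  have hflip := differentiableAt_dotProduct hω (differentiableAt_flipVec f hK (cmSeq l m n) ξ₀
    (ldRes l m n) (n - ldRes l m n - 1))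
  have h2 := isBigO_mul_sq ((isBigO_snd_prod' (f' := coordEN f l m n)).trans (h.coordEN_isBigO hK))
    hflip.isBigO_sub_norm
  have ha := h.aConst_eq_start hρ
  have ht := h.tConst_neg_one_ne
  have htl := h.tConst_l_sub_one_neg.ne
  rw [h.omegaVec_self hρ hK] at h2
  set b := uVec f l m n ξ₀ (-1) ⬝ᵥ
        flipVec f (cmSeq l m n) ξ₀ (ldRes l m n) (n - ldRes l m n - 1) with hb
  have hP : ∀ w, tConst f l m n ξ₀ (-1) * pCoord' f l m n ξ₀ w = b * w.2 := by
    intro w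
    rw [pCoord', ha]
    field_simp
  refine (h1.add h2).neg_left.congr' ?_ EventuallyEq.rfl
  filter_upwards [h.eventually_det_ne hK] with ξ hξ
  rw [wordMap_cmSeq_start h.coprime (by omega) (by omega) hξ, hP, sub_sub_cancel_left,
    dotProduct_neg, dotProduct_smul, smul_eq_mul]
  ring

/-- The displacement at `x_{-d}(ξ)` is known in two ways: exactly, as a multiple of `η`, and to
first order as the drift plus `(λ - 1) t_{-d}`. Equating them, with the drift already known, gives
`λ - 1 = P' - P` up to `O(r²)`. -/
theorem IsShrinkingPoint.critEig_expansion (h : IsShrinkingPoint f l m n ξ₀)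
    (hρ : rhoMax f l m n ξ₀ < 1) (hK : 1 ≤ K) :
    (fun ξ => critEig f l m n ξ₀ ξ - 1 - (pCoord' f l m n ξ₀ (coordEN f l m n ξ) -
      pCoord f l m n ξ₀ (coordEN f l m n ξ))) =O[𝓝 ξ₀] fun ξ => ‖ξ - ξ₀‖ ^ 2 := by
  have hl1 := h.1
  have hl2 := h.2.1
  obtain ⟨q, -, -, -, hc0⟩ := h.exists_factor hρ
  obtain ⟨-, -, -, -, huv, hedge⟩ := h.centre_eigenvectors hρ
  have h1 := h.centre_displacement hρ hK (h.differentiableAt_cyclePt hK (-modInv m n))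
  have ht := h.tConst_neg_one_ne
  have ht1 := h.tConst_one_neg.ne
  have hpt : uVec f l m n ξ₀ (-1) ⬝ᵥ (cyclePt f (seqS0 l m n) n ξ₀ (-modInv m n) -
      cyclePt f (seqS0 l m n) n ξ₀ 0) = tConst f l m n ξ₀ (-1) := by
    rw [← neg_sub, ← hedge, dotProduct_neg, dotProduct_smul, huv]; simp
  rw [hpt] at h1
  have hω := (h.omegaVec_spec hρ hK).2
  have hflip := differentiableAt_dotProduct hω (differentiableAt_flipVec f hK (cmSeq l m n) ξ₀
    (invRes m n) (n - invRes m n - 1))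
  have h2 := isBigO_mul_sq ((isBigO_fst_prod' (f' := coordEN f l m n)).trans (h.coordEN_isBigO hK))
    hflip.isBigO_sub_norm
  have ha := h.aConst_eq_neg hρ
  rw [h.omegaVec_self hρ hK] at h2
  set b := uVec f l m n ξ₀ (-1) ⬝ᵥ
        flipVec f (cmSeq l m n) ξ₀ (invRes m n) (n - invRes m n - 1) with hb
  have hP : ∀ w, tConst f l m n ξ₀ (-1) * pCoord f l m n ξ₀ w = b * w.1 := by
    intro w
    rw [pCoord, ha]
    field_simp
  have h3 := ((h1.add h2).add (h.drift_isBigO hρ hK)).neg_left.const_mul_left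
    (tConst f l m n ξ₀ (-1))⁻¹
  refine h3.congr' ?_ EventuallyEq.rfl
  filter_upwards [h.eventually_det_ne hK] with ξ hξ
  have hP' := hP (coordEN f l m n ξ)
  rw [wordMap_cmSeq_neg (by omega) (by omega) hξ, sub_sub_cancel_left,
    dotProduct_neg, dotProduct_smul, smul_eq_mul, inv_mul_eq_iff_eq_mul₀ ht]
  linear_combination -hP'

end Expansions

/-! ### The scalar balance between the multiplier and the drift. -/

section CentreBalance

theorem card_mul_min_le_geom_sum {x : ℝ} (hx : 0 < x) (k : ℕ) :
    k * min 1 (x ^ k) ≤ ∑ i ∈ Finset.range k, x ^ i := by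
  have h : ∀ i ∈ Finset.range k, min 1 (x ^ k) ≤ x ^ i := by
    intro i hi
    rcases le_total 1 x with h1 | h1
    · exact (min_le_left _ _).trans (one_le_pow₀ h1)
    · exact (min_le_right _ _).trans
        (pow_le_pow_of_le_one hx.le h1 (Finset.mem_range.1 hi).le)
  simpa using Finset.card_nsmul_le_sum _ _ _ h

theorem geom_sum_le_card_mul_max {x : ℝ} (hx : 0 < x) (k : ℕ) :
    ∑ i ∈ Finset.range k, x ^ i ≤ k * max 1 (x ^ k) := by
  have h : ∀ i ∈ Finset.range k, x ^ i ≤ max 1 (x ^ k) := by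
    intro i hi
    rcases le_total 1 x with h1 | h1
    · exact (pow_le_pow_right₀ h1 (Finset.mem_range.1 hi).le).trans (le_max_right _ _)
    · exact (pow_le_one₀ hx.le h1).trans (le_max_left _ _)
  simpa using Finset.sum_le_card_nsmul _ _ _ h

theorem abs_log_sub_log_le {x y c : ℝ} (hc : 0 < c) (hx : c ≤ x) (hy : c ≤ y) :
    |Real.log x - Real.log y| ≤ |x - y| / c := by
  have key : ∀ {a b : ℝ}, c ≤ a → c ≤ b → Real.log a - Real.log b ≤ |a - b| / c := by
    intro a b ha hb
    have ha0 := hc.trans_le ha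
    have hb0 := hc.trans_le hb
    have h1 := Real.log_le_sub_one_of_pos (div_pos ha0 hb0)
    rw [Real.log_div ha0.ne' hb0.ne'] at h1
    calc Real.log a - Real.log b ≤ a / b - 1 := h1
      _ = (a - b) / b := by field_simp
      _ ≤ |a - b| / b := by gcongr; exact le_abs_self _
      _ ≤ |a - b| / c := by gcongr
  rw [abs_le]
  refine ⟨?_, key hx hy⟩
  have := key hy hx
  rw [abs_sub_comm] at this
  linarith

theorem abs_sub_le_mul_abs_log {x y c : ℝ} (hx0 : 0 < x) (hy0 : 0 < y) (hx : x ≤ c) (hy : y ≤ c) :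
    |x - y| ≤ c * |Real.log x - Real.log y| := by
  have key : ∀ {a b : ℝ}, 0 < a → 0 < b → a ≤ c → a - b ≤ c * |Real.log a - Real.log b| := by
    intro a b ha0 hb0 ha
    have h1 := Real.log_le_sub_one_of_pos (div_pos hb0 ha0)
    rw [Real.log_div hb0.ne' ha0.ne'] at h1
    have h2 : a - b ≤ a * (Real.log a - Real.log b) := by
      have : a * (b / a - 1) = b - a := by field_simp
      nlinarith
    calc a - b ≤ a * (Real.log a - Real.log b) := h2
      _ ≤ a * |Real.log a - Real.log b| := by gcongr; exact le_abs_self _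
      _ ≤ _ := by gcongr
  rw [abs_le]
  refine ⟨?_, key hx0 hy0 hx⟩
  have := key hy0 hx0 hy
  rw [abs_sub_comm] at this
  linarith

/-- The a priori estimate in the balance: the quadratic terms `r² S` are absorbed. -/
theorem balance_absorb {r S L ε x x' b q C1 C2 C3 C4 : ℝ} (hr : 0 ≤ r) (hS : 0 ≤ S) (hL : 0 ≤ L)
    (hε1 : ε < 1) (hC2 : 0 ≤ C2) (hC4 : 0 ≤ C4)
    (h1 : |b| ≤ C1 * (r ^ 2 * S)) (h2 : |x' * S - L - b| ≤ C2 * ((1 + L) * ε))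
    (h3 : |q| ≤ C3 * (r ^ 2 * S)) (h4 : r ≤ C4 * (|x| + |x'|))
    (hsm : C4 * (2 * C1 + C3) * r < 1 / 2) (hq : x * S - 1 = x' * S - L + q) :
    r * S ≤ 2 * (C4 * (2 * C2 + 1)) * (1 + L) := by
  have a1 : |x' * S - L| ≤ C1 * (r ^ 2 * S) + C2 * (1 + L) := by
    have := abs_add_le (x' * S - L - b) b
    rw [sub_add_cancel] at this
    have h2' : C2 * ((1 + L) * ε) ≤ C2 * (1 + L) := by
      refine mul_le_mul_of_nonneg_left ?_ hC2
      exact mul_le_of_le_one_right (by linarith) hε1.le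
    linarith
  have a2 : |x * S - 1| ≤ C1 * (r ^ 2 * S) + C2 * (1 + L) + C3 * (r ^ 2 * S) := by
    rw [hq]
    exact (abs_add_le _ _).trans (add_le_add a1 h3)
  have a3 : |x'| * S ≤ L + |x' * S - L| := by
    have := abs_add_le (x' * S - L) L
    rw [sub_add_cancel, abs_of_nonneg hL, abs_mul, abs_of_nonneg hS] at this
    linarith
  have a4 : |x| * S ≤ 1 + |x * S - 1| := by
    have := abs_add_le (x * S - 1) 1
    rw [sub_add_cancel, abs_one, abs_mul, abs_of_nonneg hS] at this
    linarith
  have a5 : r * S ≤ C4 * (|x| * S + |x'| * S) := by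
    calc r * S ≤ C4 * (|x| + |x'|) * S := by gcongr
      _ = _ := by ring
  have a6 : |x| * S + |x'| * S ≤
      (2 * C1 + C3) * (r ^ 2 * S) + (2 * C2 + 1) * (1 + L) := by linarith
  have a7 := a5.trans (mul_le_mul_of_nonneg_left a6 hC4)
  have a8 : C4 * (2 * C1 + C3) * r * (r * S) ≤ 1 / 2 * (r * S) := by gcongr
  linarith

variable {ι : Type*} {𝓛 : Filter ι} {k : ι → ℕ} {r lam beta P P' h₀ h₁ : ι → ℝ} {T : ℝ}

/-- Expansion of a critical multiplier `lam` near `1` in terms of small quantities `P`, `P'` that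
control the distance `r` to the bifurcation point, along a filter on which `k → ∞`. -/
structure CentreExpansion (𝓛 : Filter ι) (k : ι → ℕ) (r lam P P' : ι → ℝ) : Prop where
  tendsto_k : Tendsto k 𝓛 atTop
  tendsto_r : Tendsto r 𝓛 (𝓝 0)
  r_nonneg : ∀ i, 0 ≤ r i
  lam_sub : (fun i => lam i - 1 - (P' i - P i)) =O[𝓛] fun i => r i ^ 2
  isBigO_P : P =O[𝓛] r
  isBigO_P' : P' =O[𝓛] r
  isBigO_r : r =O[𝓛] fun i => |P i| + |P' i|

namespace CentreExpansion

variable (H : CentreExpansion 𝓛 k r lam P P')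
include H

theorem lam_isBigO : (fun i => lam i - 1) =O[𝓛] r := by
  have h1 : (fun i => r i ^ 2) =O[𝓛] r := by
    have := (isBigO_refl r 𝓛).mul (H.tendsto_r.isBigO_one ℝ)
    simpa [sq] using this
  have := (H.lam_sub.trans h1).add (H.isBigO_P'.sub H.isBigO_P)
  simpa using this

theorem tendsto_lam : Tendsto lam 𝓛 (𝓝 1) := by
  have := H.lam_isBigO.trans_tendsto H.tendsto_r
  simpa using this.add_const 1

theorem tendsto_inv_k : Tendsto (fun i => (1 : ℝ) / k i) 𝓛 (𝓝 0) :=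
  tendsto_one_div_atTop_nhds_zero_nat.comp H.tendsto_k

theorem eventually_k_pos : ∀ᶠ i in 𝓛, 0 < k i := H.tendsto_k.eventually_gt_atTop 0

/-- The powers of the multiplier, once `r = O(1/k)`. -/
theorem log_pow (hr : r =O[𝓛] fun i => (1 : ℝ) / k i) :
    (fun i => Real.log (lam i ^ k i) - k i * (P' i - P i)) =O[𝓛] fun i => (1 : ℝ) / k i := by
  have h1 : (fun i => Real.log (lam i) - (lam i - 1)) =O[𝓛] fun i => (lam i - 1) ^ 2 := by
    refine IsBigO.of_bound 2 ?_
    have h2 : ∀ᶠ i in 𝓛, |1 - lam i| < 1 / 2 := by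
      have := (H.tendsto_lam.const_sub 1).abs
      rw [sub_self, abs_zero] at this
      exact this.eventually (gt_mem_nhds (by norm_num))
    filter_upwards [h2] with i hi
    have h3 := Real.abs_log_sub_add_sum_range_le (hi.trans (by norm_num)) 1
    simp only [Finset.range_one, Finset.sum_singleton, zero_add, pow_one, Nat.cast_zero, div_one,
      sub_sub_cancel, one_add_one_eq_two] at h3
    rw [Real.norm_eq_abs, Real.norm_of_nonneg (sq_nonneg _)]
    calc |Real.log (lam i) - (lam i - 1)| = |1 - lam i + Real.log (lam i)| := by congr 1; ring
      _ ≤ |1 - lam i| ^ 2 / (1 - |1 - lam i|) := h3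
      _ ≤ |1 - lam i| ^ 2 / (1 / 2) := by gcongr; linarith
      _ = 2 * (lam i - 1) ^ 2 := by rw [sq_abs]; ring
  have h4 : (fun i => Real.log (lam i) - (P' i - P i)) =O[𝓛] fun i => ((1 : ℝ) / k i) ^ 2 := by
    have := ((h1.trans (H.lam_isBigO.pow 2)).add H.lam_sub).trans (hr.pow 2)
    refine this.congr_left fun i => by ring
  have h5 := (isBigO_refl (fun i => (k i : ℝ)) 𝓛).mul h4
  refine h5.congr' ?_ ?_
  · exact .of_forall fun i => by simp only [Real.log_pow]; ring
  · filter_upwards [H.eventually_k_pos] with i hi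
    field_simp

/-- Solution of the balance `h₁ = lam^k h₀ + beta (1 + lam + ⋯ + lam^{k-1})`. -/
theorem balance (hT : T ≠ 0) (hbeta : (fun i => beta i + T * P' i) =O[𝓛] fun i => r i ^ 2)
    (hh₀ : (fun i => h₀ i - T) =O[𝓛] fun i => r i + 1 / k i)
    (hh₁ : h₁ =O[𝓛] fun i => r i + 1 / k i)
    (hrec : ∀ᶠ i in 𝓛, h₁ i = lam i ^ k i * h₀ i + beta i * ∑ j ∈ Finset.range (k i), lam i ^ j) :
    (fun i => P' i * (∑ j ∈ Finset.range (k i), lam i ^ j) - lam i ^ k i) =O[𝓛]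
        (fun i => (1 + lam i ^ k i) * (r i + 1 / k i)) ∧
      (fun i => P i * (∑ j ∈ Finset.range (k i), lam i ^ j) - 1) =O[𝓛]
        (fun i => (1 + lam i ^ k i) * (r i + 1 / k i)) := by
  set S : ι → ℝ := fun i => ∑ j ∈ Finset.range (k i), lam i ^ j with hS
  set Λ : ι → ℝ := fun i => lam i ^ k i with hΛ
  set ε : ι → ℝ := fun i => r i + 1 / k i with hε
  have hlam : ∀ᶠ i in 𝓛, 0 < lam i := H.tendsto_lam.eventually (lt_mem_nhds one_pos)
  have hεn : ∀ i, 0 ≤ ε i := fun i => add_nonneg (H.r_nonneg i) (by positivity)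
  have hε0 : Tendsto ε 𝓛 (𝓝 0) := by
    simpa only [add_zero] using H.tendsto_r.add H.tendsto_inv_k
  have hg1 : ε =O[𝓛] fun i => (1 + Λ i) * ε i := by
    refine IsBigO.of_bound 1 ?_
    filter_upwards [hlam] with i hi
    have h0 : 0 ≤ Λ i := (pow_pos hi _).le
    have := hεn i
    rw [Real.norm_of_nonneg this, Real.norm_of_nonneg (by positivity)]
    nlinarith [mul_nonneg h0 this]
  have hg2 : (fun i => Λ i * ε i) =O[𝓛] fun i => (1 + Λ i) * ε i := by
    refine IsBigO.of_bound 1 ?_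
    filter_upwards [hlam] with i hi
    have h0 : 0 ≤ Λ i := (pow_pos hi _).le
    have := hεn i
    rw [Real.norm_of_nonneg (by positivity), Real.norm_of_nonneg (by positivity)]
    nlinarith
  have hb := hbeta.mul (isBigO_refl S 𝓛)
  -- the two balances up to `r² S`
  have e1 : (fun i => (P' i * S i - Λ i) - T⁻¹ * ((beta i + T * P' i) * S i)) =O[𝓛]
      fun i => (1 + Λ i) * ε i := by
    have := ((((isBigO_refl Λ 𝓛).mul hh₀).trans hg2).sub (hh₁.trans hg1)).const_mul_left T⁻¹
    refine this.congr' ?_ EventuallyEq.rfl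
    filter_upwards [hrec] with i hi
    have hi' : h₁ i = Λ i * h₀ i + beta i * S i := hi
    rw [hi']
    linear_combination (P' i * S i - Λ i) * (inv_mul_cancel₀ hT)
  -- The identity `(λ - 1)Σ = λ^k - 1` converts the balance for `P'` into the one for `P`.
  have e2 : ∀ i, P i * S i - 1 = (P' i * S i - Λ i) + (lam i - 1 - (P' i - P i)) * S i := by
    intro i
    have h1 := geom_sum_mul (lam i) (k i)
    change S i * (lam i - 1) = Λ i - 1 at h1
    linear_combination -h1
  have hb2 := H.lam_sub.mul (isBigO_refl S 𝓛)
  obtain ⟨C1, hC1, h1⟩ := (hb.const_mul_left T⁻¹).exists_nonneg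
  obtain ⟨C2, hC2, h2⟩ := e1.exists_nonneg
  obtain ⟨C3, hC3, h3⟩ := hb2.exists_nonneg
  obtain ⟨C4, hC4, h4⟩ := H.isBigO_r.exists_nonneg
  -- first bound on `r S`
  have hrS : ∀ᶠ i in 𝓛, r i * S i ≤ (2 * (C4 * (2 * C2 + 1))) * (1 + Λ i) := by
    have hsm : ∀ᶠ i in 𝓛, C4 * (2 * C1 + C3) * r i < 1 / 2 := by
      have := H.tendsto_r.const_mul (C4 * (2 * C1 + C3))
      rw [mul_zero] at this
      exact this.eventually (gt_mem_nhds (by norm_num))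
    filter_upwards [h1.bound, h2.bound, h3.bound, h4.bound, hlam, hsm,
      hε0.eventually (gt_mem_nhds one_pos)] with i h1 h2 h3 h4 hl hs hε1
    have hS0 : 0 ≤ S i := Finset.sum_nonneg fun _ _ => (pow_pos hl _).le
    have hΛ0 : 0 ≤ Λ i := (pow_pos hl _).le
    have hr := H.r_nonneg i
    rw [Real.norm_of_nonneg (mul_nonneg (sq_nonneg _) hS0), Real.norm_eq_abs] at h1 h3
    rw [Real.norm_of_nonneg (mul_nonneg (by linarith) (hεn i)), Real.norm_eq_abs] at h2
    rw [Real.norm_of_nonneg hr,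
      Real.norm_of_nonneg (add_nonneg (abs_nonneg _) (abs_nonneg _))] at h4
    exact balance_absorb hr hS0 hΛ0 hε1 hC2 hC4 h1 h2 h3 h4 hs (e2 i)
  have hr2S : (fun i => r i ^ 2 * S i) =O[𝓛] fun i => (1 + Λ i) * ε i := by
    refine IsBigO.of_bound (2 * (C4 * (2 * C2 + 1))) ?_
    filter_upwards [hrS, hlam] with i h1 hl
    have hS0 : 0 ≤ S i := Finset.sum_nonneg fun _ _ => (pow_pos hl _).le
    have hΛ0 : 0 ≤ Λ i := (pow_pos hl _).le
    have hr := H.r_nonneg i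
    have hεi := hεn i
    rw [Real.norm_of_nonneg (by positivity), Real.norm_of_nonneg (by positivity)]
    have hle : r i ≤ ε i := le_add_of_nonneg_right (by positivity)
    calc r i ^ 2 * S i = r i * (r i * S i) := by ring
      _ ≤ r i * ((2 * (C4 * (2 * C2 + 1))) * (1 + Λ i)) := by gcongr
      _ ≤ ε i * ((2 * (C4 * (2 * C2 + 1))) * (1 + Λ i)) := by gcongr
      _ = _ := by ring
  have f1 : (fun i => P' i * S i - Λ i) =O[𝓛] fun i => (1 + Λ i) * ε i := by
    have := e1.add ((hb.const_mul_left T⁻¹).trans hr2S)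
    simpa using this
  refine ⟨f1, (f1.add (hb2.trans hr2S)).congr_left fun i => (e2 i).symm⟩

end CentreExpansion

end CentreBalance

section CentreBalance

variable {ι : Type*} {𝓛 : Filter ι} {k : ι → ℕ} {r lam P P' : ι → ℝ}

namespace CentreExpansion

variable (H : CentreExpansion 𝓛 k r lam P P')
include H

theorem isBigO_r_of_le {C : ℝ} (hP : ∀ᶠ i in 𝓛, |k i * P i| ≤ C)
    (hP' : ∀ᶠ i in 𝓛, |k i * P' i| ≤ C) : r =O[𝓛] fun i => (1 : ℝ) / k i := by
  refine H.isBigO_r.trans (IsBigO.of_bound (2 * C) ?_)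
  filter_upwards [hP, hP', H.eventually_k_pos] with i h1 h2 hk
  have hk' : (0 : ℝ) < k i := Nat.cast_pos.2 hk
  rw [abs_mul, abs_of_pos hk'] at h1 h2
  rw [Real.norm_of_nonneg (by positivity), Real.norm_of_nonneg (by positivity), mul_one_div,
    le_div_iff₀ hk']
  linarith

/-- Inside the region where `P'/P` is bounded, `P` is of order `1/k` and the logarithmic relation
holds, the power of the multiplier is close to `P'/P`. -/
theorem pow_of_log_relation {τ₁ τ₂ A B C : ℝ} (hτ₁ : 0 < τ₁) (hA : 0 < A)
    (hP : ∀ᶠ i in 𝓛, A ≤ k i * P i ∧ k i * P i ≤ B)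
    (hτ : ∀ᶠ i in 𝓛, τ₁ * P i ≤ P' i ∧ P' i ≤ τ₂ * P i)
    (hlog : ∀ᶠ i in 𝓛, |k i * (P' i - P i) - Real.log (P' i / P i)| ≤ C / k i) :
    r =O[𝓛] (fun i => (1 : ℝ) / k i) ∧
      (fun i => lam i ^ k i - P' i / P i) =O[𝓛] fun i => (1 : ℝ) / k i := by
  have hr : r =O[𝓛] fun i => (1 : ℝ) / k i := by
    refine H.isBigO_r_of_le (C := max B (τ₂ * B)) ?_ ?_
    · filter_upwards [hP] with i h
      rw [abs_of_pos (hA.trans_le h.1)]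
      exact h.2.trans (le_max_left _ _)
    · filter_upwards [hP, hτ, H.eventually_k_pos] with i h h2 hk
      have hk' : (0 : ℝ) < k i := Nat.cast_pos.2 hk
      have hPp : 0 < P i := pos_of_mul_pos_right (hA.trans_le h.1) hk'.le
      have hτ' : τ₁ ≤ τ₂ := le_of_mul_le_mul_right (h2.1.trans h2.2) hPp
      have h0 : 0 ≤ P' i := (mul_pos hτ₁ hPp).le.trans h2.1
      rw [abs_of_nonneg (by positivity)]
      refine le_trans ?_ (le_max_right _ _)
      calc (k i : ℝ) * P' i ≤ k i * (τ₂ * P i) := by gcongr; exact h2.2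
        _ = τ₂ * (k i * P i) := by ring
        _ ≤ τ₂ * B := by gcongr; exacts [hτ₁.le.trans hτ', h.2]
  refine ⟨hr, ?_⟩
  have hlog' : (fun i => Real.log (lam i ^ k i) - Real.log (P' i / P i)) =O[𝓛]
      fun i => (1 : ℝ) / k i := by
    have h1 : (fun i => k i * (P' i - P i) - Real.log (P' i / P i)) =O[𝓛]
        fun i => (1 : ℝ) / k i := by
      refine IsBigO.of_bound C ?_
      filter_upwards [hlog] with i hi
      rw [Real.norm_eq_abs, Real.norm_of_nonneg (by positivity), mul_one_div]
      exact hi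
    simpa using (H.log_pow hr).add h1
  have h0 := hlog'.trans_tendsto H.tendsto_inv_k
  have hlam : ∀ᶠ i in 𝓛, 0 < lam i := H.tendsto_lam.eventually (lt_mem_nhds one_pos)
  -- Both logarithms are eventually at most `log τ₂ + 1`, so exponentiation is Lipschitz on the
  -- relevant range.
  refine IsBigO.trans ?_ hlog'
  refine IsBigO.of_bound (Real.exp (Real.log τ₂ + 1)) ?_
  filter_upwards [hP, hτ, H.eventually_k_pos, hlam, (tendsto_order.1 h0).2 1 one_pos]
    with i h h2 hk hl h3
  have hk' : (0 : ℝ) < k i := Nat.cast_pos.2 hk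
  have hPp : 0 < P i := pos_of_mul_pos_right (hA.trans_le h.1) hk'.le
  have hq1 : τ₁ ≤ P' i / P i := (le_div_iff₀ hPp).2 h2.1
  have hq2 : P' i / P i ≤ τ₂ := (div_le_iff₀ hPp).2 h2.2
  have hq0 := hτ₁.trans_le hq1
  have hlq := Real.log_le_log hq0 hq2
  refine abs_sub_le_mul_abs_log (pow_pos hl _) hq0 ?_ ?_
  · rw [← Real.log_le_iff_le_exp (pow_pos hl _)]
    linarith
  · rw [← Real.log_le_iff_le_exp hq0]
    linarith

section Consequences

variable (h1 : (fun i => P' i * (∑ j ∈ Finset.range (k i), lam i ^ j) - lam i ^ k i) =O[𝓛]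
        (fun i => (1 + lam i ^ k i) * (r i + 1 / k i)))
  (h2 : (fun i => P i * (∑ j ∈ Finset.range (k i), lam i ^ j) - 1) =O[𝓛]
        (fun i => (1 + lam i ^ k i) * (r i + 1 / k i)))
include h1 h2

/-- Bounds on `λ^k` make the geometric sum comparable to `k`, so `PΣ → 1` gives `P` of order `1/k`.
Then `r = O(1/k)` and the errors improve to `O(1/k)`. Dividing the balances yields `P'/P = λ^k +
O(1/k)`, and `log_pow` evaluates the logarithm. -/
theorem log_relation_of_pow_bounded {c₁ c₂ : ℝ} (hc₁ : 0 < c₁)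
    (hΛ : ∀ᶠ i in 𝓛, c₁ ≤ lam i ^ k i ∧ lam i ^ k i ≤ c₂) :
    (∃ A B : ℝ, 0 < A ∧ ∀ᶠ i in 𝓛, A ≤ k i * P i ∧ k i * P i ≤ B) ∧
      r =O[𝓛] (fun i => (1 : ℝ) / k i) ∧
      (fun i => P' i / P i - lam i ^ k i) =O[𝓛] (fun i => (1 : ℝ) / k i) ∧
      (fun i => k i * (P' i - P i) - Real.log (P' i / P i)) =O[𝓛] fun i => (1 : ℝ) / k i := by
  set S : ι → ℝ := fun i => ∑ j ∈ Finset.range (k i), lam i ^ j with hS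
  have hlam : ∀ᶠ i in 𝓛, 0 < lam i := H.tendsto_lam.eventually (lt_mem_nhds one_pos)
  have hε0 : Tendsto (fun i => r i + 1 / (k i : ℝ)) 𝓛 (𝓝 0) := by
    simpa only [add_zero] using H.tendsto_r.add H.tendsto_inv_k
  have hg : (fun i => (1 + lam i ^ k i) * (r i + 1 / (k i : ℝ))) =O[𝓛]
      fun i => r i + 1 / (k i : ℝ) := by
    refine IsBigO.of_bound (1 + c₂) ?_
    filter_upwards [hlam, hΛ] with i hl h3
    rw [norm_mul, Real.norm_of_nonneg (by positivity : (0 : ℝ) ≤ 1 + lam i ^ k i)]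
    gcongr
    exact h3.2
  replace h1 := h1.trans hg
  replace h2 := h2.trans hg
  have hPS : Tendsto (fun i => P i * S i) 𝓛 (𝓝 1) := by
    have := (h2.trans_tendsto hε0).add_const 1
    simpa only [sub_add_cancel, zero_add] using this
  have hP'S := h1.trans_tendsto hε0
  have hSk : ∀ᶠ i in 𝓛, min 1 c₁ * k i ≤ S i ∧ S i ≤ max 1 c₂ * k i := by
    filter_upwards [hlam, hΛ] with i hl h3
    constructor
    · refine le_trans ?_ (card_mul_min_le_geom_sum hl (k i))
      rw [mul_comm]
      gcongr
      exact h3.1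
    · refine (geom_sum_le_card_mul_max hl (k i)).trans ?_
      rw [mul_comm]
      gcongr
      exact h3.2
  have hm : 0 < min 1 c₁ := lt_min one_pos hc₁
  have hM : 0 < max 1 c₂ := one_pos.trans_le (le_max_left _ _)
  have hAB : ∀ᶠ i in 𝓛, 1 / 2 / max 1 c₂ ≤ k i * P i ∧ k i * P i ≤ 2 / min 1 c₁ := by
    filter_upwards [hSk, hPS.eventually (lt_mem_nhds (show (1 / 2 : ℝ) < 1 by norm_num)),
      hPS.eventually (gt_mem_nhds (show (1 : ℝ) < 2 by norm_num)), H.eventually_k_pos]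
      with i hs h3 h4 hk
    have hk' : (0 : ℝ) < k i := Nat.cast_pos.2 hk
    have hS0 : 0 < S i := (mul_pos hm hk').trans_le hs.1
    have hP0 : 0 < P i := pos_of_mul_pos_left (by linarith : 0 < P i * S i) hS0.le
    rw [div_le_iff₀ hM, le_div_iff₀ hm]
    constructor
    · nlinarith [mul_le_mul_of_nonneg_left hs.2 hP0.le]
    · nlinarith [mul_le_mul_of_nonneg_left hs.1 hP0.le]
  have hr : r =O[𝓛] fun i => (1 : ℝ) / k i := by
    refine H.isBigO_r_of_le (C := max (2 / min 1 c₁) ((c₂ + 1) / min 1 c₁)) ?_ ?_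
    · filter_upwards [hAB] with i h
      rw [abs_of_nonneg ((by positivity : (0 : ℝ) ≤ 1 / 2 / max 1 c₂).trans h.1)]
      exact h.2.trans (le_max_left _ _)
    · filter_upwards [hSk, hP'S.abs.eventually (gt_mem_nhds (show |(0 : ℝ)| < 1 by norm_num)),
        H.eventually_k_pos, hΛ, hlam] with i hs h3 hk h4 hl
      have hk' : (0 : ℝ) < k i := Nat.cast_pos.2 hk
      refine le_trans ?_ (le_max_right _ _)
      have hL : |lam i ^ k i| ≤ c₂ := by rw [abs_of_pos (pow_pos hl _)]; exact h4.2
      have h5 : |P' i * S i| ≤ c₂ + 1 := by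
        have := abs_add_le (P' i * S i - lam i ^ k i) (lam i ^ k i)
        rw [sub_add_cancel] at this
        linarith
      rw [abs_mul, abs_of_pos ((mul_pos hm hk').trans_le hs.1)] at h5
      rw [le_div_iff₀ hm, abs_mul, abs_of_pos hk']
      nlinarith [mul_le_mul_of_nonneg_left hs.1 (abs_nonneg (P' i))]
  have hε : (fun i => r i + 1 / (k i : ℝ)) =O[𝓛] fun i => (1 : ℝ) / k i :=
    hr.add (isBigO_refl _ _)
  replace h1 := h1.trans hε
  replace h2 := h2.trans hε
  have hq : (fun i => P' i / P i - lam i ^ k i) =O[𝓛] fun i => (1 : ℝ) / k i := by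
    have hΛO : (fun i => lam i ^ k i) =O[𝓛] fun _ => (1 : ℝ) := by
      refine IsBigO.of_bound c₂ ?_
      filter_upwards [hΛ, hlam] with i h3 hl
      rw [norm_one, mul_one, Real.norm_of_nonneg (pow_pos hl _).le]
      exact h3.2
    have h4 := hΛO.mul h2
    simp only [one_mul] at h4
    have h3 := h1.sub h4
    refine IsBigO.trans (IsBigO.of_bound 2 ?_) h3
    filter_upwards [hPS.eventually (lt_mem_nhds (show (1 / 2 : ℝ) < 1 by norm_num))] with i hi
    have hPSi : P i * S i ≠ 0 := by linarith
    have e : P' i * S i - lam i ^ k i - lam i ^ k i * (P i * S i - 1) =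
        (P' i / P i - lam i ^ k i) * (P i * S i) := by
      have := left_ne_zero_of_mul hPSi
      field_simp
      ring
    rw [e, norm_mul, Real.norm_of_nonneg (by linarith : 0 ≤ P i * S i)]
    nlinarith [norm_nonneg (P' i / P i - lam i ^ k i)]
  refine ⟨⟨_, _, by positivity, hAB⟩, hr, hq, ?_⟩
  have hq0 := hq.trans_tendsto H.tendsto_inv_k
  have hlogq : (fun i => Real.log (lam i ^ k i) - Real.log (P' i / P i)) =O[𝓛]
      fun i => (1 : ℝ) / k i := by
    refine IsBigO.trans (IsBigO.of_bound (2 / c₁) ?_) hq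
    filter_upwards [hΛ, (tendsto_order.1 hq0).1 (-(c₁ / 2)) (by linarith)] with i h3 h4
    have := abs_log_sub_log_le (x := lam i ^ k i) (y := P' i / P i) (half_pos hc₁)
      (by linarith) (by linarith)
    rw [abs_sub_comm (lam i ^ k i)] at this
    rw [Real.norm_eq_abs, Real.norm_eq_abs]
    refine this.trans (le_of_eq ?_)
    field_simp
  refine (hlogq.sub (H.log_pow hr)).congr_left fun i => by ring

/-- Eliminating the geometric sum from the two balances leaves `|λ^k - P'/P|` bounded by a small
multiple of `1 + λ^k`. Bounds on the ratio therefore pass to the power. -/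
theorem pow_bounded_of_ratio {τ₁ τ₂ : ℝ} (hτ₁ : 0 < τ₁)
    (hP : ∀ᶠ i in 𝓛, P i ≠ 0)
    (hτ : ∀ᶠ i in 𝓛, τ₁ ≤ P' i / P i ∧ P' i / P i ≤ τ₂) :
    ∀ᶠ i in 𝓛, τ₁ / 4 ≤ lam i ^ k i ∧ lam i ^ k i ≤ 2 * τ₂ + 1 := by
  have hε0 : Tendsto (fun i => r i + 1 / (k i : ℝ)) 𝓛 (𝓝 0) := by
    simpa only [add_zero] using H.tendsto_r.add H.tendsto_inv_k
  have hlam : ∀ᶠ i in 𝓛, 0 < lam i := H.tendsto_lam.eventually (lt_mem_nhds one_pos)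
  obtain ⟨C1, hC1, h1⟩ := h1.exists_nonneg
  obtain ⟨C2, hC2, h2⟩ := h2.exists_nonneg
  -- `δ ≤ 1/2` allows the term `δλ^k` to be absorbed, and `δ ≤ τ₁/2` keeps the lower bound positive.
  set δ := min (1 / 2) (τ₁ / 2) with hδ
  have hδ0 : 0 < δ := lt_min (by norm_num) (by linarith)
  have hsm : ∀ᶠ i in 𝓛, (C1 + τ₂ * C2) * (r i + 1 / (k i : ℝ)) < δ := by
    have := hε0.const_mul (C1 + τ₂ * C2)
    rw [mul_zero] at this
    exact this.eventually (gt_mem_nhds hδ0)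
  filter_upwards [h1.bound, h2.bound, hlam, hsm, hP, hτ] with i h1 h2 hl hs hP hτ
  have hL : 0 < lam i ^ k i := pow_pos hl _
  set L := lam i ^ k i
  set S := ∑ j ∈ Finset.range (k i), lam i ^ j
  have hε : 0 ≤ r i + 1 / (k i : ℝ) := add_nonneg (H.r_nonneg i) (by positivity)
  rw [Real.norm_eq_abs, Real.norm_of_nonneg (by positivity)] at h1 h2
  set q := P' i / P i with hq
  have e : L - q = q * (P i * S - 1) - (P' i * S - L) := by
    rw [hq]; field_simp; ring
  have hq0 : 0 < q := hτ₁.trans_le hτ.1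
  have hτ2 : 0 < τ₂ := hq0.trans_le hτ.2
  have hb : |L - q| ≤ (1 + L) * δ := by
    rw [e]
    calc |q * (P i * S - 1) - (P' i * S - L)| ≤ |q * (P i * S - 1)| + |P' i * S - L| := abs_sub _ _
      _ = q * |P i * S - 1| + |P' i * S - L| := by rw [abs_mul, abs_of_pos hq0]
      _ ≤ τ₂ * (C2 * ((1 + L) * (r i + 1 / (k i : ℝ)))) +
          C1 * ((1 + L) * (r i + 1 / (k i : ℝ))) := by
          gcongr
          exact hτ.2
      _ = (1 + L) * ((C1 + τ₂ * C2) * (r i + 1 / (k i : ℝ))) := by ring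
      _ ≤ _ := by gcongr
  have hd1 : δ ≤ 1 / 2 := min_le_left _ _
  have hd2 : δ ≤ τ₁ / 2 := min_le_right _ _
  rw [abs_le] at hb
  have m1 : L * δ ≤ L * (1 / 2) := by gcongr
  constructor
  · nlinarith [hb.1, hτ.1]
  · nlinarith [hb.2, hτ.2]

end Consequences

end CentreExpansion

end CentreBalance

/-! ### Centre and stable parts of iterates of an affine map. -/

section CentreSplitting

variable {N : ℕ}

theorem abs_dotProduct_le (v w : Fin N → ℝ) : |v ⬝ᵥ w| ≤ N * ‖v‖ * ‖w‖ := by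
  calc |v ⬝ᵥ w| ≤ ∑ i, |v i * w i| := Finset.abs_sum_le_sum_abs _ _
    _ ≤ ∑ _i : Fin N, ‖v‖ * ‖w‖ := by
        refine Finset.sum_le_sum fun i _ => ?_
        rw [abs_mul]
        gcongr
        exacts [norm_le_pi_norm v i, norm_le_pi_norm w i]
    _ = _ := by simp [mul_assoc]

/-- The component of `x` along the kernel of `w`, parallel to `v`. -/
def stablePart (w v x : Fin N → ℝ) : Fin N → ℝ := x - (w ⬝ᵥ x) • v

theorem stablePart_add (w v x y : Fin N → ℝ) :
    stablePart w v (x + y) = stablePart w v x + stablePart w v y := by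
  simp only [stablePart, dotProduct_add, add_smul]; abel

theorem norm_stablePart_le (w v x : Fin N → ℝ) :
    ‖stablePart w v x‖ ≤ (1 + N * ‖w‖ * ‖v‖) * ‖x‖ := by
  calc ‖stablePart w v x‖ ≤ ‖x‖ + ‖(w ⬝ᵥ x) • v‖ := norm_sub_le _ _
    _ = ‖x‖ + |w ⬝ᵥ x| * ‖v‖ := by rw [norm_smul, Real.norm_eq_abs]
    _ ≤ ‖x‖ + (N * ‖w‖ * ‖x‖) * ‖v‖ := by gcongr; exact abs_dotProduct_le _ _
    _ = _ := by ring

variable {M : Matrix (Fin N) (Fin N) ℝ} {w v : Fin N → ℝ} {lam : ℝ}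

theorem stablePart_mulVec (hv : M *ᵥ v = lam • v) (hw : w ᵥ* M = lam • w) (hwv : w ⬝ᵥ v = 1)
    (x : Fin N → ℝ) :
    stablePart w v (M *ᵥ x) = (M - lam • vecMulVec v w) *ᵥ stablePart w v x := by
  have h1 : ∀ y, vecMulVec v w *ᵥ y = (w ⬝ᵥ y) • v := by
    intro y; ext i; simp [vecMulVec_mulVec, mul_comm]
  simp only [stablePart, sub_mulVec, smul_mulVec, h1, mulVec_sub, mulVec_smul, hv,
    hwv, dotProduct_mulVec, hw, smul_dotProduct, smul_eq_mul,
    mul_one, sub_self, smul_zero, sub_zero, smul_smul]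

variable {φ : (Fin N → ℝ) → Fin N → ℝ}

/-- Pairing with the left eigenvector reduces the iteration to the scalar recursion `h ↦ λh + β`,
where `β` is the drift at `y`. -/
theorem centre_iterate (hφ : ∀ x y, φ x - φ y = M *ᵥ (x - y)) (hw : w ᵥ* M = lam • w)
    (y x : Fin N → ℝ) (k : ℕ) :
    w ⬝ᵥ (φ^[k] x - y) = lam ^ k * (w ⬝ᵥ (x - y)) +
      (w ⬝ᵥ (φ y - y)) * ∑ i ∈ Finset.range k, lam ^ i := by
  induction k with
  | zero => simp
  | succ k ih =>
    have e : φ^[k + 1] x - y = M *ᵥ (φ^[k] x - y) + (φ y - y) := by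
      rw [Function.iterate_succ_apply', ← hφ]; abel
    rw [e, dotProduct_add, dotProduct_mulVec, hw, smul_dotProduct, ih, geom_sum_succ, smul_eq_mul]
    ring

theorem stable_iterate (hφ : ∀ x y, φ x - φ y = M *ᵥ (x - y)) (hv : M *ᵥ v = lam • v)
    (hw : w ᵥ* M = lam • w) (hwv : w ⬝ᵥ v = 1) {D : Matrix (Fin N) (Fin N) ℝ}
    (hD : D = M - lam • vecMulVec v w) (y x : Fin N → ℝ) (k : ℕ) :
    stablePart w v (φ^[k] x - y) = D ^ k *ᵥ stablePart w v (x - y) +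
      ∑ i ∈ Finset.range k, D ^ i *ᵥ stablePart w v (φ y - y) := by
  induction k with
  | zero => simp
  | succ k ih =>
    have e : φ^[k + 1] x - y = M *ᵥ (φ^[k] x - y) + (φ y - y) := by
      rw [Function.iterate_succ_apply', ← hφ]; abel
    rw [e, stablePart_add, stablePart_mulVec hv hw hwv, ← hD, ih, mulVec_add, mulVec_mulVec,
      ← pow_succ', Finset.sum_range_succ', mulVec_sum, add_assoc]
    simp only [mulVec_mulVec, ← pow_succ', pow_zero, one_mulVec]

/-- The initial stable part decays geometrically. The constant forcing `φ y - y` accumulates to at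
most a geometric series. -/
theorem norm_stable_iterate_le (hφ : ∀ x y, φ x - φ y = M *ᵥ (x - y)) (hv : M *ᵥ v = lam • v)
    (hw : w ᵥ* M = lam • w) (hwv : w ⬝ᵥ v = 1) {D : Matrix (Fin N) (Fin N) ℝ}
    (hD : D = M - lam • vecMulVec v w) {C σ : ℝ} (hC : 0 < C) (hσ0 : 0 < σ) (hσ1 : σ < 1)
    (hpow : ∀ (k : ℕ) (x : Fin N → ℝ), ‖D ^ k *ᵥ x‖ ≤ C * σ ^ k * ‖x‖) (y x : Fin N → ℝ) (k : ℕ) :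
    ‖stablePart w v (φ^[k] x - y)‖ ≤ C * σ ^ k * ‖stablePart w v (x - y)‖ +
      C / (1 - σ) * ‖stablePart w v (φ y - y)‖ := by
  rw [stable_iterate hφ hv hw hwv hD]
  refine (norm_add_le _ _).trans (add_le_add (hpow _ _) ?_)
  calc ‖∑ i ∈ Finset.range k, D ^ i *ᵥ stablePart w v (φ y - y)‖
      ≤ ∑ i ∈ Finset.range k, C * σ ^ i * ‖stablePart w v (φ y - y)‖ :=
        norm_sum_le_of_le _ fun i _ => hpow _ _
    _ = C * (∑ i ∈ Finset.range k, σ ^ i) * ‖stablePart w v (φ y - y)‖ := by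
        rw [Finset.mul_sum, Finset.sum_mul]
    _ ≤ C * (1 / (1 - σ)) * ‖stablePart w v (φ y - y)‖ := by
        gcongr
        rw [geom_sum_eq hσ1.ne, ← neg_div_neg_eq, neg_sub, neg_sub]
        exact div_le_div_of_nonneg_right (by linarith [pow_pos hσ0 k]) (by linarith)
    _ = _ := by ring

end CentreSplitting

section Expansion

variable {N K : ℕ} [NeZero N] {f : PWLFamily N K} {l m n : ℕ} {ξ₀ : ℝ × ℝ}
  {𝓛 : Filter (ℕ × ℝ × ℝ)}

/-- Uniformity in `k` and `ξ` is encoded by filters on pairs `(k, ξ)` finer than `atTop ×ˢ 𝓝 ξ₀`.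
Restricting the filter to the pairs with some property turns a bound along it into a uniform bound
on those pairs. -/
theorem IsShrinkingPoint.centreExpansion (h : IsShrinkingPoint f l m n ξ₀)
    (hρ : rhoMax f l m n ξ₀ < 1) (hK : 1 ≤ K) (hJ : detJ f l m n ξ₀ ≠ 0)
    (h𝓛 : 𝓛 ≤ atTop ×ˢ 𝓝 ξ₀) :
    CentreExpansion 𝓛 Prod.fst (fun p => ‖p.2 - ξ₀‖) (fun p => critEig f l m n ξ₀ p.2)
      (fun p => pCoord f l m n ξ₀ (coordEN f l m n p.2))
      (fun p => pCoord' f l m n ξ₀ (coordEN f l m n p.2)) where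
  tendsto_k := tendsto_fst.mono_left h𝓛
  tendsto_r := by
    have h1 : Tendsto (fun ξ => ‖ξ - ξ₀‖) (𝓝 ξ₀) (𝓝 0) := tendsto_norm_sub_self ξ₀
    exact h1.comp (tendsto_snd.mono_left h𝓛)
  r_nonneg _ := norm_nonneg _
  lam_sub := (h.critEig_expansion hρ hK).comp_tendsto (tendsto_snd.mono_left h𝓛)
  isBigO_P := (h.pCoord_isBigO hK).1.comp_tendsto (tendsto_snd.mono_left h𝓛)
  isBigO_P' := (h.pCoord_isBigO hK).2.comp_tendsto (tendsto_snd.mono_left h𝓛)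
  isBigO_r := (h.isBigO_pCoord hK hρ hJ).comp_tendsto (tendsto_snd.mono_left h𝓛)

end Expansion

/-! ### Centre coordinates of a returning collision point and the resulting balance. -/

section Collision

/-- Here `W = ‖z - y‖`, `U` is the modulus of the centre coordinate, `Q` the norm of the stable part
and `s = σ^k`. The three bounds are circular, as no a priori bound on the returning point is known;
since `W` enters the bound on `Q` only with the factor `s`, smallness of `s` breaks the circle. -/
theorem collision_absorb {W U Q s r C1 C2 C3 C4 : ℝ} (hC1 : 0 ≤ C1) (hC2 : 0 ≤ C2)
    (hC4 : 0 ≤ C4) (hr : 0 ≤ r) (hs : 0 ≤ s) (hs1 : s ≤ 1) (hQ : 0 ≤ Q)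
    (hsm : C2 * (C1 * C4 + 1) * s ≤ 1 / 2) (h1 : W ≤ C1 * U + Q)
    (h2 : Q ≤ C2 * s * (1 + W) + C3 * r) (h3 : U ≤ C4 * (r + Q)) (hC3 : 0 ≤ C3) :
    ∃ D, D = 2 * (C2 + C2 * C1 * C4 + C3) ∧
      U ≤ C4 * (1 + D) * (r + s) ∧ W ≤ (C1 * (C4 * (1 + D)) + D) * (r + s) := by
  refine ⟨_, rfl, ?_⟩
  set D := 2 * (C2 + C2 * C1 * C4 + C3) with hD
  have hW : W ≤ (C1 * C4 + 1) * Q + C1 * C4 * r := by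
    have := mul_le_mul_of_nonneg_left h3 hC1
    linarith
  have e1 : C2 * s * (1 + W) ≤ C2 * s * (1 + ((C1 * C4 + 1) * Q + C1 * C4 * r)) := by gcongr
  have e2 : C2 * (C1 * C4 + 1) * s * Q ≤ 1 / 2 * Q := by gcongr
  have e3 : C2 * (C1 * C4) * (s * r) ≤ C2 * (C1 * C4) * r := by
    gcongr
    exact mul_le_of_le_one_left hr hs1
  have hQD : Q ≤ D * (r + s) := by
    have e4 : 0 ≤ C2 * r := by positivity
    have e5 : 0 ≤ (C2 * C1 * C4 + C3) * s := by positivity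
    rw [hD]
    linarith
  have hD0 : 0 ≤ D := by positivity
  have hU : U ≤ C4 * (1 + D) * (r + s) := by
    have : r + Q ≤ (1 + D) * (r + s) := by linarith
    calc U ≤ C4 * (r + Q) := h3
      _ ≤ C4 * ((1 + D) * (r + s)) := by gcongr
      _ = _ := by ring
  refine ⟨hU, ?_⟩
  have := mul_le_mul_of_nonneg_left hU hC1
  linarith

/-- Estimates for a point `z = φ^k x` on the hyperplane `gy + p ⬝ (z - y) = 0`, for an affine map
`φ` with a one-dimensional centre direction `v` transverse to the hyperplane. -/
theorem centre_estimates {N : ℕ} {φ : (Fin N → ℝ) → Fin N → ℝ} {M D : Matrix (Fin N) (Fin N) ℝ}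
    {w v p y x z : Fin N → ℝ} {lam C σ Bv Bw Bp CF Cd Cg c r gy : ℝ} {k : ℕ}
    (hφ : ∀ x y, φ x - φ y = M *ᵥ (x - y)) (hv : M *ᵥ v = lam • v)
    (hw : w ᵥ* M = lam • w) (hwv : w ⬝ᵥ v = 1) (hD : D = M - lam • vecMulVec v w)
    (hC : 0 < C) (hσ0 : 0 < σ) (hσ1 : σ < 1)
    (hpow : ∀ (k : ℕ) (x : Fin N → ℝ), ‖D ^ k *ᵥ x‖ ≤ C * σ ^ k * ‖x‖) (hz : z = φ^[k] x)
    (bv : ‖v‖ ≤ Bv) (bw : ‖w‖ ≤ Bw) (bp : ‖p‖ ≤ Bp) (hgz : gy + p ⬝ᵥ (z - y) = 0)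
    (hgy : |gy| ≤ Cg * r) (hCg : 0 ≤ Cg) (hr : 0 ≤ r) (hc : 0 < c) (hsl : c < |p ⬝ᵥ v|)
    (hx : ‖x - y‖ ≤ CF * (1 + ‖z - y‖)) (hd : ‖φ y - y‖ ≤ Cd * r) :
    ∃ Q, 0 ≤ Q ∧ ‖z - y‖ ≤ Bv * |w ⬝ᵥ (z - y)| + Q ∧
      Q ≤ C * ((1 + N * Bw * Bv) * CF) * σ ^ k * (1 + ‖z - y‖) +
        C / (1 - σ) * ((1 + N * Bw * Bv) * Cd) * r ∧
      |w ⬝ᵥ (z - y)| ≤ (Cg + N * Bp) / c * (r + Q) := by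
  have hBw := (norm_nonneg _).trans bw
  have hBv := (norm_nonneg _).trans bv
  have hBp := (norm_nonneg _).trans bp
  have h1σ : 0 < 1 - σ := by linarith
  have hst : ∀ x, ‖stablePart w v x‖ ≤ (1 + N * Bw * Bv) * ‖x‖ := fun x =>
    (norm_stablePart_le w v x).trans (by gcongr)
  have hdec : z - y = (w ⬝ᵥ (z - y)) • v + stablePart w v (z - y) := by
    simp [stablePart]
  refine ⟨‖stablePart w v (z - y)‖, norm_nonneg _, ?_, ?_, ?_⟩
  · calc ‖z - y‖ = ‖(w ⬝ᵥ (z - y)) • v + stablePart w v (z - y)‖ := by rw [← hdec]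
      _ ≤ ‖(w ⬝ᵥ (z - y)) • v‖ + ‖stablePart w v (z - y)‖ := norm_add_le _ _
      _ ≤ _ := by
        rw [norm_smul, Real.norm_eq_abs, mul_comm]
        gcongr
  · have h1 := norm_stable_iterate_le hφ hv hw hwv hD hC hσ0 hσ1 hpow y x k
    rw [← hz] at h1
    refine h1.trans ?_
    calc C * σ ^ k * ‖stablePart w v (x - y)‖ + C / (1 - σ) * ‖stablePart w v (φ y - y)‖
        ≤ C * σ ^ k * ((1 + N * Bw * Bv) * (CF * (1 + ‖z - y‖))) +
          C / (1 - σ) * ((1 + N * Bw * Bv) * (Cd * r)) := by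
          gcongr
          · exact (hst _).trans (by gcongr)
          · exact (hst _).trans (by gcongr)
      _ = _ := by ring
  · have h1 : (w ⬝ᵥ (z - y)) * (p ⬝ᵥ v) = -(gy + p ⬝ᵥ stablePart w v (z - y)) := by
      rw [hdec, dotProduct_add, dotProduct_smul, smul_eq_mul] at hgz
      linarith
    have h2 : |w ⬝ᵥ (z - y)| * c ≤ Cg * r + N * Bp * ‖stablePart w v (z - y)‖ := by
      calc |w ⬝ᵥ (z - y)| * c ≤ |w ⬝ᵥ (z - y)| * |p ⬝ᵥ v| := by gcongr
        _ = |gy + p ⬝ᵥ stablePart w v (z - y)| := by rw [← abs_mul, h1, abs_neg]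
        _ ≤ |gy| + |p ⬝ᵥ stablePart w v (z - y)| := abs_add_le _ _
        _ ≤ _ := add_le_add hgy ((abs_dotProduct_le _ _).trans (by gcongr))
    rw [div_mul_eq_mul_div, le_div_iff₀ hc]
    have h3 : 0 ≤ Cg * ‖stablePart w v (z - y)‖ := by positivity
    have h4 : 0 ≤ N * Bp * r := by positivity
    linarith

theorem DifferentiableAt.eventually_norm_le {E F : Type*} [NormedAddCommGroup E] [NormedSpace ℝ E]
    [NormedAddCommGroup F] [NormedSpace ℝ F] {g : E → F} {x : E} (hg : DifferentiableAt ℝ g x) :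
    ∀ᶠ y in 𝓝 x, ‖g y‖ ≤ ‖g x‖ + 1 :=
  (hg.continuousAt.norm.eventually (gt_mem_nhds (lt_add_one _))).mono fun _ h => le_of_lt h

attribute [local instance] Matrix.linftyOpNormedAddCommGroup Matrix.linftyOpNormedSpace
  Matrix.linftyOpNormedRing Matrix.linftyOpNormedAlgebra in
theorem MatDiffAt.exists_mulVec_le {N : ℕ} {E : Type*} [NormedAddCommGroup E] [NormedSpace ℝ E]
    {A : E → Matrix (Fin N) (Fin N) ℝ} {ξ₀ : E} (hA : MatDiffAt A ξ₀) :
    ∃ C : ℝ, 0 ≤ C ∧ ∀ᶠ ξ in 𝓝 ξ₀, ∀ x, ‖A ξ *ᵥ x‖ ≤ C * ‖x‖ := by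
  refine ⟨‖A ξ₀‖ + 1, by positivity, ?_⟩
  filter_upwards [hA.eventually_norm_lt (lt_add_one _)] with ξ hξ x
  exact (linfty_opNorm_mulVec _ _).trans (by gcongr)

variable {N K : ℕ} [NeZero N] {f : PWLFamily N K} {l m n : ℕ} {ξ₀ : ℝ × ℝ}
  {𝓛 : Filter (ℕ × ℝ × ℝ)}

theorem IsShrinkingPoint.uVec_dotProduct_edge (h : IsShrinkingPoint f l m n ξ₀)
    (hρ : rhoMax f l m n ξ₀ < 1) :
    uVec f l m n ξ₀ (-1) ⬝ᵥ (cyclePt f (seqS0 l m n) n ξ₀ (-modInv m n) -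
      cyclePt f (seqS0 l m n) n ξ₀ 0) = tConst f l m n ξ₀ (-1) := by
  obtain ⟨-, -, -, -, huv, hedge⟩ := h.centre_eigenvectors hρ
  rw [← neg_sub, ← hedge, dotProduct_neg, dotProduct_smul, huv]; simp

theorem IsShrinkingPoint.wordMap_cmSeq_self (h : IsShrinkingPoint f l m n ξ₀) :
    wordMap f (cmSeq l m n) ξ₀ n (cyclePt f (seqS0 l m n) n ξ₀ 0) =
      cyclePt f (seqS0 l m n) n ξ₀ 0 := by
  rw [cmSeq, h.isCycle_shift.wordMap_zero]
  simpa using h.isCycle_shift.1 0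

theorem IsShrinkingPoint.displacement_isBigO (h : IsShrinkingPoint f l m n ξ₀) (hK : 1 ≤ K) :
    (fun ξ => wordMap f (cmSeq l m n) ξ n (cyclePt f (seqS0 l m n) n ξ₀ 0) -
      cyclePt f (seqS0 l m n) n ξ₀ 0) =O[𝓝 ξ₀] fun ξ => ‖ξ - ξ₀‖ := by
  have := ((differentiableAt_wordMap f hK (cmSeq l m n) n ξ₀
    (differentiableAt_const (cyclePt f (seqS0 l m n) n ξ₀ 0))).sub_const
      (cyclePt f (seqS0 l m n) n ξ₀ 0)).isBigO_sub_norm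
  simpa only [h.wordMap_cmSeq_self, sub_self, sub_zero] using this

/-- A point returning under `k - j` turns around the centre manifold after the map `F`, and lying
on the hyperplane `g = 0`, has centre coordinate close to that of the base point. -/
theorem IsShrinkingPoint.collision_estimate (h : IsShrinkingPoint f l m n ξ₀)
    (hρ : rhoMax f l m n ξ₀ < 1) (hK : 1 ≤ K) (h𝓛 : 𝓛 ≤ atTop ×ˢ 𝓝 ξ₀)
    {F : ℝ × ℝ → (Fin N → ℝ) → Fin N → ℝ} {A : ℝ × ℝ → Matrix (Fin N) (Fin N) ℝ}
    {g : ℝ × ℝ → (Fin N → ℝ) → ℝ} {p : ℝ × ℝ → Fin N → ℝ}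
    (hF : ∀ ξ x y, F ξ x - F ξ y = A ξ *ᵥ (x - y)) (hA : MatDiffAt A ξ₀)
    (hFd : DifferentiableAt ℝ (fun ξ => F ξ (cyclePt f (seqS0 l m n) n ξ₀ 0)) ξ₀)
    (hF0 : F ξ₀ (cyclePt f (seqS0 l m n) n ξ₀ 0) = cyclePt f (seqS0 l m n) n ξ₀ (-modInv m n))
    (hg : ∀ ξ x y, g ξ x - g ξ y = p ξ ⬝ᵥ (x - y)) (hp : DifferentiableAt ℝ p ξ₀)
    (hgd : DifferentiableAt ℝ (fun ξ => g ξ (cyclePt f (seqS0 l m n) n ξ₀ 0)) ξ₀)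
    (hg0 : g ξ₀ (cyclePt f (seqS0 l m n) n ξ₀ 0) = 0)
    (hslope : p ξ₀ ⬝ᵥ vVec f l m n ξ₀ (-1) ≠ 0) (j : ℕ) {z : ℕ × ℝ × ℝ → Fin N → ℝ}
    (hz : ∀ᶠ q in 𝓛, z q = (wordMap f (cmSeq l m n) q.2 n)^[q.1 - j] (F q.2 (z q)) ∧
      g q.2 (z q) = 0) :
    ∃ C σ : ℝ, 0 < σ ∧ σ < 1 ∧ ∀ᶠ q in 𝓛,
      |omegaVec f l m n ξ₀ q.2 ⬝ᵥ (z q - cyclePt f (seqS0 l m n) n ξ₀ 0)| ≤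
        C * (‖q.2 - ξ₀‖ + σ ^ (q.1 - j)) ∧
      |omegaVec f l m n ξ₀ q.2 ⬝ᵥ (F q.2 (z q) - cyclePt f (seqS0 l m n) n ξ₀ 0) -
        tConst f l m n ξ₀ (-1)| ≤ C * (‖q.2 - ξ₀‖ + σ ^ (q.1 - j)) := by
  obtain ⟨hζ, hζd⟩ := h.zetaVec_spec hρ hK
  obtain ⟨hω, hωd⟩ := h.omegaVec_spec hρ hK
  obtain ⟨C, σ, hC, hσ0, hσ1, hpow⟩ := h.stableMat_bound hρ hK
  obtain ⟨CA, hCA, hA'⟩ := hA.exists_mulVec_le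
  set y := cyclePt f (seqS0 l m n) n ξ₀ 0 with hy
  obtain ⟨Cd, hCd, hd⟩ := (h.displacement_isBigO hK).exists_nonneg
  have hgO := hgd.isBigO_sub_norm
  rw [hg0] at hgO
  obtain ⟨Cg, hCg, hgO⟩ := hgO.exists_nonneg
  have htd := differentiableAt_dotProduct hωd (hFd.sub_const y)
  have htO := htd.isBigO_sub_norm
  rw [hF0, h.omegaVec_self hρ hK, h.uVec_dotProduct_edge hρ] at htO
  obtain ⟨Ct, hCt, htO⟩ := htO.exists_nonneg
  have hsl : ∀ᶠ ξ in 𝓝 ξ₀, |p ξ₀ ⬝ᵥ vVec f l m n ξ₀ (-1)| / 2 <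
      |p ξ ⬝ᵥ zetaVec f l m n ξ₀ ξ| := by
    have := (differentiableAt_dotProduct hp hζd).continuousAt.abs
    refine this.eventually (lt_mem_nhds ?_)
    change _ < |p ξ₀ ⬝ᵥ zetaVec f l m n ξ₀ ξ₀|
    rw [h.zetaVec_self hρ hK]
    exact half_lt_self (abs_pos.2 hslope)
  set c := |p ξ₀ ⬝ᵥ vVec f l m n ξ₀ (-1)| / 2 with hc
  have hc0 : 0 < c := half_pos (abs_pos.2 hslope)
  set Bζ := ‖zetaVec f l m n ξ₀ ξ₀‖ + 1
  set Bω := ‖omegaVec f l m n ξ₀ ξ₀‖ + 1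
  set Bp := ‖p ξ₀‖ + 1
  set BF := ‖F ξ₀ y - y‖ + 1
  have hBζ : 0 ≤ Bζ := by positivity
  have hBω : 0 ≤ Bω := by positivity
  have hBp : 0 ≤ Bp := by positivity
  have hBF : 0 ≤ BF := by positivity
  set CP : ℝ := 1 + N * Bω * Bζ with hCPd
  have hCP : 0 ≤ CP := by positivity
  set CF : ℝ := CA + BF with hCFd
  have hCF : 0 ≤ CF := by positivity
  set C2 := C * (CP * CF)
  set C3 := C / (1 - σ) * (CP * Cd)
  set C4 := (Cg + N * Bp) / c
  have h1σ : 0 < 1 - σ := by linarith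
  have hC2 : 0 ≤ C2 := by positivity
  have hC3 : 0 ≤ C3 := by positivity
  have hC4 : 0 ≤ C4 := by positivity
  set D := 2 * (C2 + C2 * Bζ * C4 + C3) with hD
  have hD0 : 0 ≤ D := by positivity
  set E1 := C4 * (1 + D)
  set E2 := Bζ * (C4 * (1 + D)) + D
  have hE1 : 0 ≤ E1 := by positivity
  have hE2 : 0 ≤ E2 := by positivity
  refine ⟨max E1 (N * Bω * CA * E2 + Ct), σ, hσ0, hσ1, ?_⟩
  have hsm : ∀ᶠ q : ℕ × ℝ × ℝ in 𝓛, C2 * (Bζ * C4 + 1) * σ ^ (q.1 - j) ≤ 1 / 2 := by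
    have h1 := (tendsto_pow_atTop_nhds_zero_of_lt_one hσ0.le hσ1).const_mul (C2 * (Bζ * C4 + 1))
    rw [mul_zero] at h1
    have h2 : Tendsto (fun q : ℕ × ℝ × ℝ => q.1 - j) 𝓛 atTop :=
      (tendsto_sub_atTop_nat j).comp (tendsto_fst.mono_left h𝓛)
    exact ((h1.comp h2).eventually (gt_mem_nhds (by norm_num))).mono fun _ h => le_of_lt h
  have htend := (tendsto_snd (f := (atTop : Filter ℕ)) (g := 𝓝 ξ₀)).mono_left h𝓛
  filter_upwards [hz, hsm, htend.eventually hζ, htend.eventually hω, htend.eventually hpow,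
    htend.eventually hA', htend.eventually hd.bound, htend.eventually hgO.bound,
    htend.eventually htO.bound, htend.eventually hsl, htend.eventually hζd.eventually_norm_le,
    htend.eventually hωd.eventually_norm_le, htend.eventually hp.eventually_norm_le,
    htend.eventually (hFd.sub_const y).eventually_norm_le]
    with q hz hsm hζ hω hpow hA hd hg1 ht hsl b1 b2 b3 b4
  obtain ⟨k, ξ⟩ := q
  simp only at hz hsm hζ hω hpow hA hd hg1 ht hsl b1 b2 b3 b4 ⊢
  rw [norm_norm] at hd hg1 ht
  rw [sub_zero] at hg1
  have hFz : F ξ (z (k, ξ)) - y = A ξ *ᵥ (z (k, ξ) - y) + (F ξ y - y) := by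
    rw [← hF]; abel
  have hx : ‖F ξ (z (k, ξ)) - y‖ ≤ CF * (1 + ‖z (k, ξ) - y‖) := by
    rw [hFz]
    have h1 := norm_add_le (A ξ *ᵥ (z (k, ξ) - y)) (F ξ y - y)
    have h2 := hA (z (k, ξ) - y)
    have h3 : 0 ≤ BF * ‖z (k, ξ) - y‖ := by positivity
    rw [hCFd]
    linarith
  obtain ⟨Q, hQ0, hW, hQ, hU⟩ := centre_estimates (Cg := Cg) (y := y) (gy := g ξ y)
    (wordMap_sub f (cmSeq l m n) ξ n) hζ.1 hω.1 hω.2 rfl hC hσ0 hσ1 hpow hz.1 b1 b2 b3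
    (by rw [← hg, hz.2]; ring) hg1 hCg (norm_nonneg _) hc0 hsl hx hd
  rw [← hCPd] at hQ
  obtain ⟨D', rfl, hU', hW'⟩ := collision_absorb hBζ hC2 hC4 (norm_nonneg _)
    (pow_nonneg hσ0.le _) (pow_le_one₀ hσ0.le hσ1.le) hQ0 hsm hW hQ hU hC3
  have hrs : 0 ≤ ‖ξ - ξ₀‖ + σ ^ (k - j) := by positivity
  refine ⟨hU'.trans (by gcongr; exact le_max_left _ _), ?_⟩
  have e : omegaVec f l m n ξ₀ ξ ⬝ᵥ (F ξ (z (k, ξ)) - y) - tConst f l m n ξ₀ (-1) =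
      omegaVec f l m n ξ₀ ξ ⬝ᵥ (A ξ *ᵥ (z (k, ξ) - y)) +
        (omegaVec f l m n ξ₀ ξ ⬝ᵥ (F ξ y - y) - tConst f l m n ξ₀ (-1)) := by
    rw [hFz, dotProduct_add]; ring
  rw [e]
  calc _ ≤ |omegaVec f l m n ξ₀ ξ ⬝ᵥ (A ξ *ᵥ (z (k, ξ) - y))| +
        |omegaVec f l m n ξ₀ ξ ⬝ᵥ (F ξ y - y) - tConst f l m n ξ₀ (-1)| := abs_add_le _ _
    _ ≤ N * Bω * (CA * (E2 * (‖ξ - ξ₀‖ + σ ^ (k - j)))) + Ct * (‖ξ - ξ₀‖ + σ ^ (k - j)) := by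
        refine add_le_add ((abs_dotProduct_le _ _).trans ?_) (ht.trans ?_)
        · gcongr
          exact (hA _).trans (by gcongr)
        · gcongr
          linarith [pow_pos hσ0 (k - j)]
    _ = (N * Bω * CA * E2 + Ct) * (‖ξ - ξ₀‖ + σ ^ (k - j)) := by ring
    _ ≤ _ := by gcongr; exact le_max_right _ _

end Collision

section Collision

variable {N K : ℕ} [NeZero N] {f : PWLFamily N K} {l m n : ℕ} {ξ₀ : ℝ × ℝ}
  {𝓛 : Filter (ℕ × ℝ × ℝ)}

theorem pow_sub_isBigO_inv {ι : Type*} {𝓛 : Filter ι} {k : ι → ℕ} (hk : Tendsto k 𝓛 atTop) {σ : ℝ}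
    (hσ0 : 0 < σ) (hσ1 : σ < 1) (j : ℕ) :
    (fun i => σ ^ (k i - j)) =O[𝓛] fun i => (1 : ℝ) / k i := by
  have h1 : (fun k : ℕ => σ ^ k) =O[atTop] fun k : ℕ => (1 : ℝ) / k := by
    have h2 := (tendsto_self_mul_const_pow_of_lt_one hσ0.le hσ1).isBigO_one ℝ
    have h3 := (isBigO_refl (fun k : ℕ => (1 : ℝ) / k) atTop).mul h2
    refine h3.congr' ?_ (.of_forall fun k => mul_one _)
    filter_upwards [eventually_gt_atTop 0] with k hk
    have : (k : ℝ) ≠ 0 := by positivity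
    field_simp
  have h2 : (fun k : ℕ => σ ^ (k - j)) =O[atTop] fun k : ℕ => σ ^ k := by
    refine IsBigO.of_bound (1 / σ ^ j) ?_
    filter_upwards [eventually_ge_atTop j] with k hk
    rw [Real.norm_of_nonneg (by positivity), Real.norm_of_nonneg (by positivity),
      one_div_mul_eq_div, le_div_iff₀ (by positivity), ← pow_add, Nat.sub_add_cancel hk]
  exact (h2.trans h1).comp_tendsto hk

/-- `collision_estimate` gives the centre coordinate at the entry of the turns (near `t_{-d}`) and
at the exit (near `0`). With `centre_iterate` these are the data of `CentreExpansion.balance`. -/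
theorem IsShrinkingPoint.collision_balance (h : IsShrinkingPoint f l m n ξ₀)
    (hρ : rhoMax f l m n ξ₀ < 1) (hK : 1 ≤ K) (hJ : detJ f l m n ξ₀ ≠ 0)
    (h𝓛 : 𝓛 ≤ atTop ×ˢ 𝓝 ξ₀)
    {F : ℝ × ℝ → (Fin N → ℝ) → Fin N → ℝ} {A : ℝ × ℝ → Matrix (Fin N) (Fin N) ℝ}
    {g : ℝ × ℝ → (Fin N → ℝ) → ℝ} {p : ℝ × ℝ → Fin N → ℝ}
    (hF : ∀ ξ x y, F ξ x - F ξ y = A ξ *ᵥ (x - y)) (hA : MatDiffAt A ξ₀)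
    (hFd : DifferentiableAt ℝ (fun ξ => F ξ (cyclePt f (seqS0 l m n) n ξ₀ 0)) ξ₀)
    (hF0 : F ξ₀ (cyclePt f (seqS0 l m n) n ξ₀ 0) = cyclePt f (seqS0 l m n) n ξ₀ (-modInv m n))
    (hg : ∀ ξ x y, g ξ x - g ξ y = p ξ ⬝ᵥ (x - y)) (hp : DifferentiableAt ℝ p ξ₀)
    (hgd : DifferentiableAt ℝ (fun ξ => g ξ (cyclePt f (seqS0 l m n) n ξ₀ 0)) ξ₀)
    (hg0 : g ξ₀ (cyclePt f (seqS0 l m n) n ξ₀ 0) = 0)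
    (hslope : p ξ₀ ⬝ᵥ vVec f l m n ξ₀ (-1) ≠ 0) (j : ℕ)
    (hz : ∀ᶠ q in 𝓛, ∃ z, z = (wordMap f (cmSeq l m n) q.2 n)^[q.1 - j] (F q.2 z) ∧
      g q.2 z = 0) :
    (fun q : ℕ × ℝ × ℝ => pCoord' f l m n ξ₀ (coordEN f l m n q.2) *
        (∑ i ∈ Finset.range q.1, critEig f l m n ξ₀ q.2 ^ i) - critEig f l m n ξ₀ q.2 ^ q.1) =O[𝓛]
        (fun q => (1 + critEig f l m n ξ₀ q.2 ^ q.1) * (‖q.2 - ξ₀‖ + 1 / q.1)) ∧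
      (fun q : ℕ × ℝ × ℝ => pCoord f l m n ξ₀ (coordEN f l m n q.2) *
        (∑ i ∈ Finset.range q.1, critEig f l m n ξ₀ q.2 ^ i) - 1) =O[𝓛]
        (fun q => (1 + critEig f l m n ξ₀ q.2 ^ q.1) * (‖q.2 - ξ₀‖ + 1 / q.1)) := by
  obtain ⟨z, hz⟩ : ∃ z : ℕ × ℝ × ℝ → Fin N → ℝ, ∀ᶠ q in 𝓛,
      z q = (wordMap f (cmSeq l m n) q.2 n)^[q.1 - j] (F q.2 (z q)) ∧ g q.2 (z q) = 0 :=
    ⟨fun q => Classical.epsilon fun z =>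
      z = (wordMap f (cmSeq l m n) q.2 n)^[q.1 - j] (F q.2 z) ∧ g q.2 z = 0, hz.mono fun q hq => Classical.epsilon_spec hq⟩
  obtain ⟨C, σ, hσ0, hσ1, hest⟩ := h.collision_estimate hρ hK h𝓛 hF hA hFd hF0 hg hp hgd hg0
    hslope j hz
  have H := h.centreExpansion hρ hK hJ h𝓛
  have htend := (tendsto_snd (f := (atTop : Filter ℕ)) (g := 𝓝 ξ₀)).mono_left h𝓛
  set y := cyclePt f (seqS0 l m n) n ξ₀ 0 with hy
  have hε : ∀ e : ℕ × ℝ × ℝ → ℝ, (∀ᶠ q in 𝓛, |e q| ≤ C * (‖q.2 - ξ₀‖ + σ ^ (q.1 - j))) →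
      e =O[𝓛] fun q => ‖q.2 - ξ₀‖ + 1 / (q.1 : ℝ) := by
    intro e he
    obtain ⟨C', hC', hb⟩ := (pow_sub_isBigO_inv H.tendsto_k hσ0 hσ1 j).exists_nonneg
    refine IsBigO.of_bound (|C| * (1 + C')) ?_
    filter_upwards [he, hb.bound] with q h1 h2
    rw [Real.norm_of_nonneg (by positivity), Real.norm_of_nonneg (by positivity)] at h2
    rw [Real.norm_eq_abs, Real.norm_of_nonneg (by positivity)]
    have h3 : 0 ≤ C' * ‖q.2 - ξ₀‖ := by positivity
    have h4 : (0 : ℝ) ≤ 1 / q.1 := by positivity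
    calc |e q| ≤ C * (‖q.2 - ξ₀‖ + σ ^ (q.1 - j)) := h1
      _ ≤ |C| * (‖q.2 - ξ₀‖ + σ ^ (q.1 - j)) := by gcongr; exact le_abs_self C
      _ ≤ |C| * ((1 + C') * (‖q.2 - ξ₀‖ + 1 / q.1)) := by gcongr; linarith
      _ = _ := by ring
  have hdrift : (drift f l m n ξ₀) =O[𝓝 ξ₀] fun ξ => ‖ξ - ξ₀‖ := by
    have h1 : (fun ξ => ‖ξ - ξ₀‖ ^ 2) =O[𝓝 ξ₀] fun ξ => ‖ξ - ξ₀‖ := by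
      have := (isBigO_refl (fun ξ => ‖ξ - ξ₀‖) (𝓝 ξ₀)).mul
        ((tendsto_norm_sub_self ξ₀).isBigO_one ℝ)
      simpa [sq] using this
    have := ((h.drift_isBigO hρ hK).trans h1).sub
      ((h.pCoord_isBigO hK).2.const_mul_left (tConst f l m n ξ₀ (-1)))
    simpa using this
  have hgeom : Tendsto (fun ξ => ∑ i ∈ Finset.range j, critEig f l m n ξ₀ ξ ^ i) (𝓝 ξ₀)
      (𝓝 (∑ i ∈ Finset.range j, critEig f l m n ξ₀ ξ₀ ^ i)) :=
    tendsto_finsetSum _ fun i _ => (h.differentiableAt_critEig hρ hK).continuousAt.pow i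
  have hpowj := (h.differentiableAt_critEig hρ hK).continuousAt.pow j
  refine H.balance (beta := fun q => drift f l m n ξ₀ q.2)
    (h₀ := fun q => omegaVec f l m n ξ₀ q.2 ⬝ᵥ (F q.2 (z q) - y))
    (h₁ := fun q => critEig f l m n ξ₀ q.2 ^ j * (omegaVec f l m n ξ₀ q.2 ⬝ᵥ (z q - y)) +
      drift f l m n ξ₀ q.2 * ∑ i ∈ Finset.range j, critEig f l m n ξ₀ q.2 ^ i)
    h.tConst_neg_one_ne ((h.drift_isBigO hρ hK).comp_tendsto htend)
    (hε _ (hest.mono fun q hq => hq.2)) ?_ ?_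
  · have h1 := ((hpowj.tendsto.isBigO_one ℝ).comp_tendsto htend).mul
      (hε _ (hest.mono fun q hq => hq.1))
    have h2 := (hdrift.mul (hgeom.isBigO_one ℝ)).comp_tendsto htend
    have h3 : (fun q : ℕ × ℝ × ℝ => ‖q.2 - ξ₀‖) =O[𝓛] fun q => ‖q.2 - ξ₀‖ + 1 / (q.1 : ℝ) := by
      refine IsBigO.of_bound 1 (.of_forall fun q => ?_)
      rw [norm_norm, Real.norm_of_nonneg (by positivity), one_mul]
      exact le_add_of_nonneg_right (by positivity)
    simp only [one_mul, Function.comp_def] at h1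
    simp only [mul_one, Function.comp_def] at h2
    exact h1.add (h2.trans h3)
  · filter_upwards [hz, htend.eventually (h.omegaVec_spec hρ hK).1, H.tendsto_k.eventually_ge_atTop j]
      with q hq hω hj
    have hj' : j ≤ q.1 := hj
    have e1 := centre_iterate (wordMap_sub f (cmSeq l m n) q.2 n) hω.1 y (F q.2 (z q)) q.1
    have e2 := centre_iterate (wordMap_sub f (cmSeq l m n) q.2 n) hω.1 y (z q) j
    -- Applying `j` more turns to both sides completes the exponent to `k`. The exit value changes
    -- only by a bounded number of turns.
    have e3 : (wordMap f (cmSeq l m n) q.2 n)^[j] (z q) =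
        (wordMap f (cmSeq l m n) q.2 n)^[q.1] (F q.2 (z q)) := by
      conv_lhs => rw [hq.1]
      rw [← Function.iterate_add_apply, Nat.add_sub_cancel' hj']
    rw [e3] at e2
    exact e2.symm.trans e1

end Collision

section Collision

variable {N K : ℕ} [NeZero N] {f : PWLFamily N K} {l m n mm nm mp np : ℕ} {ξ₀ : ℝ × ℝ}
  {𝓛 : Filter (ℕ × ℝ × ℝ)}

/-- The balance between the drift and the critical multiplier along the filter `𝓛`. -/
def CentreBalanced (f : PWLFamily N K) (l m n : ℕ) (ξ₀ : ℝ × ℝ) (𝓛 : Filter (ℕ × ℝ × ℝ)) : Prop :=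
  (fun q : ℕ × ℝ × ℝ => pCoord' f l m n ξ₀ (coordEN f l m n q.2) *
        (∑ i ∈ Finset.range q.1, critEig f l m n ξ₀ q.2 ^ i) - critEig f l m n ξ₀ q.2 ^ q.1) =O[𝓛]
        (fun q => (1 + critEig f l m n ξ₀ q.2 ^ q.1) * (‖q.2 - ξ₀‖ + 1 / q.1)) ∧
      (fun q : ℕ × ℝ × ℝ => pCoord f l m n ξ₀ (coordEN f l m n q.2) *
        (∑ i ∈ Finset.range q.1, critEig f l m n ξ₀ q.2 ^ i) - 1) =O[𝓛]
        (fun q => (1 + critEig f l m n ξ₀ q.2 ^ q.1) * (‖q.2 - ξ₀‖ + 1 / q.1))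

theorem wordMap_comp_sub (S T : ℤ → Side) (ξ : ℝ × ℝ) (a b : ℕ) (x y : Fin N → ℝ) :
    wordMap f S ξ a (wordMap f T ξ b x) - wordMap f S ξ a (wordMap f T ξ b y) =
      (wordMat f S ξ a * wordMat f T ξ b) *ᵥ (x - y) := by
  rw [wordMap_sub, wordMap_sub, mulVec_mulVec]

theorem differentiableAt_wordMap_const (hK : 1 ≤ K) (S : ℤ → Side) (a : ℕ) (x : Fin N → ℝ) :
    DifferentiableAt ℝ (fun ξ => wordMap f S ξ a x) ξ₀ :=
  differentiableAt_wordMap f hK S a ξ₀ (differentiableAt_const x)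

theorem IsCycle.wordMap_mul_zero {S : ℤ → Side} {n : ℕ} {ξ : ℝ × ℝ} {x : ℤ → Fin N → ℝ}
    (h : IsCycle f S n ξ x) (j : ℕ) : wordMap f S ξ (j * n) (x 0) = x 0 := by
  rw [h.wordMap_zero]
  refine h.eq_of_modEq ?_
  push_cast
  exact Int.modEq_zero_iff_dvd.2 (dvd_mul_left _ _)

theorem IsShrinkingPoint.wordMap_np (h : IsShrinkingPoint f l m n ξ₀)
    (hF : IsFareyRoots m n mm nm mp np) :
    wordMap f (rotSeq l m n) ξ₀ np (cyclePt f (seqS0 l m n) n ξ₀ 0) =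
      cyclePt f (seqS0 l m n) n ξ₀ (-modInv m n) := by
  rw [h.isCycle_rotSeq.wordMap_zero]
  simpa using h.cyclePt_np hF 0

/-- The collision hyperplane is `s = 0` itself, whose slope along `v_{-d}` is `1`. -/
theorem IsShrinkingPoint.balanced_start (h : IsShrinkingPoint f l m n ξ₀)
    (hρ : rhoMax f l m n ξ₀ < 1) (hK : 1 ≤ K) (hJ : detJ f l m n ξ₀ ≠ 0)
    (hF : IsFareyRoots m n mm nm mp np) (h𝓛 : 𝓛 ≤ atTop ×ˢ 𝓝 ξ₀) (j : ℕ)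
    (hb : ∀ᶠ q in 𝓛, IsBorderCollision f l m n mp np q.1 j 0 q.2) :
    CentreBalanced f l m n ξ₀ 𝓛 := by
  have hl1 := h.1
  have hl2 := h.2.1
  refine h.collision_balance hρ hK hJ h𝓛
    (F := fun ξ x => wordMap f (rotSeq l m n) ξ np (wordMap f (seqSld l m n) ξ (j * n) x))
    (g := fun _ x => x 0) (p := fun _ => Pi.single 0 1)
    (fun ξ x y => wordMap_comp_sub _ _ ξ _ _ x y)
    ((matDiffAt_wordMat f hK _ np ξ₀).mul (matDiffAt_wordMat f hK _ (j * n) ξ₀))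
    (differentiableAt_wordMap f hK _ _ _ (differentiableAt_wordMap_const hK _ _ _))
    ?_ (fun _ x y => by simp) (differentiableAt_const _) (differentiableAt_const _)
    ((h.zero_iff 0).2 (Or.inl rfl)) ?_ j ?_
  · rw [h.isCycle_seqSld.wordMap_mul_zero, h.wordMap_np hF]
  · rw [single_dotProduct, one_mul, (h.centre_eigenvectors hρ).2.2.1]
    exact one_ne_zero
  · have hk : Tendsto (Prod.fst : ℕ × ℝ × ℝ → ℕ) 𝓛 atTop := tendsto_fst.mono_left h𝓛
    filter_upwards [hb, hk.eventually_gt_atTop j] with q hq hj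
    obtain ⟨z, hz0, hz⟩ := collision_start hF h.coprime (by omega) (by omega) hj hq
    refine ⟨z, ?_, hz0⟩
    rw [wordMap_mul f (seqSld_add_period l m n)]
    exact hz

/-- The vector equation from `collision_end_succ` is paired, after the link, with the fixed vector
`u_{-d}`. The resulting hyperplane has slope `-(t_{-d}/t_d)(κ_{j+1} - κ_j)` along `v_{-d}`, nonzero
by assumption. -/
theorem IsShrinkingPoint.balanced_end_succ (h : IsShrinkingPoint f l m n ξ₀)
    (hρ : rhoMax f l m n ξ₀ < 1) (hK : 1 ≤ K) (hJ : detJ f l m n ξ₀ ≠ 0)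
    (hF : IsFareyRoots m n mm nm mp np) (h𝓛 : 𝓛 ≤ atTop ×ˢ 𝓝 ξ₀) (j : ℕ)
    (hκ : kappaPlus f l m n ξ₀ (j + 1 : ℕ) ≠ kappaPlus f l m n ξ₀ j)
    (hb : ∀ᶠ q in 𝓛, IsBorderCollision f l m n mp np q.1 (j + 1 : ℕ)
      ((ellK l n np q.1 + (j + 1 : ℕ) - 1) * modInv (levelK m mp q.1) (levelK n np q.1)) q.2) :
    CentreBalanced f l m n ξ₀ 𝓛 := by
  have hl1 := h.1
  have hl2 := h.2.1
  set u := uVec f l m n ξ₀ (-1) with hu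
  have hA := (matDiffAt_wordMat f hK (rotSeq l m n) np ξ₀).mul
    (matDiffAt_wordMat f hK (seqSld l m n) ((j + 1) * n) ξ₀)
  have hA' := (matDiffAt_wordMat f hK (rotSeq l m n) np ξ₀).mul
    ((matDiffAt_wordMat f hK (rotSeq l m n) n ξ₀).mul
      (matDiffAt_wordMat f hK (seqSld l m n) (j * n) ξ₀))
  have hX : DifferentiableAt ℝ (fun ξ => wordMap f (rotSeq l m n) ξ np
      (wordMap f (seqSld l m n) ξ ((j + 1) * n) (cyclePt f (seqS0 l m n) n ξ₀ 0))) ξ₀ :=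
    differentiableAt_wordMap f hK _ _ _ (differentiableAt_wordMap_const hK _ _ _)
  have hX' : DifferentiableAt ℝ (fun ξ => wordMap f (rotSeq l m n) ξ np
      (wordMap f (rotSeq l m n) ξ n
        (wordMap f (seqSld l m n) ξ (j * n) (cyclePt f (seqS0 l m n) n ξ₀ 0)))) ξ₀ :=
    differentiableAt_wordMap f hK _ _ _ (differentiableAt_wordMap f hK _ _ _
      (differentiableAt_wordMap_const hK _ _ _))
  have hfix : wordMap f (rotSeq l m n) ξ₀ n (cyclePt f (seqS0 l m n) n ξ₀ 0) =
      cyclePt f (seqS0 l m n) n ξ₀ 0 := by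
    simpa using h.isCycle_rotSeq.wordMap_mul_zero 1
  refine h.collision_balance hρ hK hJ h𝓛
    (F := fun ξ x => wordMap f (rotSeq l m n) ξ np (wordMap f (seqSld l m n) ξ ((j + 1) * n) x))
    (g := fun ξ x => u ⬝ᵥ (wordMap f (rotSeq l m n) ξ np
        (wordMap f (seqSld l m n) ξ ((j + 1) * n) x) -
      wordMap f (rotSeq l m n) ξ np (wordMap f (rotSeq l m n) ξ n
        (wordMap f (seqSld l m n) ξ (j * n) x))))
    (fun ξ x y => wordMap_comp_sub _ _ ξ _ _ x y) hA hX
    ?_ (fun ξ x y => ?_) ((hA.sub hA').vecMul (differentiableAt_const u))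
    (differentiableAt_dotProduct (differentiableAt_const u) (hX.sub hX')) ?_ ?_ (j + 1) ?_
  · rw [h.isCycle_seqSld.wordMap_mul_zero, h.wordMap_np hF]
  · rw [← dotProduct_sub, sub_sub_sub_comm, wordMap_comp_sub, wordMap_sub, wordMap_comp_sub,
      mulVec_mulVec, ← sub_mulVec, dotProduct_mulVec]
  · rw [h.isCycle_seqSld.wordMap_mul_zero, h.isCycle_seqSld.wordMap_mul_zero, hfix, sub_self,
      dotProduct_zero]
  · obtain ⟨-, -, -, hu1, -⟩ := h.centre_eigenvectors hρ
    have e1 := h.slope_nat hρ hF (j + 1)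
    have e2 := h.slope_nat hρ hF j
    have e3 : u ᵥ* (wordMat f (rotSeq l m n) ξ₀ np * wordMat f (rotSeq l m n) ξ₀ n) =
        u ᵥ* wordMat f (rotSeq l m n) ξ₀ np := by
      rw [← link_comm f hF h.coprime, ← vecMul_vecMul, hu1]
    rw [← dotProduct_mulVec, sub_mulVec, dotProduct_sub, wordMat_mul f (seqSld_add_period l m n),
      wordMat_mul f (seqSld_add_period l m n), e1, ← Matrix.mul_assoc, dotProduct_mulVec,
      ← vecMul_vecMul, e3, vecMul_vecMul, ← dotProduct_mulVec, e2, ← mul_sub]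
    refine mul_ne_zero (neg_ne_zero.2 (div_ne_zero h.tConst_neg_one_ne h.tConst_one_neg.ne))
      (sub_ne_zero.2 hκ)
  · have hk : Tendsto (Prod.fst : ℕ × ℝ × ℝ → ℕ) 𝓛 atTop := tendsto_fst.mono_left h𝓛
    filter_upwards [hb, hk.eventually_gt_atTop (j + 1)] with q hq hj
    obtain ⟨z, hz0, hz⟩ := collision_end_succ hF h.coprime (by omega) (by omega) hj hq
    refine ⟨z, ?_, ?_⟩
    · rw [wordMap_mul f (seqSld_add_period l m n)]
      exact hz
    · rw [wordMap_mul f (seqSld_add_period l m n), wordMap_mul f (seqSld_add_period l m n),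
        Function.iterate_succ_apply', hz0, sub_self, dotProduct_zero]

/-- The collision takes place inside a turn of `S^{(-d)}`. The slope along `v_{-d}` is
`t_{(ℓ-1)d}/t_{-d}`, from the image of the edge at `x_{-d}`. -/
theorem IsShrinkingPoint.balanced_end_zero (h : IsShrinkingPoint f l m n ξ₀)
    (hρ : rhoMax f l m n ξ₀ < 1) (hK : 1 ≤ K) (hJ : detJ f l m n ξ₀ ≠ 0)
    (hF : IsFareyRoots m n mm nm mp np) (h𝓛 : 𝓛 ≤ atTop ×ˢ 𝓝 ξ₀)
    (hb : ∀ᶠ q in 𝓛, IsBorderCollision f l m n mp np q.1 (0 : ℕ)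
      ((ellK l n np q.1 + (0 : ℕ) - 1) * modInv (levelK m mp q.1) (levelK n np q.1)) q.2) :
    CentreBalanced f l m n ξ₀ 𝓛 := by
  have hl1 := h.1
  have hl2 := h.2.1
  have hn := h.n_pos
  refine h.collision_balance hρ hK hJ h𝓛
    (F := fun ξ x => wordMap f (rotSeq l m n) ξ np (wordMap f (cmSeq l m n) ξ n x))
    (g := fun ξ x => wordMap f (cmSeq l m n) ξ (ldRes l m n) x 0)
    (p := fun ξ => Pi.single 0 1 ᵥ* wordMat f (cmSeq l m n) ξ (ldRes l m n))
    (fun ξ x y => wordMap_comp_sub _ _ ξ _ _ x y)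
    ((matDiffAt_wordMat f hK _ np ξ₀).mul (matDiffAt_wordMat f hK _ n ξ₀))
    (differentiableAt_wordMap f hK _ _ _ (differentiableAt_wordMap_const hK _ _ _))
    ?_ (fun ξ x y => ?_) ((matDiffAt_wordMat f hK _ _ ξ₀).vecMul (differentiableAt_const _))
    (differentiableAt_entry (differentiableAt_wordMap_const hK _ _ _) 0) ?_ ?_ 1 ?_
  · rw [h.wordMap_cmSeq_self, h.wordMap_np hF]
  · rw [← dotProduct_mulVec, single_dotProduct, one_mul, ← wordMap_sub]; rfl
  · rw [cmSeq, h.isCycle_shift.wordMap_zero]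
    exact (h.zero_iff _).2 (Or.inr (ldRes_modEq hn))
  · obtain ⟨-, -, -, -, -, hedge⟩ := h.centre_eigenvectors hρ
    have e1 : wordMap f (cmSeq l m n) ξ₀ (ldRes l m n) (cyclePt f (seqS0 l m n) n ξ₀ 0) 0 = 0 := by
      rw [cmSeq, h.isCycle_shift.wordMap_zero]
      exact (h.zero_iff _).2 (Or.inr (ldRes_modEq hn))
    have e2 : wordMap f (cmSeq l m n) ξ₀ (ldRes l m n)
        (cyclePt f (seqS0 l m n) n ξ₀ (-modInv m n)) 0 = tConst f l m n ξ₀ (l - 1) := by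
      rw [cmSeq, h.isCycle_rotSeq.wordMap_eq f, tConst]
      refine congrFun (h.isCycle_rotSeq.eq_of_modEq ?_) 0
      have := (ldRes_modEq (l := l) (m := m) hn).add_left (-modInv m n)
      rwa [show -modInv m n + l * modInv m n = (l - 1) * modInv m n by ring] at this
    have e3 := congrFun (wordMap_sub f (cmSeq l m n) ξ₀ (ldRes l m n)
      (cyclePt f (seqS0 l m n) n ξ₀ 0) (cyclePt f (seqS0 l m n) n ξ₀ (-modInv m n))) 0
    rw [← hedge, mulVec_smul, Pi.sub_apply, e1, e2, Pi.smul_apply, smul_eq_mul] at e3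
    rw [← dotProduct_mulVec, single_dotProduct, one_mul]
    intro h0
    rw [h0, mul_zero, zero_sub, neg_eq_zero] at e3
    exact h.tConst_l_sub_one_neg.ne e3
  · have hk : Tendsto (Prod.fst : ℕ × ℝ × ℝ → ℕ) 𝓛 atTop := tendsto_fst.mono_left h𝓛
    filter_upwards [hb, hk.eventually_ge_atTop 1] with q hq hj
    obtain ⟨z, hz0, hz⟩ := collision_end_zero hF h.coprime (by omega) (by omega) hj hq
    exact ⟨z, hz, hz0⟩

theorem IsShrinkingPoint.balanced_arc (h : IsShrinkingPoint f l m n ξ₀)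
    (hρ : rhoMax f l m n ξ₀ < 1) (hK : 1 ≤ K) (hJ : detJ f l m n ξ₀ ≠ 0)
    (hF : IsFareyRoots m n mm nm mp np) (h𝓛 : 𝓛 ≤ atTop ×ˢ 𝓝 ξ₀) (j : ℕ)
    (hκ : kappaPlus f l m n ξ₀ j ≠ kappaPlus f l m n ξ₀ (j - 1))
    (hb : (∀ᶠ q in 𝓛, IsBorderCollision f l m n mp np q.1 j 0 q.2) ∨
      ∀ᶠ q in 𝓛, IsBorderCollision f l m n mp np q.1 j
      ((ellK l n np q.1 + j - 1) * modInv (levelK m mp q.1) (levelK n np q.1)) q.2) :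
    CentreBalanced f l m n ξ₀ 𝓛 := by
  rcases hb with hb | hb
  · exact h.balanced_start hρ hK hJ hF h𝓛 j hb
  · cases j with
    | zero => exact h.balanced_end_zero hρ hK hJ hF h𝓛 hb
    | succ j =>
      refine h.balanced_end_succ hρ hK hJ hF h𝓛 j ?_ hb
      simpa using hκ

end Collision

/-! ### The critical power when a return word has multiplier `±1`. -/

section Multiplier

/-- An eigenvector for an eigenvalue `μ` of modulus one of `M^k Y` is close to the centre direction
of `M`. -/
theorem centre_multiplier_estimate {N : ℕ} {M D Y : Matrix (Fin N) (Fin N) ℝ} {w v x : Fin N → ℝ}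
    {lam μ C σ Bv Bw CY : ℝ} {k : ℕ} (hv : M *ᵥ v = lam • v) (hw : w ᵥ* M = lam • w)
    (hwv : w ⬝ᵥ v = 1) (hD : D = M - lam • vecMulVec v w) (hC : 0 < C) (hσ0 : 0 < σ)
    (hσ1 : σ < 1) (hpow : ∀ (k : ℕ) (x : Fin N → ℝ), ‖D ^ k *ᵥ x‖ ≤ C * σ ^ k * ‖x‖)
    (bv : ‖v‖ ≤ Bv) (bw : ‖w‖ ≤ Bw) (hY : ∀ x, ‖Y *ᵥ x‖ ≤ CY * ‖x‖) (hCY : 0 ≤ CY)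
    (hμ : |μ| = 1) (hx : x ≠ 0) (heig : (M ^ k * Y) *ᵥ x = μ • x)
    (hsm : C * ((1 + N * Bw * Bv) * CY) * σ ^ k ≤ 1 / 2) :
    ∃ e, lam ^ k * (w ⬝ᵥ (Y *ᵥ v) + e) = μ ∧
      |e| ≤ N * Bw * CY * (2 * (C * ((1 + N * Bw * Bv) * CY)) * Bv) * σ ^ k := by
  have hBw := (norm_nonneg _).trans bw
  have hBv := (norm_nonneg _).trans bv
  have hφ : ∀ x y, M *ᵥ x - M *ᵥ y = M *ᵥ (x - y) := fun x y => (mulVec_sub _ _ _).symm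
  have hit : ∀ (k : ℕ) (y : Fin N → ℝ), (fun x => M *ᵥ x)^[k] y = M ^ k *ᵥ y := by
    intro k y
    induction k with
    | zero => simp
    | succ k ih => rw [Function.iterate_succ_apply', ih, mulVec_mulVec, ← pow_succ']
  have h1 := centre_iterate hφ hw 0 (Y *ᵥ x) k
  have h2 := norm_stable_iterate_le hφ hv hw hwv hD hC hσ0 hσ1 hpow 0 (Y *ᵥ x) k
  simp only [hit, mulVec_zero, sub_zero, dotProduct_zero, zero_mul, add_zero] at h1 h2
  have hst0 : stablePart w v (0 : Fin N → ℝ) = 0 := by simp [stablePart]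
  rw [hst0, norm_zero, mul_zero, add_zero] at h2
  rw [mulVec_mulVec, heig] at h1 h2
  have hstμ : stablePart w v (μ • x) = μ • stablePart w v x := by
    simp [stablePart, smul_sub, smul_smul]
  rw [hstμ, norm_smul, Real.norm_eq_abs, hμ, one_mul] at h2
  rw [dotProduct_smul, smul_eq_mul] at h1
  set s := stablePart w v x with hs
  have hdec : x = (w ⬝ᵥ x) • v + s := by simp [hs, stablePart]
  set G := C * ((1 + N * Bw * Bv) * CY) with hG
  have hG0 : 0 ≤ G := by positivity
  have hsle : ‖s‖ ≤ G * σ ^ k * ‖x‖ := by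
    refine h2.trans ?_
    calc C * σ ^ k * ‖stablePart w v (Y *ᵥ x)‖
        ≤ C * σ ^ k * ((1 + N * Bw * Bv) * (CY * ‖x‖)) := by
          gcongr
          refine (norm_stablePart_le _ _ _).trans ?_
          gcongr
          exact hY x
      _ = _ := by rw [hG]; ring
  have hxle : ‖x‖ ≤ Bv * |w ⬝ᵥ x| + ‖s‖ := by
    calc ‖x‖ = ‖(w ⬝ᵥ x) • v + s‖ := by rw [← hdec]
      _ ≤ ‖(w ⬝ᵥ x) • v‖ + ‖s‖ := norm_add_le _ _
      _ ≤ _ := by rw [norm_smul, Real.norm_eq_abs, mul_comm]; gcongr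
  have hx2 : ‖x‖ ≤ 2 * (Bv * |w ⬝ᵥ x|) := by
    have : G * σ ^ k * ‖x‖ ≤ 1 / 2 * ‖x‖ := by gcongr
    linarith
  have hu : w ⬝ᵥ x ≠ 0 := by
    intro h0
    rw [h0, abs_zero, mul_zero, mul_zero] at hx2
    exact hx (norm_le_zero_iff.1 hx2)
  refine ⟨(w ⬝ᵥ (Y *ᵥ s)) / (w ⬝ᵥ x), ?_, ?_⟩
  · have h3 : w ⬝ᵥ (Y *ᵥ x) = (w ⬝ᵥ x) * (w ⬝ᵥ (Y *ᵥ v)) + w ⬝ᵥ (Y *ᵥ s) := by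
      conv_lhs => rw [hdec]
      rw [mulVec_add, mulVec_smul, dotProduct_add, dotProduct_smul, smul_eq_mul]
    rw [h3] at h1
    field_simp
    linarith
  · rw [abs_div, div_le_iff₀ (abs_pos.2 hu)]
    calc |w ⬝ᵥ (Y *ᵥ s)| ≤ N * ‖w‖ * ‖Y *ᵥ s‖ := abs_dotProduct_le _ _
      _ ≤ N * Bw * (CY * (G * σ ^ k * (2 * (Bv * |w ⬝ᵥ x|)))) := by
        gcongr
        refine (hY s).trans ?_
        gcongr
        exact hsle.trans (by gcongr)
      _ = _ := by ring

variable {N K : ℕ} [NeZero N] {f : PWLFamily N K} {l m n mm nm mp np : ℕ} {ξ₀ : ℝ × ℝ}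
  {𝓛 : Filter (ℕ × ℝ × ℝ)}

/-- The eigenvector is forced close to the centre direction, where the product acts as `λ^(k-j)`
times a factor tending to `y`. Solving for the power and multiplying by `λ^j = 1 + O(r)` gives the
claim. -/
theorem IsShrinkingPoint.pow_of_multiplier (h : IsShrinkingPoint f l m n ξ₀)
    (hρ : rhoMax f l m n ξ₀ < 1) (hK : 1 ≤ K) (hJ : detJ f l m n ξ₀ ≠ 0)
    (h𝓛 : 𝓛 ≤ atTop ×ˢ 𝓝 ξ₀) {Y : ℝ × ℝ → Matrix (Fin N) (Fin N) ℝ} (hY : MatDiffAt Y ξ₀) {y : ℝ}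
    (hy : uVec f l m n ξ₀ (-1) ⬝ᵥ (Y ξ₀ *ᵥ vVec f l m n ξ₀ (-1)) = y) (hy0 : y ≠ 0) (j : ℕ)
    {μ : ℝ} (hμ : |μ| = 1)
    (hx : ∀ᶠ q in 𝓛, ∃ x : Fin N → ℝ, x ≠ 0 ∧
      (wordMat f (cmSeq l m n) q.2 n ^ (q.1 - j) * Y q.2) *ᵥ x = μ • x) :
    (fun q : ℕ × ℝ × ℝ => critEig f l m n ξ₀ q.2 ^ q.1 - μ / y) =O[𝓛]
      fun q => ‖q.2 - ξ₀‖ + 1 / (q.1 : ℝ) := by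
  have H := h.centreExpansion hρ hK hJ h𝓛
  have htend := (tendsto_snd (f := (atTop : Filter ℕ)) (g := 𝓝 ξ₀)).mono_left h𝓛
  obtain ⟨hζ, hζd⟩ := h.zetaVec_spec hρ hK
  obtain ⟨hω, hωd⟩ := h.omegaVec_spec hρ hK
  obtain ⟨C, σ, hC, hσ0, hσ1, hpow⟩ := h.stableMat_bound hρ hK
  obtain ⟨CY, hCY, hY'⟩ := hY.exists_mulVec_le
  set Bζ := ‖zetaVec f l m n ξ₀ ξ₀‖ + 1
  set Bω := ‖omegaVec f l m n ξ₀ ξ₀‖ + 1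
  have hlam : ∀ᶠ q in 𝓛, 0 < critEig f l m n ξ₀ q.2 := H.tendsto_lam.eventually
    (lt_mem_nhds one_pos)
  -- the slope along the centre direction
  have hyd := differentiableAt_dotProduct hωd (hY.mulVec hζd)
  have hyO := hyd.isBigO_sub_norm
  rw [h.omegaVec_self hρ hK, h.zetaVec_self hρ hK, hy] at hyO
  replace hyO := hyO.comp_tendsto htend
  have hσO := pow_sub_isBigO_inv H.tendsto_k hσ0 hσ1 j
  have hsm : ∀ᶠ q : ℕ × ℝ × ℝ in 𝓛,
      C * ((1 + N * Bω * Bζ) * CY) * σ ^ (q.1 - j) ≤ 1 / 2 := by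
    have h1 := (hσO.trans_tendsto H.tendsto_inv_k).const_mul (C * ((1 + N * Bω * Bζ) * CY))
    rw [mul_zero] at h1
    exact (h1.eventually (gt_mem_nhds (by norm_num))).mono fun _ h => le_of_lt h
  have hex : ∀ᶠ q in 𝓛, ∃ e, critEig f l m n ξ₀ q.2 ^ (q.1 - j) * (omegaVec f l m n ξ₀ q.2 ⬝ᵥ
      (Y q.2 *ᵥ zetaVec f l m n ξ₀ q.2) + e) = μ ∧
      |e| ≤ N * Bω * CY * (2 * (C * ((1 + N * Bω * Bζ) * CY)) * Bζ) * σ ^ (q.1 - j) := by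
    filter_upwards [hx, hsm, htend.eventually hζ, htend.eventually hω, htend.eventually hpow,
      htend.eventually hY', htend.eventually hζd.eventually_norm_le,
      htend.eventually hωd.eventually_norm_le] with q hx hsm hζ hω hpow hY b1 b2
    obtain ⟨x, hx0, hx⟩ := hx
    exact centre_multiplier_estimate hζ.1 hω.1 hω.2 rfl hC hσ0 hσ1 hpow b1 b2 hY hCY hμ hx0 hx hsm
  set ε : ℕ × ℝ × ℝ → ℝ := fun q => ‖q.2 - ξ₀‖ + 1 / (q.1 : ℝ) with hε
  have hεn : ∀ q, 0 ≤ ε q := fun q => by positivity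
  have hε0 : Tendsto ε 𝓛 (𝓝 0) := by
    simpa only [add_zero] using H.tendsto_r.add H.tendsto_inv_k
  obtain ⟨C1, hC1, hyO⟩ := hyO.exists_nonneg
  obtain ⟨C2, hC2, hσO⟩ := hσO.exists_nonneg
  set E := N * Bω * CY * (2 * (C * ((1 + N * Bω * Bζ) * CY)) * Bζ) with hE
  have hE0 : 0 ≤ E := by positivity
  set G := C1 + E * C2 with hG
  have hG0 : 0 ≤ G := by positivity
  have hy1 : 0 < |y| := abs_pos.2 hy0
  have hGs : ∀ᶠ q in 𝓛, G * ε q < |y| / 2 := by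
    have := hε0.const_mul G
    rw [mul_zero] at this
    exact this.eventually (gt_mem_nhds (half_pos hy1))
  have hk' : (fun q : ℕ × ℝ × ℝ => critEig f l m n ξ₀ q.2 ^ (q.1 - j) - μ / y) =O[𝓛] ε ∧
      ∀ᶠ q in 𝓛, |critEig f l m n ξ₀ q.2 ^ (q.1 - j)| ≤ 2 / |y| := by
    have key : ∀ᶠ q in 𝓛, |critEig f l m n ξ₀ q.2 ^ (q.1 - j)| ≤ 2 / |y| ∧
        |critEig f l m n ξ₀ q.2 ^ (q.1 - j) - μ / y| ≤ 2 / |y| * G / |y| * ε q := by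
      filter_upwards [hex, hyO.bound, hσO.bound, hGs] with q he h1 h2 hs
      obtain ⟨e, he, hele⟩ := he
      simp only [Function.comp_apply] at h1
      rw [Real.norm_eq_abs, norm_norm] at h1
      rw [Real.norm_of_nonneg (by positivity), Real.norm_of_nonneg (by positivity)] at h2
      set Λ := critEig f l m n ξ₀ q.2 ^ (q.1 - j)
      set a := omegaVec f l m n ξ₀ q.2 ⬝ᵥ (Y q.2 *ᵥ zetaVec f l m n ξ₀ q.2)
      have hd : |a + e - y| ≤ G * ε q := by
        have h3 : |a + e - y| ≤ |a - y| + |e| := by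
          rw [show a + e - y = (a - y) + e by ring]; exact abs_add_le _ _
        have h4 : E * σ ^ (q.1 - j) ≤ E * (C2 * (1 / (q.1 : ℝ))) := by gcongr
        have h5 : 0 ≤ C1 * (1 / (q.1 : ℝ)) := by positivity
        have h6 : 0 ≤ E * C2 * ‖q.2 - ξ₀‖ := by positivity
        simp only [hG, hε]
        linarith
      have hae : |y| / 2 ≤ |a + e| := by
        have := abs_sub_abs_le_abs_sub y (a + e)
        rw [abs_sub_comm] at this
        linarith
      have hΛ : |Λ| * |a + e| = 1 := by rw [← abs_mul, he, hμ]
      have hΛle : |Λ| ≤ 2 / |y| := by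
        rw [le_div_iff₀ hy1]
        nlinarith [abs_nonneg Λ]
      refine ⟨hΛle, ?_⟩
      have e1 : Λ - μ / y = -(Λ * (a + e - y)) / y := by
        rw [← he]; field_simp; ring
      rw [e1, abs_div, abs_neg, abs_mul]
      calc |Λ| * |a + e - y| / |y| ≤ 2 / |y| * (G * ε q) / |y| := by gcongr
        _ = _ := by ring
    refine ⟨IsBigO.of_bound (2 / |y| * G / |y|) (key.mono fun q hq => ?_),
      key.mono fun q hq => hq.1⟩
    rw [Real.norm_eq_abs, Real.norm_of_nonneg (hεn q)]
    exact hq.2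
  have hj : (fun q : ℕ × ℝ × ℝ => critEig f l m n ξ₀ q.2 ^ j - 1) =O[𝓛] ε := by
    have hpd := ((h.differentiableAt_critEig hρ hK).pow j).isBigO_sub_norm
    simp only [Pi.pow_apply] at hpd
    rw [(h.critEig_spec hρ hK).1, one_pow] at hpd
    refine (hpd.comp_tendsto htend).trans (IsBigO.of_bound 1 (.of_forall fun q => ?_))
    simp only [Function.comp_apply]
    rw [norm_norm, Real.norm_of_nonneg (hεn q), one_mul]
    exact le_add_of_nonneg_right (by positivity)
  have hb : (fun q : ℕ × ℝ × ℝ => critEig f l m n ξ₀ q.2 ^ (q.1 - j)) =O[𝓛]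
      fun _ => (1 : ℝ) := by
    refine IsBigO.of_bound (2 / |y|) (hk'.2.mono fun q hq => ?_)
    rw [norm_one, mul_one]; exact hq
  have h1 := hb.mul hj
  simp only [one_mul] at h1
  refine (h1.add hk'.1).congr' ?_ EventuallyEq.rfl
  filter_upwards [H.tendsto_k.eventually_ge_atTop j] with q hq
  have hq' : j ≤ q.1 := hq
  conv_rhs => rw [← Nat.sub_add_cancel hq', pow_add]
  ring

end Multiplier

/-! ### Location of the arcs and of their end points. -/

section Endpoints

variable {N K : ℕ} [NeZero N] {f : PWLFamily N K} {l m n mm nm mp np : ℕ} {ξ₀ : ℝ × ℝ}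
  {𝓛 : Filter (ℕ × ℝ × ℝ)}

theorem exists_eigenvector_of_det {N : ℕ} {M : Matrix (Fin N) (Fin N) ℝ} {μ : ℝ}
    (h : (μ • (1 : Matrix (Fin N) (Fin N) ℝ) - M).det = 0) : ∃ x, x ≠ 0 ∧ M *ᵥ x = μ • x := by
  obtain ⟨x, hx, h0⟩ := exists_mulVec_eq_zero_iff.2 h
  refine ⟨x, hx, ?_⟩
  rw [sub_mulVec, smul_mulVec, one_mulVec, sub_eq_zero] at h0
  exact h0.symm

theorem IsArcEnd.exists_eigenvector {j : ℤ} {k : ℕ} {ξ : ℝ × ℝ}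
    (hκ : kappaPlus f l m n ξ₀ j ≠ 0) (h : IsArcEnd f l m n ξ₀ mp np k j ξ) :
    ∃ x, x ≠ 0 ∧ wordMat f (seqG l m n mp np k j) ξ (levelK n np k) *ᵥ x =
      (if 0 < kappaPlus f l m n ξ₀ j then (1 : ℝ) else -1) • x := by
  refine exists_eigenvector_of_det ?_
  split_ifs with h0
  · rw [one_smul]
    exact (h.1 h0).det_eq_zero
  · rw [neg_smul, one_smul]
    exact (h.2 (lt_of_le_of_ne (not_lt.1 h0) hκ)).2

/-- Both kinds of end point make `1` or `-1` an eigenvalue of the matrix of `G^+[k,j]`. As `κ_j ≠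
0`, this determines a finite nonzero limit of `λ^k`, the same for all `k`. -/
theorem IsShrinkingPoint.pow_of_arcEnd (h : IsShrinkingPoint f l m n ξ₀)
    (hρ : rhoMax f l m n ξ₀ < 1) (hK : 1 ≤ K) (hJ : detJ f l m n ξ₀ ≠ 0)
    (hF : IsFareyRoots m n mm nm mp np) {j : ℤ} (hj : -1 ≤ j)
    (hκ : kappaPlus f l m n ξ₀ j ≠ 0) :
    ∃ τ : ℝ, τ ≠ 0 ∧ ∀ 𝓛 : Filter (ℕ × ℝ × ℝ), 𝓛 ≤ atTop ×ˢ 𝓝 ξ₀ →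
      (∀ᶠ q in 𝓛, IsArcEnd f l m n ξ₀ mp np q.1 j q.2) →
      (fun q : ℕ × ℝ × ℝ => critEig f l m n ξ₀ q.2 ^ q.1 - τ) =O[𝓛]
      fun q => ‖q.2 - ξ₀‖ + 1 / (q.1 : ℝ) := by
  have hl1 := h.1
  have hl2 := h.2.1
  set μ : ℝ := if 0 < kappaPlus f l m n ξ₀ j then 1 else -1 with hμd
  have hμ : |μ| = 1 := by rw [hμd]; split_ifs <;> simp
  have hμ0 : μ ≠ 0 := by intro h0; rw [h0] at hμ; simp at hμ
  obtain ⟨i, rfl⟩ | rfl : (∃ i : ℕ, j = i) ∨ j = -1 := by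
    rcases hj.lt_or_eq with hj | rfl
    · exact Or.inl ⟨j.toNat, by omega⟩
    · exact Or.inr rfl
  · have hy := h.slope_nat hρ hF i
    have hy0 : -(tConst f l m n ξ₀ (-1) / tConst f l m n ξ₀ 1) * kappaPlus f l m n ξ₀ i ≠ 0 :=
      mul_ne_zero (neg_ne_zero.2 (div_ne_zero h.tConst_neg_one_ne h.tConst_one_neg.ne)) hκ
    refine ⟨_, div_ne_zero hμ0 hy0, fun 𝓛 h𝓛 hend => ?_⟩
    refine h.pow_of_multiplier hρ hK hJ h𝓛 (Y := fun ξ => wordMat f (rotSeq l m n) ξ np *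
      wordMat f (seqSld l m n) ξ n ^ i) ((matDiffAt_wordMat f hK _ np ξ₀).mul
      ((matDiffAt_wordMat f hK _ n ξ₀).pow i)) hy hy0 i hμ ?_
    have hk : Tendsto (Prod.fst : ℕ × ℝ × ℝ → ℕ) 𝓛 atTop := tendsto_fst.mono_left h𝓛
    filter_upwards [hend, hk.eventually_gt_atTop i] with q hq hik
    rw [← wordMat_seqG f hF h.coprime (by omega) (by omega) hik]
    exact hq.exists_eigenvector hκ
  · have hy := h.slope_neg_one hρ hF
    have hy0 : -(tConst f l m n ξ₀ (l - 1) / tConst f l m n ξ₀ (l + 1)) *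
        kappaPlus f l m n ξ₀ (-1) ≠ 0 :=
      mul_ne_zero (neg_ne_zero.2 (div_ne_zero h.tConst_l_sub_one_neg.ne h.tConst_l_add_one_ne)) hκ
    refine ⟨_, div_ne_zero hμ0 hy0, fun 𝓛 h𝓛 hend => ?_⟩
    refine h.pow_of_multiplier hρ hK hJ h𝓛 (Y := fun ξ => wordMat f (rotSeq l m n) ξ np *
      wordMat f (seqS0 l m n) ξ n) ((matDiffAt_wordMat f hK _ np ξ₀).mul
      (matDiffAt_wordMat f hK _ n ξ₀)) hy hy0 1 hμ ?_
    have hk : Tendsto (Prod.fst : ℕ × ℝ × ℝ → ℕ) 𝓛 atTop := tendsto_fst.mono_left h𝓛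
    filter_upwards [hend, hk.eventually_ge_atTop 1] with q hq hik
    obtain ⟨x, hx0, hx⟩ := hq.exists_eigenvector hκ
    rw [wordMat_seqG_neg_one f hF h.coprime (by omega) (by omega) hik, ← mulVec_mulVec] at hx
    -- Cyclic permutation of the factors: the image of `x` under the right-hand factors is an
    -- eigenvector of the permuted product. It is nonzero because the remaining factor maps it to `μ
    -- x`.
    refine ⟨(wordMat f (cmSeq l m n) q.2 n ^ (q.1 - 1) * wordMat f (rotSeq l m n) q.2 np) *ᵥ x,
      fun h0 => ?_, ?_⟩
    · rw [h0, mulVec_zero] at hx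
      exact smul_ne_zero hμ0 hx0 hx.symm
    · rw [← Matrix.mul_assoc, ← mulVec_mulVec, hx, mulVec_smul]

/-- The condition for a point to lie on one of the two curves bounding the mode-locking region. -/
def IsArcCollision (f : PWLFamily N K) (l m n mp np k j : ℕ) (ξ : ℝ × ℝ) : Prop :=
  IsBorderCollision f l m n mp np k j 0 ξ ∨ IsBorderCollision f l m n mp np k j
    ((ellK l n np k + j - 1) * modInv (levelK m mp k) (levelK n np k)) ξ

/-- The type of collision may vary with the pair `(k, ξ)`, so the filter is split into two pieces,
each of one type. -/
theorem IsShrinkingPoint.balanced_collision (h : IsShrinkingPoint f l m n ξ₀)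
    (hρ : rhoMax f l m n ξ₀ < 1) (hK : 1 ≤ K) (hJ : detJ f l m n ξ₀ ≠ 0)
    (hF : IsFareyRoots m n mm nm mp np) (h𝓛 : 𝓛 ≤ atTop ×ˢ 𝓝 ξ₀) (j : ℕ)
    (hκ : kappaPlus f l m n ξ₀ j ≠ kappaPlus f l m n ξ₀ (j - 1))
    (hb : ∀ᶠ q in 𝓛, IsArcCollision f l m n mp np q.1 j q.2) :
    CentreBalanced f l m n ξ₀ 𝓛 := by
  have hsplit : 𝓛 = 𝓛 ⊓ 𝓟 {q | IsBorderCollision f l m n mp np q.1 j 0 q.2} ⊔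
      𝓛 ⊓ 𝓟 {q | IsBorderCollision f l m n mp np q.1 j
        ((ellK l n np q.1 + j - 1) * modInv (levelK m mp q.1) (levelK n np q.1)) q.2} := by
    rw [← inf_sup_left, sup_principal, eq_comm, inf_eq_left, le_principal_iff]
    exact hb
  have h1 := h.balanced_arc hρ hK hJ hF (inf_le_left.trans h𝓛) j hκ
    (Or.inl (eventually_inf_principal.2 (.of_forall fun q hq => hq)) :
      (∀ᶠ q in 𝓛 ⊓ 𝓟 {q | IsBorderCollision f l m n mp np q.1 j 0 q.2}, _) ∨ _)
  have h2 := h.balanced_arc hρ hK hJ hF (inf_le_left.trans h𝓛) j hκ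
    (Or.inr (eventually_inf_principal.2 (.of_forall fun q hq => hq)) :
      _ ∨ (∀ᶠ q in 𝓛 ⊓ 𝓟 {q | IsBorderCollision f l m n mp np q.1 j
        ((ellK l n np q.1 + j - 1) * modInv (levelK m mp q.1) (levelK n np q.1)) q.2}, _))
  rw [hsplit]
  exact ⟨h1.1.sup h2.1, h1.2.sup h2.2⟩

theorem eventually_le_div_of_isBigO {g : ℕ × ℝ × ℝ → ℝ} (h : g =O[𝓛] fun q => (1 : ℝ) / q.1) :
    ∃ C : ℝ, 0 ≤ C ∧ ∀ᶠ q in 𝓛, |g q| ≤ C / q.1 := by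
  obtain ⟨C, hC, hb⟩ := h.exists_nonneg
  refine ⟨C, hC, hb.bound.mono fun q hq => ?_⟩
  rwa [Real.norm_eq_abs, Real.norm_of_nonneg (by positivity), mul_one_div] at hq

/-- Position of the end points of the arcs. -/
theorem IsShrinkingPoint.arcEnd_relation (h : IsShrinkingPoint f l m n ξ₀)
    (hρ : rhoMax f l m n ξ₀ < 1) (hK : 1 ≤ K) (hJ : detJ f l m n ξ₀ ≠ 0)
    (hF : IsFareyRoots m n mm nm mp np) (j : ℕ)
    (hκ : kappaPlus f l m n ξ₀ j ≠ kappaPlus f l m n ξ₀ (j - 1))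
    {i : ℤ} (hi : -1 ≤ i) (hκi : kappaPlus f l m n ξ₀ i ≠ 0) :
    ∃ τ A B C : ℝ, 0 < τ ∧ 0 < A ∧ 0 ≤ C ∧ ∀ᶠ q : ℕ × ℝ × ℝ in atTop ×ˢ 𝓝 ξ₀,
      IsArcEnd f l m n ξ₀ mp np q.1 i q.2 → IsArcCollision f l m n mp np q.1 j q.2 →
      (A ≤ q.1 * pCoord f l m n ξ₀ (coordEN f l m n q.2) ∧
        q.1 * pCoord f l m n ξ₀ (coordEN f l m n q.2) ≤ B) ∧
      |pCoord' f l m n ξ₀ (coordEN f l m n q.2) / pCoord f l m n ξ₀ (coordEN f l m n q.2) - τ| ≤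
        C / q.1 ∧
      |q.1 * (pCoord' f l m n ξ₀ (coordEN f l m n q.2) - pCoord f l m n ξ₀ (coordEN f l m n q.2)) -
        Real.log (pCoord' f l m n ξ₀ (coordEN f l m n q.2) /
          pCoord f l m n ξ₀ (coordEN f l m n q.2))| ≤ C / q.1 := by
  obtain ⟨τ, hτ0, hτ⟩ := h.pow_of_arcEnd hρ hK hJ hF hi hκi
  set 𝓛 : Filter (ℕ × ℝ × ℝ) := (atTop ×ˢ 𝓝 ξ₀) ⊓ 𝓟 {q | IsArcEnd f l m n ξ₀ mp np q.1 i q.2 ∧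
    IsArcCollision f l m n mp np q.1 j q.2} with h𝓛d
  have h𝓛 : 𝓛 ≤ atTop ×ˢ 𝓝 ξ₀ := inf_le_left
  have hmem : ∀ᶠ q in 𝓛, IsArcEnd f l m n ξ₀ mp np q.1 i q.2 ∧
      IsArcCollision f l m n mp np q.1 j q.2 :=
    eventually_inf_principal.2 (.of_forall fun q hq => hq)
  have hpow := hτ 𝓛 h𝓛 (hmem.mono fun q hq => hq.1)
  have hbal := h.balanced_collision hρ hK hJ hF h𝓛 j hκ (hmem.mono fun q hq => hq.2)
  have H := h.centreExpansion hρ hK hJ h𝓛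
  have hlam : ∀ᶠ q in 𝓛, 0 < critEig f l m n ξ₀ q.2 := H.tendsto_lam.eventually
    (lt_mem_nhds one_pos)
  -- As `λ^k` is eventually positive, it is at least as close to `|τ|` as to `τ`, so the sign of `τ`
  -- need not be determined.
  have hpow' : (fun q : ℕ × ℝ × ℝ => critEig f l m n ξ₀ q.2 ^ q.1 - |τ|) =O[𝓛]
      fun q => ‖q.2 - ξ₀‖ + 1 / (q.1 : ℝ) := by
    refine IsBigO.trans (IsBigO.of_bound 1 ?_) hpow
    filter_upwards [hlam] with q hq
    rw [one_mul]
    have := abs_abs_sub_abs_le (critEig f l m n ξ₀ q.2 ^ q.1) τ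
    rwa [abs_of_pos (pow_pos hq _)] at this
  have hε0 : Tendsto (fun q : ℕ × ℝ × ℝ => ‖q.2 - ξ₀‖ + 1 / (q.1 : ℝ)) 𝓛 (𝓝 0) := by
    simpa only [add_zero] using H.tendsto_r.add H.tendsto_inv_k
  have hτa : 0 < |τ| := abs_pos.2 hτ0
  have hbd : ∀ᶠ q in 𝓛, |τ| / 2 ≤ critEig f l m n ξ₀ q.2 ^ q.1 ∧
      critEig f l m n ξ₀ q.2 ^ q.1 ≤ 2 * |τ| := by
    have := (hpow'.trans_tendsto hε0).add_const |τ|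
    simp only [sub_add_cancel, zero_add] at this
    filter_upwards [this.eventually (lt_mem_nhds (half_lt_self hτa)),
      this.eventually (gt_mem_nhds (show |τ| < 2 * |τ| by linarith))] with q h1 h2
    exact ⟨h1.le, h2.le⟩
  obtain ⟨⟨A, B, hA, hAB⟩, hr, hq, hlog⟩ := H.log_relation_of_pow_bounded hbal.1 hbal.2
    (half_pos hτa) hbd
  have hq' := hq.add (hpow'.trans (hr.add (isBigO_refl _ _)))
  simp only [sub_add_sub_cancel] at hq'
  obtain ⟨C1, hC1, h1⟩ := eventually_le_div_of_isBigO hq'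
  obtain ⟨C2, hC2, h2⟩ := eventually_le_div_of_isBigO hlog
  refine ⟨|τ|, A, B, max C1 C2, hτa, hA, hC1.trans (le_max_left _ _), ?_⟩
  have hall := (hAB.and (h1.and h2))
  rw [h𝓛d, eventually_inf_principal] at hall
  filter_upwards [hall] with q hq he hc
  obtain ⟨a1, a2, a3⟩ := hq ⟨he, hc⟩
  exact ⟨a1, a2.trans (by gcongr; exact le_max_left _ _), a3.trans (by gcongr; exact le_max_right _ _)⟩

/-- Position of the points of the arcs. -/
theorem IsShrinkingPoint.arc_relation (h : IsShrinkingPoint f l m n ξ₀)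
    (hρ : rhoMax f l m n ξ₀ < 1) (hK : 1 ≤ K) (hJ : detJ f l m n ξ₀ ≠ 0)
    (hF : IsFareyRoots m n mm nm mp np) (j : ℕ)
    (hκ : kappaPlus f l m n ξ₀ j ≠ kappaPlus f l m n ξ₀ (j - 1)) {τ₁ : ℝ} (τ₂ : ℝ) (hτ₁ : 0 < τ₁) :
    ∃ A B C : ℝ, 0 < A ∧ 0 ≤ C ∧ ∀ᶠ q : ℕ × ℝ × ℝ in atTop ×ˢ 𝓝 ξ₀,
      IsArcCollision f l m n mp np q.1 j q.2 → pCoord f l m n ξ₀ (coordEN f l m n q.2) ≠ 0 →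
      τ₁ ≤ pCoord' f l m n ξ₀ (coordEN f l m n q.2) / pCoord f l m n ξ₀ (coordEN f l m n q.2) →
      pCoord' f l m n ξ₀ (coordEN f l m n q.2) / pCoord f l m n ξ₀ (coordEN f l m n q.2) ≤ τ₂ →
      (A ≤ q.1 * pCoord f l m n ξ₀ (coordEN f l m n q.2) ∧
        q.1 * pCoord f l m n ξ₀ (coordEN f l m n q.2) ≤ B) ∧
      |q.1 * (pCoord' f l m n ξ₀ (coordEN f l m n q.2) - pCoord f l m n ξ₀ (coordEN f l m n q.2)) -
        Real.log (pCoord' f l m n ξ₀ (coordEN f l m n q.2) /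
          pCoord f l m n ξ₀ (coordEN f l m n q.2))| ≤ C / q.1 := by
  set 𝓛 : Filter (ℕ × ℝ × ℝ) := (atTop ×ˢ 𝓝 ξ₀) ⊓ 𝓟 {q |
    IsArcCollision f l m n mp np q.1 j q.2 ∧ pCoord f l m n ξ₀ (coordEN f l m n q.2) ≠ 0 ∧
      τ₁ ≤ pCoord' f l m n ξ₀ (coordEN f l m n q.2) / pCoord f l m n ξ₀ (coordEN f l m n q.2) ∧
      pCoord' f l m n ξ₀ (coordEN f l m n q.2) / pCoord f l m n ξ₀ (coordEN f l m n q.2) ≤ τ₂}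
    with h𝓛d
  have h𝓛 : 𝓛 ≤ atTop ×ˢ 𝓝 ξ₀ := inf_le_left
  have hmem : ∀ᶠ q in 𝓛, IsArcCollision f l m n mp np q.1 j q.2 ∧
      pCoord f l m n ξ₀ (coordEN f l m n q.2) ≠ 0 ∧
      τ₁ ≤ pCoord' f l m n ξ₀ (coordEN f l m n q.2) / pCoord f l m n ξ₀ (coordEN f l m n q.2) ∧
      pCoord' f l m n ξ₀ (coordEN f l m n q.2) / pCoord f l m n ξ₀ (coordEN f l m n q.2) ≤ τ₂ :=
    eventually_inf_principal.2 (.of_forall fun q hq => hq)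
  have hbal := h.balanced_collision hρ hK hJ hF h𝓛 j hκ (hmem.mono fun q hq => hq.1)
  have H := h.centreExpansion hρ hK hJ h𝓛
  have hbd := H.pow_bounded_of_ratio hbal.1 hbal.2 hτ₁ (hmem.mono fun q hq => hq.2.1)
    (hmem.mono fun q hq => hq.2.2)
  obtain ⟨⟨A, B, hA, hAB⟩, hr, hq, hlog⟩ := H.log_relation_of_pow_bounded hbal.1 hbal.2
    (by linarith) hbd
  obtain ⟨C, hC, h1⟩ := eventually_le_div_of_isBigO hlog
  refine ⟨A, B, C, hA, hC, ?_⟩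
  have hall := hAB.and h1
  rw [h𝓛d, eventually_inf_principal] at hall
  filter_upwards [hall] with q hq hc hP h1 h2
  exact hq ⟨hc, hP, h1, h2⟩

end Endpoints

/-! ### Enclosed regions and the logarithmic relation. -/

section Region

/-- A point joined to infinity by a connected set avoiding `W ⊇ S` lies in an unbounded component of
the complement of `S`. -/
theorem enclosedRegion_subset {S W : Set (ℝ × ℝ)} (hS : S ⊆ W)
    (hW : ∀ w ∉ W, ∃ T : Set (ℝ × ℝ), w ∈ T ∧ IsPreconnected T ∧ ¬ Bornology.IsBounded T ∧
      Disjoint T W) : enclosedRegion S ⊆ W := by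
  rintro w (hw | ⟨-, hb⟩)
  · exact hS hw
  · by_contra hwW
    obtain ⟨T, hwT, hT, hTb, hd⟩ := hW w hwW
    refine hTb (hb.subset (hT.subset_connectedComponentIn hwT ?_))
    exact fun x hx hxS => hd.le_bot ⟨hx, hS hxS⟩

theorem not_isBounded_smul_image {w : ℝ × ℝ} (hw : w ≠ 0) {I : Set ℝ}
    (hI : ¬ Bornology.IsBounded I) : ¬ Bornology.IsBounded ((fun s : ℝ => s • w) '' I) := by
  intro hb
  obtain ⟨R, hR⟩ := hb.exists_norm_le
  refine hI ((Metric.isBounded_iff_subset_closedBall 0).2 ⟨R / ‖w‖, fun s hs => ?_⟩)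
  rw [mem_closedBall_zero_iff, le_div_iff₀ (norm_pos_iff.2 hw), ← norm_smul]
  exact hR _ ⟨s, hs, rfl⟩

theorem not_isBounded_Ici (a : ℝ) : ¬ Bornology.IsBounded (Set.Ici a) := fun h =>
  not_bddAbove_Ici a h.bddAbove

theorem not_isBounded_Iic (a : ℝ) : ¬ Bornology.IsBounded (Set.Iic a) := fun h =>
  not_bddBelow_Iic a h.bddBelow

theorem isPreconnected_smul_image (w : ℝ × ℝ) {I : Set ℝ} (hI : I.OrdConnected) :
    IsPreconnected ((fun s : ℝ => s • w) '' I) :=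
  hI.isPreconnected.image _ (by fun_prop)

/-- A set that meets every line through the origin in an interval, and misses one such line, fills
the region enclosed by any of its subsets. -/
theorem enclosedRegion_subset_of_ordConnected {S W : Set (ℝ × ℝ)} (hS : S ⊆ W)
    (hW : ∀ w, {s : ℝ | s • w ∈ W}.OrdConnected) {e : ℝ × ℝ} (he : e ≠ 0)
    (heW : ∀ s : ℝ, s • e ∉ W) : enclosedRegion S ⊆ W := by
  have key : ∀ v : ℝ × ℝ, v ≠ 0 → ∀ (a : ℝ) (I : Set ℝ), a ∈ I → I.OrdConnected →
      ¬ Bornology.IsBounded I → (∀ s ∈ I, s • v ∉ W) → ∃ T : Set (ℝ × ℝ), a • v ∈ T ∧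
        IsPreconnected T ∧ ¬ Bornology.IsBounded T ∧ Disjoint T W := by
    intro v hv a I ha hI hIb hIW
    refine ⟨(fun s : ℝ => s • v) '' I, ⟨a, ha, rfl⟩, isPreconnected_smul_image v hI,
      not_isBounded_smul_image hv hIb, ?_⟩
    rw [Set.disjoint_left]
    rintro _ ⟨s, hs, rfl⟩
    exact hIW s hs
  refine enclosedRegion_subset hS fun w hw => ?_
  rcases eq_or_ne w 0 with rfl | hw0
  · simpa using key e he 0 (Set.Ici 0) (Set.mem_Ici.2 le_rfl) Set.ordConnected_Ici
      (not_isBounded_Ici 0) fun s _ => heW s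
  -- If the outward ray from `w` meets `W`, the interval property keeps the opposite half-line,
  -- through the origin and beyond, clear of `W`. Otherwise the outward ray itself is clear.
  · by_cases h : ∃ s : ℝ, 1 ≤ s ∧ s • w ∈ W
    · obtain ⟨s, hs, hsW⟩ := h
      have := key w hw0 1 (Set.Iic 1) (Set.mem_Iic.2 le_rfl) Set.ordConnected_Iic
        (not_isBounded_Iic 1) fun t ht htW => hw (by
          have h1 : (1 : ℝ) ∈ {s : ℝ | s • w ∈ W} := (hW w).out htW hsW ⟨ht, hs⟩
          simpa using h1)
      simpa using this
    · have := key w hw0 1 (Set.Ici 1) (Set.mem_Ici.2 le_rfl) Set.ordConnected_Ici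
        (not_isBounded_Ici 1) fun t ht htW => h ⟨t, ht, htW⟩
      simpa using this

/-- The conditions on `x = P`, `x' = P'` that describe the neighbourhood of the `k`-th sector. -/
def LogRelation (τ₁ τ₂ A B C : ℝ) (k : ℕ) (x x' : ℝ) : Prop :=
  (A ≤ k * x ∧ k * x ≤ B) ∧ (τ₁ * x ≤ x' ∧ x' ≤ τ₂ * x) ∧
    |k * (x' - x) - Real.log (x' / x)| ≤ C / k

theorem LogRelation.mono {τ₁ τ₂ A B C τ₁' τ₂' A' B' C' : ℝ} {k : ℕ} {x x' : ℝ}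
    (h : LogRelation τ₁ τ₂ A B C k x x') (hA : 0 < A) (h1 : τ₁' ≤ τ₁) (h2 : τ₂ ≤ τ₂') (h3 : A' ≤ A)
    (h4 : B ≤ B') (h5 : C ≤ C') : LogRelation τ₁' τ₂' A' B' C' k x x' := by
  obtain ⟨⟨a1, a2⟩, ⟨b1, b2⟩, c1⟩ := h
  have hx : 0 ≤ x := (pos_of_mul_pos_right (hA.trans_le a1) (Nat.cast_nonneg k)).le
  exact ⟨⟨h3.trans a1, a2.trans h4⟩, ⟨le_trans (by gcongr) b1, b2.trans (by gcongr)⟩,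
    c1.trans (by gcongr)⟩

theorem LogRelation.pos {τ₁ τ₂ A B C : ℝ} {k : ℕ} {x x' : ℝ}
    (h : LogRelation τ₁ τ₂ A B C k x x') (hA : 0 < A) : 0 < x :=
  pos_of_mul_pos_right (hA.trans_le h.1.1) (Nat.cast_nonneg k)

theorem between_mul {s₁ s s₂ : ℝ} (h1 : s₁ ≤ s) (h2 : s ≤ s₂) (x : ℝ) :
    min (s₁ * x) (s₂ * x) ≤ s * x ∧ s * x ≤ max (s₁ * x) (s₂ * x) := by
  rcases le_total 0 x with hx | hx
  · exact ⟨(min_le_left _ _).trans (by gcongr), le_trans (by gcongr) (le_max_right _ _)⟩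
  · exact ⟨(min_le_right _ _).trans (mul_le_mul_of_nonpos_right h2 hx),
      (mul_le_mul_of_nonpos_right h1 hx).trans (le_max_left _ _)⟩

/-- Scaling leaves `x'/x` unchanged, so the logarithm is constant along the line and every condition
is a linear inequality in `s`. -/
theorem LogRelation.ordConnected {τ₁ τ₂ A B C : ℝ} {k : ℕ} (hA : 0 < A) (x x' : ℝ) :
    {s : ℝ | LogRelation τ₁ τ₂ A B C k (s * x) (s * x')}.OrdConnected := by
  refine ⟨fun s₁ h₁ s₂ h₂ s ⟨hs1, hs2⟩ => ?_⟩
  have hx1 := h₁.pos hA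
  have hx2 := h₂.pos hA
  have b0 := between_mul hs1 hs2 x
  have hx : 0 < s * x := (lt_min hx1 hx2).trans_le b0.1
  have hlog : ∀ t : ℝ, 0 < t * x → Real.log (t * x' / (t * x)) = Real.log (x' / x) := by
    intro t ht
    rw [mul_div_mul_left _ _ (left_ne_zero_of_mul ht.ne')]
  obtain ⟨⟨a1, a2⟩, ⟨b1, b2⟩, c1⟩ := h₁
  obtain ⟨⟨a1', a2'⟩, ⟨b1', b2'⟩, c1'⟩ := h₂
  rw [hlog _ hx1, abs_le] at c1
  rw [hlog _ hx2, abs_le] at c1'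
  have e1 := between_mul hs1 hs2 (k * x)
  have e2 := between_mul hs1 hs2 (x' - τ₁ * x)
  have e3 := between_mul hs1 hs2 (τ₂ * x - x')
  have e4 := between_mul hs1 hs2 (k * (x' - x))
  refine ⟨⟨?_, ?_⟩, ⟨?_, ?_⟩, ?_⟩
  · have : A ≤ min (s₁ * (k * x)) (s₂ * (k * x)) := le_min (by linarith) (by linarith)
    linarith
  · have : max (s₁ * (k * x)) (s₂ * (k * x)) ≤ B := max_le (by linarith) (by linarith)
    linarith
  · have : 0 ≤ min (s₁ * (x' - τ₁ * x)) (s₂ * (x' - τ₁ * x)) := le_min (by linarith) (by linarith)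
    linarith
  · have : 0 ≤ min (s₁ * (τ₂ * x - x')) (s₂ * (τ₂ * x - x')) := le_min (by linarith) (by linarith)
    linarith
  · rw [hlog _ hx, abs_le]
    have h1 : Real.log (x' / x) - C / k ≤ min (s₁ * (k * (x' - x))) (s₂ * (k * (x' - x))) :=
      le_min (by linarith [c1.1]) (by linarith [c1'.1])
    have h2 : max (s₁ * (k * (x' - x))) (s₂ * (k * (x' - x))) ≤ Real.log (x' / x) + C / k :=
      max_le (by linarith [c1.2]) (by linarith [c1'.2])
    constructor <;> linarith [e4.1, e4.2]

/-- Passage from the level `k + 1` to the level `k`. -/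
theorem LogRelation.of_succ {τ₁ τ₂ A B C : ℝ} {k : ℕ} (hk : 0 < k) {x x' : ℝ} (hτ₁ : 0 < τ₁)
    (hA : 0 < A) (hC : 0 ≤ C) (h : LogRelation τ₁ τ₂ A B C (k + 1) x x') :
    LogRelation τ₁ τ₂ (A / 2) B (C + (τ₂ + 1) * B) k x x' := by
  have hx := h.pos hA
  obtain ⟨⟨a1, a2⟩, ⟨b1, b2⟩, c1⟩ := h
  have hk' : (1 : ℝ) ≤ k := Nat.one_le_cast.2 hk
  push_cast at a1 a2 c1
  have hτ₂ : 0 < τ₂ := pos_of_mul_pos_left ((mul_pos hτ₁ hx).trans_le (b1.trans b2)) hx.le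
  have hx' : 0 ≤ x' := (mul_pos hτ₁ hx).le.trans b1
  have hkx : x ≤ k * x := le_mul_of_one_le_left hx.le hk'
  refine ⟨⟨by linarith, by linarith⟩, ⟨b1, b2⟩, ?_⟩
  have h1 : |x' - x| ≤ (τ₂ + 1) * x := by
    rw [abs_le]; constructor <;> nlinarith
  have h2 : (τ₂ + 1) * x ≤ (τ₂ + 1) * B / k := by
    rw [le_div_iff₀ (by linarith)]
    have : (τ₂ + 1) * (k * x) ≤ (τ₂ + 1) * B := by gcongr; linarith
    linarith
  have h3 : C / ((k : ℝ) + 1) ≤ C / k := by gcongr; linarith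
  calc |(k : ℝ) * (x' - x) - Real.log (x' / x)|
      = |((k : ℝ) + 1) * (x' - x) - Real.log (x' / x) - (x' - x)| := by congr 1; ring
    _ ≤ |((k : ℝ) + 1) * (x' - x) - Real.log (x' / x)| + |x' - x| := abs_sub _ _
    _ ≤ C / k + (τ₂ + 1) * B / k := by linarith
    _ = _ := by ring

theorem abs_div_sub_le_iff {x x' τ δ : ℝ} (hx : 0 < x) :
    |x' / x - τ| ≤ δ ↔ |x' - τ * x| ≤ δ * x := by
  rw [← div_le_iff₀ hx, ← abs_of_pos hx, ← abs_div, abs_of_pos hx, sub_div,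
    mul_div_cancel_right₀ _ hx.ne']

/-- A relation at a point whose ratio is close to `τ` persists on segments. -/
theorem LogRelation.segment {τ A B C : ℝ} {k : ℕ} (hk : 0 < k) (hτ : 0 < τ) (hA : 0 < A)
    (hC : 0 ≤ C) (hkC : C / k ≤ τ / 2) {x x' y y' s t : ℝ} (hs : 0 ≤ s) (ht : 0 ≤ t)
    (hst : s + t = 1)
    (h₁ : LogRelation (τ / 2) (2 * τ) A B C k x x') (h₂ : LogRelation (τ / 2) (2 * τ) A B C k y y')
    (hx : |x' / x - τ| ≤ C / k) (hy : |y' / y - τ| ≤ C / k) :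
    LogRelation (τ / 2) (2 * τ) A B (C + 4 * C / τ) k (s * x + t * y) (s * x' + t * y') := by
  have hx0 := h₁.pos hA
  have hy0 := h₂.pos hA
  obtain ⟨⟨a1, a2⟩, ⟨b1, b2⟩, c1⟩ := h₁
  obtain ⟨⟨a1', a2'⟩, ⟨b1', b2'⟩, c1'⟩ := h₂
  have hconv : ∀ {u v w : ℝ}, u ≤ v → u ≤ w → u ≤ s * v + t * w := by
    intro u v w h1 h2
    have := mul_le_mul_of_nonneg_left h1 hs
    have := mul_le_mul_of_nonneg_left h2 ht
    have : u = s * u + t * u := by rw [← add_mul, hst, one_mul]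
    linarith
  have hz0 : 0 < s * x + t * y := (lt_min hx0 hy0).trans_le (hconv (min_le_left _ _) (min_le_right _ _))
  have hkR : (0 : ℝ) < k := Nat.cast_pos.2 hk
  -- `k(x' - x)` is affine along the segment but the logarithm is not. Since all ratios stay within
  -- `C/k` of `τ`, each logarithm is replaced by `log τ` at a cost of `2C/(τk)`. Doing so at an end
  -- point and at the intermediate point produces `4C/τ`.
  have hlog : ∀ {x x' : ℝ}, |x' / x - τ| ≤ C / k →
      |Real.log (x' / x) - Real.log τ| ≤ 2 * C / τ / k := by
    intro x x' h
    have := abs_log_sub_log_le (half_pos hτ) (x := x' / x) (y := τ)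
      (by have := (abs_le.1 h).1; linarith) (by linarith)
    refine this.trans ?_
    rw [div_le_iff₀ (half_pos hτ)]
    refine h.trans (le_of_eq ?_)
    field_simp
  have hz : |(s * x' + t * y') / (s * x + t * y) - τ| ≤ C / k := by
    rw [abs_div_sub_le_iff hx0, abs_le] at hx
    rw [abs_div_sub_le_iff hy0, abs_le] at hy
    rw [abs_div_sub_le_iff hz0, abs_le]
    have e1 := mul_le_mul_of_nonneg_left hx.1 hs
    have e2 := mul_le_mul_of_nonneg_left hx.2 hs
    have e3 := mul_le_mul_of_nonneg_left hy.1 ht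
    have e4 := mul_le_mul_of_nonneg_left hy.2 ht
    constructor <;> linarith
  refine ⟨⟨?_, ?_⟩, ⟨?_, ?_⟩, ?_⟩
  · linarith [hconv a1 a1']
  · have := hconv (neg_le_neg a2) (neg_le_neg a2')
    linarith
  · have := hconv (sub_nonneg.2 b1) (sub_nonneg.2 b1')
    linarith
  · have := hconv (sub_nonneg.2 b2) (sub_nonneg.2 b2')
    linarith
  · have l1 := abs_le.1 (hlog hx)
    have l2 := abs_le.1 (hlog hy)
    have l3 := abs_le.1 (hlog hz)
    rw [abs_le] at c1 c1'
    have e : (C + 4 * C / τ) / k = C / k + (2 * C / τ / k + 2 * C / τ / k) := by ring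
    rw [e, abs_le]
    have m1 := hconv (u := Real.log τ - (C / k + 2 * C / τ / k)) (v := k * (x' - x))
      (w := k * (y' - y)) (by linarith) (by linarith)
    have m2 := hconv (u := -(Real.log τ + (C / k + 2 * C / τ / k))) (v := -(k * (x' - x)))
      (w := -(k * (y' - y))) (by linarith) (by linarith)
    constructor <;> linarith

end Region

/-! ### The sector lies in the region of the logarithmic relation. -/

section Sectors

theorem LogRelation.of_ratio {τ A B C : ℝ} {k : ℕ} {x x' : ℝ} (hA : 0 < A)
    (hx : A ≤ k * x ∧ k * x ≤ B) (hτ : |x' / x - τ| ≤ C / k) (hC : C / k ≤ τ / 2)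
    (hlog : |k * (x' - x) - Real.log (x' / x)| ≤ C / k) (hτ0 : 0 < τ) :
    LogRelation (τ / 2) (2 * τ) A B C k x x' := by
  have hx0 : 0 < x := pos_of_mul_pos_right (hA.trans_le hx.1) (Nat.cast_nonneg k)
  rw [abs_div_sub_le_iff hx0, abs_le] at hτ
  have h1 : C / k * x ≤ τ / 2 * x := by gcongr
  have h2 : 0 < τ * x := mul_pos hτ0 hx0
  exact ⟨hx, ⟨by linarith [hτ.1], by linarith [hτ.2]⟩, hlog⟩

/-- For the segments joining `p_k` to `p_{k+1}` and `q_k` to `q_{k+1}`. The end point of level `k +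
1` is brought to level `k`, which halves `A` and adds `(2τ + 1)B` to `C`. -/
theorem LogRelation.segment_succ {τ A B C : ℝ} {k : ℕ} (hk : 0 < k) (hτ : 0 < τ) (hA : 0 < A)
    (hC : 0 ≤ C) (hkC : (C + (2 * τ + 1) * B) / k ≤ τ / 2) {x x' y y' s t : ℝ} (hs : 0 ≤ s)
    (ht : 0 ≤ t) (hst : s + t = 1)
    (h₁ : LogRelation (τ / 2) (2 * τ) A B C k x x')
    (h₂ : LogRelation (τ / 2) (2 * τ) A B C (k + 1) y y')
    (hx : |x' / x - τ| ≤ C / k) (hy : |y' / y - τ| ≤ C / (k + 1 : ℕ)) :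
    LogRelation (τ / 2) (2 * τ) (A / 2) B
      (C + (2 * τ + 1) * B + 4 * (C + (2 * τ + 1) * B) / τ) k (s * x + t * y) (s * x' + t * y') := by
  have hB : 0 < B := hA.trans_le (h₁.1.1.trans h₁.1.2)
  have hCC : C ≤ C + (2 * τ + 1) * B := by
    have : 0 < (2 * τ + 1) * B := by positivity
    linarith
  have hkR : (0 : ℝ) < k := Nat.cast_pos.2 hk
  refine LogRelation.segment hk hτ (half_pos hA) (hC.trans hCC) hkC hs ht hst
    (h₁.mono hA le_rfl le_rfl (by linarith) le_rfl hCC) (h₂.of_succ hk (half_pos hτ) hA hC)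
    (hx.trans (by gcongr)) (hy.trans ?_)
  calc C / ((k + 1 : ℕ) : ℝ) ≤ C / k := by gcongr; simp
    _ ≤ _ := by gcongr

variable {N K : ℕ} [NeZero N] {f : PWLFamily N K} {l m n mm nm mp np : ℕ} {ξ₀ : ℝ × ℝ}

theorem pCoord_combo (s t : ℝ) (w v : ℝ × ℝ) :
    pCoord f l m n ξ₀ (s • w + t • v) = s * pCoord f l m n ξ₀ w + t * pCoord f l m n ξ₀ v := by
  simp only [pCoord, Prod.fst_add, Prod.smul_fst, smul_eq_mul]; ring

theorem pCoord'_combo (s t : ℝ) (w v : ℝ × ℝ) :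
    pCoord' f l m n ξ₀ (s • w + t • v) = s * pCoord' f l m n ξ₀ w + t * pCoord' f l m n ξ₀ v := by
  simp only [pCoord', Prod.snd_add, Prod.smul_snd, smul_eq_mul]; ring

/-- The region of the `(η, ν)`-plane given by `LogRelation`. -/
def logRegion (f : PWLFamily N K) (l m n : ℕ) (ξ₀ : ℝ × ℝ) (τ₁ τ₂ A B C : ℝ) (k : ℕ) :
    Set (ℝ × ℝ) :=
  {w | LogRelation τ₁ τ₂ A B C k (pCoord f l m n ξ₀ w) (pCoord' f l m n ξ₀ w)}

/-- The line missed by the region is the axis `η = 0`, where `P = 0` contradicts `A ≤ kP`. -/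
theorem enclosedRegion_subset_logRegion {τ₁ τ₂ A B C : ℝ} {k : ℕ} (hA : 0 < A) {S : Set (ℝ × ℝ)}
    (hS : S ⊆ logRegion f l m n ξ₀ τ₁ τ₂ A B C k) :
    enclosedRegion S ⊆ logRegion f l m n ξ₀ τ₁ τ₂ A B C k := by
  refine enclosedRegion_subset_of_ordConnected hS (fun w => ?_) (e := (0, 1)) (by simp) ?_
  · have h1 : ∀ s : ℝ, pCoord f l m n ξ₀ (s • w) = s * pCoord f l m n ξ₀ w := fun s => by
      simpa using pCoord_combo (f := f) (l := l) (m := m) (n := n) (ξ₀ := ξ₀) s 0 w 0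
    have h2 : ∀ s : ℝ, pCoord' f l m n ξ₀ (s • w) = s * pCoord' f l m n ξ₀ w := fun s => by
      simpa using pCoord'_combo (f := f) (l := l) (m := m) (n := n) (ξ₀ := ξ₀) s 0 w 0
    simp only [logRegion, Set.mem_ofPred_eq, h1, h2]
    exact LogRelation.ordConnected hA _ _
  · intro s hs
    have := LogRelation.pos hs hA
    simp [pCoord] at this

/-- Both `t_d` and `t_{(ℓ-1)d}` are negative, so the absolute values in the polar coordinates leave
the same factor, up to sign, in `P` and `P'`. -/
theorem IsShrinkingPoint.pCoord_polar (h : IsShrinkingPoint f l m n ξ₀)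
    (hρ : rhoMax f l m n ξ₀ < 1) {r θ : ℝ} (hr : 0 < r) (hθ : Real.cos θ ≠ 0) :
    pCoord f l m n ξ₀ (polarEN f l m n ξ₀ r θ) ≠ 0 ∧
      pCoord' f l m n ξ₀ (polarEN f l m n ξ₀ r θ) / pCoord f l m n ξ₀ (polarEN f l m n ξ₀ r θ) =
        -Real.tan θ := by
  obtain ⟨q, -, -, -, hc0⟩ := h.exists_factor hρ
  have ha := h.aConst_ne
  have ht1 := h.tConst_one_neg
  have htl := h.tConst_l_sub_one_neg
  set a := aConst f l m n ξ₀
  set c := cConst f l m n ξ₀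
  set t := tConst f l m n ξ₀ 1
  set t' := tConst f l m n ξ₀ (l - 1)
  have e : ∀ y : ℝ, y < 0 → a / (c * y) * |c * y / a| = -(a / c * |c / a|) := by
    intro y hy
    have hy' := hy.ne
    rw [abs_div, abs_mul, abs_of_neg hy, abs_div]
    field_simp
  have hu : a / c * |c / a| ≠ 0 :=
    mul_ne_zero (div_ne_zero ha hc0) (abs_ne_zero.2 (div_ne_zero hc0 ha))
  have h1 : pCoord f l m n ξ₀ (polarEN f l m n ξ₀ r θ) = -(a / c * |c / a|) * (r * Real.cos θ) := by
    rw [pCoord, polarEN, ← e t ht1]; simp only; ring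
  have h2 : pCoord' f l m n ξ₀ (polarEN f l m n ξ₀ r θ) = (a / c * |c / a|) * (r * Real.sin θ) := by
    rw [pCoord', polarEN, ← neg_neg (a / c * |c / a|), ← e t' htl]; simp only; ring
  rw [h1, h2]
  refine ⟨mul_ne_zero (neg_ne_zero.2 hu) (mul_ne_zero hr.ne' hθ), ?_⟩
  rw [Real.tan_eq_sin_div_cos]
  field_simp

/-- In either case the quadrant lies within a single branch of `tan`, so the values of `tan` at the
end points bound it on the arc. -/
theorem InnerArc.tan_between {k : ℕ} {j : ℤ} (ha : aConst f l m n ξ₀ ≠ 0)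
    (γ : InnerArc f l m n ξ₀ mp np k j) {θ : ℝ} (hθ : θ ∈ Set.uIcc γ.θp γ.θq) :
    Real.cos θ ≠ 0 ∧ Real.tan θ ∈ Set.uIcc (Real.tan γ.θp) (Real.tan γ.θq) := by
  have hmono : ∀ c : ℝ, (∀ x, Real.tan (x - c) = Real.tan x) →
      (∀ x ∈ Set.uIcc γ.θp γ.θq, x - c ∈ Set.Ioo (-(Real.pi / 2)) (Real.pi / 2)) →
      Real.tan θ ∈ Set.uIcc (Real.tan γ.θp) (Real.tan γ.θq) := by
    intro c hc hx
    have : MonotoneOn Real.tan (Set.uIcc γ.θp γ.θq) := by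
      intro x hx' y hy' hxy
      rw [← hc x, ← hc y]
      exact Real.strictMonoOn_tan.monotoneOn (hx x hx') (hx y hy') (by linarith)
    exact this.mapsTo_uIcc hθ
  have hπ := Real.pi_pos
  rcases lt_or_gt_of_ne ha with h0 | h0
  · have hq := γ.quadrant_neg h0
    have hq' : ∀ x ∈ Set.uIcc γ.θp γ.θq,
        x - 2 * Real.pi ∈ Set.Ioo (-(Real.pi / 2)) (Real.pi / 2) := fun x hx => by
      have := hq hx
      exact ⟨by linarith [this.1], by linarith [this.2]⟩
    refine ⟨?_, hmono (2 * Real.pi) (fun x => ?_) hq'⟩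
    · have := Real.cos_pos_of_mem_Ioo (hq' θ hθ)
      rw [Real.cos_sub_two_pi] at this
      exact this.ne'
    · rw [two_mul, ← sub_sub, Real.tan_periodic.sub_eq, Real.tan_periodic.sub_eq]
  · have hq := γ.quadrant_pos h0
    have hq' : ∀ x ∈ Set.uIcc γ.θp γ.θq,
        x - Real.pi ∈ Set.Ioo (-(Real.pi / 2)) (Real.pi / 2) := fun x hx => by
      have := hq hx
      exact ⟨by linarith [this.1], by linarith [this.2]⟩
    refine ⟨?_, hmono Real.pi (fun x => Real.tan_periodic.sub_eq x) hq'⟩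
    have := Real.cos_pos_of_mem_Ioo (hq' θ hθ)
    rw [Real.cos_sub_pi] at this
    linarith

theorem InnerArc.collision {k j : ℕ} (γ : InnerArc f l m n ξ₀ mp np k j) {θ : ℝ}
    (hθ : θ ∈ Set.uIcc γ.θp γ.θq) : IsArcCollision f l m n mp np k j (γ.curve θ) :=
  γ.border.imp (fun h => h θ hθ) fun h => h θ hθ

/-- The ends of the arcs have ratios close to the constants `τp`, `τq`. Monotonicity of `tan` then
bounds the ratio on the arcs, where the collision yields the logarithmic relation. Corresponding
ends at levels `k` and `k + 1` share the same limiting ratio, so the relation persists on the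
segments, and finally on the enclosed region. -/
theorem IsShrinkingPoint.sector_subset (h : IsShrinkingPoint f l m n ξ₀)
    (hρ : rhoMax f l m n ξ₀ < 1) (hK : 1 ≤ K) (hJ : detJ f l m n ξ₀ ≠ 0)
    (hF : IsFareyRoots m n mm nm mp np) (j : ℕ)
    (hκj : kappaPlus f l m n ξ₀ j ≠ kappaPlus f l m n ξ₀ (j - 1))
    (hκ : kappaPlus f l m n ξ₀ j ≠ 0) (hκ' : kappaPlus f l m n ξ₀ (j - 1) ≠ 0) :
    ∃ τ₁ τ₂ A B C : ℝ, 0 < τ₁ ∧ 0 < A ∧ ∃ U ∈ 𝓝 ξ₀, ∃ k₀ : ℕ, ∀ k ≥ k₀,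
      ∀ (γ : InnerArc f l m n ξ₀ mp np k j) (γ' : InnerArc f l m n ξ₀ mp np (k + 1) j),
      γ.points ⊆ U → γ'.points ⊆ U → sector γ γ' ⊆ logRegion f l m n ξ₀ τ₁ τ₂ A B C k := by
  obtain ⟨τp, Ap, Bp, Cp, hτp, hAp, hCp, hp⟩ := h.arcEnd_relation hρ hK hJ hF j hκj
    (i := j) (by omega) hκ
  obtain ⟨τq, Aq, Bq, Cq, hτq, hAq, hCq, hq⟩ := h.arcEnd_relation hρ hK hJ hF j hκj
    (i := j - 1) (by omega) hκ'
  set τ₁ := min τp τq / 2 with hτ₁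
  set τ₂ := 2 * max τp τq with hτ₂
  have hτ₁0 : 0 < τ₁ := half_pos (lt_min hτp hτq)
  obtain ⟨Aa, Ba, Ca, hAa, hCa, ha⟩ := h.arc_relation hρ hK hJ hF j hκj τ₂ hτ₁0
  -- The halves and the enlarged constants in `C` absorb the passage from level `k + 1` to level
  -- `k`.
  set A := min (Aa / 2) (min (Ap / 2) (Aq / 2)) with hA
  set B := max Ba (max Bp Bq) with hB
  set Dp := Cp + (2 * τp + 1) * Bp with hDp
  set Dq := Cq + (2 * τq + 1) * Bq with hDq
  set C := max (max Ca (Ca + (τ₂ + 1) * Ba)) (max (Dp + 4 * Dp / τp) (Dq + 4 * Dq / τq)) with hC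
  have hA0 : 0 < A := lt_min (half_pos hAa) (lt_min (half_pos hAp) (half_pos hAq))
  refine ⟨τ₁, τ₂, A, B, C, hτ₁0, hA0, ?_⟩
  have hsmall : ∀ D τ : ℝ, 0 < τ → ∀ᶠ q : ℕ × ℝ × ℝ in atTop ×ˢ 𝓝 ξ₀, D / q.1 ≤ τ / 2 := by
    intro D τ hτ
    have h1 : Tendsto (fun k : ℕ => D / k) atTop (𝓝 0) := tendsto_const_div_atTop_nhds_zero_nat D
    exact ((h1.comp tendsto_fst).eventually (gt_mem_nhds (half_pos hτ))).mono fun _ h => le_of_lt h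
  have hall := (hp.and (hq.and ha)).and (((hsmall Cp τp hτp).and (hsmall Cq τq hτq)).and
    (((hsmall Dp τp hτp).and (hsmall Dq τq hτq)).and
      (tendsto_fst.eventually (eventually_gt_atTop 0))))
  -- The bounds hold on a product of a tail of `ℕ` and a neighbourhood of `ξ₀`, so one neighbourhood
  -- serves both levels `k` and `k + 1`.
  obtain ⟨pa, hpa, pb, hpb, hall⟩ := eventually_prod_iff.1 hall
  obtain ⟨k₀, hk₀⟩ := eventually_atTop.1 hpa
  refine ⟨{ξ | pb ξ}, hpb, k₀, fun k hk γ γ' hγ hγ' => ?_⟩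
  -- the end points of one arc
  have hend : ∀ k ≥ k₀, ∀ γ : InnerArc f l m n ξ₀ mp np k j, γ.points ⊆ {ξ | pb ξ} →
      (LogRelation (τp / 2) (2 * τp) Ap Bp Cp k
          (pCoord f l m n ξ₀ (coordEN f l m n (γ.curve γ.θp)))
          (pCoord' f l m n ξ₀ (coordEN f l m n (γ.curve γ.θp))) ∧
        |pCoord' f l m n ξ₀ (coordEN f l m n (γ.curve γ.θp)) /
          pCoord f l m n ξ₀ (coordEN f l m n (γ.curve γ.θp)) - τp| ≤ Cp / k) ∧
      (LogRelation (τq / 2) (2 * τq) Aq Bq Cq k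
          (pCoord f l m n ξ₀ (coordEN f l m n (γ.curve γ.θq)))
          (pCoord' f l m n ξ₀ (coordEN f l m n (γ.curve γ.θq))) ∧
        |pCoord' f l m n ξ₀ (coordEN f l m n (γ.curve γ.θq)) /
          pCoord f l m n ξ₀ (coordEN f l m n (γ.curve γ.θq)) - τq| ≤ Cq / k) := by
    intro k hk γ hγ
    have hP := hall (hk₀ k hk) (hγ ⟨γ.θp, Set.left_mem_uIcc, rfl⟩)
    have hQ := hall (hk₀ k hk) (hγ ⟨γ.θq, Set.right_mem_uIcc, rfl⟩)
    obtain ⟨a1, a2, a3⟩ := hP.1.1 γ.end_p (γ.collision Set.left_mem_uIcc)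
    obtain ⟨b1, b2, b3⟩ := hQ.1.2.1 γ.end_q (γ.collision Set.right_mem_uIcc)
    exact ⟨⟨LogRelation.of_ratio hAp a1 a2 hP.2.1.1 a3 hτp, a2⟩,
      ⟨LogRelation.of_ratio hAq b1 b2 hQ.2.1.2 b3 hτq, b2⟩⟩
  -- the points of one arc
  have harc : ∀ k ≥ k₀, ∀ γ : InnerArc f l m n ξ₀ mp np k j, γ.points ⊆ {ξ | pb ξ} →
      ∀ θ ∈ Set.uIcc γ.θp γ.θq, LogRelation τ₁ τ₂ Aa Ba Ca k
          (pCoord f l m n ξ₀ (coordEN f l m n (γ.curve θ)))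
          (pCoord' f l m n ξ₀ (coordEN f l m n (γ.curve θ))) := by
    intro k hk γ hγ θ hθ
    obtain ⟨⟨hP, -⟩, ⟨hQ, -⟩⟩ := hend k hk γ hγ
    have hpol : ∀ θ ∈ Set.uIcc γ.θp γ.θq, _ := fun θ hθ =>
      h.pCoord_polar hρ (γ.rad_pos θ hθ) (γ.tan_between h.aConst_ne hθ).1
    have hratio : ∀ θ ∈ Set.uIcc γ.θp γ.θq, pCoord f l m n ξ₀ (coordEN f l m n (γ.curve θ)) ≠ 0 ∧
        pCoord' f l m n ξ₀ (coordEN f l m n (γ.curve θ)) /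
          pCoord f l m n ξ₀ (coordEN f l m n (γ.curve θ)) = -Real.tan θ := by
      intro θ hθ
      rw [γ.polar θ hθ]
      exact hpol θ hθ
    have hp1 := hP.pos hAp
    have hq1 := hQ.pos hAq
    have hp2 := hP.2.1
    have hq2 := hQ.2.1
    rw [← le_div_iff₀ hp1, ← div_le_iff₀ hp1, (hratio _ Set.left_mem_uIcc).2] at hp2
    rw [← le_div_iff₀ hq1, ← div_le_iff₀ hq1, (hratio _ Set.right_mem_uIcc).2] at hq2
    have hm1 : min τp τq ≤ τp := min_le_left _ _
    have hm2 : min τp τq ≤ τq := min_le_right _ _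
    have hm3 : τp ≤ max τp τq := le_max_left _ _
    have hm4 : τq ≤ max τp τq := le_max_right _ _
    have ht : Real.tan θ ∈ Set.Icc (-τ₂) (-τ₁) := by
      refine Set.uIcc_subset_Icc ⟨?_, ?_⟩ ⟨?_, ?_⟩ (γ.tan_between h.aConst_ne hθ).2 <;>
        linarith [hp2.1, hp2.2, hq2.1, hq2.2]
    obtain ⟨h0, hr⟩ := hratio θ hθ
    have h1 : τ₁ ≤ pCoord' f l m n ξ₀ (coordEN f l m n (γ.curve θ)) /
          pCoord f l m n ξ₀ (coordEN f l m n (γ.curve θ)) := by rw [hr]; linarith [ht.2]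
    have h2 : pCoord' f l m n ξ₀ (coordEN f l m n (γ.curve θ)) /
          pCoord f l m n ξ₀ (coordEN f l m n (γ.curve θ)) ≤ τ₂ := by rw [hr]; linarith [ht.1]
    obtain ⟨c1, c2⟩ := (hall (hk₀ k hk) (hγ ⟨θ, hθ, rfl⟩)).1.2.2 (γ.collision hθ) h0 h1 h2
    have hx0 : 0 < pCoord f l m n ξ₀ (coordEN f l m n (γ.curve θ)) :=
      pos_of_mul_pos_right (hAa.trans_le c1.1) (Nat.cast_nonneg k)
    exact ⟨c1, ⟨(le_div_iff₀ hx0).1 h1, (div_le_iff₀ hx0).1 h2⟩, c2⟩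
  have hk1 : k + 1 ≥ k₀ := by omega
  obtain ⟨⟨hP, hPr⟩, ⟨hQ, hQr⟩⟩ := hend k hk γ hγ
  obtain ⟨⟨hP', hPr'⟩, ⟨hQ', hQr'⟩⟩ := hend (k + 1) hk1 γ' hγ'
  have hkk := (hall (hk₀ k hk) (hγ ⟨γ.θp, Set.left_mem_uIcc, rfl⟩)).2.2
  have hkpos : 0 < k := hkk.2
  have hτp1 : τ₁ ≤ τp / 2 := by
    have : min τp τq ≤ τp := min_le_left _ _
    linarith
  have hτq1 : τ₁ ≤ τq / 2 := by
    have : min τp τq ≤ τq := min_le_right _ _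
    linarith
  have hτp2 : 2 * τp ≤ τ₂ := by
    have : τp ≤ max τp τq := le_max_left _ _
    linarith
  have hτq2 : 2 * τq ≤ τ₂ := by
    have : τq ≤ max τp τq := le_max_right _ _
    linarith
  have hA1 : A ≤ Aa / 2 := min_le_left _ _
  have hA2 : A ≤ Ap / 2 := (min_le_right _ _).trans (min_le_left _ _)
  have hA3 : A ≤ Aq / 2 := (min_le_right _ _).trans (min_le_right _ _)
  have hB1 : Ba ≤ B := le_max_left _ _
  have hB2 : Bp ≤ B := (le_max_left _ _).trans (le_max_right _ _)
  have hB3 : Bq ≤ B := (le_max_right _ _).trans (le_max_right _ _)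
  have hC1 : Ca ≤ C := (le_max_left _ _).trans (le_max_left _ _)
  have hC2 : Ca + (τ₂ + 1) * Ba ≤ C := (le_max_right _ _).trans (le_max_left _ _)
  have hC3 : Dp + 4 * Dp / τp ≤ C := (le_max_left _ _).trans (le_max_right _ _)
  have hC4 : Dq + 4 * Dq / τq ≤ C := (le_max_right _ _).trans (le_max_right _ _)
  refine enclosedRegion_subset_logRegion hA0 ?_
  rintro w (((hw | hw) | hw) | hw)
  · obtain ⟨_, ⟨θ, hθ, rfl⟩, rfl⟩ := hw
    exact (harc k hk γ hγ θ hθ).mono hAa le_rfl le_rfl (by linarith) hB1 hC1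
  · obtain ⟨_, ⟨θ, hθ, rfl⟩, rfl⟩ := hw
    exact ((harc (k + 1) hk1 γ' hγ' θ hθ).of_succ hkpos hτ₁0 hAa hCa).mono (half_pos hAa)
      le_rfl le_rfl hA1 hB1 hC2
  · obtain ⟨s, t, hs, ht, hst, rfl⟩ := hw
    rw [logRegion, Set.mem_ofPred_eq, pCoord_combo, pCoord'_combo]
    exact (LogRelation.segment_succ hkpos hτp hAp hCp hkk.1.1 hs ht hst hP hP' hPr hPr').mono
      (half_pos hAp) hτp1 hτp2 hA2 hB2 hC3
  · obtain ⟨s, t, hs, ht, hst, rfl⟩ := hw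
    rw [logRegion, Set.mem_ofPred_eq, pCoord_combo, pCoord'_combo]
    exact (LogRelation.segment_succ hkpos hτq hAq hCq hkk.1.2 hs ht hst hQ hQ' hQr hQr').mono
      (half_pos hAq) hτq1 hτq2 hA3 hB3 hC4

end Sectors

/-! ### Slopes of the return maps along the centre direction. -/

section Slopes

variable {N K : ℕ} [NeZero N] {f : PWLFamily N K} {l m n mm nm mp np : ℕ} {ξ₀ : ℝ × ℝ}
  {𝓛 : Filter (ℕ × ℝ × ℝ)}

/-- The composite is affine in `h`. The base point `x^int` affects only its constant term, so no
property of it is needed. -/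
theorem hasDerivAt_uFun_wordMap (S : ℤ → Side) (a : ℕ) (ξ : ℝ × ℝ) (h : ℝ) :
    HasDerivAt (fun h => uFun f l m n ξ₀ ξ (wordMap f S ξ a (vFun f l m n ξ₀ ξ h)))
      (omegaVec f l m n ξ₀ ξ ⬝ᵥ (wordMat f S ξ a *ᵥ zetaVec f l m n ξ₀ ξ)) h := by
  have e : ∀ h, uFun f l m n ξ₀ ξ (wordMap f S ξ a (vFun f l m n ξ₀ ξ h)) =
      uFun f l m n ξ₀ ξ (wordMap f S ξ a (xInt f l m n ξ₀ ξ)) +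
        h * (omegaVec f l m n ξ₀ ξ ⬝ᵥ (wordMat f S ξ a *ᵥ zetaVec f l m n ξ₀ ξ)) := by
    intro h
    have e1 := wordMap_sub f S ξ a (vFun f l m n ξ₀ ξ h) (xInt f l m n ξ₀ ξ)
    rw [sub_eq_iff_eq_add, vFun, add_sub_cancel_left] at e1
    rw [uFun, uFun, vFun, e1, add_sub_assoc, dotProduct_add, mulVec_smul, dotProduct_smul,
      smul_eq_mul, add_comm]
  simp only [e]
  simpa using ((hasDerivAt_id h).mul_const
    (omegaVec f l m n ξ₀ ξ ⬝ᵥ (wordMat f S ξ a *ᵥ zetaVec f l m n ξ₀ ξ))).const_add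
      (uFun f l m n ξ₀ ξ (wordMap f S ξ a (xInt f l m n ξ₀ ξ)))

theorem vecMul_pow_of_eigen {N : ℕ} {M : Matrix (Fin N) (Fin N) ℝ} {w : Fin N → ℝ} {lam : ℝ}
    (hw : w ᵥ* M = lam • w) (k : ℕ) : w ᵥ* M ^ k = lam ^ k • w := by
  induction k with
  | zero => simp
  | succ k ih => rw [pow_succ, ← vecMul_vecMul, ih, smul_vecMul, hw, smul_smul, pow_succ]

/-- `ω` is a left eigenvector, so the slope is exactly `λ^(k-j) ω·(Yζ)`. In the region `r = O(1/k)`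
and `λ^k = P'/P + O(1/k)`, and replacing the remaining factors by their values at `ξ*` costs
`O(1/k)`. -/
theorem IsShrinkingPoint.slope_estimate (h : IsShrinkingPoint f l m n ξ₀)
    (hρ : rhoMax f l m n ξ₀ < 1) (hK : 1 ≤ K) (hJ : detJ f l m n ξ₀ ≠ 0)
    {τ₁ τ₂ A B C : ℝ} (hτ₁ : 0 < τ₁) (hA : 0 < A) {Y : ℝ × ℝ → Matrix (Fin N) (Fin N) ℝ}
    (hY : MatDiffAt Y ξ₀) {y : ℝ}
    (hy : uVec f l m n ξ₀ (-1) ⬝ᵥ (Y ξ₀ *ᵥ vVec f l m n ξ₀ (-1)) = y) (j : ℕ) :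
    ∃ D : ℝ, 0 ≤ D ∧ ∀ᶠ q : ℕ × ℝ × ℝ in atTop ×ˢ 𝓝 ξ₀,
      coordEN f l m n q.2 ∈ logRegion f l m n ξ₀ τ₁ τ₂ A B C q.1 →
      |omegaVec f l m n ξ₀ q.2 ⬝ᵥ ((wordMat f (cmSeq l m n) q.2 n ^ (q.1 - j) * Y q.2) *ᵥ
        zetaVec f l m n ξ₀ q.2) - y * (pCoord' f l m n ξ₀ (coordEN f l m n q.2) /
          pCoord f l m n ξ₀ (coordEN f l m n q.2))| ≤ D / q.1 := by
  set 𝓛 : Filter (ℕ × ℝ × ℝ) := (atTop ×ˢ 𝓝 ξ₀) ⊓ 𝓟 {q | coordEN f l m n q.2 ∈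
    logRegion f l m n ξ₀ τ₁ τ₂ A B C q.1} with h𝓛d
  have h𝓛 : 𝓛 ≤ atTop ×ˢ 𝓝 ξ₀ := inf_le_left
  have hmem : ∀ᶠ q in 𝓛, coordEN f l m n q.2 ∈ logRegion f l m n ξ₀ τ₁ τ₂ A B C q.1 :=
    eventually_inf_principal.2 (.of_forall fun q hq => hq)
  have H := h.centreExpansion hρ hK hJ h𝓛
  have htend := (tendsto_snd (f := (atTop : Filter ℕ)) (g := 𝓝 ξ₀)).mono_left h𝓛
  obtain ⟨hr, hpow⟩ := H.pow_of_log_relation hτ₁ hA (hmem.mono fun q hq => hq.1)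
    (hmem.mono fun q hq => hq.2.1) (hmem.mono fun q hq => hq.2.2)
  obtain ⟨hζ, hζd⟩ := h.zetaVec_spec hρ hK
  obtain ⟨hω, hωd⟩ := h.omegaVec_spec hρ hK
  have hyO := (differentiableAt_dotProduct hωd (hY.mulVec hζd)).isBigO_sub_norm
  rw [h.omegaVec_self hρ hK, h.zetaVec_self hρ hK, hy] at hyO
  have hyO' := (hyO.comp_tendsto htend).trans hr
  simp only [Function.comp_def] at hyO'
  have hjO := ((h.differentiableAt_critEig hρ hK).pow j).isBigO_sub_norm
  simp only [Pi.pow_apply] at hjO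
  rw [(h.critEig_spec hρ hK).1, one_pow] at hjO
  have hjO' := (hjO.comp_tendsto htend).trans hr
  simp only [Function.comp_def] at hjO'
  have hlam : ∀ᶠ q in 𝓛, 0 < critEig f l m n ξ₀ q.2 := H.tendsto_lam.eventually
    (lt_mem_nhds one_pos)
  have hratio : (fun q : ℕ × ℝ × ℝ => pCoord' f l m n ξ₀ (coordEN f l m n q.2) /
      pCoord f l m n ξ₀ (coordEN f l m n q.2)) =O[𝓛] fun _ => (1 : ℝ) := by
    refine IsBigO.of_bound τ₂ ?_
    filter_upwards [hmem] with q hq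
    have hx := LogRelation.pos hq hA
    have h0 := (mul_pos hτ₁ hx).trans_le hq.2.1.1
    rw [norm_one, mul_one, Real.norm_of_nonneg (div_pos h0 hx).le, div_le_iff₀ hx]
    exact hq.2.1.2
  have hpowO : (fun q : ℕ × ℝ × ℝ => critEig f l m n ξ₀ q.2 ^ q.1) =O[𝓛] fun _ => (1 : ℝ) := by
    have := (hpow.trans (H.tendsto_inv_k.isBigO_one ℝ)).add hratio
    simpa only [sub_add_cancel] using this
  have hpowj : (fun q : ℕ × ℝ × ℝ => critEig f l m n ξ₀ q.2 ^ (q.1 - j)) =O[𝓛]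
      fun _ => (1 : ℝ) := by
    refine IsBigO.trans (IsBigO.of_bound 2 ?_) hpowO
    have hj1 := hjO'.trans_tendsto H.tendsto_inv_k
    filter_upwards [hlam, H.tendsto_k.eventually_ge_atTop j,
      (tendsto_order.1 hj1).1 (-(1 / 2)) (by norm_num)] with q hq hk h1
    have hk' : j ≤ q.1 := hk
    have hp : 0 < critEig f l m n ξ₀ q.2 ^ (q.1 - j) := pow_pos hq _
    rw [Real.norm_of_nonneg hp.le, Real.norm_of_nonneg (pow_pos hq _).le]
    have e : critEig f l m n ξ₀ q.2 ^ q.1 =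
        critEig f l m n ξ₀ q.2 ^ (q.1 - j) * critEig f l m n ξ₀ q.2 ^ j := by
      rw [← pow_add, Nat.sub_add_cancel hk']
    rw [e]
    nlinarith
  have hfin : (fun q : ℕ × ℝ × ℝ => omegaVec f l m n ξ₀ q.2 ⬝ᵥ
      ((wordMat f (cmSeq l m n) q.2 n ^ (q.1 - j) * Y q.2) *ᵥ zetaVec f l m n ξ₀ q.2) -
        y * (pCoord' f l m n ξ₀ (coordEN f l m n q.2) /
          pCoord f l m n ξ₀ (coordEN f l m n q.2))) =O[𝓛] fun q => (1 : ℝ) / q.1 := by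
    have h1 := hpowj.mul hyO'
    have h2 := hpowj.mul hjO'
    simp only [one_mul] at h1 h2
    have h3 := (h1.sub (h2.const_mul_left y)).add (hpow.const_mul_left y)
    refine h3.congr' ?_ EventuallyEq.rfl
    filter_upwards [htend.eventually hω, H.tendsto_k.eventually_ge_atTop j] with q hω hk
    have hk' : j ≤ q.1 := hk
    have e : critEig f l m n ξ₀ q.2 ^ q.1 =
        critEig f l m n ξ₀ q.2 ^ (q.1 - j) * critEig f l m n ξ₀ q.2 ^ j := by
      rw [← pow_add, Nat.sub_add_cancel hk']
    have e2 : omegaVec f l m n ξ₀ q.2 ⬝ᵥ ((wordMat f (cmSeq l m n) q.2 n ^ (q.1 - j) * Y q.2) *ᵥ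
        zetaVec f l m n ξ₀ q.2) = critEig f l m n ξ₀ q.2 ^ (q.1 - j) *
          (omegaVec f l m n ξ₀ q.2 ⬝ᵥ (Y q.2 *ᵥ zetaVec f l m n ξ₀ q.2)) := by
      rw [← mulVec_mulVec, dotProduct_mulVec _ (wordMat f (cmSeq l m n) q.2 n ^ (q.1 - j)),
        vecMul_pow_of_eigen hω.1, smul_dotProduct, smul_eq_mul]
    rw [e2, e]
    ring
  obtain ⟨D, hD, hb⟩ := eventually_le_div_of_isBigO hfin
  rw [h𝓛d, eventually_inf_principal] at hb
  exact ⟨D, hD, hb⟩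

/-- Slope of the return map of the flipped word. -/
theorem IsShrinkingPoint.exists_flip_slope (h : IsShrinkingPoint f l m n ξ₀)
    (hρ : rhoMax f l m n ξ₀ < 1) (hK : 1 ≤ K) (hF : IsFareyRoots m n mm nm mp np) (j : ℕ) :
    ∃ (i : ℕ) (Y : ℝ × ℝ → Matrix (Fin N) (Fin N) ℝ), MatDiffAt Y ξ₀ ∧
      (∀ k, i < k → ∀ ξ, wordMat f (flipAt (levelK n np k) (seqG l m n mp np k j) 0) ξ
        (levelK n np k) = wordMat f (cmSeq l m n) ξ n ^ (k - i) * Y ξ) ∧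
      uVec f l m n ξ₀ (-1) ⬝ᵥ (Y ξ₀ *ᵥ vVec f l m n ξ₀ (-1)) =
        if j = 0 then -(tConst f l m n ξ₀ (l - 1) / tConst f l m n ξ₀ (l + 1)) *
            kappaPlus f l m n ξ₀ (-1)
          else -(tConst f l m n ξ₀ (-1) / tConst f l m n ξ₀ 1) * kappaPlus f l m n ξ₀ (j - 1) := by
  have hl1 := h.1
  have hl2 := h.2.1
  cases j with
  | zero =>
    refine ⟨1, fun ξ => wordMat f (rotSeq l m n) ξ np * wordMat f (seqS0 l m n) ξ n,
      (matDiffAt_wordMat f hK _ np ξ₀).mul (matDiffAt_wordMat f hK _ n ξ₀), fun k hk ξ => ?_, ?_⟩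
    · exact wordMat_flip_seqG_zero f hF h.coprime (by omega) (by omega) hk ξ
    · rw [if_pos rfl, h.slope_neg_one hρ hF]
  | succ i =>
    refine ⟨i + 1, fun ξ => wordMat f (rotSeq l m n) ξ np *
      (wordMat f (seqSld l m n) ξ n ^ i * wordMat f (cmSeq l m n) ξ n),
      (matDiffAt_wordMat f hK _ np ξ₀).mul (((matDiffAt_wordMat f hK _ n ξ₀).pow i).mul
        (matDiffAt_wordMat f hK _ n ξ₀)), fun k hk ξ => ?_, ?_⟩
    · exact wordMat_flip_seqG f hF h.coprime (by omega) (by omega) hk ξ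
    · beta_reduce
      rw [if_neg (Nat.succ_ne_zero i), ← Matrix.mul_assoc, ← mulVec_mulVec,
        (h.centre_eigenvectors hρ).2.1, h.slope_nat hρ hF]
      simp

end Slopes

/-! ### Assembly of the two slope estimates. -/

theorem lemma5p1 {N K : ℕ} [NeZero N] (hN : 2 ≤ N) (hK : 2 ≤ K) (f : PWLFamily N K)
    (l m n mm nm mp np : ℕ) (hFarey : IsFareyRoots m n mm nm mp np)
    (ξ₀ : ℝ × ℝ) (hshrink : IsShrinkingPoint f l m n ξ₀)
    (hJ : detJ f l m n ξ₀ ≠ 0) (hρ : rhoMax f l m n ξ₀ < 1)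
    (Δl : ℕ)
    (hκ : kappaPlus f l m n ξ₀ Δl ≠ 0) (hκ' : kappaPlus f l m n ξ₀ (Δl - 1) ≠ 0)
    (hsign : 0 < (kappaPlus f l m n ξ₀ Δl - kappaPlus f l m n ξ₀ (Δl - 1)) *
      aConst f l m n ξ₀) :
    ∃ U ∈ 𝓝 ξ₀, ∃ C : ℝ, ∃ k₀ : ℕ, ∀ k ≥ k₀,
      ∀ (γ : InnerArc f l m n ξ₀ mp np k Δl) (γ' : InnerArc f l m n ξ₀ mp np (k + 1) Δl),
      γ.points ⊆ U → γ'.points ⊆ U →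
      ∀ ξ ∈ U, coordEN f l m n ξ ∈ sector γ γ' →
      ∀ r θ : ℝ, 0 < r → coordEN f l m n ξ = polarEN f l m n ξ₀ r θ →
      (∃ slope : ℝ,
        (∀ h : ℝ, HasDerivAt (fun h => uFun f l m n ξ₀ ξ
          (wordMap f (seqG l m n mp np k Δl) ξ (levelK n np k) (vFun f l m n ξ₀ ξ h))) slope h) ∧
        |slope - tConst f l m n ξ₀ (-1) * kappaPlus f l m n ξ₀ Δl * Real.tan θ /
          tConst f l m n ξ₀ 1| ≤ C / k) ∧
      (∃ slope : ℝ,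
        (∀ h : ℝ, HasDerivAt (fun h => uFun f l m n ξ₀ ξ
          (wordMap f (flipAt (levelK n np k) (seqG l m n mp np k Δl) 0) ξ (levelK n np k)
            (vFun f l m n ξ₀ ξ h))) slope h) ∧
        |slope - (if Δl = 0 then
            tConst f l m n ξ₀ (l - 1) * kappaPlus f l m n ξ₀ (-1) * Real.tan θ /
              tConst f l m n ξ₀ (l + 1)
          else
            tConst f l m n ξ₀ (-1) * kappaPlus f l m n ξ₀ (Δl - 1) * Real.tan θ /
              tConst f l m n ξ₀ 1)| ≤ C / k) := by
  have hK1 : 1 ≤ K := by omega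
  have hl1 := hshrink.1
  have hl2 := hshrink.2.1
  -- The sign condition makes the two `κ` distinct, which is the transversality used for the
  -- collision in the last flipped turn.
  have hκj : kappaPlus f l m n ξ₀ Δl ≠ kappaPlus f l m n ξ₀ (Δl - 1) := by
    intro h0
    rw [h0, sub_self, zero_mul] at hsign
    exact lt_irrefl _ hsign
  obtain ⟨τ₁, τ₂, A, B, C, hτ₁, hA, U, hU, k₁, hsec⟩ := hshrink.sector_subset hρ hK1 hJ hFarey Δl
    hκj hκ hκ'
  obtain ⟨D, hD, hslope⟩ := hshrink.slope_estimate hρ hK1 hJ (τ₂ := τ₂) (B := B) (C := C) hτ₁ hA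
    (Y := fun ξ => wordMat f (rotSeq l m n) ξ np * wordMat f (seqSld l m n) ξ n ^ Δl)
    ((matDiffAt_wordMat f hK1 _ np ξ₀).mul ((matDiffAt_wordMat f hK1 _ n ξ₀).pow Δl))
    (hshrink.slope_nat hρ hFarey Δl) Δl
  obtain ⟨i, Y, hY, hYG, hy⟩ := hshrink.exists_flip_slope hρ hK1 hFarey Δl
  obtain ⟨D', hD', hslope'⟩ := hshrink.slope_estimate hρ hK1 hJ (τ₂ := τ₂) (B := B) (C := C) hτ₁ hA
    hY hy i
  obtain ⟨pa, hpa, pb, hpb, hall⟩ := eventually_prod_iff.1 (hslope.and hslope')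
  obtain ⟨k₂, hk₂⟩ := eventually_atTop.1 hpa
  refine ⟨U ∩ {ξ | pb ξ}, inter_mem hU hpb, max D D', max (max k₁ k₂) (max (Δl + 1) (i + 1)), ?_⟩
  intro k hk γ γ' hγ hγ' ξ hξ hξs r θ hr hpol
  have hk₁ : k₁ ≤ k := ((le_max_left _ _).trans (le_max_left _ _)).trans hk
  have hk₂' : k₂ ≤ k := ((le_max_right _ _).trans (le_max_left _ _)).trans hk
  have hkΔ : Δl < k := ((le_max_left _ _).trans (le_max_right _ _)).trans hk
  have hki : i < k := ((le_max_right _ _).trans (le_max_right _ _)).trans hk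
  have hreg := hsec k hk₁ γ γ' (hγ.trans Set.inter_subset_left) (hγ'.trans Set.inter_subset_left) hξs
  -- `P` is positive throughout the region, so the point is off the axis `η = 0` and `tan θ` has its
  -- usual meaning.
  have hcos : Real.cos θ ≠ 0 := by
    intro h0
    have := LogRelation.pos hreg hA
    rw [hpol, pCoord, polarEN, h0] at this
    simp at this
  have hratio := (hshrink.pCoord_polar hρ hr hcos).2
  rw [← hpol] at hratio
  obtain ⟨h1, h2⟩ := hall (hk₂ k hk₂') hξ.2
  replace h1 := h1 hreg
  replace h2 := h2 hreg
  -- Replacing `P'/P` by `-tan θ` cancels the minus sign carried by the limiting slopes.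
  simp only [hratio] at h1 h2
  refine ⟨⟨_, hasDerivAt_uFun_wordMap _ _ _, ?_⟩, ⟨_, hasDerivAt_uFun_wordMap _ _ _, ?_⟩⟩
  · rw [wordMat_seqG f hFarey hshrink.coprime (by omega) (by omega) hkΔ]
    refine le_trans (le_of_eq ?_) (h1.trans (by gcongr; exact le_max_left _ _))
    congr 1
    ring
  · rw [hYG k hki]
    refine le_trans (le_of_eq ?_) (h2.trans (by gcongr; exact le_max_right _ _))
    congr 2
    split_ifs <;> ring

end
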